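/- **Setting.** Let $G_1=gp\langle X_1\mid R_1\rangle$ and $G_2=gp\langle X_2\mid R_2\rangle$ be finite groups given by presentations with finite disjoint generating sets, let $\phi_i:A\to G_i$ ($i=1,2$) be monomorphisms from a group $A$, and let $G=G_1*_AG_2$ be the amalgam, with $X=X_1\cup X_2$; $A$ is identified with its images $\phi_i(A)$. All graphs are pointed graphs labelled with $X^{\pm}$ (directed edges come in inverse pairs with inverse labels) and are considered up to isomorphism; the basepoint is always written $v_0$. $\mathrm{Lab}(\Gamma,v)$ is the set of group elements represented by labels of closed paths at $v$. $Cayley(G_i,S)$ is the graph of right cosets of $S\le G_i$ with edges $Sg\to Sgx$ labelled $x\in X_i^{\pm}$, pointed at $S\cdot 1$, and $Cayley(G_i)=Cayley(G_i,1)$. An $X_i$-monochromatic component is a maximal connected subgraph with at least one edge and with labels in $X_i^{\pm}$; a vertex is bichromatic if edges with labels in $X_1^{\pm}$ and in $X_2^{\pm}$ begin at it, and $X_i$-monochromatic if all edges beginning at it have labels in $X_i^\pm$. **The algorithm** (generalized Stallings' folding algorithm). On input of words $g_1,\dots,g_n$ over $X^{\pm}$: 1. $\Gamma_1$ is the bouquet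 of $n$ loops at $v_0$ labelled $g_1,\dots,g_n$. 2. $\Gamma_2$ is obtained by folding edges and cutting hairs (away from $v_0$) as long as possible. (A folding identifies two distinct edges with the same initial vertex and the same label; a hair is an edge whose terminal vertex has degree one.) 3. For each $X_i$-monochromatic component $C$ of $\Gamma_2$ pick an edge $e$ of $C$ and glue on it a copy of $Cayley(G_i)$, identifying $1$ with the initial vertex of $e$, and $e$ with its copy; then fold as long as possible to get $\Gamma_3$. 4. For each bichromatic vertex $v$ of $\Gamma_3$ and all paths $p_1,p_2$ from $v$ whose labels are words over $X_1^{\pm}$ and $X_2^{\pm}$ respectively that represent the same element of $A$, identify the terminal vertices of $p_1$ and $p_2$; then fold as long as possible to get $\Gamma_4$. 5. As long as possible, remove the edges and the $X_i$-monochromatic vertices of an $X_i$-monochromatic component $C$ such that, for some bichromatic vertex $\vartheta$ of $C$ and some $K\le A$, $(C,\vartheta)\cong Cayley(G_i,K)$, the number of bichromatic vertices of $C$ is $[A:K]$, and either $K=1$ and $v_0$ is not an $X_i$-monochromatic vertex of $C$, or $K\neq1$ and $v_0$ is not a vertex of $C$. If the result has no bichromatic vertex and is isomorphic to $Cayley(G_i)$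 for some $i$, then $\Gamma_5$ is the single vertex $v_0$; otherwise $\Gamma_5$ is the result. 6. If $v_0$ is an $X_i$-monochromatic vertex of $\Gamma_5$ and the component $C$ at $v_0$ satisfies $(C,v_0)\cong Cayley(G_i,K)$ with $L=K\cap A\ne1$, glue to $\Gamma_5$ the graph $Cayley(G_j,L)$, $j\ne i$, identifying its vertex $L\cdot a$ with the vertex $v_0\cdot a$ of $C$ for all $a\in A$. The result, or $\Gamma_5$ if the condition fails, is $\Gamma_6=\Gamma(H)$, where $H=\langle g_1,\dots,g_n\rangle\le G$. **Reduced precovers.** A connected graph is a precover of $G$ if every path in it whose label is $1$ in $G$ is closed and every $X_i$-monochromatic component is isomorphic to $Cayley(G_i,S)$ for some $S\le G_i$. In a precover, a component $C$ is redundant if either it is the only component and $\mathrm{Lab}(C,v_0)=1$, or there are others and, for a bichromatic vertex $\vartheta$ of $C$ and $K=\mathrm{Lab}(C,\vartheta)$, one has $K\le A$, the bichromatic vertices of $C$ form the orbit $\vartheta\cdot A$, and either $v_0\notin V(C)$, or $v_0$ is a bichromatic vertex of $C$ and $K=1$. A precover is reduced if it has no redundant component and, whenever $v_0$ lies in an $X_i$-monochromatic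 component $C$ with $\mathrm{Lab}(C,v_0)\cap A\neq 1$, then $v_0$ also lies in an $X_j$-monochromatic component $D$, $j\neq i$, with $\mathrm{Lab}(D,v_0)\cap A=\mathrm{Lab}(C,v_0)\cap A$. **Statement.** The algorithm computes $(\Gamma(H),v_0)$ in time $O(m^2)$, where $m$ is the sum of the lengths of the words $g_1,\dots,g_n$ and the finite groups, with their Cayley graphs and relative Cayley graphs, are given for free. Precisely: for every fixed amalgam as above there are a program $P$ for a random access machine (uniform cost; instructions: constants, addition, subtraction, indirect load and store, conditional jump, read, print, halt) and a constant $C$, both depending only on the amalgam, its presentation and a numbering of $X$, such that for every finite list of words $g_1,\dots,g_n$ over $X^{\pm}$ the program $P$ halts on this input after printing in turn the graphs $\Gamma_1,\dots,\Gamma_6$ of a run of the algorithm; the last of them, $\Gamma(H)$, is a finite reduced precover of $G$ with $\mathrm{Lab}(\Gamma(H),v_0)=H$; and if $n\ge1$ and all the words are nonempty, then $P$ halts within $C\,m^2$ steps. -/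

import Mathlib

/-! ## Amalgams of two finite groups -/

/-- The data of an amalgam `G = G₀ *_A G₁` of two finite groups: each factor is given by a
presentation `Gᵢ = gp⟨Xᵢ | Rᵢ⟩` with finitely many generators, and `A` is a group with
monomorphisms `φᵢ : A → Gᵢ`. -/
structure FiniteAmalgam where
  X : Fin 2 → Type
  finX : ∀ i, Finite (X i)
  R : ∀ i, Set (FreeGroup (X i))
  finG : ∀ i, Finite (PresentedGroup (R i))
  A : Type
  grpA : Group A
  φ : ∀ i, A →* PresentedGroup (R i)
  inj : ∀ i, Function.Injective (φ i)

namespace FiniteAmalgam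

instance (D : FiniteAmalgam) : Group D.A := D.grpA

/-- The free factor `Gᵢ`. -/
abbrev Factor (D : FiniteAmalgam) (i : Fin 2) : Type := PresentedGroup (D.R i)

/-- The amalgamated free product `G`. -/
abbrev Gp (D : FiniteAmalgam) : Type := Monoid.PushoutI D.φ

/-- The disjoint union `X` of the generating sets `X₀` and `X₁`. -/
abbrev Gen (D : FiniteAmalgam) : Type := Σ i, D.X i

/-- The letters of `X^±`: `(x, true)` is `x` and `(x, false)` is `x⁻¹`. -/
abbrev Letter (D : FiniteAmalgam) : Type := D.Gen × Bool

/-- The element of `G` represented by a letter. -/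
def letterVal (D : FiniteAmalgam) (l : D.Letter) : D.Gp :=
  let g : D.Gp := Monoid.PushoutI.of (φ := D.φ) l.1.1 (PresentedGroup.of l.1.2)
  if l.2 then g else g⁻¹

/-- The element of `G` represented by a word. -/
def val (D : FiniteAmalgam) (w : List D.Letter) : D.Gp := (w.map D.letterVal).prod

/-- The element of the factor `Gᵢ` represented by a word over `Xᵢ^±`. -/
def valIn (D : FiniteAmalgam) (i : Fin 2) (w : List (D.X i × Bool)) : D.Factor i :=
  PresentedGroup.mk (D.R i) (FreeGroup.mk w)

/-- A word over `Xᵢ^±` as a word over `X^±`. -/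
def tag (D : FiniteAmalgam) (i : Fin 2) (w : List (D.X i × Bool)) : List D.Letter :=
  w.map fun l => (⟨i, l.1⟩, l.2)

end FiniteAmalgam

/-! ## Pointed labelled graphs -/

/-- A pointed graph labelled with `Y^±`.  Edges come in mutually inverse pairs, of which exactly
one has its label in `Y`; `E` is the set of these positively labelled edges. -/
structure PGraph (Y : Type) where
  V : Type
  E : Type
  src : E → V
  tgt : E → V
  lab : E → Y
  base : V

namespace PGraph

variable {Y : Type}

/-- The directed edges: `(e, true)` is the positive edge `e`, and `(e, false)` is its inverse. -/
abbrev DEdge (Γ : PGraph Y) : Type := Γ.E × Bool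

/-- The initial vertex of a directed edge. -/
def ini (Γ : PGraph Y) (d : Γ.DEdge) : Γ.V := if d.2 then Γ.src d.1 else Γ.tgt d.1

/-- The terminal vertex of a directed edge. -/
def ter (Γ : PGraph Y) (d : Γ.DEdge) : Γ.V := if d.2 then Γ.tgt d.1 else Γ.src d.1

/-- The inverse of a directed edge. -/
def rev (Γ : PGraph Y) (d : Γ.DEdge) : Γ.DEdge := (d.1, !d.2)

/-- The label in `Y^±` of a directed edge. -/
def dlab (Γ : PGraph Y) (d : Γ.DEdge) : Y × Bool := (Γ.lab d.1, d.2)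

/-- There is a path from `u` to `v` labelled by the given word. -/
def Reads (Γ : PGraph Y) : Γ.V → List (Y × Bool) → Γ.V → Prop
  | u, [], v => u = v
  | u, l :: w, v => ∃ d : Γ.DEdge, Γ.ini d = u ∧ Γ.dlab d = l ∧ Γ.Reads (Γ.ter d) w v

/-- Morphisms of pointed labelled graphs. -/
structure Hom (Γ Δ : PGraph Y) where
  onV : Γ.V → Δ.V
  onE : Γ.E → Δ.E
  src_onE : ∀ e, Δ.src (onE e) = onV (Γ.src e)
  tgt_onE : ∀ e, Δ.tgt (onE e) = onV (Γ.tgt e)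
  lab_onE : ∀ e, Δ.lab (onE e) = Γ.lab e
  onV_base : onV Γ.base = Δ.base

/-- Isomorphism of pointed labelled graphs. -/
def Iso (Γ Δ : PGraph Y) : Prop :=
  ∃ f : Hom Γ Δ, Function.Bijective f.onV ∧ Function.Bijective f.onE

/-- `Δ` is (isomorphic to) the subgraph of `Γ` with vertex set `SV` and edge set `SE`. -/
def IsSub (Γ Δ : PGraph Y) (SV : Set Γ.V) (SE : Set Γ.E) : Prop :=
  ∃ f : Hom Δ Γ, Function.Injective f.onV ∧ Function.Injective f.onE ∧
    Set.range f.onV = SV ∧ Set.range f.onE = SE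

/-- `Δ` is (isomorphic to) the graph obtained from `Γ` by identifying vertices related by `rV`
and edges related by `rE`, and no others. -/
def IsQuot (Γ Δ : PGraph Y) (rV : Γ.V → Γ.V → Prop) (rE : Γ.E → Γ.E → Prop) : Prop :=
  ∃ f : Hom Γ Δ, Function.Surjective f.onV ∧ Function.Surjective f.onE ∧
    (∀ u v, f.onV u = f.onV v ↔ Relation.EqvGen rV u v) ∧
    (∀ a b, f.onE a = f.onE b ↔ Relation.EqvGen rE a b)

/-- The disjoint union of `Γ` with the graphs `F k`, with the basepoint of `Γ`. -/
def attach (Γ : PGraph Y) {κ : Type} (F : κ → PGraph Y) : PGraph Y where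
  V := Γ.V ⊕ (Σ k, (F k).V)
  E := Γ.E ⊕ (Σ k, (F k).E)
  src := Sum.map Γ.src (fun e => ⟨e.1, (F e.1).src e.2⟩)
  tgt := Sum.map Γ.tgt (fun e => ⟨e.1, (F e.1).tgt e.2⟩)
  lab := Sum.elim Γ.lab (fun e => (F e.1).lab e.2)
  base := Sum.inl Γ.base

/-- `Δ` is obtained from `Γ` by one Stallings folding: two distinct edges with the same initial
vertex and the same label are identified. -/
def Fold (Γ Δ : PGraph Y) : Prop :=
  ∃ d₁ d₂ : Γ.DEdge, d₁ ≠ d₂ ∧ Γ.ini d₁ = Γ.ini d₂ ∧ Γ.dlab d₁ = Γ.dlab d₂ ∧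
    IsQuot Γ Δ (fun u v => u = Γ.ter d₁ ∧ v = Γ.ter d₂) (fun a b => a = d₁.1 ∧ b = d₂.1)

/-- `Δ` is obtained from `Γ` by cutting one hair: an edge whose terminal vertex has degree one
(and is not the basepoint) is removed together with that vertex. -/
def CutHair (Γ Δ : PGraph Y) : Prop :=
  ∃ d : Γ.DEdge, Γ.ter d ≠ Γ.base ∧ (∀ d', Γ.ini d' = Γ.ter d → d' = Γ.rev d) ∧
    IsSub Γ Δ {v | v ≠ Γ.ter d} {e | e ≠ d.1}

/-- `Δ` is (isomorphic to) a graph obtained from `Γ` by applying the operation `r` iteratively,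
until it is no longer applicable. -/
def IteratesTo (r : PGraph Y → PGraph Y → Prop) (Γ Δ : PGraph Y) : Prop :=
  ∃ Δ₀, Relation.ReflTransGen r Γ Δ₀ ∧ Iso Δ₀ Δ ∧ ∀ Δ', ¬ r Δ Δ'

/-- The `k`-th vertex on the `j`-th loop of the bouquet of loops labelled by the words `ws`:
the common vertex `none` for `k = 0` and for `k` the length of the `j`-th word. -/
def bouquetPoint (ws : List (List (Y × Bool))) (j : Fin ws.length) (k : ℕ) :
    Option (Σ j : Fin ws.length, {k : ℕ // 0 < k ∧ k < (ws.get j).length}) :=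
  if h : 0 < k ∧ k < (ws.get j).length then some ⟨j, k, h⟩ else none

/-- The bouquet of loops around a common vertex, labelled by the words `ws`. -/
def bouquet (ws : List (List (Y × Bool))) : PGraph Y where
  V := Option (Σ j : Fin ws.length, {k : ℕ // 0 < k ∧ k < (ws.get j).length})
  E := Σ j : Fin ws.length, Fin (ws.get j).length
  src e := bouquetPoint ws e.1 (if ((ws.get e.1).get e.2).2 then e.2 else e.2 + 1)
  tgt e := bouquetPoint ws e.1 (if ((ws.get e.1).get e.2).2 then e.2 + 1 else e.2)
  lab e := ((ws.get e.1).get e.2).1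
  base := none

/-- `Γ` is connected. -/
def Connected (Γ : PGraph Y) : Prop :=
  ∀ u v, Relation.EqvGen (fun u v => ∃ e, Γ.src e = u ∧ Γ.tgt e = v) u v

end PGraph

/-! ## Graphs labelled by the generators of an amalgam -/

namespace FiniteAmalgam

variable (D : FiniteAmalgam)

open PGraph

/-- Pointed graphs labelled with `X^±`. -/
abbrev Graph : Type 1 := PGraph D.Gen

/-- `Cayley(Gᵢ)`, pointed at `1`: the positive edge `(g, x)` goes from `g` to `g x`. -/
def cayley (i : Fin 2) : D.Graph where
  V := D.Factor i
  E := D.Factor i × D.X i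
  src p := p.1
  tgt p := p.1 * PresentedGroup.of p.2
  lab p := ⟨i, p.2⟩
  base := 1

/-- `Cayley(Gᵢ, S)`, pointed at `S · 1`: the vertices are the right cosets of `S`, and the positive
edge `(S g, x)` goes from `S g` to `S g x`. -/
def relCayley (i : Fin 2) (S : Subgroup (D.Factor i)) : D.Graph where
  V := Quotient (QuotientGroup.rightRel S)
  E := Quotient (QuotientGroup.rightRel S) × D.X i
  src p := p.1
  tgt p := Quotient.map' (· * PresentedGroup.of p.2) (by
    intro a b h
    rw [QuotientGroup.rightRel_apply] at h ⊢
    simpa [mul_assoc] using h) p.1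
  lab p := ⟨i, p.2⟩
  base := Quotient.mk'' 1

/-- The directed edge of `Cayley(Gᵢ)` that begins at `1` and is labelled by the given letter. -/
def cayleyEdge (l : D.Letter) : (D.cayley l.1.1).DEdge :=
  ((if l.2 then 1 else (PresentedGroup.of l.1.2)⁻¹, l.1.2), l.2)

variable {D}

/-- The colour of an edge: `i` if the label is in `Xᵢ`. -/
def col (Γ : D.Graph) (e : Γ.E) : Fin 2 := (Γ.lab e).1

/-- `u` and `v` are joined by a path labelled with `Xᵢ^±`. -/
def ConnIn (Γ : D.Graph) (i : Fin 2) : Γ.V → Γ.V → Prop :=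
  Relation.EqvGen fun u v => ∃ e, col Γ e = i ∧ Γ.src e = u ∧ Γ.tgt e = v

/-- The edge `e'` belongs to the monochromatic component that contains the edge `e`. -/
def SameComp (Γ : D.Graph) (e e' : Γ.E) : Prop :=
  col Γ e' = col Γ e ∧ ConnIn Γ (col Γ e) (Γ.src e) (Γ.src e')

/-- The vertex `v` belongs to the monochromatic component that contains the edge `e`. -/
def InComp (Γ : D.Graph) (e : Γ.E) (v : Γ.V) : Prop := ConnIn Γ (col Γ e) (Γ.src e) v

/-- The monochromatic component that contains the edge `e`, pointed at its vertex `v`. -/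
def component (Γ : D.Graph) (e : Γ.E) (v : Γ.V) (hv : InComp Γ e v) : D.Graph where
  V := {u // InComp Γ e u}
  E := {e' // SameComp Γ e e'}
  src e' := ⟨Γ.src e'.1, e'.2.2⟩
  tgt e' := ⟨Γ.tgt e'.1, Relation.EqvGen.trans _ _ _ e'.2.2
    (Relation.EqvGen.rel _ _ ⟨e'.1, e'.2.1, rfl, rfl⟩)⟩
  lab e' := Γ.lab e'.1
  base := ⟨v, hv⟩

/-- Edges of both colours begin at `v`. -/
def Bichromatic (Γ : D.Graph) (v : Γ.V) : Prop := ∀ i, ∃ d : Γ.DEdge, Γ.ini d = v ∧ col Γ d.1 = i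

/-- All edges that begin at `v` have colour `i`. -/
def Monochromatic (Γ : D.Graph) (i : Fin 2) (v : Γ.V) : Prop :=
  ∀ d : Γ.DEdge, Γ.ini d = v → col Γ d.1 = i

/-- There is a path from `u` to `v` whose label is a word over `Xᵢ^±` that represents the element
`g` of `Gᵢ`. -/
def ColPath (Γ : D.Graph) (i : Fin 2) (u : Γ.V) (g : D.Factor i) (v : Γ.V) : Prop :=
  ∃ w, Γ.Reads u (D.tag i w) v ∧ D.valIn i w = g

/-- `Lab(C, v)` for the component `C` of colour `i` at `v`, as a subset of `Gᵢ`. -/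
def compLab (Γ : D.Graph) (i : Fin 2) (v : Γ.V) : Set (D.Factor i) := {g | ColPath Γ i v g v}

/-- `Lab(Γ, v₀)`: the elements of `G` represented by the labels of the closed paths at the
basepoint. -/
def Lab (Γ : D.Graph) : Set D.Gp := {g | ∃ w, Γ.Reads Γ.base w Γ.base ∧ D.val w = g}

/-! ### Reduced precovers -/

/-- Every path whose label represents `1` in `G` is closed. -/
def GBased (Γ : D.Graph) : Prop := ∀ u w v, Γ.Reads u w v → D.val w = 1 → u = v

/-- Connected precovers of `G`: `G`-based graphs each of whose monochromatic components is a
relative Cayley graph of the factor of its colour. -/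
def IsPrecover (Γ : D.Graph) : Prop :=
  Γ.Connected ∧ GBased Γ ∧ ∀ e : Γ.E, ∃ S : Subgroup (D.Factor (col Γ e)),
    Iso (component Γ e (Γ.src e) (Relation.EqvGen.refl _)) (D.relCayley (col Γ e) S)

/-- The monochromatic component `C` of the edge `e` is redundant: either it is the only one and
`Lab(C, v₀) = 1`, or there are others and, for a bichromatic vertex `ϑ` of `C` and
`K = Lab(C, ϑ)`, we have `K ≤ A`, the bichromatic vertices of `C` form the `A`-orbit of `ϑ`, and
either `v₀` is not in `C`, or `v₀` is a bichromatic vertex of `C` and `K = 1`. -/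
def Redundant (Γ : D.Graph) (e : Γ.E) : Prop :=
  ((∀ e', SameComp Γ e e') ∧ compLab Γ (col Γ e) Γ.base = {1}) ∨
  ((∃ e', ¬ SameComp Γ e e') ∧ ∃ ϑ, InComp Γ e ϑ ∧ Bichromatic Γ ϑ ∧
    compLab Γ (col Γ e) ϑ ⊆ Set.range (D.φ (col Γ e)) ∧
    (∀ v, (InComp Γ e v ∧ Bichromatic Γ v) ↔ ∃ a, ColPath Γ (col Γ e) ϑ (D.φ _ a) v) ∧
    (¬ InComp Γ e Γ.base ∨
      (InComp Γ e Γ.base ∧ Bichromatic Γ Γ.base ∧ compLab Γ (col Γ e) ϑ = {1})))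

/-- Reduced precovers: there is no redundant component, and if the component at `v₀` of one colour
determines a subgroup that meets `A` nontrivially, then there is a component at `v₀` of the other
colour, which determines a subgroup with the same intersection with `A`. -/
def IsReducedPrecover (Γ : D.Graph) : Prop :=
  IsPrecover Γ ∧ (∀ e, ¬ Redundant Γ e) ∧
  ∀ e, InComp Γ e Γ.base → (∃ a, a ≠ 1 ∧ D.φ _ a ∈ compLab Γ (col Γ e) Γ.base) →
    ∃ e', InComp Γ e' Γ.base ∧ col Γ e' ≠ col Γ e ∧
      ∀ a, D.φ _ a ∈ compLab Γ (col Γ e) Γ.base ↔ D.φ _ a ∈ compLab Γ (col Γ e') Γ.base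

/-! ### The generalized Stallings' folding algorithm

The steps are stated as relations between a graph and the result of the step: the algorithm
leaves open which edges are picked and in which order the operations are applied, and graphs are
taken up to isomorphism. -/

/-- Step 1: construct a bouquet of loops labelled by the given generators. -/
def Step1 (ws : List (List D.Letter)) (Γ : D.Graph) : Prop := Iso (bouquet ws) Γ

/-- Step 2: iteratively fold edges and cut hairs. -/
def Step2 (Γ Γ' : D.Graph) : Prop := IteratesTo (fun Δ Δ' => Fold Δ Δ' ∨ CutHair Δ Δ') Γ Γ'

/-- Step 3: in each monochromatic component pick an edge (`T` is the set of the picked edges), glue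
on it a copy of the Cayley graph of the factor of its colour, identifying the initial vertex of the
edge with `1` and the edge with its copy in the Cayley graph, and iteratively fold edges. -/
def Step3 (Γ Γ' : D.Graph) : Prop :=
  ∃ T : Set Γ.DEdge, (∀ e, ∃! d, d ∈ T ∧ SameComp Γ d.1 e) ∧
    ∃ Δ : D.Graph,
      IsQuot (Γ.attach fun d : T => D.cayley (Γ.dlab d.1).1.1) Δ
        (fun p q => ∃ d : T,
          (p = Sum.inl (Γ.ini d.1) ∧
            q = Sum.inr ⟨d, (D.cayley _).ini (D.cayleyEdge (Γ.dlab d.1))⟩) ∨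
          (p = Sum.inl (Γ.ter d.1) ∧
            q = Sum.inr ⟨d, (D.cayley _).ter (D.cayleyEdge (Γ.dlab d.1))⟩))
        (fun p q => ∃ d : T,
          p = Sum.inl d.1.1 ∧ q = Sum.inr ⟨d, (D.cayleyEdge (Γ.dlab d.1)).1⟩) ∧
      IteratesTo Fold Δ Γ'

/-- Step 4: for each bichromatic vertex `v` and all paths `p₀`, `p₁` from `v`, where `pᵢ` is labelled
with `Xᵢ^±` by a word that represents an element of `A`, the same for both, identify their terminal
vertices; then iteratively fold edges. -/
def Step4 (Γ Γ' : D.Graph) : Prop :=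
  ∃ Δ : D.Graph,
    IsQuot Γ Δ
      (fun u w => ∃ v, Bichromatic Γ v ∧
        ∃ a : D.A, ColPath Γ 0 v (D.φ 0 a) u ∧ ColPath Γ 1 v (D.φ 1 a) w)
      (fun _ _ => False) ∧
    IteratesTo Fold Δ Γ'

/-- One removal in Step 5: `C` is a component of colour `i` (given by its edge `e`) with a
bichromatic vertex `ϑ` such that `(C, ϑ)` is isomorphic to `Cayley(Gᵢ, K)` with `K ≤ A`, the number
of bichromatic vertices of `C` is `[A : K]`, and either `K = 1` and `v₀` is not a monochromatic
vertex of `C`, or `K ≠ 1` and `v₀` is not a vertex of `C`.  The edges and the monochromatic vertices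
of `C` are removed. -/
def RemoveComp (Γ Γ' : D.Graph) : Prop :=
  ∃ (e : Γ.E) (ϑ : Γ.V) (hϑ : InComp Γ e ϑ) (K : Subgroup D.A),
    Bichromatic Γ ϑ ∧
    Iso (component Γ e ϑ hϑ) (D.relCayley (col Γ e) (K.map (D.φ _))) ∧
    Nat.card {v // InComp Γ e v ∧ Bichromatic Γ v} = K.index ∧
    ((K = ⊥ ∧ ¬ (InComp Γ e Γ.base ∧ Monochromatic Γ (col Γ e) Γ.base)) ∨
      (K ≠ ⊥ ∧ ¬ InComp Γ e Γ.base)) ∧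
    IsSub Γ Γ' {v | ¬ (InComp Γ e v ∧ Monochromatic Γ (col Γ e) v)} {e' | ¬ SameComp Γ e e'}

/-- Step 5: iteratively remove redundant components; if the result has no bichromatic vertices and
is isomorphic to the Cayley graph of a factor, replace it by the single vertex `v₀`. -/
def Step5 (Γ Γ' : D.Graph) : Prop :=
  ∃ Δ : D.Graph, IteratesTo RemoveComp Γ Δ ∧
    ((((∀ v, ¬ Bichromatic Δ v) ∧ ∃ i, Iso Δ (D.cayley i)) ∧ IsSub Δ Γ' {Δ.base} ∅) ∨
      (¬ ((∀ v, ¬ Bichromatic Δ v) ∧ ∃ i, Iso Δ (D.cayley i)) ∧ Iso Δ Γ'))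

/-- The condition of Step 6: all edges at `v₀` have the same colour `i`, and the component `C` at
`v₀` (given by its edge `e`) is isomorphic to `Cayley(Gᵢ, K)`, where `K ∩ A` is nontrivial. -/
def Step6Cond (Γ : D.Graph) (e : Γ.E) (K : Subgroup (D.Factor (col Γ e))) : Prop :=
  Monochromatic Γ (col Γ e) Γ.base ∧
  (∃ h : InComp Γ e Γ.base, Iso (component Γ e Γ.base h) (D.relCayley (col Γ e) K)) ∧
  K.comap (D.φ _) ≠ ⊥

/-- Step 6: under the above condition, with `L = K ∩ A`, glue `Cayley(Gⱼ, L)` at `v₀` for the other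
colour `j`, identifying its vertex `L a` with the vertex `v₀ · a` of `C`, for all `a` in `A`. -/
def Step6 (Γ Γ' : D.Graph) : Prop :=
  (∃ (e : Γ.E) (K : Subgroup (D.Factor (col Γ e))) (j : Fin 2),
    Step6Cond Γ e K ∧ j ≠ col Γ e ∧
    IsQuot (Γ.attach fun _ : Unit => D.relCayley j ((K.comap (D.φ _)).map (D.φ j))) Γ'
      (fun p q => ∃ (a : D.A) (u : Γ.V), ColPath Γ (col Γ e) Γ.base (D.φ _ a) u ∧
        p = Sum.inl u ∧ q = Sum.inr ⟨(), Quotient.mk'' (D.φ j a)⟩)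
      (fun _ _ => False)) ∨
  ((∀ e K, ¬ Step6Cond Γ e K) ∧ Iso Γ Γ')

end FiniteAmalgam

/-! ## Random access machines

The random access machine of Cook and Reckhow with the uniform cost criterion, with natural numbers
in the registers: there are infinitely many registers, a read-only input and a write-only output. -/

namespace RAM

/-- Instructions; `R r` is the content of the register `r`. -/
inductive Instr where
  /-- `R r := c`. -/
  | const (r c : ℕ)
  /-- `R r := R s + R t`. -/
  | add (r s t : ℕ)
  /-- `R r := R s - R t`, and `0` if `R s < R t`. -/
  | sub (r s t : ℕ)
  /-- `R r := R (R s)`. -/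
  | load (r s : ℕ)
  /-- `R (R r) := R s`. -/
  | store (r s : ℕ)
  /-- Continue with the instruction number `l` if `0 < R r`. -/
  | jpos (r l : ℕ)
  /-- Read the next input number into the register `r` (`0` if the input is exhausted). -/
  | read (r : ℕ)
  /-- Append `R r` to the output. -/
  | print (r : ℕ)
  /-- Stop. -/
  | halt

/-- A program is a finite list of instructions, numbered from `0`. -/
abbrev Program : Type := List Instr

/-- A configuration: program counter, registers, unread input, output so far. -/
structure Config where
  pc : ℕ
  reg : ℕ → ℕ
  inp : List ℕ
  out : List ℕ

/-- The effect of an instruction other than `halt`, which has none. -/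
def exec (c : Config) : Instr → Option Config
  | .const r k => some { c with pc := c.pc + 1, reg := Function.update c.reg r k }
  | .add r s t => some { c with
      pc := c.pc + 1, reg := Function.update c.reg r (c.reg s + c.reg t) }
  | .sub r s t => some { c with
      pc := c.pc + 1, reg := Function.update c.reg r (c.reg s - c.reg t) }
  | .load r s => some { c with
      pc := c.pc + 1, reg := Function.update c.reg r (c.reg (c.reg s)) }
  | .store r s => some { c with
      pc := c.pc + 1, reg := Function.update c.reg (c.reg r) (c.reg s) }
  | .jpos r l => some { c with pc := if 0 < c.reg r then l else c.pc + 1 }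
  | .read r => some { c with
      pc := c.pc + 1, reg := Function.update c.reg r (c.inp.headD 0), inp := c.inp.tail }
  | .print r => some { c with pc := c.pc + 1, out := c.out ++ [c.reg r] }
  | .halt => none

/-- One step; `none` if the machine has stopped (at `halt` or by leaving the program). -/
def step (P : Program) (c : Config) : Option Config := (P[c.pc]?).bind (exec c)

/-- `t` steps; `none` if the machine stops earlier. -/
def steps (P : Program) : ℕ → Config → Option Config
  | 0, c => some c
  | t + 1, c => (step P c).bind (steps P t)

/-- On the given input, the program stops after exactly `t` steps with the given output. -/
def RunsIn (P : Program) (inp out : List ℕ) (t : ℕ) : Prop :=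
  ∃ c, steps P t ⟨0, fun _ => 0, inp, []⟩ = some c ∧ step P c = none ∧ c.out = out

end RAM

/-! ## Input and output of the algorithm -/

/-- A finite pointed graph with labels in `Y`, with numbered vertices and edges. -/
structure NumGraph (Y : Type) where
  nV : ℕ
  nE : ℕ
  src : Fin nE → Fin nV
  tgt : Fin nE → Fin nV
  lab : Fin nE → Y
  base : Fin nV

namespace NumGraph

variable {Y : Type}

/-- The underlying pointed labelled graph. -/
def toPGraph (Γ : NumGraph Y) : PGraph Y where
  V := Fin Γ.nV
  E := Fin Γ.nE
  src := Γ.src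
  tgt := Γ.tgt
  lab := Γ.lab
  base := Γ.base

/-- The graph as a list of numbers: the numbers of vertices and edges, the basepoint, and for each
edge its initial vertex, its terminal vertex and the number of its label. -/
def encode {N : ℕ} (code : Y ≃ Fin N) (Γ : NumGraph Y) : List ℕ :=
  Γ.nV :: Γ.nE :: (Γ.base : ℕ) ::
    (List.ofFn fun e => [(Γ.src e : ℕ), (Γ.tgt e : ℕ), (code (Γ.lab e) : ℕ)]).flatten

end NumGraph

/-- A list of words over `Y^±` as a list of numbers: the number of words, and for each word its
length and its letters, where the letter `x` has the number `2 c + 1` and the letter `x⁻¹` the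
number `2 c`, for `c` the number of `x`. -/
def encodeWords {Y : Type} {N : ℕ} (code : Y ≃ Fin N) (ws : List (List (Y × Bool))) : List ℕ :=
  ws.length :: ws.flatMap fun w =>
    w.length :: w.map fun l => 2 * (code l.1 : ℕ) + (if l.2 then 1 else 0)

/-- The sum of the lengths of the words. -/
def totalLength {Y : Type} (ws : List (List (Y × Bool))) : ℕ := (ws.map List.length).sum

namespace FiniteAmalgam

/-- The graphs `Γ₁, …, Γ₆` are the results of the successive steps of the algorithm, applied to the
words `ws`. -/
def IsRun {D : FiniteAmalgam} (ws : List (List D.Letter)) (Γ : Fin 6 → NumGraph D.Gen) : Prop :=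
  Step1 ws (Γ 0).toPGraph ∧
  Step2 (Γ 0).toPGraph (Γ 1).toPGraph ∧
  Step3 (Γ 1).toPGraph (Γ 2).toPGraph ∧
  Step4 (Γ 2).toPGraph (Γ 3).toPGraph ∧
  Step5 (Γ 3).toPGraph (Γ 4).toPGraph ∧
  Step6 (Γ 4).toPGraph (Γ 5).toPGraph

end FiniteAmalgam

/-! ## A structured language for random access machines -/

namespace RAM

/-- Scalar variables. -/
inductive Var | lim | cap | len | np | i | j | k | p | q | flag | idx | cnt | cur | nxt | num | ltr
  deriving DecidableEq

/-- Array variables. -/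
inductive Arr | S | T | L | P | Q | tab | nm
  deriving DecidableEq

/-- The number of a scalar variable. -/
def Var.no : Var → ℕ
  | .lim => 0 | .cap => 1 | .len => 2 | .np => 3 | .i => 4 | .j => 5 | .k => 6 | .p => 7 | .q => 8
  | .flag => 9 | .idx => 10 | .cnt => 11 | .cur => 12 | .nxt => 13 | .num => 14 | .ltr => 15

/-- The number of an array variable. -/
def Arr.no : Arr → ℕ
  | .S => 0 | .T => 1 | .L => 2 | .P => 3 | .Q => 4 | .tab => 5 | .nm => 6

theorem Var.no_inj {x y : Var} (h : x.no = y.no) : x = y := by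
  cases x <;> cases y <;> first | rfl | exact absurd h (by decide)

theorem Arr.no_inj {x y : Arr} (h : x.no = y.no) : x = y := by
  cases x <;> cases y <;> first | rfl | exact absurd h (by decide)

theorem Var.no_lt (x : Var) : x.no < 32 := by cases x <;> decide

theorem Arr.no_lt (x : Arr) : x.no < 7 := by cases x <;> decide

/-- The register that holds a scalar variable. -/
def vreg (x : Var) : ℕ := 8 * x.no + 7

/-- The register that holds an array cell. -/
def cell (a : Arr) (n : ℕ) : ℕ := 8 * n + a.no

/-- The temporary registers. -/
def tmp (d : ℕ) : ℕ := 8 * (32 + d) + 7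

@[simp] theorem tmp_inj {d d' : ℕ} : tmp d = tmp d' ↔ d = d' := by unfold tmp; omega

theorem vreg_inj {x y : Var} : vreg x = vreg y ↔ x = y :=
  ⟨fun h => Var.no_inj (by unfold vreg at h; omega), fun h => h ▸ rfl⟩

theorem cell_inj {a b : Arr} {m n : ℕ} : cell a m = cell b n ↔ a = b ∧ m = n := by
  have := a.no_lt; have := b.no_lt
  refine ⟨fun h => ?_, by rintro ⟨rfl, rfl⟩; rfl⟩
  unfold cell at h
  exact ⟨Arr.no_inj (by omega), by omega⟩

theorem vreg_ne_tmp (x : Var) (d : ℕ) : vreg x ≠ tmp d := by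
  have := x.no_lt; unfold vreg tmp; omega

theorem cell_ne_tmp (a : Arr) (n d : ℕ) : cell a n ≠ tmp d := by
  have := a.no_lt; unfold cell tmp; omega

theorem cell_ne_vreg (a : Arr) (n : ℕ) (x : Var) : cell a n ≠ vreg x := by
  have := a.no_lt; unfold cell vreg; omega

theorem cell_eq (a : Arr) (n : ℕ) : n + n + (n + n) + (n + n + (n + n)) + a.no = cell a n := by
  unfold cell; ring

/-- States of structured programs. -/
structure St where
  v : Var → ℕ
  a : Arr → ℕ → ℕ
  inp : List ℕ
  out : List ℕ

/-- Assignment to a scalar variable. -/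
def St.set (s : St) (x : Var) (n : ℕ) : St := { s with v := Function.update s.v x n }

/-- Assignment to an array cell. -/
def St.put (s : St) (a : Arr) (m n : ℕ) : St :=
  { s with a := Function.update s.a a (Function.update (s.a a) m n) }

/-- Expressions. -/
inductive Exp
  | lit (n : ℕ)
  | var (x : Var)
  | get (a : Arr) (e : Exp)
  | add (e f : Exp)
  | sub (e f : Exp)
  | mulc (c : ℕ) (e : Exp)

/-- The value of an expression. -/
def Exp.eval (s : St) : Exp → ℕ
  | .lit n => n
  | .var x => s.v x
  | .get a e => s.a a (e.eval s)
  | .add e f => e.eval s + f.eval s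
  | .sub e f => e.eval s - f.eval s
  | .mulc c e => c * e.eval s

/-- Commands. -/
inductive Cmd
  | skip
  | set (x : Var) (e : Exp)
  | put (a : Arr) (e f : Exp)
  | seq (c₁ c₂ : Cmd)
  | ite (e : Exp) (c₁ c₂ : Cmd)
  | iter (x : Var) (e : Exp) (c : Cmd)
  | read (x : Var)
  | print (e : Exp)

/-- Iteration with a counter. -/
def loop (f : ℕ → St → St) : ℕ → St → St
  | 0, s => s
  | n + 1, s => f n (loop f n s)

/-- The effect of a command. -/
def Cmd.run : Cmd → St → St
  | .skip, s => s
  | .set x e, s => s.set x (e.eval s)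
  | .put a e f, s => s.put a (e.eval s) (f.eval s)
  | .seq c₁ c₂, s => c₂.run (c₁.run s)
  | .ite e c₁ c₂, s => if 0 < e.eval s then c₁.run s else c₂.run s
  | .iter x e c, s => loop (fun n s => c.run (s.set x n)) (e.eval s) s
  | .read x, s => { s.set x (s.inp.headD 0) with inp := s.inp.tail }
  | .print e, s => { s with out := s.out ++ [e.eval s] }

/-- The machine code of an expression; the value is left in the temporary register `d`. -/
def Exp.code : Exp → ℕ → List Instr
  | .lit n, d => [.const (tmp d) n]
  | .var x, d => [.const (tmp (d + 1)) 0, .add (tmp d) (vreg x) (tmp (d + 1))]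
  | .get a e, d => e.code d ++
      [.add (tmp d) (tmp d) (tmp d), .add (tmp d) (tmp d) (tmp d), .add (tmp d) (tmp d) (tmp d),
        .const (tmp (d + 1)) a.no, .add (tmp d) (tmp d) (tmp (d + 1)), .load (tmp d) (tmp d)]
  | .add e f, d => e.code d ++ f.code (d + 1) ++ [.add (tmp d) (tmp d) (tmp (d + 1))]
  | .sub e f, d => e.code d ++ f.code (d + 1) ++ [.sub (tmp d) (tmp d) (tmp (d + 1))]
  | .mulc c e, d => e.code d ++ ([.const (tmp (d + 1)) 0] ++
      List.replicate c (.add (tmp (d + 1)) (tmp (d + 1)) (tmp d)) ++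
      [.const (tmp (d + 2)) 0, .add (tmp d) (tmp (d + 1)) (tmp (d + 2))])

/-- The number of instructions of an expression. -/
def Exp.size (e : Exp) : ℕ := (e.code 0).length

theorem Exp.length_code (e : Exp) (d : ℕ) : (e.code d).length = e.size := by
  unfold size
  generalize 0 = d'
  induction e generalizing d d' with
  | lit | var => rfl
  | get a e ih => simp [code, ih d d']
  | add e f ihe ihf | sub e f ihe ihf => simp [code, ihe d d', ihf (d + 1) (d' + 1)]
  | mulc c e ih => simp [code, ih d d']

/-- The number of instructions of a command. -/
def Cmd.size : Cmd → ℕ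
  | .skip => 0
  | .set _ e => e.size + 2
  | .put _ e f => e.size + f.size + 6
  | .seq c₁ c₂ => c₁.size + c₂.size
  | .ite e c₁ c₂ => e.size + 1 + c₂.size + 2 + c₁.size
  | .iter _ e c => e.size + 1 + 4 + 2 + c.size + 3
  | .read _ => 1
  | .print e => e.size + 1

/-- The machine code of a command, placed at `pc`, with the temporary registers below `d` kept. -/
def Cmd.code : Cmd → ℕ → ℕ → List Instr
  | .skip, _, _ => []
  | .set x e, _, d => e.code d ++ [.const (tmp (d + 1)) 0, .add (vreg x) (tmp d) (tmp (d + 1))]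
  | .put a e f, _, d => e.code d ++ (f.code (d + 1) ++
      [.add (tmp d) (tmp d) (tmp d), .add (tmp d) (tmp d) (tmp d), .add (tmp d) (tmp d) (tmp d),
        .const (tmp (d + 2)) a.no, .add (tmp d) (tmp d) (tmp (d + 2)),
        .store (tmp d) (tmp (d + 1))])
  | .seq c₁ c₂, pc, d => c₁.code pc d ++ c₂.code (pc + c₁.size) d
  | .ite e c₁ c₂, pc, d => e.code d ++ ([.jpos (tmp d) (pc + e.size + 1 + c₂.size + 2)] ++
      (c₂.code (pc + e.size + 1) d ++
      ([.const (tmp d) 1, .jpos (tmp d) (pc + e.size + 1 + c₂.size + 2 + c₁.size)] ++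
      c₁.code (pc + e.size + 1 + c₂.size + 2) d)))
  | .iter x e c, pc, d => e.code d ++ ([.const (tmp (d + 1)) 0] ++
      ([.sub (tmp (d + 2)) (tmp d) (tmp (d + 1)), .jpos (tmp (d + 2)) (pc + e.size + 1 + 4),
        .const (tmp (d + 2)) 1, .jpos (tmp (d + 2)) (pc + e.size + 1 + 4 + 2 + c.size + 3)] ++
      ([.const (tmp (d + 2)) 0, .add (vreg x) (tmp (d + 1)) (tmp (d + 2))] ++
      (c.code (pc + e.size + 1 + 4 + 2) (d + 2) ++
      [.const (tmp (d + 2)) 1, .add (tmp (d + 1)) (tmp (d + 1)) (tmp (d + 2)),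
        .jpos (tmp (d + 2)) (pc + e.size + 1)]))))
  | .read x, _, _ => [.read (vreg x)]
  | .print e, _, d => e.code d ++ [.print (tmp d)]

theorem Cmd.length_code (c : Cmd) (pc d : ℕ) : (c.code pc d).length = c.size := by
  induction c generalizing pc d with
  | skip | read => rfl
  | set | put | print => simp [code, size, Exp.length_code, add_assoc]
  | seq | ite => simp [code, size, Exp.length_code, *]; try omega
  | iter => simp [code, size, Exp.length_code, *]; omega

/-- The number of steps of a command. -/
def Cmd.cost : Cmd → St → ℕ
  | .skip, _ => 0
  | .set _ e, _ => e.size + 2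
  | .put _ e f, _ => e.size + f.size + 6
  | .seq c₁ c₂, s => c₁.cost s + c₂.cost (c₁.run s)
  | .ite e c₁ c₂, s => e.size + 1 + if 0 < e.eval s then c₁.cost s else c₂.cost s + 2
  | .iter x e c, s => e.size + 1 + (∑ n ∈ Finset.range (e.eval s),
      (c.cost ((loop (fun n s => c.run (s.set x n)) n s).set x n) + 7) + 4)
  | .read _, _ => 1
  | .print e, _ => e.size + 1

/-! ### Correctness of the compiler -/

/-- Instructions other than jumps and `halt`. -/
def Instr.Lin : Instr → Prop
  | .jpos _ _ => False
  | .halt => False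
  | _ => True

/-- The effect of an instruction other than a jump. -/
def lin (c : Config) (i : Instr) : Config := (exec c i).getD c

theorem exec_lin {c : Config} {i : Instr} (h : i.Lin) : exec c i = some (lin c i) := by
  cases i <;> first | rfl | exact h.elim

theorem lin_pc {c : Config} {i : Instr} (h : i.Lin) : (lin c i).pc = c.pc + 1 := by
  cases i <;> first | rfl | exact h.elim

theorem steps_add (P : Program) (m n : ℕ) (c : Config) :
    steps P (m + n) c = (steps P m c).bind (steps P n) := by
  induction m generalizing c with
  | zero => simp [steps]
  | succ m ih =>
    rw [Nat.succ_add]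
    simp only [steps]
    cases step P c with
    | none => rfl
    | some c' => simp [ih]

theorem steps_trans {P : Program} {m n : ℕ} {c c' c'' : Config} (h : steps P m c = some c')
    (h' : steps P n c' = some c'') : steps P (m + n) c = some c'' := by
  rw [steps_add, h]; exact h'

theorem pre_append {α : Type*} {a b P : List α} {n : ℕ} (h : a ++ b <+: P.drop n) :
    a <+: P.drop n ∧ b <+: P.drop (n + a.length) := by
  obtain ⟨t, ht⟩ := h
  refine ⟨⟨b ++ t, by simpa using ht⟩, ⟨t, ?_⟩⟩
  rw [← List.drop_drop, ← ht]
  simp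

theorem pre_pc {α : Type*} {l P : List α} {m n : ℕ} (h : l <+: P.drop n) (e : m = n) :
    l <+: P.drop m := e ▸ h

theorem get_of_pre {α : Type*} {a : α} {l P : List α} {n : ℕ} (h : a :: l <+: P.drop n) :
    P[n]? = some a ∧ l <+: P.drop (n + 1) := by
  obtain ⟨t, ht⟩ := h
  refine ⟨?_, t, ?_⟩
  · have := List.getElem?_drop (xs := P) (i := n) (j := 0)
    rw [← ht] at this
    simpa using this.symm
  · rw [← List.drop_drop, ← ht]; simp

theorem steps_lin {P : Program} {l : List Instr} {c : Config} (hl : ∀ i ∈ l, i.Lin)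
    (h : l <+: P.drop c.pc) :
    steps P l.length c = some (l.foldl lin c) ∧ (l.foldl lin c).pc = c.pc + l.length := by
  induction l generalizing c with
  | nil => exact ⟨rfl, rfl⟩
  | cons i l ih =>
    obtain ⟨h1, h2⟩ := get_of_pre h
    have hi := hl i (by simp)
    have := ih (c := lin c i) (fun j hj => hl j (by simp [hj])) (by rwa [lin_pc hi])
    refine ⟨?_, ?_⟩
    · rw [List.length_cons, steps, step, h1, Option.bind_some, exec_lin hi, Option.bind_some,
        this.1]
      rfl
    · rw [List.foldl_cons, this.2, lin_pc hi, List.length_cons]; omega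

theorem steps_branch {P : Program} {l : List Instr} {c : Config} {r t : ℕ} {rest : List Instr}
    (hl : ∀ i ∈ l, i.Lin) (h : l ++ .jpos r t :: rest <+: P.drop c.pc) :
    ∃ c', steps P (l.length + 1) c = some c' ∧
      c'.pc = (if 0 < c'.reg r then t else c.pc + l.length + 1) ∧
      c'.reg = (l.foldl lin c).reg ∧ c'.inp = (l.foldl lin c).inp ∧
      c'.out = (l.foldl lin c).out := by
  obtain ⟨h1, h2⟩ := pre_append h
  obtain ⟨k1, k2⟩ := steps_lin hl h1
  exact ⟨{ l.foldl lin c with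
    pc := if 0 < (l.foldl lin c).reg r then t else (l.foldl lin c).pc + 1 },
    steps_trans k1 (by simp [steps, step, (get_of_pre (pre_pc h2 k2)).1, exec]), by rw [k2],
    rfl, rfl, rfl⟩

/-- The machine configuration holds the given state. -/
structure Sim (s : St) (c : Config) : Prop where
  v : ∀ x, c.reg (vreg x) = s.v x
  a : ∀ a n, c.reg (cell a n) = s.a a n
  inp : c.inp = s.inp
  out : c.out = s.out

theorem Sim.congr {s : St} {c c' : Config} (h : Sim s c) (hi : c'.inp = c.inp)
    (ho : c'.out = c.out) (hr : ∀ r, (∀ d, r ≠ tmp d) → c'.reg r = c.reg r) : Sim s c' where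
  v x := by rw [hr _ (vreg_ne_tmp x), h.v]
  a a n := by rw [hr _ (cell_ne_tmp a n), h.a]
  inp := by rw [hi, h.inp]
  out := by rw [ho, h.out]

theorem Exp.code_lin (e : Exp) (d : ℕ) : ∀ i ∈ e.code d, i.Lin := by
  induction e generalizing d with
  | lit | var => simp [code, Instr.Lin]
  | get a e ih =>
    intro i hi
    simp only [code, List.mem_append] at hi
    rcases hi with hi | hi
    · exact ih _ i hi
    · simp at hi; rcases hi with rfl | rfl | rfl | rfl <;> trivial
  | add e f ihe ihf | sub e f ihe ihf =>
    intro i hi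
    simp only [code, List.mem_append] at hi
    rcases hi with (hi | hi) | hi
    · exact ihe _ i hi
    · exact ihf _ i hi
    · simp at hi; subst hi; trivial
  | mulc c e ih =>
    intro i hi
    simp only [code, List.mem_append] at hi
    rcases hi with hi | (hi | hi) | hi
    · exact ih _ i hi
    · simp at hi; subst hi; trivial
    · rw [List.eq_of_mem_replicate hi]; trivial
    · simp at hi; rcases hi with rfl | rfl <;> trivial

/-- The effect of the code of an expression. -/
structure Exp.Result (e : Exp) (d : ℕ) (s : St) (c c' : Config) : Prop where
  val : c'.reg (tmp d) = e.eval s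
  keep : ∀ r, (∀ d', d ≤ d' → r ≠ tmp d') → c'.reg r = c.reg r
  inp : c'.inp = c.inp
  out : c'.out = c.out

theorem Exp.Result.sim {e : Exp} {d : ℕ} {s : St} {c c' : Config} (h : e.Result d s c c')
    (hs : Sim s c) : Sim s c' :=
  hs.congr h.inp h.out fun r hr => h.keep r fun d' _ => hr d'

theorem Exp.Result.keep_tmp {e : Exp} {d : ℕ} {s : St} {c c' : Config} (h : e.Result d s c c')
    {d' : ℕ} (hd : d' < d) : c'.reg (tmp d') = c.reg (tmp d') :=
  h.keep _ fun d'' h' => by simp; omega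

theorem foldl_lin_replicate (k : ℕ) (c : Config) (r t : ℕ) (h : r ≠ t) :
    ((List.replicate k (Instr.add r r t)).foldl lin c).reg =
      Function.update c.reg r (c.reg r + k * c.reg t) ∧
    ((List.replicate k (Instr.add r r t)).foldl lin c).inp = c.inp ∧
    ((List.replicate k (Instr.add r r t)).foldl lin c).out = c.out := by
  induction k generalizing c with
  | zero => simp
  | succ k ih =>
    rw [List.replicate_succ, List.foldl_cons]
    obtain ⟨h1, h2, h3⟩ := ih (lin c (.add r r t))
    refine ⟨?_, h2, h3⟩
    rw [h1]
    have ht : (lin c (.add r r t)).reg = Function.update c.reg r (c.reg r + c.reg t) := rfl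
    rw [ht, Function.update_idem, Function.update_self, Function.update_of_ne h.symm]
    congr 1; ring

theorem Exp.code_result (e : Exp) (d : ℕ) (s : St) (c : Config) (hs : Sim s c) :
    e.Result d s c ((e.code d).foldl lin c) := by
  induction e generalizing d c with
  | lit n =>
    refine ⟨by simp [code, lin, exec, eval], fun r hr => ?_, rfl, rfl⟩
    simp [code, lin, exec, Function.update_of_ne (hr d le_rfl)]
  | var x =>
    refine ⟨by simp [code, lin, exec, eval, hs.v, Function.update_of_ne (vreg_ne_tmp x _)],
      fun r hr => ?_, rfl, rfl⟩
    simp [code, lin, exec, Function.update_of_ne (hr d le_rfl),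
      Function.update_of_ne (hr (d + 1) (by omega))]
  | get a e ih =>
    have h := ih d c hs
    have hc := fun a n => (h.sim hs).a a n
    simp only [code, List.foldl_append]
    generalize (e.code d).foldl lin c = c' at h hc
    refine ⟨?_, fun r hr => ?_, ?_, ?_⟩
    · simp [lin, exec, eval, h.val, cell_eq, cell_ne_tmp, hc]
    · simp [lin, exec, Function.update_of_ne (hr d le_rfl),
        Function.update_of_ne (hr (d + 1) (by omega)), h.keep r hr]
    · simp [lin, exec, h.inp]
    · simp [lin, exec, h.out]
  | add e f ihe ihf | sub e f ihe ihf =>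
    have h := ihe d c hs
    have h' := ihf (d + 1) _ (h.sim hs)
    simp only [code, List.foldl_append]
    have hd := h'.keep_tmp (Nat.lt_succ_self d)
    generalize (f.code (d + 1)).foldl lin ((e.code d).foldl lin c) = c' at h' hd
    refine ⟨?_, fun r hr => ?_, ?_, ?_⟩
    · simp [lin, exec, eval, h'.val, hd, h.val]
    · simp only [List.foldl_cons, List.foldl_nil, lin, exec, Option.getD_some]
      rw [Function.update_of_ne (hr d le_rfl), h'.keep r fun d' hd' => hr d' (by omega),
        h.keep r hr]
    · simp [lin, exec, h'.inp, h.inp]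
    · simp [lin, exec, h'.out, h.out]
  | mulc k e ih =>
    have h := ih d c hs
    simp only [code, List.foldl_append]
    generalize (e.code d).foldl lin c = c' at h
    obtain ⟨h1, h2, h3⟩ := foldl_lin_replicate k ([Instr.const (tmp (d + 1)) 0].foldl lin c')
      (tmp (d + 1)) (tmp d) (by simp)
    generalize (List.replicate k (Instr.add (tmp (d + 1)) (tmp (d + 1)) (tmp d))).foldl lin
      ([Instr.const (tmp (d + 1)) 0].foldl lin c') = c'' at h1 h2 h3
    refine ⟨?_, fun r hr => ?_, ?_, ?_⟩
    · simp [lin, exec, h1, eval, h.val]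
    · simp [lin, exec, h1, Function.update_of_ne (hr d le_rfl),
        Function.update_of_ne (hr (d + 1) (by omega)),
        Function.update_of_ne (hr (d + 2) (by omega)), h.keep r hr]
    · simp [lin, exec, h2, h.inp]
    · simp [lin, exec, h3, h.out]

/-- Running the code of an expression. -/
theorem Exp.steps_code (e : Exp) {d : ℕ} {s : St} {P : Program} {c : Config} (hs : Sim s c)
    (h : e.code d <+: P.drop c.pc) :
    ∃ c', steps P e.size c = some c' ∧ c'.pc = c.pc + e.size ∧ e.Result d s c c' := by
  have := steps_lin (e.code_lin d) h
  rw [e.length_code] at this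
  exact ⟨_, this.1, this.2, e.code_result d s c hs⟩

theorem Sim.set {s : St} {c c' : Config} (h : Sim s c) (x : Var) (n : ℕ) (hi : c'.inp = c.inp)
    (ho : c'.out = c.out) (hx : c'.reg (vreg x) = n)
    (hr : ∀ r, r ≠ vreg x → (∀ d, r ≠ tmp d) → c'.reg r = c.reg r) : Sim (s.set x n) c' where
  v y := by
    by_cases hy : y = x
    · subst hy; simp [St.set, hx]
    · rw [hr _ (by rwa [Ne, vreg_inj]) (vreg_ne_tmp y), h.v]; simp [St.set, hy]
  a a n := by rw [hr _ (cell_ne_vreg a n x) (cell_ne_tmp a n), h.a]; rfl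
  inp := by rw [hi, h.inp]; rfl
  out := by rw [ho, h.out]; rfl

theorem Sim.put {s : St} {c c' : Config} (h : Sim s c) (a : Arr) (m n : ℕ) (hi : c'.inp = c.inp)
    (ho : c'.out = c.out) (hx : c'.reg (cell a m) = n)
    (hr : ∀ r, r ≠ cell a m → (∀ d, r ≠ tmp d) → c'.reg r = c.reg r) : Sim (s.put a m n) c' where
  v y := by rw [hr _ (cell_ne_vreg a m y).symm (vreg_ne_tmp y), h.v]; rfl
  a b k := by
    by_cases hy : b = a ∧ k = m
    · obtain ⟨rfl, rfl⟩ := hy; simp [St.put, hx]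
    · rw [hr _ (by rwa [Ne, cell_inj]) (cell_ne_tmp b k), h.a]
      by_cases hb : b = a
      · subst hb; simp only [St.put, Function.update_self]
        rw [Function.update_of_ne (by tauto)]
      · simp [St.put, hb]
  inp := by rw [hi, h.inp]; rfl
  out := by rw [ho, h.out]; rfl

/-- Correctness of the compiler. -/
theorem Cmd.steps_code (k : Cmd) : ∀ {pc d : ℕ} {s : St} {P : Program} {c : Config}, Sim s c →
    c.pc = pc → k.code pc d <+: P.drop pc → ∃ c', steps P (k.cost s) c = some c' ∧
      Sim (k.run s) c' ∧ c'.pc = pc + k.size ∧ ∀ d' < d, c'.reg (tmp d') = c.reg (tmp d') := by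
  induction k with
  | skip =>
    intro pc d s P c hs hpc h
    exact ⟨c, rfl, hs, hpc, fun _ _ => rfl⟩
  | set x e =>
    rintro pc d s P c hs rfl h
    obtain ⟨h1, h2⟩ := pre_append h
    obtain ⟨c', e1, e2, e3⟩ := e.steps_code hs h1
    rw [e.length_code, ← e2] at h2
    obtain ⟨e4, e5⟩ := steps_lin (by simp [Instr.Lin]) h2
    refine ⟨_, steps_trans e1 e4, ?_, ?_, ?_⟩
    · refine (e3.sim hs).set x _ rfl rfl ?_ ?_
      · simp [lin, exec, e3.val]
      · intro r hr hd
        simp [lin, exec, hr, hd]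
    · rw [e5, e2]; rfl
    · intro d' hd'
      have h1 : d' ≠ d + 1 := by omega
      simp [lin, exec, (vreg_ne_tmp x _).symm, h1, e3.keep_tmp hd']
  | put a e f =>
    rintro pc d s P c hs rfl h
    obtain ⟨h1, h2⟩ := pre_append h
    obtain ⟨c', e1, e2, e3⟩ := e.steps_code hs h1
    rw [e.length_code, ← e2] at h2
    obtain ⟨h2, h3⟩ := pre_append h2
    obtain ⟨c'', f1, f2, f3⟩ := f.steps_code (e3.sim hs) h2
    rw [f.length_code, ← f2] at h3
    obtain ⟨e4, e5⟩ := steps_lin (by simp [Instr.Lin]) h3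
    have hd0 : c''.reg (tmp d) = e.eval s := by rw [f3.keep_tmp (Nat.lt_succ_self d), e3.val]
    refine ⟨_, by rw [Cmd.cost, show e.size + f.size + 6 = e.size + (f.size + 6) by ring];
                  exact steps_trans e1 (steps_trans f1 e4), ?_, ?_, ?_⟩
    · refine (f3.sim (e3.sim hs)).put a _ _ rfl rfl ?_ ?_
      · simp [lin, exec, hd0, cell_eq, f3.val]
      · intro r hr hd
        simp [lin, exec, hd0, cell_eq, hr, hd]
    · rw [e5, f2, e2]; simp [Cmd.size]; ring
    · intro d' hd'
      have h1 : d' ≠ d + 2 := by omega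
      simp [lin, exec, hd0, cell_eq, h1, hd'.ne, (cell_ne_tmp _ _ _).symm,
        f3.keep_tmp (Nat.lt_succ_of_lt hd'), e3.keep_tmp hd']
  | seq c₁ c₂ ih1 ih2 =>
    rintro pc d s P c hs rfl h
    obtain ⟨h1, h2⟩ := pre_append h
    rw [c₁.length_code] at h2
    obtain ⟨c', a1, a2, a3, a4⟩ := ih1 hs rfl h1
    obtain ⟨c'', b1, b2, b3, b4⟩ := ih2 a2 a3 h2
    exact ⟨c'', steps_trans a1 b1, b2, by rw [b3]; simp [Cmd.size]; ring,
      fun d' hd' => by rw [b4 d' hd', a4 d' hd']⟩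
  | ite e c₁ c₂ ih1 ih2 =>
    rintro pc d s P c hs rfl h
    obtain ⟨h1, h2⟩ := pre_append h
    obtain ⟨c', e1, e2, e3⟩ := e.steps_code hs h1
    rw [e.length_code] at h2
    obtain ⟨_, h3⟩ := pre_append h2
    obtain ⟨h3, h4⟩ := pre_append h3
    obtain ⟨_, h5⟩ := pre_append h4
    rw [c₂.length_code] at h4 h5
    obtain ⟨c₃, j1, j2, j3, j4, j5⟩ := steps_branch (l := []) (by simp) (pre_pc h2 e2)
    have hs' : Sim s c₃ := (e3.sim hs).congr j4 j5 fun _ _ => by rw [j3]; rfl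
    have hv : c₃.reg (tmp d) = e.eval s := by rw [j3, ← e3.val]; rfl
    have hk : ∀ d' < d, c₃.reg (tmp d') = c.reg (tmp d') := fun d' hd' => by
      rw [j3, ← e3.keep_tmp hd']; rfl
    rw [hv] at j2
    by_cases hp : 0 < e.eval s
    · rw [if_pos hp] at j2
      obtain ⟨c'', b1, b2, b3, b4⟩ := ih1 hs' j2 h5
      refine ⟨c'', ?_, by rwa [Cmd.run, if_pos hp], by rw [b3]; simp [Cmd.size]; ring,
        fun d' hd' => by rw [b4 d' hd', hk d' hd']⟩
      rw [Cmd.cost, if_pos hp]; exact steps_trans (steps_trans e1 j1) b1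
    · rw [if_neg hp, e2] at j2
      obtain ⟨c'', b1, b2, b3, b4⟩ := ih2 hs' j2 h3
      obtain ⟨c₄, k1, k2, k3, k4, k5⟩ := steps_branch (l := [_]) (by simp [Instr.Lin])
        (pre_pc h4 b3)
      rw [if_pos (by simp [k3, lin, exec])] at k2
      refine ⟨c₄, ?_, ?_, k2.trans (by simp [Cmd.size]; ring), fun d' hd' => ?_⟩
      · rw [Cmd.cost, if_neg hp]
        exact steps_trans (steps_trans e1 j1) (steps_trans b1 k1)
      · rw [Cmd.run, if_neg hp]
        exact b2.congr k4 k5 fun r hr => by simp [k3, lin, exec, hr]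
      · simp [k3, lin, exec, hd'.ne, b4 d' hd', hk d' hd']
  | iter x e k ih =>
    rintro pc d s P c hs rfl h
    obtain ⟨h1, h2⟩ := pre_append h
    obtain ⟨c', e1, e2, e3⟩ := e.steps_code hs h1
    rw [e.length_code] at h2
    obtain ⟨h2, h3⟩ := pre_append h2
    obtain ⟨h3, h4⟩ := pre_append h3
    obtain ⟨h4, h5⟩ := pre_append h4
    obtain ⟨h5, h6⟩ := pre_append h5
    rw [k.length_code] at h6
    simp only [List.length_cons, List.length_nil, zero_add, Nat.reduceAdd] at h3 h4 h5 h6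
    obtain ⟨k1, k2⟩ := steps_lin (by simp [Instr.Lin]) (pre_pc h2 e2)
    set n := e.eval s with hn
    have key : ∀ m ≤ n, ∃ c₁, steps P (e.size + 1 + ∑ i ∈ Finset.range m,
        (k.cost ((loop (fun n s => k.run (s.set x n)) i s).set x i) + 7)) c = some c₁ ∧
        Sim (loop (fun n s => k.run (s.set x n)) m s) c₁ ∧ c₁.pc = c.pc + e.size + 1 ∧
        c₁.reg (tmp d) = n ∧ c₁.reg (tmp (d + 1)) = m ∧
        ∀ d' < d, c₁.reg (tmp d') = c.reg (tmp d') := by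
      intro m
      induction m with
      | zero =>
        intro _
        refine ⟨[Instr.const (tmp (d + 1)) 0].foldl lin c', (steps_trans e1 k1 :), (e3.sim hs).congr rfl rfl fun r hr => ?_,
          k2.trans (by rw [e2]; rfl), ?_, ?_, fun d' hd' => ?_⟩
        · simp [lin, exec, hr]
        · simp [lin, exec, e3.val]; rfl
        · simp [lin, exec]
        · have h1 : d' ≠ d + 1 := by omega
          simp [lin, exec, h1, e3.keep_tmp hd']
      | succ m ihm =>
        intro hm
        obtain ⟨c₁, a1, a2, a3, a4, a5, a6⟩ := ihm (by omega)
        obtain ⟨c₂, l1, l2, l3, l4, l5⟩ := steps_branch (l := [_]) (by simp [Instr.Lin])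
          (pre_pc h3 a3)
        rw [if_pos (by simp [l3, lin, exec, a4, a5]; omega)] at l2
        obtain ⟨m1, m2⟩ := steps_lin (by simp [Instr.Lin]) (pre_pc h4 l2)
        obtain ⟨c₄, b1, b2, b3, b4⟩ := ih (c := [Instr.const (tmp (d + 2)) 0,
          Instr.add (vreg x) (tmp (d + 1)) (tmp (d + 2))].foldl lin c₂)
          (a2.set x m l4 l5 (by simp [l3, lin, exec, a5])
            fun r hr hd => by simp [l3, lin, exec, hr, hd]) (by rw [m2, l2]; rfl) h5
        obtain ⟨c₅, n1, n2, n3, n4, n5⟩ := steps_branch (l := [_, _]) (by simp [Instr.Lin])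
          (pre_pc h6 b3)
        rw [if_pos (by simp [n3, lin, exec])] at n2
        refine ⟨c₅, ?_, b2.congr n4 n5 fun r hr => by simp [n3, lin, exec, hr], n2, ?_, ?_,
          fun d' hd' => ?_⟩
        · rw [Finset.sum_range_succ, ← add_assoc]
          refine steps_trans a1 ?_
          have := steps_trans l1 (steps_trans m1 (steps_trans b1 n1))
          simp only [List.length_cons, List.length_nil, zero_add, Nat.reduceAdd] at this
          rw [← this]
          congr 1
          ring
        · simp [n3, lin, exec, b4, l3, (vreg_ne_tmp x _).symm, a4]
        · simp [n3, lin, exec, b4, l3, (vreg_ne_tmp x _).symm, a5]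
        · have h1 : d' ≠ d + 1 ∧ d' ≠ d + 2 := by omega
          simp [n3, lin, exec, h1, b4 d' (by omega), l3, (vreg_ne_tmp x _).symm, a6 d' hd']
    obtain ⟨c₁, a1, a2, a3, a4, a5, a6⟩ := key n le_rfl
    obtain ⟨c₂, l1, l2, l3, l4, l5⟩ := steps_branch (l := [_]) (by simp [Instr.Lin]) (pre_pc h3 a3)
    rw [if_neg (by simp [l3, lin, exec, a4, a5])] at l2
    obtain ⟨c₃, j1, j2, j3, j4, j5⟩ := steps_branch (l := [_]) (by simp [Instr.Lin])
      (pre_pc (pre_append (a := [_, _]) h3).2 (l2.trans (by rw [a3]; rfl)))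
    rw [if_pos (by simp [j3, lin, exec])] at j2
    refine ⟨c₃, ?_, a2.congr (j4.trans l4) (j5.trans l5) fun r hr => by
      simp [j3, l3, lin, exec, hr], j2.trans (by simp [Cmd.size]; ring), fun d' hd' => ?_⟩
    · rw [Cmd.cost, ← add_assoc]
      exact steps_trans a1 (steps_trans l1 j1)
    · have h2 : d' ≠ d + 2 := by omega
      simp [j3, l3, lin, exec, h2, a6 d' hd']
  | read x =>
    rintro pc d s P c hs rfl h
    obtain ⟨e4, e5⟩ := steps_lin (l := [Instr.read (vreg x)]) (by simp [Instr.Lin]) h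
    refine ⟨_, e4, ?_, e5, ?_⟩
    · have := hs.set (c' := { c with reg := Function.update c.reg (vreg x) (s.inp.headD 0) })
        x (s.inp.headD 0) rfl rfl (by simp) (fun r hr _ => by simp [hr])
      exact ⟨fun y => by rw [← hs.inp] at this; simpa [lin, exec, Cmd.run] using
        (by simpa [hs.inp] using this.v y),
        fun a n => by rw [← hs.inp] at this; simpa [lin, exec, Cmd.run] using
        (by simpa [hs.inp] using this.a a n), by simp [lin, exec, Cmd.run, hs.inp], by
          simp [lin, exec, Cmd.run, St.set, hs.out]⟩
    · intro d' hd'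
      simp [lin, exec, (vreg_ne_tmp x _).symm]
  | print e =>
    rintro pc d s P c hs rfl h
    obtain ⟨h1, h2⟩ := pre_append h
    obtain ⟨c', e1, e2, e3⟩ := e.steps_code hs h1
    rw [e.length_code, ← e2] at h2
    obtain ⟨e4, e5⟩ := steps_lin (by simp [Instr.Lin]) h2
    have hs' := e3.sim hs
    refine ⟨_, steps_trans e1 e4, ⟨hs'.v, hs'.a, hs'.inp, ?_⟩, by rw [e5, e2]; rfl, ?_⟩
    · simp [lin, exec, Cmd.run, e3.val, hs'.out]
    · intro d' hd'; exact e3.keep_tmp hd'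

/-- The initial state. -/
def St.init (inp : List ℕ) : St := ⟨fun _ => 0, fun _ _ => 0, inp, []⟩

theorem Cmd.runsIn (k : Cmd) (inp : List ℕ) :
    RunsIn (k.code 0 0) inp (k.run (.init inp)).out (k.cost (.init inp)) := by
  obtain ⟨c', h1, h2, h3, -⟩ := k.steps_code (s := .init inp) (P := k.code 0 0) (pc := 0) (d := 0)
    (c := ⟨0, fun _ => 0, inp, []⟩) ⟨fun _ => rfl, fun _ _ => rfl, rfl, rfl⟩ rfl (by simp)
  refine ⟨c', h1, ?_, h2.out⟩
  rw [step, List.getElem?_eq_none]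
  · rfl
  · rw [h3, k.length_code]; simp


/-! ### Reasoning about commands -/

@[simp] theorem St.set_v (s : St) (x y : Var) (n : ℕ) :
    (s.set x n).v y = if y = x then n else s.v y := by
  simp [St.set, Function.update_apply]

@[simp] theorem St.set_a (s : St) (x : Var) (n : ℕ) : (s.set x n).a = s.a := rfl
@[simp] theorem St.set_inp (s : St) (x : Var) (n : ℕ) : (s.set x n).inp = s.inp := rfl
@[simp] theorem St.set_out (s : St) (x : Var) (n : ℕ) : (s.set x n).out = s.out := rfl
@[simp] theorem St.put_v (s : St) (a : Arr) (m n : ℕ) : (s.put a m n).v = s.v := rfl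
@[simp] theorem St.put_inp (s : St) (a : Arr) (m n : ℕ) : (s.put a m n).inp = s.inp := rfl
@[simp] theorem St.put_out (s : St) (a : Arr) (m n : ℕ) : (s.put a m n).out = s.out := rfl

theorem St.put_a_ne (s : St) {a b : Arr} (m n : ℕ) (h : b ≠ a) : (s.put a m n).a b = s.a b := by
  simp [St.put, h]

@[simp] theorem St.put_a (s : St) (a b : Arr) (m n k : ℕ) :
    (s.put a m n).a b k = if b = a ∧ k = m then n else s.a b k := by
  by_cases h : b = a
  · subst h; simp [St.put, Function.update_apply]
  · simp [St.put, h]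

attribute [simp] Exp.eval Cmd.run

/-- The command does not assign to the scalar variable `x`. -/
def Cmd.KeepsV (x : Var) : Cmd → Prop
  | .skip => True
  | .set y _ => y ≠ x
  | .put _ _ _ => True
  | .seq c d => c.KeepsV x ∧ d.KeepsV x
  | .ite _ c d => c.KeepsV x ∧ d.KeepsV x
  | .iter y _ c => y ≠ x ∧ c.KeepsV x
  | .read y => y ≠ x
  | .print _ => True

/-- The command does not assign to the array `a`. -/
def Cmd.KeepsA (a : Arr) : Cmd → Prop
  | .put b _ _ => b ≠ a
  | .seq c d => c.KeepsA a ∧ d.KeepsA a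
  | .ite _ c d => c.KeepsA a ∧ d.KeepsA a
  | .iter _ _ c => c.KeepsA a
  | _ => True

/-- The command neither reads nor prints. -/
def Cmd.Quiet : Cmd → Prop
  | .seq c d => c.Quiet ∧ d.Quiet
  | .ite _ c d => c.Quiet ∧ d.Quiet
  | .iter _ _ c => c.Quiet
  | .read _ => False
  | .print _ => False
  | _ => True

attribute [simp] Cmd.KeepsV Cmd.KeepsA Cmd.Quiet

theorem loop_keeps {α : Type*} (g : St → α) (f : ℕ → St → St) (h : ∀ n s, g (f n s) = g s) (n : ℕ)
    (s : St) : g (loop f n s) = g s := by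
  induction n with
  | zero => rfl
  | succ n ih => rw [loop, h, ih]

theorem Cmd.run_v {x : Var} (c : Cmd) (h : c.KeepsV x) (s : St) : (c.run s).v x = s.v x := by
  induction c generalizing s with
  | skip | put | print => rfl
  | set | read => simp [Ne.symm h]
  | seq c d ih1 ih2 => simp [ih1 h.1, ih2 h.2]
  | ite e c d ih1 ih2 => simp only [run]; split <;> simp [ih1 h.1, ih2 h.2]
  | iter y e c ih =>
    exact loop_keeps (fun s => s.v x) _ (fun n s => by simp [ih h.2, Ne.symm h.1]) _ _

theorem Cmd.run_a {a : Arr} (c : Cmd) (h : c.KeepsA a) (s : St) : (c.run s).a a = s.a a := by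
  induction c generalizing s with
  | skip | set | print | read => rfl
  | put => exact St.put_a_ne _ _ _ (Ne.symm h)
  | seq c d ih1 ih2 => simp [ih1 h.1, ih2 h.2]
  | ite e c d ih1 ih2 => simp only [run]; split <;> simp [ih1 h.1, ih2 h.2]
  | iter y e c ih => exact loop_keeps (fun s => s.a a) _ (fun n s => by simp [ih h]) _ _

theorem Cmd.run_out (c : Cmd) (h : c.Quiet) (s : St) : (c.run s).out = s.out := by
  induction c generalizing s with
  | skip | set | put => rfl
  | print | read => exact h.elim
  | seq c d ih1 ih2 => simp [ih1 h.1, ih2 h.2]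
  | ite e c d ih1 ih2 => simp only [run]; split <;> simp [ih1 h.1, ih2 h.2]
  | iter y e c ih => exact loop_keeps St.out _ (fun n s => by simp [ih h]) _ _

/-- What a command keeps, `t` agrees on with `s`. -/
structure Frame (c : Cmd) (s t : St) : Prop where
  v : ∀ {x}, c.KeepsV x → t.v x = s.v x
  a : ∀ {a}, c.KeepsA a → t.a a = s.a a
  out : c.Quiet → t.out = s.out

theorem Cmd.frame (c : Cmd) (s : St) : Frame c s (c.run s) :=
  ⟨fun h => c.run_v h s, fun h => c.run_a h s, fun h => c.run_out h s⟩

/-- Loop invariants. -/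
theorem Cmd.iter_inv {x : Var} {e : Exp} {c : Cmd} {s : St} (I : ℕ → St → Prop) (h0 : I 0 s)
    (hs : ∀ n < e.eval s, ∀ t, Frame (.iter x e c) s t → I n t → I (n + 1) (c.run (t.set x n))) :
    I (e.eval s) ((Cmd.iter x e c).run s) := by
  have : ∀ m ≤ e.eval s, I m (loop (fun n s => c.run (s.set x n)) m s) := by
    intro m
    induction m with
    | zero => exact fun _ => h0
    | succ m ih =>
      intro hm
      refine hs m (by omega) _ ⟨?_, ?_, ?_⟩ (ih (by omega))
      · exact fun {y} h => loop_keeps (fun s => s.v y) _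
          (fun n s => by simp [c.run_v h.2, Ne.symm h.1]) _ _
      · exact fun {a} h => loop_keeps (fun s => s.a a) _ (fun n s => by simp [c.run_a h]) _ _
      · exact fun h => loop_keeps St.out _ (fun n s => by simp [c.run_out h]) _ _
  exact this _ le_rfl

/-- The sequence of a list of commands. -/
def Cmd.seqs : List Cmd → Cmd
  | [] => .skip
  | c :: l => .seq c (seqs l)

@[simp] theorem Cmd.run_seqs_nil (s : St) : (seqs []).run s = s := rfl
@[simp] theorem Cmd.run_seqs_cons (c : Cmd) (l : List Cmd) (s : St) :
    (seqs (c :: l)).run s = (seqs l).run (c.run s) := rfl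

@[simp] theorem Cmd.keepsV_seqs {x : Var} {l : List Cmd} :
    (seqs l).KeepsV x ↔ ∀ c ∈ l, c.KeepsV x := by
  induction l with
  | nil => simp [seqs]
  | cons c l ih => simp [seqs, ih]

@[simp] theorem Cmd.keepsA_seqs {a : Arr} {l : List Cmd} :
    (seqs l).KeepsA a ↔ ∀ c ∈ l, c.KeepsA a := by
  induction l with
  | nil => simp [seqs]
  | cons c l ih => simp [seqs, ih]

@[simp] theorem Cmd.quiet_seqs {l : List Cmd} : (seqs l).Quiet ↔ ∀ c ∈ l, c.Quiet := by
  induction l with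
  | nil => simp [seqs]
  | cons c l ih => simp [seqs, ih]

/-! ### Time bounds -/

/-- All loops of the command run up to the variable `lim`, which is not assigned to. -/
def Cmd.Lim : Cmd → Prop
  | .set y _ => y ≠ .lim
  | .seq c d => c.Lim ∧ d.Lim
  | .ite _ c d => c.Lim ∧ d.Lim
  | .iter x e c => x ≠ .lim ∧ e = .var .lim ∧ c.Lim
  | .read y => y ≠ .lim
  | _ => True

attribute [simp] Cmd.Lim

@[simp] theorem Cmd.lim_seqs {l : List Cmd} : (seqs l).Lim ↔ ∀ c ∈ l, c.Lim := by
  induction l with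
  | nil => simp [seqs]
  | cons c l ih => simp [seqs, ih]

theorem Cmd.Lim.keepsV {c : Cmd} (h : c.Lim) : c.KeepsV .lim := by
  induction c with
  | skip | put | print => trivial
  | set | read => exact h
  | seq c d ih1 ih2 | ite e c d ih1 ih2 => exact ⟨ih1 h.1, ih2 h.2⟩
  | iter x e c ih => exact ⟨h.1, ih h.2.2⟩

/-- The nesting depth of the loops. -/
def Cmd.depth : Cmd → ℕ
  | .seq c d => max c.depth d.depth
  | .ite _ c d => max c.depth d.depth
  | .iter _ _ c => c.depth + 1
  | _ => 0

/-- The constant factor of the time bound. -/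
def Cmd.coef : Cmd → ℕ
  | .skip => 0
  | .set _ e => e.size + 2
  | .put _ e f => e.size + f.size + 6
  | .seq c d => c.coef + d.coef
  | .ite e c d => e.size + 3 + c.coef + d.coef
  | .iter _ e c => e.size + 12 + c.coef
  | .read _ => 1
  | .print e => e.size + 1

theorem Cmd.cost_le {c : Cmd} (h : c.Lim) (s : St) :
    c.cost s ≤ c.coef * (s.v .lim + 1) ^ c.depth := by
  induction c generalizing s with
  | skip | set | put | print | read => simp [cost, coef, depth]
  | seq c d ih1 ih2 =>
    have h1 := ih1 h.1 s
    have h2 := ih2 h.2 (c.run s)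
    rw [c.run_v h.1.keepsV] at h2
    have e1 := Nat.pow_le_pow_right (Nat.succ_pos (s.v .lim)) (le_max_left c.depth d.depth)
    have e2 := Nat.pow_le_pow_right (Nat.succ_pos (s.v .lim)) (le_max_right c.depth d.depth)
    simp only [cost, coef, depth, add_mul]
    exact add_le_add (h1.trans (Nat.mul_le_mul_left _ e1)) (h2.trans (Nat.mul_le_mul_left _ e2))
  | ite e c d ih1 ih2 =>
    have h1 := ih1 h.1 s
    have h2 := ih2 h.2 s
    have e1 := Nat.pow_le_pow_right (Nat.succ_pos (s.v .lim)) (le_max_left c.depth d.depth)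
    have e2 := Nat.pow_le_pow_right (Nat.succ_pos (s.v .lim)) (le_max_right c.depth d.depth)
    have h1' := h1.trans (Nat.mul_le_mul_left _ e1)
    have h2' := h2.trans (Nat.mul_le_mul_left _ e2)
    have e3 := Nat.le_mul_of_pos_right (e.size + 3)
      (Nat.pow_pos (Nat.succ_pos (s.v .lim)) (n := max c.depth d.depth))
    simp only [cost, coef, depth, add_mul _ d.coef, add_mul _ c.coef]
    split_ifs <;> simp only [Nat.succ_eq_add_one] at * <;> omega
  | iter x e c ih =>
    obtain ⟨hx, rfl, hc⟩ := h
    simp only [cost, coef, depth]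
    set L := s.v .lim with hL
    have hi : ∀ n, c.cost ((loop (fun n s => c.run (s.set x n)) n s).set x n) ≤
        c.coef * (L + 1) ^ c.depth := by
      intro n
      refine (ih hc _).trans_eq ?_
      have := loop_keeps (fun s => s.v .lim) (fun n s => c.run (s.set x n))
          (fun n s => by simp [c.run_v hc.keepsV, Ne.symm hx]) n s
      rw [St.set_v, if_neg (Ne.symm hx), this]
    have h1 : ∑ n ∈ Finset.range (Exp.eval s (.var .lim)),
        (c.cost ((loop (fun n s => c.run (s.set x n)) n s).set x n) + 7) ≤
        L * (c.coef * (L + 1) ^ c.depth + 7) := by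
      refine (Finset.sum_le_sum fun n _ => Nat.add_le_add_right (hi n) 7).trans ?_
      simp [hL]
    have h2 := Nat.one_le_pow c.depth (L + 1) (Nat.succ_pos _)
    rw [pow_succ]
    generalize (L + 1) ^ c.depth = X at *
    nlinarith [Nat.zero_le ((Exp.var .lim).size * (L * X)), Nat.zero_le (c.coef * X),
      Nat.zero_le (L * (X - 1)), Nat.mul_le_mul_left L h2,
      Nat.mul_le_mul_left (Exp.var .lim).size h2]

/-! ### Boolean expressions -/

namespace Exp

/-- Equality. -/
def eq (e f : Exp) : Exp := .sub (.lit 1) (.add (.sub e f) (.sub f e))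
/-- Negation. -/
def not (e : Exp) : Exp := .sub (.lit 1) e
/-- Conjunction. -/
def and (e f : Exp) : Exp := .not (.add (.not e) (.not f))
/-- Disjunction of a list. -/
def any : List Exp → Exp
  | [] => .lit 0
  | e :: l => .add e (any l)
/-- Conjunction of a list. -/
def all : List Exp → Exp
  | [] => .lit 1
  | e :: l => .and e (all l)

variable (s : St)

@[simp] theorem eval_eq (e f : Exp) : 0 < (eq e f).eval s ↔ e.eval s = f.eval s := by
  simp [eq]; omega
@[simp] theorem eval_not (e : Exp) : 0 < (not e).eval s ↔ ¬ 0 < e.eval s := by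
  simp [not]
@[simp] theorem eval_and (e f : Exp) : 0 < (and e f).eval s ↔ 0 < e.eval s ∧ 0 < f.eval s := by
  simp [and, not]; omega
@[simp] theorem eval_any (l : List Exp) : 0 < (any l).eval s ↔ ∃ e ∈ l, 0 < e.eval s := by
  induction l with
  | nil => simp [any]
  | cons e l ih =>
    have : 0 < (any (e :: l)).eval s ↔ 0 < e.eval s ∨ 0 < (any l).eval s := by simp [any]
    rw [this, ih]; simp
@[simp] theorem eval_all (l : List Exp) : 0 < (all l).eval s ↔ ∀ e ∈ l, 0 < e.eval s := by
  induction l with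
  | nil => simp [all]
  | cons e l ih => simp [all, ih, eval_and]

end Exp

end RAM

/-- Sets of edges `(u, c, v)`, from the vertex `u` to `v`, where `c` is the number of the label. -/
abbrev EdgeSet := Set (ℕ × ℕ × ℕ)

namespace RAM

/-! ### Graphs in memory -/

/-- The edges `(u, c, v)` held in memory: `u` and `v` are vertices and `c` is the number of the
label.  A cell of the array `L` holds `c + 1`, and `0` if there is no edge with this index. -/
def edges (s : St) : EdgeSet :=
  {e | ∃ k < s.v .lim, s.a .S k = e.1 ∧ s.a .L k = e.2.1 + 1 ∧ s.a .T k = e.2.2}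

/-- The letter number `l` leads from `u` to `v`. -/
def Tr (E : EdgeSet) (u l v : ℕ) : Prop :=
  ∃ c, (l = 2 * c + 1 ∧ (u, c, v) ∈ E) ∨ (l = 2 * c ∧ (v, c, u) ∈ E)

/-- No two edges are foldable. -/
def Det (s : St) : Prop :=
  ∀ k < s.v .lim, ∀ k' < s.v .lim, s.a .L k ≠ 0 → s.a .L k = s.a .L k' →
    (s.a .S k = s.a .S k' ∨ s.a .T k = s.a .T k') → k = k'

/-- Well-formed states, for `N` labels. -/
structure Wf (N : ℕ) (s : St) : Prop where
  lt : ∀ k < s.v .lim, s.a .L k ≠ 0 → s.a .S k < s.v .cap ∧ s.a .T k < s.v .cap ∧ s.a .L k ≤ N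
  cap_pos : 0 < s.v .cap
  cap_le : s.v .cap ≤ s.v .lim
  cap_le' : 2 * N * s.v .cap ≤ s.v .lim

/-- The table of the transitions is correct. -/
def Tab (N : ℕ) (s : St) : Prop :=
  ∀ u < s.v .cap, ∀ l < 2 * N, ∀ v, s.a .tab (2 * N * u + l) = v + 1 ↔ Tr (edges s) u l v

/-- A loop up to the variable `lim`. -/
abbrev loopL (x : Var) (c : Cmd) : Cmd := .iter x (.var .lim) c

theorem loopL_inv {x : Var} {c : Cmd} {s : St} {M : ℕ} (hM : s.v .lim = M) (I : ℕ → St → Prop)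
    (h0 : I 0 s) (hs : ∀ n < M, ∀ t, Frame (loopL x c) s t → I n t → I (n + 1) (c.run (t.set x n))) :
    I M ((loopL x c).run s) := by
  subst hM
  exact Cmd.iter_inv (e := .var .lim) I h0 hs

/-- The address of a table entry. -/
abbrev ix (N : ℕ) (u l : Exp) : Exp := .add (.mulc (2 * N) u) l

theorem ix_lt {M u c l : ℕ} (hu : u < c) (hl : l < M) : M * u + l < M * c := by
  have : M * (u + 1) ≤ M * c := Nat.mul_le_mul_left _ hu
  rw [mul_add] at this; omega

theorem ix_inj {M u u' l l' : ℕ} (hl : l < M) (hl' : l' < M) (h : M * u + l = M * u' + l') :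
    u = u' ∧ l = l' := by
  have h1 : (M * u + l) / M = u := by
    rw [Nat.mul_add_div (by omega), Nat.div_eq_of_lt hl]; rfl
  have h2 : (M * u' + l') / M = u' := by
    rw [Nat.mul_add_div (by omega), Nat.div_eq_of_lt hl']; rfl
  have : u = u' := by rw [← h1, ← h2, h]
  subst this
  exact ⟨rfl, by omega⟩

/-- The source of the edge `k`. -/
abbrev eS : Exp := .get .S (.var .k)
/-- The target of the edge `k`. -/
abbrev eT : Exp := .get .T (.var .k)
/-- The label of the edge `k`, plus one. -/
abbrev eL : Exp := .get .L (.var .k)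

/-- Enter the edge `k` into the table of the transitions; on a conflict with an earlier edge, set
`flag`, and `idx` to `k`, and `p`, `q` to the vertices to be identified. -/
def buildStep (N : ℕ) : Cmd :=
  .ite eL
    (.ite (.get .tab (ix N eS (.sub (.mulc 2 eL) (.lit 1))))
      (.seqs [.set .flag (.lit 1), .set .idx (.var .k), .set .p eT,
        .set .q (.sub (.get .tab (ix N eS (.sub (.mulc 2 eL) (.lit 1)))) (.lit 1))])
      (.ite (.get .tab (ix N eT (.sub (.mulc 2 eL) (.lit 2))))
        (.seqs [.set .flag (.lit 1), .set .idx (.var .k), .set .p eS,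
          .set .q (.sub (.get .tab (ix N eT (.sub (.mulc 2 eL) (.lit 2)))) (.lit 1))])
        (.seqs [.put .tab (ix N eS (.sub (.mulc 2 eL) (.lit 1))) (.add eT (.lit 1)),
          .put .tab (ix N eT (.sub (.mulc 2 eL) (.lit 2))) (.add eS (.lit 1))])))
    .skip

/-- Fill the table of the transitions; set `flag` if there are foldable edges. -/
def build (N : ℕ) : Cmd := .seqs [
  loopL .k (.put .tab (.var .k) (.lit 0)),
  .set .flag (.lit 0),
  loopL .k (buildStep N)]

/-- The edge `idx` is foldable with another one, which identifies `p` and `q`. -/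
def Conflict (s t : St) : Prop :=
  ∃ k < s.v .lim, t.v .idx < s.v .lim ∧ k ≠ t.v .idx ∧ s.a .L k ≠ 0 ∧
    s.a .L k = s.a .L (t.v .idx) ∧
    ((s.a .S k = s.a .S (t.v .idx) ∧ t.v .p = s.a .T (t.v .idx) ∧ t.v .q = s.a .T k) ∨
      (s.a .T k = s.a .T (t.v .idx) ∧ t.v .p = s.a .S (t.v .idx) ∧ t.v .q = s.a .S k))

/-- The transitions along the first `n` edges. -/
def TrN (s : St) (n u l v : ℕ) : Prop :=
  ∃ k < n, s.a .L k ≠ 0 ∧ ((l + 1 = 2 * s.a .L k ∧ s.a .S k = u ∧ s.a .T k = v) ∨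
    (l + 2 = 2 * s.a .L k ∧ s.a .T k = u ∧ s.a .S k = v))

theorem trN_iff (s : St) (u l v : ℕ) : TrN s (s.v .lim) u l v ↔ Tr (edges s) u l v := by
  constructor
  · rintro ⟨k, hk, h0, ⟨h1, h2, h3⟩ | ⟨h1, h2, h3⟩⟩
    · exact ⟨s.a .L k - 1, Or.inl ⟨by omega, k, hk, h2, by simp only; omega, h3⟩⟩
    · exact ⟨s.a .L k - 1, Or.inr ⟨by omega, k, hk, h3, by simp only; omega, h2⟩⟩
  · rintro ⟨c, ⟨h, k, hk, h1, h2, h3⟩ | ⟨h, k, hk, h1, h2, h3⟩⟩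
    · exact ⟨k, hk, by simp only at h2; omega, Or.inl ⟨by simp only at h2; omega, h1, h3⟩⟩
    · exact ⟨k, hk, by simp only at h2; omega, Or.inr ⟨by simp only at h2; omega, h3, h1⟩⟩

theorem build_spec {N : ℕ} {s : St} (hs : Wf N s) :
    (((build N).run s).v .flag = 0 → Det s ∧ Tab N ((build N).run s)) ∧
    (((build N).run s).v .flag ≠ 0 → Conflict s ((build N).run s)) := by
  set s₁ := (loopL .k (.put .tab (.var .k) (.lit 0))).run s with hs₁
  have f₁ : Frame _ s s₁ := Cmd.frame _ s
  have clear : ∀ k < s.v .lim, s₁.a .tab k = 0 := by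
    refine Cmd.iter_inv (c := .put .tab (.var .k) (.lit 0)) (e := .var .lim)
      (fun n t => ∀ k < n, t.a .tab k = 0) (by simp) fun n _ t _ ih k hk => ?_
    simp only [Cmd.run, Exp.eval, St.put_a, St.set_v, St.set_a, if_true, true_and]
    split_ifs with h
    · rfl
    · exact ih k (by omega)
  have hS : s₁.a .S = s.a .S := f₁.a (by simp)
  have hT : s₁.a .T = s.a .T := f₁.a (by simp)
  have hL : s₁.a .L = s.a .L := f₁.a (by simp)
  have hlim : s₁.v .lim = s.v .lim := f₁.v (by simp)
  obtain ⟨k1, k2, k3⟩ := loopL_inv (x := .k) (c := buildStep N) (s := s₁.set .flag 0)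
    (M := s.v .lim) (by simp [hlim]) (fun n t => (t.v .flag = 0 →
        (∀ k < n, ∀ k' < n, s.a .L k ≠ 0 → s.a .L k = s.a .L k' →
          (s.a .S k = s.a .S k' ∨ s.a .T k = s.a .T k') → k = k') ∧
        (∀ u l v, TrN s n u l v → t.a .tab (2 * N * u + l) = v + 1)) ∧
      (∀ u < s.v .cap, ∀ l < 2 * N, ∀ v, t.a .tab (2 * N * u + l) = v + 1 → TrN s n u l v) ∧
      (t.v .flag ≠ 0 → Conflict s t)) (by
    · refine ⟨fun _ => ⟨by simp, fun u l v ⟨k, hk, _⟩ => by omega⟩, fun u hu l hl v h => ?_,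
        by simp⟩
      rw [St.set_a, clear _ ((ix_lt hu hl).trans_le hs.cap_le')] at h
      omega) (by
    · intro n hn t ft ⟨h1, h2, h3⟩
      have hS' : t.a .S = s.a .S := (ft.a (by simp [buildStep])).trans hS
      have hT' : t.a .T = s.a .T := (ft.a (by simp [buildStep])).trans hT
      have hL' : t.a .L = s.a .L := (ft.a (by simp [buildStep])).trans hL
      have mono : ∀ {u l v}, TrN s n u l v → TrN s (n + 1) u l v :=
        fun ⟨k, hk, h⟩ => ⟨k, by omega, h⟩
      simp only [buildStep, Cmd.run, Exp.eval, St.set_v, St.set_a, if_true, hL', hS', hT', Cmd.run_seqs_cons,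
        Cmd.run_seqs_nil]
      have split : ∀ {u l v}, TrN s (n + 1) u l v → TrN s n u l v ∨ (s.a .L n ≠ 0 ∧
          ((l + 1 = 2 * s.a .L n ∧ s.a .S n = u ∧ s.a .T n = v) ∨
            (l + 2 = 2 * s.a .L n ∧ s.a .T n = u ∧ s.a .S n = v))) := by
        rintro u l v ⟨k, hk, h⟩
        rcases Nat.lt_succ_iff_lt_or_eq.1 hk with h' | rfl
        · exact Or.inl ⟨k, h', h⟩
        · exact Or.inr h
      by_cases hl : 0 < s.a .L n
      swap
      · simp only [hl, if_false, St.set_v, St.set_a, reduceCtorEq]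
        refine ⟨fun hf => ⟨fun k hk k' hk' a1 a2 a3 => ?_, fun u l v h => ?_⟩,
          fun u hu l hl v h => mono (h2 u hu l hl v h), fun hf => by
            simpa [Conflict] using h3 hf⟩
        · have : k ≠ n := by rintro rfl; omega
          have : k' ≠ n := by rintro rfl; omega
          exact (h1 hf).1 k (by omega) k' (by omega) a1 a2 a3
        · rcases split h with h | ⟨h, -⟩
          · exact (h1 hf).2 u l v h
          · omega
      obtain ⟨w1, w2, w3⟩ := hs.lt n hn (by omega)
      simp only [hl, if_true]
      by_cases ht : 0 < t.a .tab (2 * N * s.a .S n + (2 * s.a .L n - 1))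
      · simp only [ht, if_true, St.set_v, St.set_a, reduceCtorEq, if_false]
        refine ⟨by simp, fun u hu l hl v h => mono (h2 u hu l hl v h), fun _ => ?_⟩
        obtain ⟨k, hk, b1, ⟨b2, b3, b4⟩ | ⟨b2, b3, b4⟩⟩ := h2 _ w1 (2 * s.a .L n - 1) (by omega)
          (t.a .tab (2 * N * s.a .S n + (2 * s.a .L n - 1)) - 1) (by omega)
        · refine ⟨k, by omega, by simpa using hn, by simp; omega, b1, by simp; omega, Or.inl ?_⟩
          simp [b3, b4]
        · omega
      simp only [ht, if_false]
      by_cases ht' : 0 < t.a .tab (2 * N * s.a .T n + (2 * s.a .L n - 2))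
      · simp only [ht', if_true, St.set_v, St.set_a, reduceCtorEq, if_false]
        refine ⟨by simp, fun u hu l hl v h => mono (h2 u hu l hl v h), fun _ => ?_⟩
        obtain ⟨k, hk, b1, ⟨b2, b3, b4⟩ | ⟨b2, b3, b4⟩⟩ := h2 _ w2 (2 * s.a .L n - 2) (by omega)
          (t.a .tab (2 * N * s.a .T n + (2 * s.a .L n - 2)) - 1) (by omega)
        · omega
        · refine ⟨k, by omega, by simpa using hn, by simp; omega, b1, by simp; omega, Or.inr ?_⟩
          simp [b3, b4]
      simp only [ht', if_false, if_true, St.put_v, St.set_v, reduceCtorEq, St.put_a, false_and,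
        St.set_a, hL', hS', hT', true_and]
      have hne : 2 * N * s.a .S n + (2 * s.a .L n - 1) ≠ 2 * N * s.a .T n + (2 * s.a .L n - 2) :=
        fun h => by have := ix_inj (by omega) (by omega) h; omega
      refine ⟨fun hf => ⟨?_, ?_⟩, ?_, ?_⟩
      · obtain ⟨g1, g2⟩ := h1 hf
        have nol : ∀ k < n, s.a .L k = s.a .L n →
            ¬ (s.a .S k = s.a .S n ∨ s.a .T k = s.a .T n) := by
          rintro k hk e1 (e2 | e2)
          · have := g2 (s.a .S n) (2 * s.a .L n - 1) (s.a .T k)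
              ⟨k, hk, by omega, Or.inl ⟨by omega, e2, rfl⟩⟩
            omega
          · have := g2 (s.a .T n) (2 * s.a .L n - 2) (s.a .S k)
              ⟨k, hk, by omega, Or.inr ⟨by omega, e2, rfl⟩⟩
            omega
        intro k hk k' hk' a1 a2 a3
        rcases Nat.lt_succ_iff_lt_or_eq.1 hk with h | rfl <;>
        rcases Nat.lt_succ_iff_lt_or_eq.1 hk' with h' | rfl
        · exact g1 k h k' h' a1 a2 a3
        · exact (nol k h a2 a3).elim
        · exact (nol k' h' a2.symm (a3.imp Eq.symm Eq.symm)).elim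
        · rfl
      · obtain ⟨g1, g2⟩ := h1 hf
        intro u l v h
        rcases split h with h | ⟨-, ⟨e1, e2, e3⟩ | ⟨e1, e2, e3⟩⟩
        · have h' := g2 u l v h
          rw [if_neg, if_neg]
          · exact h'
          · intro e; rw [e] at h'; omega
          · intro e; rw [e] at h'; omega
        · have : 2 * N * u + l = 2 * N * s.a .S n + (2 * s.a .L n - 1) := by rw [e2]; omega
          rw [this, if_neg hne, if_pos rfl, e3]
        · have : 2 * N * u + l = 2 * N * s.a .T n + (2 * s.a .L n - 2) := by rw [e2]; omega
          rw [this, if_pos rfl, e3]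
      · intro u hu l hl' v
        split_ifs with i1 i2
        · intro e
          obtain ⟨rfl, rfl⟩ := ix_inj hl' (by omega) i1
          exact ⟨n, by omega, by omega, Or.inr ⟨by omega, rfl, by omega⟩⟩
        · intro e
          obtain ⟨rfl, rfl⟩ := ix_inj hl' (by omega) i2
          exact ⟨n, by omega, by omega, Or.inl ⟨by omega, rfl, by omega⟩⟩
        · exact fun h => mono (h2 u hu l hl' v h)
      · intro hf; simpa [Conflict] using h3 hf)
  have fr := (build N).frame s
  have hE : edges ((build N).run s) = edges s := by
    unfold edges
    rw [fr.a (a := .S) (by simp [build, buildStep]), fr.a (a := .T) (by simp [build, buildStep]),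
      fr.a (a := .L) (by simp [build, buildStep]), fr.v (x := .lim) (by simp [build, buildStep])]
  refine ⟨fun hf => ⟨(k1 hf).1, fun u hu l hl v => ?_⟩, k3⟩
  rw [hE, ← trN_iff]
  rw [fr.v (by simp [build, buildStep])] at hu
  exact ⟨k2 u hu l hl v, (k1 hf).2 u l v⟩


/-! ### Folding -/

/-- Rename the vertices of an edge. -/
def map3 (R : ℕ → ℕ) (e : ℕ × ℕ × ℕ) : ℕ × ℕ × ℕ := (R e.1, e.2.1, R e.2.2)

/-- Rename the vertex `p` to `q`. -/
def ren (p q x : ℕ) : ℕ := if x = p then q else x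

/-- Maps of the vertices that are compatible with foldings and with the given identifications. -/
def Adm (E : EdgeSet) (P : Set (ℕ × ℕ)) {W : Type} (φ : ℕ → W) : Prop :=
  (∀ e ∈ E, ∀ e' ∈ E, e.2.1 = e'.2.1 → (φ e.1 = φ e'.1 ↔ φ e.2.2 = φ e'.2.2)) ∧
    ∀ x ∈ P, φ x.1 = φ x.2

/-- The edges `E` and the identifications `P` are obtained from `E₀` and `P₀` by the renaming `R`,
which performs forced identifications only. -/
structure Quo (E₀ : EdgeSet) (P₀ : Set (ℕ × ℕ)) (R : ℕ → ℕ) (E : EdgeSet)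
    (P : Set (ℕ × ℕ)) : Prop where
  edges : E = map3 R '' E₀
  pairs : ∀ x ∈ P₀, R x.1 = R x.2 ∨ (R x.1, R x.2) ∈ P
  pairs' : ∀ y ∈ P, ∃ x ∈ P₀, (R x.1, R x.2) = y
  zero : R 0 = 0
  adm : ∀ (W : Type) (φ : ℕ → W), Adm E₀ P₀ φ → ∀ v, φ (R v) = φ v

theorem Quo.refl (E : EdgeSet) (P : Set (ℕ × ℕ)) : Quo E P id E P where
  edges := by ext ⟨a, b, c⟩; simp [map3]
  pairs x hx := Or.inr hx
  pairs' y hy := ⟨y, hy, rfl⟩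
  zero := rfl
  adm _ _ _ _ := rfl

theorem Quo.step {E₀ E : EdgeSet} {P₀ P P' : Set (ℕ × ℕ)} {R : ℕ → ℕ}
    (h : Quo E₀ P₀ R E P) {p q : ℕ} (hpq : q ≤ p)
    (hf : ∀ (W : Type) (φ : ℕ → W), Adm E₀ P₀ φ → φ p = φ q)
    (h1 : ∀ x ∈ P, ren p q x.1 = ren p q x.2 ∨ (ren p q x.1, ren p q x.2) ∈ P')
    (h2 : ∀ y ∈ P', ∃ x ∈ P, (ren p q x.1, ren p q x.2) = y) :
    Quo E₀ P₀ (ren p q ∘ R) (map3 (ren p q) '' E) P' where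
  edges := by rw [h.edges, Set.image_image]; rfl
  pairs x hx := by
    rcases h.pairs x hx with h' | h'
    · left; simp [h']
    · exact h1 _ h'
  pairs' y hy := by
    obtain ⟨x, hx, rfl⟩ := h2 y hy
    obtain ⟨z, hz, rfl⟩ := h.pairs' x hx
    exact ⟨z, hz, rfl⟩
  zero := by
    simp only [Function.comp, h.zero, ren]
    split_ifs <;> omega
  adm W φ ha v := by
    simp only [Function.comp, ren]
    split_ifs with h'
    · rw [← hf W φ ha, ← h', h.adm W φ ha]
    · exact h.adm W φ ha v

theorem Quo.forced {E₀ E : EdgeSet} {P₀ P : Set (ℕ × ℕ)} {R : ℕ → ℕ}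
    (h : Quo E₀ P₀ R E P) {e e' : ℕ × ℕ × ℕ} (he : e ∈ E) (he' : e' ∈ E) (hl : e.2.1 = e'.2.1)
    {W : Type} {φ : ℕ → W} (hφ : Adm E₀ P₀ φ) : φ e.1 = φ e'.1 ↔ φ e.2.2 = φ e'.2.2 := by
  rw [h.edges] at he he'
  obtain ⟨e, he, rfl⟩ := he
  obtain ⟨e', he', rfl⟩ := he'
  simp only [map3, h.adm W φ hφ]
  exact hφ.1 e he e' he' hl

/-- Replace the vertex `p` by `q` in the cell `k` of the array `a`. -/
def renameCell (a : Arr) : Cmd :=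
  .ite (.eq (.get a (.var .k)) (.var .p)) (.put a (.var .k) (.var .q)) .skip

theorem renameCell_v (a : Arr) (s : St) : ((renameCell a).run s).v = s.v := by
  rw [renameCell, Cmd.run]; split_ifs <;> rfl

theorem renameCell_a (a b : Arr) (s : St) (m : ℕ) : ((renameCell a).run s).a b m =
    if b = a ∧ m = s.v .k then ren (s.v .p) (s.v .q) (s.a b m) else s.a b m := by
  rw [renameCell, Cmd.run]
  simp only [Exp.eval_eq, Exp.eval]
  split_ifs with h1 h2 h2
  · obtain ⟨rfl, rfl⟩ := h2; simp [ren, h1]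
  · simp [h2]
  · obtain ⟨rfl, rfl⟩ := h2; simp [ren, h1]
  · rfl

/-- Replace the vertex `p` by `q` at the index `k`. -/
def renameStep : Cmd := .seqs [renameCell .S, renameCell .T, renameCell .P, renameCell .Q]

/-- Identify the vertices `p` and `q`. -/
def merge : Cmd := .seqs [
  .ite (.sub (.var .q) (.var .p))
    (.seqs [.set .cur (.var .p), .set .p (.var .q), .set .q (.var .cur)]) .skip,
  loopL .k renameStep]

theorem merge_spec (s : St) (a : Arr) (ha : a = .S ∨ a = .T ∨ a = .P ∨ a = .Q) :
    ∀ k < s.v .lim, (merge.run s).a a k =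
      ren (max (s.v .p) (s.v .q)) (min (s.v .p) (s.v .q)) (s.a a k) := by
  unfold merge
  rw [Cmd.run_seqs_cons]
  have h1 : ∀ c, c = (Cmd.ite (.sub (.var .q) (.var .p))
    (.seqs [.set .cur (.var .p), .set .p (.var .q), .set .q (.var .cur)]) .skip) →
    (c.run s).v .p = max (s.v .p) (s.v .q) ∧ (c.run s).v .q = min (s.v .p) (s.v .q) ∧
    (c.run s).a = s.a ∧ (c.run s).v .lim = s.v .lim := by
    rintro c rfl
    by_cases h : 0 < s.v .q - s.v .p
    · rw [Cmd.run, if_pos (by simpa using h)]; simp; omega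
    · rw [Cmd.run, if_neg (by simpa using h)]; simp; omega
  obtain ⟨e1, e2, e3, e4⟩ := h1 _ rfl
  generalize Cmd.run _ s = s' at e1 e2 e3 e4
  rw [← e1, ← e2, ← e3, ← e4, Cmd.run_seqs_cons, Cmd.run_seqs_nil]
  have := loopL_inv (x := .k) (c := renameStep) (s := s') rfl
    (fun n t => ∀ a, (a = .S ∨ a = .T ∨ a = .P ∨ a = .Q) → ∀ k,
      t.a a k = if k < n then ren (s'.v .p) (s'.v .q) (s'.a a k) else s'.a a k) (by simp) (by
    intro n hn t ft ih a ha k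
    have hp : t.v .p = s'.v .p := ft.v (by simp [renameStep, renameCell])
    have hq : t.v .q = s'.v .q := ft.v (by simp [renameStep, renameCell])
    simp only [renameStep, Cmd.run_seqs_cons, Cmd.run_seqs_nil, renameCell_a, renameCell_v,
      St.set_v, St.set_a, reduceCtorEq, if_false, if_true, hp, hq]
    have ihk := ih a ha k
    by_cases hk : k = n
    · subst hk
      rw [if_neg (lt_irrefl k)] at ihk
      rcases ha with rfl | rfl | rfl | rfl <;> simp [ihk]
    · have : k < n + 1 ↔ k < n := by omega
      simp only [this, hk, and_false, if_false, ihk])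
  intro k hk
  rw [this a ha k, if_pos hk]

/-- The pending identifications. -/
def pairs (s : St) : Set (ℕ × ℕ) := {x | ∃ k < s.v .np, s.a .P k = x.1 ∧ s.a .Q k = x.2}

theorem merge_edges (s : St) : edges (merge.run s) =
    map3 (ren (max (s.v .p) (s.v .q)) (min (s.v .p) (s.v .q))) '' edges s := by
  have hl : (merge.run s).v .lim = s.v .lim := merge.run_v (by simp [merge, renameStep, renameCell]) s
  have hL : (merge.run s).a .L = s.a .L := merge.run_a (by simp [merge, renameStep, renameCell]) s
  ext ⟨u, c, v⟩
  simp only [edges, hl, hL, Set.mem_image, Set.mem_ofPred_eq, map3, Prod.mk.injEq]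
  constructor
  · rintro ⟨k, hk, h1, h2, h3⟩
    rw [merge_spec s _ (by simp) k hk] at h1 h3
    exact ⟨(s.a .S k, c, s.a .T k), ⟨k, hk, rfl, h2, rfl⟩, h1, rfl, h3⟩
  · rintro ⟨⟨u', c', v'⟩, ⟨k, hk, h1, h2, h3⟩, e1, e2, e3⟩
    refine ⟨k, hk, ?_, by rw [h2, e2], ?_⟩
    · rw [merge_spec s _ (by simp) k hk, h1, e1]
    · rw [merge_spec s _ (by simp) k hk, h3, e3]

theorem ren_max_min (p q : ℕ) : ren (max p q) (min p q) p = ren (max p q) (min p q) q := by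
  unfold ren; split_ifs <;> omega

theorem ren_le (p q x : ℕ) : ren (max p q) (min p q) x ≤ x := by
  unfold ren; split_ifs <;> omega

theorem merge_wf {N : ℕ} {s : St} (hs : Wf N s) : Wf N (merge.run s) := by
  have hl : (merge.run s).v .lim = s.v .lim := merge.run_v (by simp [merge, renameStep, renameCell]) s
  have hc : (merge.run s).v .cap = s.v .cap := merge.run_v (by simp [merge, renameStep, renameCell]) s
  have hL : (merge.run s).a .L = s.a .L := merge.run_a (by simp [merge, renameStep, renameCell]) s
  refine ⟨fun k hk h => ?_, by rw [hc]; exact hs.cap_pos, by rw [hc, hl]; exact hs.cap_le,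
    by rw [hc, hl]; exact hs.cap_le'⟩
  rw [hl] at hk
  rw [hL] at h ⊢
  obtain ⟨h1, h2, h3⟩ := hs.lt k hk h
  rw [merge_spec s _ (by simp) k hk, merge_spec s _ (by simp) k hk, hc]
  exact ⟨(ren_le _ _ _).trans_lt h1, (ren_le _ _ _).trans_lt h2, h3⟩

/-- Perform the pending identification on the top of the stack. -/
def pairStep : Cmd := .ite (.var .np) (.seqs [.set .np (.sub (.var .np) (.lit 1)),
  .set .p (.get .P (.var .np)), .set .q (.get .Q (.var .np)), merge]) .skip

/-- Perform all pending identifications. -/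
def mergePairs : Cmd := loopL .i pairStep

theorem mergePairs_spec {N : ℕ} {s : St} (hs : Wf N s) (hp : s.v .np ≤ s.v .lim) :
    Wf N (mergePairs.run s) ∧
    ∃ R, Quo (edges s) (pairs s) R (edges (mergePairs.run s)) ∅ := by
  have := loopL_inv (x := .i) (c := pairStep) (s := s) rfl
    (fun n t => Wf N t ∧ t.v .np = s.v .np - n ∧
      ∃ R, Quo (edges s) (pairs s) R (edges t) (pairs t)) ⟨hs, rfl, id, Quo.refl _ _⟩ (by
    rintro n hn t ft ⟨hw, hnp, R, hR⟩
    have hlim : t.v .lim = s.v .lim := ft.v (by simp [pairStep, merge, renameStep, renameCell])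
    have ei : ∀ m, edges (t.set .i m) = edges t := fun m => by simp [edges]
    have pi : ∀ m, pairs (t.set .i m) = pairs t := fun m => by simp [pairs]
    have wi : ∀ m, Wf N (t.set .i m) := fun m => ⟨by simpa using hw.lt, by simpa using hw.cap_pos,
      by simpa using hw.cap_le, by simpa using hw.cap_le'⟩
    rw [pairStep, Cmd.run]
    split_ifs with h
    swap
    · simp only [Exp.eval, St.set_v, reduceCtorEq, if_false] at h
      refine ⟨wi n, by simp only [Cmd.run, St.set_v, reduceCtorEq, if_false]; omega, R, ?_⟩
      rw [Cmd.run, ei, pi]; exact hR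
    simp only [Exp.eval, St.set_v, reduceCtorEq, if_false] at h
    simp only [Cmd.run_seqs_cons, Cmd.run_seqs_nil, Cmd.run, Exp.eval, St.set_v, St.set_a,
      reduceCtorEq, if_false, if_true]
    set p := t.a .P (t.v .np - 1) with hp'
    set q := t.a .Q (t.v .np - 1) with hq'
    set t' := (((t.set .i n).set .np (t.v .np - 1)).set .p p).set .q q with ht'
    have e1 : edges t' = edges t := by simp [edges, t']
    have v1 : t'.v .p = p := by simp [t']
    have v2 : t'.v .q = q := by simp [t']
    have v3 : t'.v .lim = s.v .lim := by simp [t', hlim]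
    have v4 : t'.v .np = t.v .np - 1 := by simp [t']
    have v5 : t'.a = t.a := rfl
    have hnp' : (merge.run t').v .np = t'.v .np := merge.run_v (by simp [merge, renameStep, renameCell]) t'
    refine ⟨merge_wf ⟨by simpa [t'] using hw.lt, by simpa [t'] using hw.cap_pos,
      by simpa [t'] using hw.cap_le, by simpa [t'] using hw.cap_le'⟩, by rw [hnp', v4]; omega, ?_⟩
    refine ⟨ren (max p q) (min p q) ∘ R, ?_⟩
    rw [merge_edges, e1, v1, v2]
    have hPQ : ∀ k < t.v .np - 1, (merge.run t').a .P k = ren (max p q) (min p q) (t.a .P k) ∧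
        (merge.run t').a .Q k = ren (max p q) (min p q) (t.a .Q k) := fun k hk => by
      rw [merge_spec t' _ (by simp) k (by omega), merge_spec t' _ (by simp) k (by omega), v1, v2,
        v5]; exact ⟨rfl, rfl⟩
    refine hR.step min_le_max (fun W φ hφ => ?_) ?_ ?_
    · obtain ⟨⟨a, b⟩, hx, hx'⟩ := hR.pairs' (p, q) ⟨t.v .np - 1, by omega, rfl, rfl⟩
      have h1 := hφ.2 _ hx
      simp only [Prod.mk.injEq] at hx'
      rw [← hR.adm W φ hφ a, ← hR.adm W φ hφ b, hx'.1, hx'.2] at h1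
      rcases le_total p q with h' | h' <;> simp [h', h1]
    · rintro ⟨a, b⟩ ⟨k, hk, rfl, rfl⟩
      by_cases hk' : k = t.v .np - 1
      · left; subst hk'; exact ren_max_min p q
      · right
        exact ⟨k, by rw [hnp', v4]; omega, (hPQ k (by omega)).1, (hPQ k (by omega)).2⟩
    · rintro ⟨a, b⟩ ⟨k, hk, h1, h2⟩
      rw [hnp', v4] at hk
      refine ⟨(t.a .P k, t.a .Q k), ⟨k, by omega, rfl, rfl⟩, ?_⟩
      simp only [← (hPQ k hk).1, ← (hPQ k hk).2]
      exact Prod.ext h1 h2)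
  obtain ⟨h1, h2, R, h3⟩ := this
  refine ⟨h1, R, ?_⟩
  have : pairs ((loopL .i pairStep).run s) = ∅ := by
    rw [Set.eq_empty_iff_forall_notMem]
    rintro x ⟨k, hk, -⟩
    rw [h2] at hk; omega
  rw [this] at h3
  exact h3

/-- Perform one folding, if there is any. -/
def foldStep (N : ℕ) : Cmd := .seqs [build N,
  .ite (.var .flag) (.seqs [.put .L (.var .idx) (.lit 0), merge]) .skip]

/-- Fold as long as possible. -/
def foldAll (N : ℕ) : Cmd := loopL .i (foldStep N)

/-- The number of edges in memory. -/
def alive (s : St) : ℕ := ((Finset.range (s.v .lim)).filter fun k => s.a .L k ≠ 0).card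

theorem alive_le (s : St) : alive s ≤ s.v .lim :=
  (Finset.card_filter_le _ _).trans (Finset.card_range _).le

theorem det_of_alive {s : St} (h : alive s = 0) : Det s := by
  intro k hk _ _ h0
  rw [alive, Finset.card_eq_zero, Finset.filter_eq_empty_iff] at h
  exact (h (Finset.mem_range.2 hk) h0).elim

theorem not_det_of_conflict {s t : St} (h : Conflict s t) : ¬ Det s := by
  obtain ⟨k, hk, hi, hne, h0, hl, h⟩ := h
  exact fun hd => hne (hd k hk _ hi h0 hl (h.imp And.left And.left))

theorem alive_lt {s t : St} (hl : t.v .lim = s.v .lim) {i : ℕ} (hi : i < s.v .lim)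
    (h0 : s.a .L i ≠ 0) (h1 : t.a .L i = 0) (h : ∀ k, t.a .L k ≠ 0 → s.a .L k ≠ 0) :
    alive t < alive s := by
  refine Finset.card_lt_card ⟨fun k => ?_, fun h' => ?_⟩
  · simp only [Finset.mem_filter, hl]; exact fun ⟨a, b⟩ => ⟨a, h k b⟩
  · have := h' (Finset.mem_filter.2 ⟨Finset.mem_range.2 hi, h0⟩)
    exact (Finset.mem_filter.1 this).2 h1

theorem pairs_eq_empty {s : St} (h : s.v .np = 0) : pairs s = ∅ := by
  ext x
  simp [pairs, h]

theorem edges_congr {s t : St} (hl : t.v .lim = s.v .lim) (hS : t.a .S = s.a .S)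
    (hT : t.a .T = s.a .T) (hL : t.a .L = s.a .L) : edges t = edges s := by
  simp [edges, hl, hS, hT, hL]

theorem Det.congr {s t : St} (h : Det s) (hl : t.v .lim = s.v .lim) (hS : t.a .S = s.a .S)
    (hT : t.a .T = s.a .T) (hL : t.a .L = s.a .L) : Det t := by
  simpa [Det, hl, hS, hT, hL] using h

theorem Wf.congr {N : ℕ} {s t : St} (h : Wf N s) (hl : t.v .lim = s.v .lim)
    (hc : t.v .cap = s.v .cap) (hS : t.a .S = s.a .S)
    (hT : t.a .T = s.a .T) (hL : t.a .L = s.a .L) : Wf N t := by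
  exact ⟨by simpa [hl, hc, hS, hT, hL] using h.lt, by simpa [hc] using h.cap_pos,
    by simpa [hl, hc] using h.cap_le, by simpa [hl, hc] using h.cap_le'⟩

theorem foldStep_spec {N : ℕ} {s : St} (hs : Wf N s) {E₀ : EdgeSet} {P₀ : Set (ℕ × ℕ)}
    {R : ℕ → ℕ} (hR : Quo E₀ P₀ R (edges s) ∅) :
    Wf N ((foldStep N).run s) ∧ (∃ R', Quo E₀ P₀ R' (edges ((foldStep N).run s)) ∅) ∧
    (Det s → Det ((foldStep N).run s)) ∧
    (Det ((foldStep N).run s) ∨ alive ((foldStep N).run s) < alive s) := by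
  obtain ⟨h1, h2⟩ := build_spec hs
  have fr := (build N).frame s
  rw [foldStep, Cmd.run_seqs_cons, Cmd.run_seqs_cons, Cmd.run_seqs_nil, Cmd.run]
  set t := (build N).run s with ht
  have hlim : t.v .lim = s.v .lim := fr.v (by simp [build, buildStep])
  have hcap : t.v .cap = s.v .cap := fr.v (by simp [build, buildStep])
  have hS : t.a .S = s.a .S := fr.a (by simp [build, buildStep])
  have hT : t.a .T = s.a .T := fr.a (by simp [build, buildStep])
  have hL : t.a .L = s.a .L := fr.a (by simp [build, buildStep])
  split_ifs with hf
  swap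
  · simp only [Exp.eval] at hf
    have hd := (h1 (by omega)).1
    simp only [Cmd.run]
    exact ⟨hs.congr hlim hcap hS hT hL, ⟨R, by rwa [edges_congr hlim hS hT hL]⟩,
      fun h => h.congr hlim hS hT hL, Or.inl (hd.congr hlim hS hT hL)⟩
  have hc := h2 (by simp only [Exp.eval] at hf; omega)
  have hnd := not_det_of_conflict hc
  obtain ⟨k, hk, hi, hne, h0, hl, h⟩ := hc
  simp only [Cmd.run_seqs_cons, Cmd.run_seqs_nil, Cmd.run, Exp.eval]
  set t' := t.put .L (t.v .idx) 0 with ht'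
  have vp : t'.v .p = t.v .p := rfl
  have vq : t'.v .q = t.v .q := rfl
  have hlim' : t'.v .lim = s.v .lim := hlim
  have hcap' : t'.v .cap = s.v .cap := hcap
  have hS' : t'.a .S = s.a .S := (St.put_a_ne _ _ _ (by simp)).trans hS
  have hT' : t'.a .T = s.a .T := (St.put_a_ne _ _ _ (by simp)).trans hT
  have hL' : ∀ m, t'.a .L m = if m = t.v .idx then 0 else s.a .L m := fun m => by
    simp [t', hL]
  have hw' : Wf N t' := by
    refine ⟨fun m hm h => ?_, hcap'.symm ▸ hs.cap_pos, ?_, ?_⟩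
    · rw [hL'] at h ⊢
      rw [hcap', hS', hT']
      rw [hlim'] at hm
      split_ifs at h ⊢
      · exact (h rfl).elim
      · exact hs.lt m hm h
    · rw [hcap', hlim']; exact hs.cap_le
    · rw [hcap', hlim']; exact hs.cap_le'
  set p := t.v .p
  set q := t.v .q
  have hE : map3 (ren (max p q) (min p q)) '' edges t' =
      map3 (ren (max p q) (min p q)) '' edges s := by
    apply Set.Subset.antisymm
    · rintro _ ⟨e, ⟨m, hm, e1, e2, e3⟩, rfl⟩
      rw [hL'] at e2
      rw [hS'] at e1
      rw [hT'] at e3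
      split_ifs at e2
      exact ⟨e, ⟨m, by rwa [hlim'] at hm, e1, e2, e3⟩, rfl⟩
    · rintro _ ⟨e, ⟨m, hm, e1, e2, e3⟩, rfl⟩
      by_cases hmi : m = t.v .idx
      · refine ⟨(s.a .S k, e.2.1, s.a .T k), ⟨k, by rwa [hlim'], by rw [hS'],
          by rw [hL', if_neg hne, hl, ← hmi, e2], by rw [hT']⟩, ?_⟩
        have rp := ren_max_min p q
        simp only [map3, ← e1, ← e3, hmi]
        rcases h with ⟨g1, g2, g3⟩ | ⟨g1, g2, g3⟩ <;> simp [g1, ← g2, ← g3, p, q, rp]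
      · exact ⟨e, ⟨m, by rwa [hlim'], by rwa [hS'], by rwa [hL', if_neg hmi], by rwa [hT']⟩, rfl⟩
  have hL'' : (merge.run t').a .L = t'.a .L := merge.run_a (by simp [merge, renameStep, renameCell]) t'
  refine ⟨merge_wf hw', ⟨ren (max p q) (min p q) ∘ R, ?_⟩, fun h => (hnd h).elim, Or.inr ?_⟩
  · rw [merge_edges, vp, vq, hE]
    refine hR.step min_le_max (fun W φ hφ => ?_) (by simp) (by simp)
    have hforce : φ p = φ q := by
      have hcL : ∃ c, s.a .L k = c + 1 := ⟨s.a .L k - 1, by omega⟩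
      obtain ⟨c, hcL⟩ := hcL
      have := hR.forced (e := (s.a .S (t.v .idx), c, s.a .T (t.v .idx)))
        (e' := (s.a .S k, c, s.a .T k)) ⟨_, hi, rfl, by rw [← hl, hcL], rfl⟩
        ⟨_, hk, rfl, hcL, rfl⟩ rfl hφ
      simp only at this
      rcases h with ⟨g1, g2, g3⟩ | ⟨g1, g2, g3⟩
      · rw [g2, g3, ← this, g1]
      · rw [g2, g3, this, g1]
    rcases le_total p q with h' | h' <;> simp [h', hforce]
  · refine alive_lt (i := t.v .idx) ?_ hi (by rw [← hl]; exact h0) ?_ ?_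
    · rw [← hlim']; exact merge.run_v (by simp [merge, renameStep, renameCell]) t'
    · rw [hL'', hL', if_pos rfl]
    · intro m hm
      rw [hL'', hL'] at hm
      split_ifs at hm
      · exact (hm rfl).elim
      · exact hm

theorem foldAll_spec {N : ℕ} {s : St} (hs : Wf N s) {E₀ : EdgeSet} {P₀ : Set (ℕ × ℕ)}
    {R : ℕ → ℕ} (hR : Quo E₀ P₀ R (edges s) ∅) :
    Wf N ((foldAll N).run s) ∧ (∃ R', Quo E₀ P₀ R' (edges ((foldAll N).run s)) ∅) ∧
    Det ((foldAll N).run s) := by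
  obtain ⟨h1, h2, h3⟩ := loopL_inv (x := .i) (c := foldStep N) (s := s) rfl
    (fun n t => Wf N t ∧ (∃ R', Quo E₀ P₀ R' (edges t) ∅) ∧ (Det t ∨ alive t + n ≤ s.v .lim))
    ⟨hs, ⟨R, hR⟩, Or.inr (alive_le s)⟩ (by
    rintro n hn t ft ⟨hw, ⟨R, hR⟩, h⟩
    have wi : Wf N (t.set .i n) := hw.congr rfl rfl rfl rfl rfl
    obtain ⟨g1, g2, g3, g4⟩ := foldStep_spec (s := t.set .i n) wi hR
    refine ⟨g1, g2, ?_⟩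
    rcases h with h | h
    · exact Or.inl (g3 (h.congr rfl rfl rfl rfl))
    · refine g4.imp_right fun g => ?_
      have : alive (t.set .i n) = alive t := rfl
      omega)
  exact ⟨h1, h2, h3.elim id fun h => det_of_alive (by unfold foldAll; omega)⟩

/-- Perform all pending identifications and fold as long as possible. -/
def engine (N : ℕ) : Cmd := .seq mergePairs (foldAll N)

theorem engine_spec {N : ℕ} {s : St} (hs : Wf N s) (hp : s.v .np ≤ s.v .lim) :
    Wf N ((engine N).run s) ∧ (∃ R, Quo (edges s) (pairs s) R (edges ((engine N).run s)) ∅) ∧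
    Det ((engine N).run s) := by
  obtain ⟨h1, R, h2⟩ := mergePairs_spec hs hp
  exact foldAll_spec h1 h2


/-! ### Numbering the vertices, and output -/

/-- The vertices of a set of edges, with the basepoint `0`. -/
def verts (E : EdgeSet) : Set ℕ := {v | v = 0 ∨ ∃ e ∈ E, v = e.1 ∨ v = e.2.2}

/-- The edges in memory as a list. -/
def elist (s : St) : List (ℕ × ℕ × ℕ) :=
  (List.range (s.v .lim)).filterMap fun k =>
    if s.a .L k = 0 then none else some (s.a .S k, s.a .L k - 1, s.a .T k)

theorem mem_elist {s : St} {e : ℕ × ℕ × ℕ} : e ∈ elist s ↔ e ∈ edges s := by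
  obtain ⟨u, c, v⟩ := e
  simp only [elist, List.mem_filterMap, List.mem_range, edges, Set.mem_ofPred_eq]
  refine exists_congr fun k => and_congr_right fun _ => ?_
  split_ifs with h
  · simp [h]
  · simp only [Option.some.injEq, Prod.mk.injEq]
    constructor <;> rintro ⟨h1, h2, h3⟩ <;> refine ⟨h1, by omega, h3⟩

theorem verts_edges {s : St} {v : ℕ} : v ∈ verts (edges s) ↔
    v = 0 ∨ ∃ k < s.v .lim, s.a .L k ≠ 0 ∧ (s.a .S k = v ∨ s.a .T k = v) := by
  refine or_congr_right ⟨?_, ?_⟩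
  · rintro ⟨e, ⟨k, hk, h1, h2, h3⟩, h⟩
    exact ⟨k, hk, by omega, by rw [h1, h3]; exact h.imp Eq.symm Eq.symm⟩
  · rintro ⟨k, hk, h1, h⟩
    exact ⟨(s.a .S k, s.a .L k - 1, s.a .T k), ⟨k, hk, rfl, by simp only; omega, rfl⟩,
      h.imp Eq.symm Eq.symm⟩

/-- Mark the ends of the edge `k`. -/
def markStep : Cmd := .ite eL (.seqs [.put .nm eS (.lit 1), .put .nm eT (.lit 1)]) .skip

/-- Give a number to the vertex `k`, if it is marked. -/
def numberStep : Cmd := .ite (.get .nm (.var .k))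
  (.seqs [.put .nm (.var .k) (.var .cnt), .set .cnt (.add (.var .cnt) (.lit 1))]) .skip

/-- Rename the ends of the edge `k` according to the numbering. -/
def relabelStep : Cmd :=
  .ite eL (.seqs [.put .S (.var .k) (.get .nm eS), .put .T (.var .k) (.get .nm eT)]) .skip

/-- Renumber the vertices. -/
def compact : Cmd := .seqs [
  loopL .k (.put .nm (.var .k) (.lit 0)),
  .put .nm (.lit 0) (.lit 1),
  loopL .k markStep,
  .set .cnt (.lit 0),
  loopL .k numberStep,
  loopL .k relabelStep,
  .set .cap (.var .cnt)]

open Classical in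
/-- The numbering of the vertices. -/
noncomputable def numbering (s : St) (v : ℕ) : ℕ := Nat.count (· ∈ verts (edges s)) v

theorem mark_spec {s : St} {s' : St} (hs' : s' =
    (loopL .k markStep).run (((loopL .k (.put .nm (.var .k) (.lit 0))).run s).put .nm 0 1)) :
    (∀ v < s.v .lim, 0 < s'.a .nm v ↔ v ∈ verts (edges s)) ∧
    s'.a .S = s.a .S ∧ s'.a .T = s.a .T ∧ s'.a .L = s.a .L ∧ s'.v .lim = s.v .lim := by
  set s₁ := (loopL .k (.put .nm (.var .k) (.lit 0))).run s with hs₁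
  have f₁ : Frame _ s s₁ := Cmd.frame _ s
  have clear : ∀ k < s.v .lim, s₁.a .nm k = 0 := by
    refine Cmd.iter_inv (c := .put .nm (.var .k) (.lit 0)) (e := .var .lim)
      (fun n t => ∀ k < n, t.a .nm k = 0) (by simp) fun n _ t _ ih k hk => ?_
    simp only [Cmd.run, Exp.eval, St.put_a, St.set_v, St.set_a, if_true, true_and]
    split_ifs with h
    · rfl
    · exact ih k (by omega)
  have hS : (s₁.put .nm 0 1).a .S = s.a .S := (St.put_a_ne _ _ _ (by simp)).trans (f₁.a (by simp))
  have hT : (s₁.put .nm 0 1).a .T = s.a .T := (St.put_a_ne _ _ _ (by simp)).trans (f₁.a (by simp))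
  have hL : (s₁.put .nm 0 1).a .L = s.a .L := (St.put_a_ne _ _ _ (by simp)).trans (f₁.a (by simp))
  have hlim : (s₁.put .nm 0 1).v .lim = s.v .lim := f₁.v (by simp)
  have f₂ : Frame _ (s₁.put .nm 0 1) s' := hs' ▸ Cmd.frame (loopL .k markStep) _
  refine ⟨?_, (f₂.a (by simp [markStep])).trans hS, (f₂.a (by simp [markStep])).trans hT,
    (f₂.a (by simp [markStep])).trans hL, (f₂.v (by simp [markStep])).trans hlim⟩
  have := loopL_inv (x := .k) (c := markStep) (s := s₁.put .nm 0 1) hlim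
    (fun n t => ∀ v < s.v .lim, 0 < t.a .nm v ↔
      v = 0 ∨ ∃ k < n, s.a .L k ≠ 0 ∧ (s.a .S k = v ∨ s.a .T k = v)) (by
    intro v hv
    by_cases h : v = 0 <;> simp [h, clear v hv]) (by
    intro n hn t ft ih v hv
    have hS' : t.a .S = s.a .S := (ft.a (by simp [markStep])).trans hS
    have hT' : t.a .T = s.a .T := (ft.a (by simp [markStep])).trans hT
    have hL' : t.a .L = s.a .L := (ft.a (by simp [markStep])).trans hL
    have ih' := ih v hv
    have key : (∃ k < n + 1, s.a .L k ≠ 0 ∧ (s.a .S k = v ∨ s.a .T k = v)) ↔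
        (∃ k < n, s.a .L k ≠ 0 ∧ (s.a .S k = v ∨ s.a .T k = v)) ∨
          (s.a .L n ≠ 0 ∧ (s.a .S n = v ∨ s.a .T n = v)) := by
      constructor
      · rintro ⟨k, hk, h⟩
        rcases Nat.lt_succ_iff_lt_or_eq.1 hk with hk | rfl
        · exact Or.inl ⟨k, hk, h⟩
        · exact Or.inr h
      · rintro (⟨k, hk, h⟩ | h)
        · exact ⟨k, by omega, h⟩
        · exact ⟨n, by omega, h⟩
    rw [key, ← or_assoc, ← ih']
    simp only [markStep, Cmd.run, Exp.eval, St.set_v, St.set_a, if_true, hL', hS',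
      Cmd.run_seqs_cons, Cmd.run_seqs_nil]
    by_cases hl : 0 < s.a .L n
    · simp only [hl, if_true, St.put_a, St.set_a, true_and, St.put_v, St.set_v, reduceCtorEq,
        false_and, if_false, hT']
      have : s.a .L n ≠ 0 := by omega
      by_cases h1 : v = s.a .T n
      · simp [h1, this]
      · by_cases h2 : v = s.a .S n
        · simp [h2, this]
        · simp [h1, h2, Ne.symm h1, Ne.symm h2]
    · have : s.a .L n = 0 := by omega
      simp [this])
  intro v hv
  rw [hs', verts_edges]
  exact this v hv

open Classical in
theorem compact_spec {N : ℕ} {s : St} (hs : Wf N s) :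
    (∀ k < s.v .lim, s.a .L k ≠ 0 → (compact.run s).a .S k = numbering s (s.a .S k) ∧
      (compact.run s).a .T k = numbering s (s.a .T k)) ∧
    (compact.run s).v .cap = numbering s (s.v .lim) := by
  simp only [compact, Cmd.run_seqs_cons, Cmd.run_seqs_nil]
  rw [show ∀ (t : St), (Cmd.put .nm (.lit 0) (.lit 1)).run t = t.put .nm 0 1 from fun _ => rfl]
  obtain ⟨m1, hS, hT, hL, hlim⟩ := mark_spec rfl (s := s)
  set s₂ := (loopL .k markStep).run
    (((loopL .k (.put .nm (.var .k) (.lit 0))).run s).put .nm 0 1) with hs₂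
  rw [show ∀ (t : St), (Cmd.set .cnt (.lit 0)).run t = t.set .cnt 0 from fun _ => rfl]
  have n1 := loopL_inv (x := .k) (c := numberStep) (s := s₂.set .cnt 0) (M := s.v .lim)
    (by simp [hlim])
    (fun n t => (∀ v < s.v .lim, n ≤ v → t.a .nm v = s₂.a .nm v) ∧
      (∀ v < n, v ∈ verts (edges s) → t.a .nm v = numbering s v) ∧
      t.v .cnt = numbering s n) ⟨by simp, by simp, by simp [numbering]⟩ (by
    rintro n hn t ft ⟨i1, i2, i3⟩
    have hm := m1 n hn
    rw [← i1 n hn le_rfl] at hm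
    simp only [numberStep, Cmd.run, Exp.eval, St.set_v, St.set_a, if_true, Cmd.run_seqs_cons,
      Cmd.run_seqs_nil]
    have hc : numbering s (n + 1) = numbering s n + if n ∈ verts (edges s) then 1 else 0 :=
      Nat.count_succ _ _
    by_cases h : 0 < t.a .nm n
    · have hv := hm.1 h
      simp only [h, if_true, St.set_a, St.put_a, true_and, St.set_v, St.put_v, reduceCtorEq,
        if_false, i3, hc, hv, and_true]
      refine ⟨fun v hv h' => ?_, fun v hv h' => ?_⟩
      · rw [if_neg (by omega)]; exact i1 v hv (by omega)
      · split_ifs with h''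
        · rw [h'']
        · exact i2 v (by omega) h'
    · have hv : n ∉ verts (edges s) := fun h' => h (hm.2 h')
      simp only [h, if_false, St.set_a, St.set_v, reduceCtorEq, i3, hc, hv, add_zero, and_true]
      refine ⟨fun v hv h' => i1 v hv (by omega), fun v hv h' => i2 v ?_ h'⟩
      have : v ≠ n := by rintro rfl; contradiction
      omega)
  obtain ⟨-, n2, n3⟩ := n1
  have f₃ : Frame _ (s₂.set .cnt 0) _ := (loopL .k numberStep).frame (s₂.set .cnt 0)
  set s₃ := (loopL .k numberStep).run (s₂.set .cnt 0) with hs₃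
  have hS3 : s₃.a .S = s.a .S := (f₃.a (by simp [numberStep])).trans hS
  have hT3 : s₃.a .T = s.a .T := (f₃.a (by simp [numberStep])).trans hT
  have hL3 : s₃.a .L = s.a .L := (f₃.a (by simp [numberStep])).trans hL
  have hlim3 : s₃.v .lim = s.v .lim := (f₃.v (by simp [numberStep])).trans (by simp [hlim])
  have f₄ : Frame _ s₃ _ := (loopL .k relabelStep).frame s₃
  refine ⟨?_, ?_⟩
  swap
  · rw [show ∀ (t : St), (Cmd.set .cap (.var .cnt)).run t = t.set .cap (t.v .cnt) from fun _ => rfl,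
      St.set_v, if_pos rfl, f₄.v (x := .cnt) (by simp [relabelStep]), n3]
  have := loopL_inv (x := .k) (c := relabelStep) (s := s₃) hlim3
    (fun n t => (∀ k, n ≤ k → t.a .S k = s.a .S k ∧ t.a .T k = s.a .T k) ∧
      ∀ k < n, s.a .L k ≠ 0 → t.a .S k = numbering s (s.a .S k) ∧
      t.a .T k = numbering s (s.a .T k)) ⟨by simp [hS3, hT3], by simp⟩ (by
    rintro n hn t ft ⟨i1, i2⟩
    have hL' : t.a .L = s.a .L := (ft.a (by simp [relabelStep])).trans hL3
    have hnm : t.a .nm = s₃.a .nm := ft.a (by simp [relabelStep])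
    simp only [relabelStep, Cmd.run, Exp.eval, St.set_v, St.set_a, if_true, Cmd.run_seqs_cons,
      Cmd.run_seqs_nil, hL', hnm]
    by_cases hl : 0 < s.a .L n
    · obtain ⟨w1, w2, -⟩ := hs.lt n hn (by omega)
      have a1 : s₃.a .nm (s.a .S n) = numbering s (s.a .S n) := n2 _ (w1.trans_le hs.cap_le)
        (verts_edges.2 (Or.inr ⟨n, hn, by omega, Or.inl rfl⟩))
      have a2 : s₃.a .nm (s.a .T n) = numbering s (s.a .T n) := n2 _ (w2.trans_le hs.cap_le)
        (verts_edges.2 (Or.inr ⟨n, hn, by omega, Or.inr rfl⟩))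
      obtain ⟨b1, b2⟩ := i1 n le_rfl
      simp only [hl, if_true, St.put_a, St.set_a, true_and, St.put_v, St.set_v, reduceCtorEq,
        false_and, if_false, b1, b2, hnm, a1, a2]
      refine ⟨fun k hk => ?_, fun k hk h => ?_⟩
      · rw [if_neg (by omega), if_neg (by omega)]; exact i1 k (by omega)
      · split_ifs with h'
        · rw [h']; exact ⟨rfl, rfl⟩
        · exact i2 k (by omega) h
    · simp only [hl, if_false, St.set_a]
      refine ⟨fun k hk => i1 k (by omega), fun k hk h => i2 k ?_ h⟩
      have : k ≠ n := by rintro rfl; omega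
      omega)
  intro k hk h
  simp only [Cmd.run, St.set_a]
  exact this.2 k hk h

/-- Write the graph. -/
def printGraph : Cmd := .seqs [
  .set .cnt (.lit 0),
  loopL .k (.ite eL (.set .cnt (.add (.var .cnt) (.lit 1))) .skip),
  .print (.var .cap), .print (.var .cnt), .print (.lit 0),
  loopL .k (.ite eL (.seqs [.print eS, .print eT, .print (.sub eL (.lit 1))]) .skip)]

/-- The encoding of a graph that is given by a list of edges. -/
def encodeList (n : ℕ) (l : List (ℕ × ℕ × ℕ)) : List ℕ :=
  n :: l.length :: 0 :: (l.map fun e => [e.1, e.2.2, e.2.1]).flatten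

theorem printGraph_out (s : St) :
    (printGraph.run s).out = s.out ++ encodeList (s.v .cap) (elist s) := by
  simp only [printGraph, Cmd.run_seqs_cons, Cmd.run_seqs_nil]
  rw [show ∀ (t : St), (Cmd.set .cnt (.lit 0)).run t = t.set .cnt 0 from fun _ => rfl]
  set el := fun n => (List.range n).filterMap fun k =>
    if s.a .L k = 0 then none else some (s.a .S k, s.a .L k - 1, s.a .T k) with hel
  have hel' : ∀ n, el (n + 1) = el n ++
      if s.a .L n = 0 then [] else [(s.a .S n, s.a .L n - 1, s.a .T n)] := by
    intro n
    simp only [hel, List.range_succ, List.filterMap_append]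
    by_cases h : s.a .L n = 0 <;> simp [h]
  have c1 := loopL_inv (x := .k) (c := .ite eL (.set .cnt (.add (.var .cnt) (.lit 1))) .skip)
    (s := s.set .cnt 0) (M := s.v .lim) (by simp)
    (fun n t => t.v .cnt = (el n).length) (by simp [hel]) (by
    intro n hn t ft ih
    have hL' : t.a .L = s.a .L := ft.a (by simp)
    rw [hel']
    by_cases h : s.a .L n = 0
    · simp [hL', h, ih]
    · simp [hL', h, ih, Nat.pos_of_ne_zero h])
  have f₁ := (loopL .k (.ite eL (.set .cnt (.add (.var .cnt) (.lit 1))) .skip)).frame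
    (s.set .cnt 0)
  set s₁ := (loopL .k (.ite eL (.set .cnt (.add (.var .cnt) (.lit 1))) .skip)).run
    (s.set .cnt 0) with hs₁
  simp only [Cmd.run, Exp.eval]
  rw [show s₁.v .cap = s.v .cap from f₁.v (by simp), c1]
  have hlim : s₁.v .lim = s.v .lim := f₁.v (by simp)
  have hout : s₁.out = s.out := f₁.out (by simp)
  have c2 := loopL_inv (x := .k)
    (c := .ite eL (.seqs [.print eS, .print eT, .print (.sub eL (.lit 1))]) .skip)
    (s := { s₁ with out := s₁.out ++ [s.v .cap] ++ [(el (s.v .lim)).length] ++ [0] })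
    (M := s.v .lim) hlim
    (fun n t => t.out = s.out ++ (s.v .cap :: (el (s.v .lim)).length :: 0 ::
      ((el n).map fun e => [e.1, e.2.2, e.2.1]).flatten)) (by simp [hel, hout]) (by
    intro n hn t ft ih
    have hL' : t.a .L = s.a .L := (ft.a (by simp [Cmd.seqs])).trans (f₁.a (by simp))
    have hS' : t.a .S = s.a .S := (ft.a (by simp [Cmd.seqs])).trans (f₁.a (by simp))
    have hT' : t.a .T = s.a .T := (ft.a (by simp [Cmd.seqs])).trans (f₁.a (by simp))
    rw [hel']
    by_cases h : s.a .L n = 0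
    · simp [hL', h, ih]
    · simp [hL', hS', hT', h, ih, Nat.pos_of_ne_zero h])
  exact c2

/-- Renumber the vertices and write the graph. -/
def emit : Cmd := .seq compact printGraph

open Classical in
theorem numbering_inj (s : St) : Set.InjOn (numbering s) (verts (edges s)) :=
  fun _ h _ h' e => Nat.count_injective h h' e

theorem emit_spec {N : ℕ} {s : St} (hs : Wf N s) :
    (emit.run s).out = s.out ++ encodeList ((emit.run s).v .cap) (elist (emit.run s)) ∧
    edges (emit.run s) = map3 (numbering s) '' edges s ∧
    (∀ v, v < (emit.run s).v .cap ↔ ∃ u ∈ verts (edges s), numbering s u = v) ∧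
    (emit.run s).v .cap ≤ s.v .cap ∧
    Wf N (emit.run s) ∧ (Det s → Det (emit.run s)) ∧
    ∀ k < s.v .lim, s.a .L k ≠ 0 → (emit.run s).a .S k = numbering s (s.a .S k) ∧
      (emit.run s).a .T k = numbering s (s.a .T k) := by
  classical
  have fp := printGraph.frame (compact.run s)
  have e0 : emit.run s = printGraph.run (compact.run s) := rfl
  have ecap : (emit.run s).v .cap = (compact.run s).v .cap := fp.v (by simp [printGraph])
  have elim : (emit.run s).v .lim = (compact.run s).v .lim := fp.v (by simp [printGraph])
  have eS : (emit.run s).a .S = (compact.run s).a .S := fp.a (by simp [printGraph])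
  have eT : (emit.run s).a .T = (compact.run s).a .T := fp.a (by simp [printGraph])
  have eL : (emit.run s).a .L = (compact.run s).a .L := fp.a (by simp [printGraph])
  have fc := compact.frame s
  have clim : (compact.run s).v .lim = s.v .lim := fc.v
    (by simp [compact, relabelStep, markStep, numberStep])
  have cL : (compact.run s).a .L = s.a .L := fc.a
    (by simp [compact, relabelStep, markStep, numberStep])
  have cout : (compact.run s).out = s.out := fc.out
    (by simp [compact, relabelStep, markStep, numberStep])
  obtain ⟨c1, c2⟩ := compact_spec hs
  rw [eS, eT, ecap, c2]
  have vlt : ∀ v ∈ verts (edges s), v < s.v .cap := by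
    intro v hv
    rcases verts_edges.1 hv with rfl | ⟨k, hk, h, rfl | rfl⟩
    exacts [hs.cap_pos, (hs.lt k hk h).1, (hs.lt k hk h).2.1]
  have numlt : ∀ v ∈ verts (edges s), numbering s v < numbering s (s.v .lim) := fun v hv =>
    Nat.count_strict_mono hv ((vlt v hv).trans_le hs.cap_le)
  have hedges : edges (emit.run s) = map3 (numbering s) '' edges s := by
    ext ⟨u, c, v⟩
    simp only [edges, elim, clim, eL, cL, eS, eT, Set.mem_image, Set.mem_ofPred_eq, map3,
      Prod.mk.injEq]
    constructor
    · rintro ⟨k, hk, h1, h2, h3⟩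
      obtain ⟨g1, g2⟩ := c1 k hk (by omega)
      rw [g1] at h1
      rw [g2] at h3
      exact ⟨(s.a .S k, c, s.a .T k), ⟨k, hk, rfl, h2, rfl⟩, h1, rfl, h3⟩
    · rintro ⟨⟨u', c', v'⟩, ⟨k, hk, h1, h2, h3⟩, rfl, rfl, rfl⟩
      simp only at h1 h2 h3
      obtain ⟨g1, g2⟩ := c1 k hk (by omega)
      exact ⟨k, hk, by rw [g1, h1], h2, by rw [g2, h3]⟩
  have hcle : numbering s (s.v .lim) ≤ s.v .cap := by
    have h1 : numbering s (s.v .lim) = numbering s (s.v .cap) := by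
      have h2 := Nat.sub_add_cancel hs.cap_le
      rw [← h2, add_comm]
      unfold numbering
      rw [Nat.count_add]
      simp only [Nat.add_eq_left]
      rw [Nat.count_eq_card_filter_range, Finset.card_eq_zero, Finset.filter_eq_empty_iff]
      intro k _ hk
      have := vlt _ hk
      omega
    rw [h1]
    exact Nat.count_le _
  refine ⟨?_, hedges, fun v => ⟨fun h => ?_, ?_⟩, hcle, ?_, ?_, c1⟩
  · have : elist (emit.run s) = elist (compact.run s) := by simp only [elist, elim, eL, eS, eT]
    rw [this, e0, printGraph_out, cout, c2]
  · have hn : v < Nat.count (· ∈ verts (edges s)) (s.v .lim) := h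
    refine ⟨Nat.nth (· ∈ verts (edges s)) v, ?_, ?_⟩
    · exact Nat.nth_mem _ fun hf => hn.trans_le (Nat.count_le_card hf _)
    · exact Nat.count_nth fun hf => hn.trans_le (Nat.count_le_card hf _)
  · rintro ⟨u, hu, rfl⟩
    exact numlt u hu
  · refine ⟨fun k hk h => ?_, ?_, ?_, ?_⟩
    · rw [elim, clim] at hk
      rw [eL, cL] at h ⊢
      rw [eS, eT, ecap, c2, (c1 k hk h).1, (c1 k hk h).2]
      exact ⟨numlt _ (verts_edges.2 (Or.inr ⟨k, hk, h, Or.inl rfl⟩)),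
        numlt _ (verts_edges.2 (Or.inr ⟨k, hk, h, Or.inr rfl⟩)), (hs.lt k hk h).2.2⟩
    · rw [ecap, c2]; exact (Nat.zero_le _).trans_lt (numlt 0 (Or.inl rfl))
    · rw [ecap, c2, elim, clim]; exact hcle.trans hs.cap_le
    · rw [ecap, c2, elim, clim]; exact (Nat.mul_le_mul_left _ hcle).trans hs.cap_le'
  · intro hd k hk k' hk' h0 hl h
    rw [elim, clim] at hk hk'
    rw [eL, cL] at h0 hl
    have inj : ∀ u v, u ∈ verts (edges s) → v ∈ verts (edges s) →
        numbering s u = numbering s v → u = v := fun u v h1 h2 => numbering_inj s h1 h2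
    have mS : ∀ k < s.v .lim, s.a .L k ≠ 0 → s.a .S k ∈ verts (edges s) := fun k hk h =>
      verts_edges.2 (Or.inr ⟨k, hk, h, Or.inl rfl⟩)
    have mT : ∀ k < s.v .lim, s.a .L k ≠ 0 → s.a .T k ∈ verts (edges s) := fun k hk h =>
      verts_edges.2 (Or.inr ⟨k, hk, h, Or.inr rfl⟩)
    have h0' : s.a .L k' ≠ 0 := hl ▸ h0
    rw [eS, eT, (c1 k hk h0).1, (c1 k hk h0).2, (c1 k' hk' h0').1, (c1 k' hk' h0').2] at h
    exact hd k hk k' hk' h0 hl (h.imp (inj _ _ (mS k hk h0) (mS k' hk' h0'))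
      (inj _ _ (mT k hk h0) (mT k' hk' h0')))

end RAM

namespace NumGraph

variable {Y : Type} {N : ℕ}

/-- The graph that is given by a list of edges between the vertices `0, …, n - 1`. -/
def ofList (code : Y ≃ Fin N) (n : ℕ) (l : List (ℕ × ℕ × ℕ)) (hn : 0 < n)
    (h : ∀ e ∈ l, e.1 < n ∧ e.2.2 < n ∧ e.2.1 < N) : NumGraph Y where
  nV := n
  nE := l.length
  src k := ⟨l[k].1, (h _ (List.getElem_mem _)).1⟩
  tgt k := ⟨l[k].2.2, (h _ (List.getElem_mem _)).2.1⟩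
  lab k := code.symm ⟨l[k].2.1, (h _ (List.getElem_mem _)).2.2⟩
  base := ⟨0, hn⟩

theorem encode_ofList (code : Y ≃ Fin N) (n : ℕ) (l : List (ℕ × ℕ × ℕ)) (hn : 0 < n)
    (h : ∀ e ∈ l, e.1 < n ∧ e.2.2 < n ∧ e.2.1 < N) :
    (ofList code n l hn h).encode code = RAM.encodeList n l := by
  simp only [encode, ofList, RAM.encodeList, Equiv.apply_symm_apply]
  congr 4
  apply List.ext_getElem
  · simp
  · intro i h1 h2; simp

end NumGraph

/-! ## Graph theory -/

namespace PGraph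

variable {Y : Type}

/-- There is a positive edge from `u` to `v` labelled `x`. -/
def Edge (Γ : PGraph Y) (u : Γ.V) (x : Y) (v : Γ.V) : Prop :=
  ∃ e, Γ.src e = u ∧ Γ.lab e = x ∧ Γ.tgt e = v

/-- No folding is possible. -/
def Folded (Γ : PGraph Y) : Prop :=
  ∀ e e', Γ.lab e = Γ.lab e' → (Γ.src e = Γ.src e' ∨ Γ.tgt e = Γ.tgt e') → e = e'

theorem Edge.mk {Γ : PGraph Y} (e : Γ.E) : Γ.Edge (Γ.src e) (Γ.lab e) (Γ.tgt e) :=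
  ⟨e, rfl, rfl, rfl⟩

theorem Folded.tgt_eq {Γ : PGraph Y} (h : Γ.Folded) {u v v' : Γ.V} {x : Y} (h1 : Γ.Edge u x v)
    (h2 : Γ.Edge u x v') : v = v' := by
  obtain ⟨e, rfl, rfl, rfl⟩ := h1
  obtain ⟨e', h3, h4, rfl⟩ := h2
  rw [h e e' h4.symm (Or.inl h3.symm)]

theorem Folded.src_eq {Γ : PGraph Y} (h : Γ.Folded) {u u' v : Γ.V} {x : Y} (h1 : Γ.Edge u x v)
    (h2 : Γ.Edge u' x v) : u = u' := by
  obtain ⟨e, rfl, rfl, rfl⟩ := h1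
  obtain ⟨e', rfl, h4, h3⟩ := h2
  rw [h e e' h4.symm (Or.inr h3.symm)]

theorem Folded.not_fold {Γ Δ : PGraph Y} (h : Γ.Folded) : ¬ Fold Γ Δ := by
  rintro ⟨⟨e, b⟩, ⟨e', b'⟩, hne, hi, hl, -⟩
  simp only [dlab, Prod.mk.injEq] at hl
  obtain ⟨hl, rfl⟩ := hl
  apply hne
  rw [h e e' hl]
  cases b
  · exact Or.inr (by simpa [ini] using hi)
  · exact Or.inl (by simpa [ini] using hi)

/-- The graph obtained by identifying vertices and edges. -/
def quotGraph (Γ : PGraph Y) (rV : Γ.V → Γ.V → Prop) (rE : Γ.E → Γ.E → Prop)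
    (h : ∀ a b, rE a b → Γ.lab a = Γ.lab b ∧ Relation.EqvGen rV (Γ.src a) (Γ.src b) ∧
      Relation.EqvGen rV (Γ.tgt a) (Γ.tgt b)) : PGraph Y where
  V := Quot rV
  E := Quot rE
  src := Quot.lift (fun e => Quot.mk _ (Γ.src e)) fun a b hab => Quot.eqvGen_sound (h a b hab).2.1
  tgt := Quot.lift (fun e => Quot.mk _ (Γ.tgt e)) fun a b hab => Quot.eqvGen_sound (h a b hab).2.2
  lab := Quot.lift Γ.lab fun a b hab => (h a b hab).1
  base := Quot.mk _ Γ.base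

/-- The projection to the quotient. -/
def quotHom (Γ : PGraph Y) (rV : Γ.V → Γ.V → Prop) (rE : Γ.E → Γ.E → Prop)
    (h : ∀ a b, rE a b → Γ.lab a = Γ.lab b ∧ Relation.EqvGen rV (Γ.src a) (Γ.src b) ∧
      Relation.EqvGen rV (Γ.tgt a) (Γ.tgt b)) : Hom Γ (quotGraph Γ rV rE h) where
  onV := Quot.mk _
  onE := Quot.mk _
  src_onE _ := rfl
  tgt_onE _ := rfl
  lab_onE _ := rfl
  onV_base := rfl

theorem isQuot_quotGraph (Γ : PGraph Y) (rV : Γ.V → Γ.V → Prop) (rE : Γ.E → Γ.E → Prop)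
    (h : ∀ a b, rE a b → Γ.lab a = Γ.lab b ∧ Relation.EqvGen rV (Γ.src a) (Γ.src b) ∧
      Relation.EqvGen rV (Γ.tgt a) (Γ.tgt b)) : IsQuot Γ (quotGraph Γ rV rE h) rV rE :=
  ⟨quotHom Γ rV rE h, Quot.mk_surjective, Quot.mk_surjective, fun _ _ => Quot.eq, fun _ _ => Quot.eq⟩

/-- Composition of morphisms. -/
def Hom.comp {Γ Δ Θ : PGraph Y} (g : Hom Δ Θ) (f : Hom Γ Δ) : Hom Γ Θ where
  onV := g.onV ∘ f.onV
  onE := g.onE ∘ f.onE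
  src_onE e := by simp [g.src_onE, f.src_onE]
  tgt_onE e := by simp [g.tgt_onE, f.tgt_onE]
  lab_onE e := by simp [g.lab_onE, f.lab_onE]
  onV_base := by simp [f.onV_base, g.onV_base]

theorem Hom.edge {Γ Δ : PGraph Y} (f : Hom Γ Δ) {u v : Γ.V} {x : Y} (h : Γ.Edge u x v) :
    Δ.Edge (f.onV u) x (f.onV v) := by
  obtain ⟨e, rfl, rfl, rfl⟩ := h
  exact ⟨f.onE e, f.src_onE e, f.lab_onE e, f.tgt_onE e⟩

theorem Hom.lift_edge {Γ Δ : PGraph Y} (f : Hom Γ Δ) (hf : Function.Surjective f.onE)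
    {u v : Δ.V} {x : Y} (h : Δ.Edge u x v) : ∃ u' v', f.onV u' = u ∧ f.onV v' = v ∧
      Γ.Edge u' x v' := by
  obtain ⟨e, rfl, rfl, rfl⟩ := h
  obtain ⟨e, rfl⟩ := hf e
  exact ⟨_, _, (f.src_onE e).symm, (f.tgt_onE e).symm, by rw [f.lab_onE]; exact .mk e⟩

/-- Maps of the vertices whose kernel is compatible with foldings. -/
def FoldCongr (Γ : PGraph Y) {W : Type} (φ : Γ.V → W) : Prop :=
  ∀ e e', Γ.lab e = Γ.lab e' → (φ (Γ.src e) = φ (Γ.src e') ↔ φ (Γ.tgt e) = φ (Γ.tgt e'))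

theorem eqvGen_imp {α β : Type*} {r : α → α → Prop} {f : α → β} (h : ∀ a b, r a b → f a = f b)
    {a b : α} (hab : Relation.EqvGen r a b) : f a = f b := by
  induction hab with
  | rel _ _ h' => exact h _ _ h'
  | refl => rfl
  | symm _ _ _ ih => exact ih.symm
  | trans _ _ _ _ _ ih1 ih2 => exact ih1.trans ih2

/-- The graph obtained by folding as long as possible is determined by the least fold-compatible
equivalence of the vertices. -/
theorem exists_foldClosure {W : Type} (Γ : PGraph Y) [Finite Γ.E] (f : Γ.V → W)
    (hf : FoldCongr Γ f)
    (hmin : ∀ (W' : Type) (φ : Γ.V → W'), FoldCongr Γ φ → ∀ u v, f u = f v → φ u = φ v) :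
    ∃ Δ, Relation.ReflTransGen Fold Γ Δ ∧ Folded Δ ∧ ∃ h : Hom Γ Δ, Function.Surjective h.onV ∧
      Function.Surjective h.onE ∧ ∀ u v, h.onV u = h.onV v ↔ f u = f v := by
  induction hn : Nat.card Γ.E using Nat.strong_induction_on generalizing Γ with
  | _ n ih =>
    by_cases hΓ : Folded Γ
    · refine ⟨Γ, .refl, hΓ, ⟨id, id, fun _ => rfl, fun _ => rfl, fun _ => rfl, rfl⟩,
        Function.surjective_id, Function.surjective_id, fun u v => ⟨fun h => congrArg f h,
          hmin _ id ?_ u v⟩⟩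
      intro e e' hl
      exact ⟨fun h => by rw [hΓ e e' hl (Or.inl h)], fun h => by rw [hΓ e e' hl (Or.inr h)]⟩
    · have : ∃ d₁ d₂ : Γ.DEdge, d₁.1 ≠ d₂.1 ∧ Γ.ini d₁ = Γ.ini d₂ ∧ Γ.dlab d₁ = Γ.dlab d₂ := by
        simp only [Folded, not_forall] at hΓ
        obtain ⟨e, e', hl, h, hne⟩ := hΓ
        rcases h with h | h
        · exact ⟨(e, true), (e', true), hne, h, by simp [dlab, hl]⟩
        · exact ⟨(e, false), (e', false), hne, h, by simp [dlab, hl]⟩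
      obtain ⟨d₁, d₂, hne, hi, hl⟩ := this
      obtain ⟨hl, hb⟩ := Prod.mk.injEq .. ▸ hl
      have hs : ∀ a b, (a = d₁.1 ∧ b = d₂.1) → Γ.lab a = Γ.lab b ∧
          Relation.EqvGen (fun u v => u = Γ.ter d₁ ∧ v = Γ.ter d₂) (Γ.src a) (Γ.src b) ∧
          Relation.EqvGen (fun u v => u = Γ.ter d₁ ∧ v = Γ.ter d₂) (Γ.tgt a) (Γ.tgt b) := by
        rintro a b ⟨rfl, rfl⟩
        refine ⟨hl, ?_⟩
        have h1 : Relation.EqvGen (fun u v => u = Γ.ter d₁ ∧ v = Γ.ter d₂) (Γ.ter d₁) (Γ.ter d₂) :=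
          .rel _ _ ⟨rfl, rfl⟩
        have h2 : Relation.EqvGen (fun u v => u = Γ.ter d₁ ∧ v = Γ.ter d₂) (Γ.ini d₁) (Γ.ini d₂) :=
          hi ▸ .refl _
        revert h1 h2
        generalize (fun u v => u = Γ.ter d₁ ∧ v = Γ.ter d₂) = r
        obtain ⟨e, b⟩ := d₁
        obtain ⟨e', b'⟩ := d₂
        obtain rfl : b = b' := hb
        cases b
        · exact fun h1 h2 => ⟨h1, h2⟩
        · exact fun h1 h2 => ⟨h2, h1⟩
      set Δ := quotGraph Γ (fun u v => u = Γ.ter d₁ ∧ v = Γ.ter d₂)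
        (fun a b => a = d₁.1 ∧ b = d₂.1) hs with hΔ
      have hfold : Fold Γ Δ := ⟨d₁, d₂, fun h => hne (by rw [h]), hi, Prod.ext hl hb,
        isQuot_quotGraph _ _ _ hs⟩
      have ft : ∀ (W' : Type) (φ : Γ.V → W'), FoldCongr Γ φ → φ (Γ.ter d₁) = φ (Γ.ter d₂) := by
        intro W' φ hφ
        have h := hφ d₁.1 d₂.1 hl
        have hi := congrArg φ hi
        obtain ⟨e, b⟩ := d₁
        obtain ⟨e', b'⟩ := d₂
        obtain rfl : b = b' := hb
        cases b
        · exact h.2 hi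
        · exact h.1 hi
      have hd : ∀ (W' : Type) (φ : Γ.V → W'), FoldCongr Γ φ → ∀ a b,
          (a = Γ.ter d₁ ∧ b = Γ.ter d₂) → φ a = φ b := by
        rintro W' φ hφ _ _ ⟨rfl, rfl⟩; exact ft W' φ hφ
      have : Finite Δ.E := Finite.of_surjective (Quot.mk _) Quot.mk_surjective
      have hcard : Nat.card Δ.E < n := by
        rw [← hn]
        have := Fintype.ofFinite Γ.E
        have := Fintype.ofFinite Δ.E
        rw [Nat.card_eq_fintype_card, Nat.card_eq_fintype_card]
        refine Fintype.card_lt_of_surjective_not_injective (Quot.mk _ : Γ.E → Δ.E)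
          Quot.mk_surjective fun hinj => hne ?_
        exact hinj (Quot.sound ⟨rfl, rfl⟩)
      obtain ⟨Θ, h1, h2, h, h3, h4, h5⟩ := ih _ hcard Δ (Quot.lift f (hd _ f hf))
        (by
          intro e e' hl
          induction e using Quot.ind
          induction e' using Quot.ind
          exact hf _ _ hl)
        (by
          intro W' φ hφ u v
          induction u using Quot.ind
          induction v using Quot.ind
          refine hmin W' (φ ∘ Quot.mk _) ?_ _ _
          exact fun e e' hl => hφ (Quot.mk _ e) (Quot.mk _ e') hl) rfl
      refine ⟨Θ, .head hfold h1, h2, h.comp (quotHom _ _ _ hs), h3.comp Quot.mk_surjective,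
        h4.comp Quot.mk_surjective, fun u v => ?_⟩
      exact h5 (Quot.mk _ u) (Quot.mk _ v)

/-- Morphisms from maps of the vertices. -/
theorem exists_hom {Γ Δ : PGraph Y} (F : Γ.V → Δ.V)
    (h : ∀ u x v, Γ.Edge u x v → Δ.Edge (F u) x (F v)) (hb : F Γ.base = Δ.base) :
    ∃ f : Hom Γ Δ, f.onV = F := by
  choose g h1 h2 h3 using fun e => h _ _ _ (Edge.mk (Γ := Γ) e)
  exact ⟨⟨F, g, h1, h3, h2, hb⟩, rfl⟩

theorem Hom.onE_injective {Γ Δ : PGraph Y} (f : Hom Γ Δ) (hΓ : Γ.Folded)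
    (hf : Function.Injective f.onV) : Function.Injective f.onE := by
  intro e e' h
  refine hΓ e e' ?_ (Or.inl (hf ?_))
  · rw [← f.lab_onE, h, f.lab_onE]
  · rw [← f.src_onE, h, f.src_onE]

theorem exists_iso_of_bijective {Γ Δ : PGraph Y} (hΓ : Γ.Folded) (hΔ : Δ.Folded) (F : Γ.V → Δ.V)
    (hF : Function.Bijective F) (h : ∀ u x v, Γ.Edge u x v ↔ Δ.Edge (F u) x (F v))
    (hb : F Γ.base = Δ.base) : ∃ f : Hom Γ Δ, f.onV = F ∧ Function.Bijective f.onE := by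
  obtain ⟨f, rfl⟩ := exists_hom F (fun u x v => (h u x v).1) hb
  refine ⟨f, rfl, f.onE_injective hΓ hF.1, fun e => ?_⟩
  obtain ⟨u, hu⟩ := hF.2 (Δ.src e)
  obtain ⟨v, hv⟩ := hF.2 (Δ.tgt e)
  obtain ⟨e', h1, h2, h3⟩ := (h u (Δ.lab e) v).2 ⟨e, hu.symm, rfl, hv.symm⟩
  exact ⟨e', hΔ _ _ (by rw [f.lab_onE, h2]) (Or.inl (by rw [f.src_onE, h1, hu]))⟩

theorem iso_of_bijective {Γ Δ : PGraph Y} (hΓ : Γ.Folded) (hΔ : Δ.Folded) (F : Γ.V → Δ.V)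
    (hF : Function.Bijective F) (h : ∀ u x v, Γ.Edge u x v ↔ Δ.Edge (F u) x (F v))
    (hb : F Γ.base = Δ.base) : Iso Γ Δ := by
  obtain ⟨f, rfl, h'⟩ := exists_iso_of_bijective hΓ hΔ F hF h hb
  exact ⟨f, hF, h'⟩

theorem Iso.symm {Γ Δ : PGraph Y} (h : Iso Γ Δ) : Iso Δ Γ := by
  obtain ⟨f, hV, hE⟩ := h
  let eV := Equiv.ofBijective _ hV
  let eE := Equiv.ofBijective _ hE
  have h1 : ∀ v, f.onV (eV.symm v) = v := eV.apply_symm_apply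
  have h2 : ∀ e, f.onE (eE.symm e) = e := eE.apply_symm_apply
  refine ⟨⟨eV.symm, eE.symm, fun e => hV.1 ?_, fun e => hV.1 ?_, fun e => ?_, hV.1 ?_⟩,
    eV.symm.bijective, eE.symm.bijective⟩
  · rw [h1, ← f.src_onE, h2]
  · rw [h1, ← f.tgt_onE, h2]
  · rw [← f.lab_onE, h2]
  · rw [h1, f.onV_base]

theorem Iso.refl (Γ : PGraph Y) : Iso Γ Γ :=
  ⟨⟨id, id, fun _ => rfl, fun _ => rfl, fun _ => rfl, rfl⟩, Function.bijective_id,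
    Function.bijective_id⟩

theorem Hom.edge_iff {Γ Δ : PGraph Y} (f : Hom Γ Δ) (hV : Function.Injective f.onV)
    (hE : Function.Surjective f.onE) (u : Γ.V) (x : Y) (v : Γ.V) :
    Δ.Edge (f.onV u) x (f.onV v) ↔ Γ.Edge u x v := by
  refine ⟨fun h => ?_, f.edge⟩
  obtain ⟨u', v', h1, h2, h3⟩ := f.lift_edge hE h
  rwa [← hV h1, ← hV h2]

/-- The subgraph with the given vertices and edges. -/
def subGraph (Γ : PGraph Y) (SV : Set Γ.V) (SE : Set Γ.E) (hb : Γ.base ∈ SV)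
    (h : ∀ e ∈ SE, Γ.src e ∈ SV ∧ Γ.tgt e ∈ SV) : PGraph Y where
  V := SV
  E := SE
  src e := ⟨Γ.src e, (h e e.2).1⟩
  tgt e := ⟨Γ.tgt e, (h e e.2).2⟩
  lab e := Γ.lab e
  base := ⟨Γ.base, hb⟩

/-- The inclusion of a subgraph. -/
def subHom (Γ : PGraph Y) (SV : Set Γ.V) (SE : Set Γ.E) (hb : Γ.base ∈ SV)
    (h : ∀ e ∈ SE, Γ.src e ∈ SV ∧ Γ.tgt e ∈ SV) : Hom (subGraph Γ SV SE hb h) Γ :=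
  ⟨Subtype.val, Subtype.val, fun _ => rfl, fun _ => rfl, fun _ => rfl, rfl⟩

theorem isSub_subGraph (Γ : PGraph Y) (SV : Set Γ.V) (SE : Set Γ.E) (hb : Γ.base ∈ SV)
    (h : ∀ e ∈ SE, Γ.src e ∈ SV ∧ Γ.tgt e ∈ SV) : IsSub Γ (subGraph Γ SV SE hb h) SV SE :=
  ⟨subHom Γ SV SE hb h, Subtype.val_injective, Subtype.val_injective, Subtype.range_val,
    Subtype.range_val⟩

/-! ### Graphs in memory -/

/-- The folded graph `Γ` is given by the set `E` of edges; the vertex `u` is called `ι u`. -/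
structure Rep {N : ℕ} (code : Y ≃ Fin N) (Γ : PGraph Y) (ι : Γ.V → ℕ) (E : EdgeSet) :
    Prop where
  inj : Function.Injective ι
  base : ι Γ.base = 0
  folded : Γ.Folded
  edge : ∀ u x v, Γ.Edge u x v ↔ (ι u, (code x : ℕ), ι v) ∈ E
  range : Set.range ι = RAM.verts E
  lab : ∀ e ∈ E, e.2.1 < N

theorem Rep.exists_edge {N : ℕ} {code : Y ≃ Fin N} {Γ : PGraph Y} {ι : Γ.V → ℕ}
    {E : EdgeSet} (h : Rep code Γ ι E) {e : ℕ × ℕ × ℕ} (he : e ∈ E) :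
    ∃ u x v, Γ.Edge u x v ∧ e = (ι u, (code x : ℕ), ι v) := by
  have h1 : e.1 ∈ Set.range ι := h.range ▸ Or.inr ⟨e, he, Or.inl rfl⟩
  have h2 : e.2.2 ∈ Set.range ι := h.range ▸ Or.inr ⟨e, he, Or.inr rfl⟩
  obtain ⟨u, hu⟩ := h1
  obtain ⟨v, hv⟩ := h2
  have : e = (ι u, (code (code.symm ⟨e.2.1, h.lab e he⟩) : ℕ), ι v) := by
    rw [hu, hv, Equiv.apply_symm_apply]
  exact ⟨u, _, v, (h.edge _ _ _).2 (this ▸ he), this⟩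

theorem Rep.iso {N : ℕ} {code : Y ≃ Fin N} {Γ Γ' : PGraph Y} {ι : Γ.V → ℕ} {ι' : Γ'.V → ℕ}
    {E E' : EdgeSet} (h : Rep code Γ ι E) (h' : Rep code Γ' ι' E') {num : ℕ → ℕ}
    (h0 : num 0 = 0) (hinj : Set.InjOn num (RAM.verts E)) (hE : E' = RAM.map3 num '' E) :
    ∃ f : Hom Γ Γ', Function.Bijective f.onV ∧ Function.Bijective f.onE ∧
      ∀ u, ι' (f.onV u) = num (ι u) := by
  have hv : ∀ u : Γ.V, ι u ∈ RAM.verts E := fun u => h.range ▸ ⟨u, rfl⟩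
  have hex : ∀ u : Γ.V, ∃ u' : Γ'.V, ι' u' = num (ι u) := by
    intro u
    have : num (ι u) ∈ RAM.verts E' := by
      rcases hv u with h1 | ⟨e, he, h1⟩
      · rw [h1, h0]; exact Or.inl rfl
      · refine Or.inr ⟨RAM.map3 num e, hE ▸ ⟨e, he, rfl⟩, ?_⟩
        exact h1.imp (congrArg num) (congrArg num)
    rw [← h'.range] at this
    exact this
  choose F hF using hex
  have hb : Function.Bijective F := by
    refine ⟨fun u v huv => ?_, fun v => ?_⟩
    · refine h.inj (hinj (hv u) (hv v) ?_)
      rw [← hF, ← hF, huv]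
    · have : ι' v ∈ RAM.verts E' := h'.range ▸ ⟨v, rfl⟩
      rcases this with h1 | ⟨e, he, h1⟩
      · refine ⟨Γ.base, h'.inj ?_⟩
        rw [hF, h.base, h0, h1]
      · rw [hE] at he
        obtain ⟨e, he, rfl⟩ := he
        obtain ⟨u, x, w, -, rfl⟩ := h.exists_edge he
        rcases h1 with h1 | h1
        · exact ⟨u, h'.inj (by rw [hF, h1]; rfl)⟩
        · exact ⟨w, h'.inj (by rw [hF, h1]; rfl)⟩
  suffices h3 : ∃ f : Hom Γ Γ', f.onV = F ∧ Function.Bijective f.onE by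
    obtain ⟨f, rfl, h3⟩ := h3
    exact ⟨f, hb, h3, hF⟩
  refine exists_iso_of_bijective h.folded h'.folded F hb ?_ ?_
  · intro u x v
    rw [h.edge, h'.edge, hF, hF, hE]
    constructor
    · exact fun h1 => ⟨_, h1, rfl⟩
    · rintro ⟨e, he, h1⟩
      obtain ⟨u', x', v', -, rfl⟩ := h.exists_edge he
      simp only [RAM.map3, Prod.mk.injEq] at h1
      rw [← h.inj (hinj (hv _) (hv _) h1.1), ← h.inj (hinj (hv _) (hv _) h1.2.2), ← h1.2.1]
      exact he
  · exact h'.inj (by rw [hF, h.base, h0, h'.base])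

end PGraph

namespace NumGraph

open RAM

variable {Y : Type} {N : ℕ}

/-- The graph held in memory. -/
def ofState (code : Y ≃ Fin N) (s : St) (hs : Wf N s) : NumGraph Y :=
  ofList code (s.v .cap) (elist s) hs.cap_pos fun e he => by
    obtain ⟨k, hk, h1, h2, h3⟩ := mem_elist.1 he
    have := hs.lt k hk (by omega)
    omega

theorem elist_nodup {s : St} (hd : Det s) : (elist s).Nodup := by
  rw [elist, List.Nodup, List.pairwise_filterMap]
  refine List.Pairwise.imp_of_mem ?_ (List.nodup_range (n := s.v .lim))
  rintro k k' hk hk' hne b hb _ hb' rfl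
  rw [List.mem_range] at hk hk'
  split_ifs at hb hb'
  simp only [Option.some.injEq] at hb hb'
  rw [← hb', Prod.mk.injEq, Prod.mk.injEq] at hb
  exact hne (hd k hk k' hk' (by assumption) (by omega) (Or.inl hb.1))

theorem rep_ofState (code : Y ≃ Fin N) {s : St} (hs : Wf N s) (hd : Det s)
    (hv : ∀ v, v < s.v .cap ↔ v ∈ verts (edges s)) :
    PGraph.Rep code (ofState code s hs).toPGraph (fun v : Fin (s.v .cap) => (v : ℕ))
      (edges s) where
  inj := Fin.val_injective
  base := rfl
  folded := by
    rintro e e' hl h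
    change Fin (elist s).length at e e'
    have h1 : (elist s)[e].2.1 = (elist s)[e'].2.1 := by
      have := congrArg (fun x => (code x : ℕ)) hl
      simpa [ofState, ofList, toPGraph] using this
    have h2 : (elist s)[e].1 = (elist s)[e'].1 ∨ (elist s)[e].2.2 = (elist s)[e'].2.2 :=
      h.imp (congrArg Fin.val) (congrArg Fin.val)
    obtain ⟨k, hk, a1, a2, a3⟩ := mem_elist.1 (List.getElem_mem e.2)
    obtain ⟨k', hk', b1, b2, b3⟩ := mem_elist.1 (List.getElem_mem e'.2)
    simp only [Fin.getElem_fin] at h1 h2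
    rw [← a1, ← a3, ← b1, ← b3] at h2
    have := hd k hk k' hk' (by omega) (by omega) h2
    subst this
    have : (elist s)[(e : ℕ)] = (elist s)[(e' : ℕ)] :=
      Prod.ext (by rw [← a1, b1]) (Prod.ext h1 (by rw [← a3, b3]))
    exact Fin.ext ((elist_nodup hd).getElem_inj_iff.1 this)
  edge u x v := by
    rw [← mem_elist, List.mem_iff_get]
    constructor
    · rintro ⟨e, rfl, rfl, rfl⟩
      exact ⟨e, by simp [ofState, ofList, toPGraph]; rfl⟩
    · rintro ⟨e, he⟩
      simp only [List.get_eq_getElem] at he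
      refine ⟨e, Fin.ext ?_, ?_, Fin.ext ?_⟩
      · simp [ofState, ofList, toPGraph, he]
      · simp [ofState, ofList, toPGraph, he]
      · simp [ofState, ofList, toPGraph, he]
  range := by
    ext v
    rw [← hv]
    exact ⟨by rintro ⟨u, rfl⟩; exact u.2, fun h => ⟨⟨v, h⟩, rfl⟩⟩
  lab e he := by
    obtain ⟨k, hk, h1, h2, h3⟩ := he
    have := hs.lt k hk (by omega)
    omega

end NumGraph

namespace PGraph

variable {Y : Type}

/-! ### Paths -/

/-- There is a directed edge from `u` to `v` with the label `l`. -/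
def Step (Γ : PGraph Y) (u : Γ.V) (l : Y × Bool) (v : Γ.V) : Prop :=
  if l.2 then Γ.Edge u l.1 v else Γ.Edge v l.1 u

theorem step_iff {Γ : PGraph Y} {u v : Γ.V} {l : Y × Bool} :
    Γ.Step u l v ↔ ∃ d, Γ.ini d = u ∧ Γ.dlab d = l ∧ Γ.ter d = v := by
  obtain ⟨x, b⟩ := l
  simp only [Step, Edge, ini, ter, dlab]
  constructor
  · split_ifs with h
    · rintro ⟨e, h1, h2, h3⟩; exact ⟨(e, b), by simp_all⟩
    · rintro ⟨e, h1, h2, h3⟩; exact ⟨(e, b), by simp_all⟩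
  · rintro ⟨⟨e, b'⟩, h1, h2, h3⟩
    obtain ⟨rfl, rfl⟩ := Prod.mk.injEq .. ▸ h2
    cases b' <;> exact ⟨e, by simp_all⟩

theorem Step.symm {Γ : PGraph Y} {u v : Γ.V} {x : Y} {b : Bool} (h : Γ.Step u (x, b) v) :
    Γ.Step v (x, !b) u := by
  cases b <;> simpa [Step] using h

theorem reads_cons {Γ : PGraph Y} {u v : Γ.V} {l : Y × Bool} {w : List (Y × Bool)} :
    Γ.Reads u (l :: w) v ↔ ∃ m, Γ.Step u l m ∧ Γ.Reads m w v := by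
  simp only [Reads, step_iff]
  constructor
  · rintro ⟨d, h1, h2, h3⟩; exact ⟨_, ⟨d, h1, h2, rfl⟩, h3⟩
  · rintro ⟨_, ⟨d, h1, h2, rfl⟩, h3⟩; exact ⟨d, h1, h2, h3⟩

theorem reads_append {Γ : PGraph Y} {u v : Γ.V} {w w' : List (Y × Bool)} :
    Γ.Reads u (w ++ w') v ↔ ∃ m, Γ.Reads u w m ∧ Γ.Reads m w' v := by
  induction w generalizing u with
  | nil => simp [Reads]
  | cons l w ih =>
    simp only [List.cons_append, reads_cons, ih]
    constructor
    · rintro ⟨m, h, m', h', h''⟩; exact ⟨m', ⟨m, h, h'⟩, h''⟩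
    · rintro ⟨m', ⟨m, h, h'⟩, h''⟩; exact ⟨m, h, m', h', h''⟩

theorem Reads.inv {Γ : PGraph Y} {u v : Γ.V} {w : List (Y × Bool)} (h : Γ.Reads u w v) :
    Γ.Reads v (FreeGroup.invRev w) u := by
  induction w generalizing u with
  | nil => exact h.symm
  | cons l w ih =>
    obtain ⟨m, h1, h2⟩ := reads_cons.1 h
    rw [FreeGroup.invRev_cons, reads_append]
    exact ⟨m, ih h2, reads_cons.2 ⟨u, h1.symm, rfl⟩⟩

theorem Folded.step_eq {Γ : PGraph Y} (h : Γ.Folded) {u v v' : Γ.V} {l : Y × Bool}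
    (h1 : Γ.Step u l v) (h2 : Γ.Step u l v') : v = v' := by
  unfold Step at h1 h2
  split_ifs at h1 h2
  exacts [h.tgt_eq h1 h2, h.src_eq h1 h2]

theorem Folded.reads_eq {Γ : PGraph Y} (h : Γ.Folded) {u v v' : Γ.V} {w : List (Y × Bool)}
    (h1 : Γ.Reads u w v) (h2 : Γ.Reads u w v') : v = v' := by
  induction w generalizing u with
  | nil => exact h1.symm.trans h2
  | cons l w ih =>
    obtain ⟨m, a1, a2⟩ := reads_cons.1 h1
    obtain ⟨m', b1, b2⟩ := reads_cons.1 h2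
    obtain rfl := h.step_eq a1 b1
    exact ih a2 b2

theorem Hom.step {Γ Δ : PGraph Y} (f : Hom Γ Δ) {u v : Γ.V} {l : Y × Bool} (h : Γ.Step u l v) :
    Δ.Step (f.onV u) l (f.onV v) := by
  unfold Step at *
  split_ifs at * <;> exact f.edge h

theorem Hom.reads {Γ Δ : PGraph Y} (f : Hom Γ Δ) {u v : Γ.V} {w : List (Y × Bool)}
    (h : Γ.Reads u w v) : Δ.Reads (f.onV u) w (f.onV v) := by
  induction w generalizing u with
  | nil => exact congrArg _ h
  | cons l w ih =>
    obtain ⟨m, h1, h2⟩ := reads_cons.1 h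
    exact reads_cons.2 ⟨_, f.step h1, ih h2⟩

/-- Every vertex can be reached from the basepoint. -/
def Reach (Γ : PGraph Y) : Prop := ∀ v, ∃ w, Γ.Reads Γ.base w v

theorem Reach.connected {Γ : PGraph Y} (h : Γ.Reach) : Γ.Connected := by
  have : ∀ w u v, Γ.Reads u w v →
      Relation.EqvGen (fun u v => ∃ e, Γ.src e = u ∧ Γ.tgt e = v) u v := by
    intro w
    induction w with
    | nil => rintro u v rfl; exact .refl _
    | cons l w ih =>
      intro u v huv
      obtain ⟨m, h1, h2⟩ := reads_cons.1 huv
      refine .trans _ _ _ ?_ (ih _ _ h2)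
      unfold Step at h1
      split_ifs at h1
      · obtain ⟨e, h1, -, h3⟩ := h1; exact .rel _ _ ⟨e, h1, h3⟩
      · obtain ⟨e, h1, -, h3⟩ := h1; exact .symm _ _ (.rel _ _ ⟨e, h1, h3⟩)
  intro u v
  obtain ⟨w, hw⟩ := h u
  obtain ⟨w', hw'⟩ := h v
  exact .trans _ _ _ (.symm _ _ (this _ _ _ hw)) (this _ _ _ hw')

theorem Reach.of_hom {Γ Δ : PGraph Y} (h : Γ.Reach) (f : Hom Γ Δ)
    (hf : Function.Surjective f.onV) : Δ.Reach := by
  intro v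
  obtain ⟨v, rfl⟩ := hf v
  obtain ⟨w, hw⟩ := h v
  exact ⟨w, f.onV_base ▸ f.reads hw⟩

/-- In a graph reachable from the basepoint, every other vertex is the end of an edge. -/
theorem Reach.exists_edge {Γ : PGraph Y} (h : Γ.Reach) (v : Γ.V) (hv : v ≠ Γ.base) :
    ∃ u x, Γ.Edge u x v ∨ Γ.Edge v x u := by
  obtain ⟨w, hw⟩ := h v
  rcases List.eq_nil_or_concat w with rfl | ⟨w, l, rfl⟩
  · exact (hv hw.symm).elim
  · rw [List.concat_eq_append, reads_append] at hw
    obtain ⟨m, -, h2⟩ := hw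
    obtain ⟨m', h3, h4⟩ := reads_cons.1 h2
    obtain rfl : m' = v := h4
    unfold Step at h3
    split_ifs at h3
    exacts [⟨m, _, Or.inl h3⟩, ⟨m, _, Or.inr h3⟩]

end PGraph

namespace FiniteAmalgam

open PGraph

variable {D : FiniteAmalgam}

/-! ### Values of words -/

/-- The inclusion of a factor into the amalgam. -/
abbrev inc (i : Fin 2) : D.Factor i →* D.Gp := Monoid.PushoutI.of (φ := D.φ) i

theorem inc_injective (i : Fin 2) : Function.Injective (inc (D := D) i) :=
  Monoid.PushoutI.of_injective D.inj i

theorem inc_φ (i j : Fin 2) (a : D.A) : inc i (D.φ i a) = inc j (D.φ j a) := by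
  rw [inc, inc, Monoid.PushoutI.of_apply_eq_base, Monoid.PushoutI.of_apply_eq_base]

@[simp] theorem val_nil : D.val [] = 1 := rfl

theorem val_cons (l : D.Letter) (w : List D.Letter) : D.val (l :: w) = D.letterVal l * D.val w := by
  simp [val]

theorem val_append (w w' : List D.Letter) : D.val (w ++ w') = D.val w * D.val w' := by
  simp [val]

theorem letterVal_not (x : D.Gen) (b : Bool) : D.letterVal (x, !b) = (D.letterVal (x, b))⁻¹ := by
  cases b <;> simp [letterVal]

theorem val_invRev (w : List D.Letter) : D.val (FreeGroup.invRev w) = (D.val w)⁻¹ := by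
  induction w with
  | nil => simp
  | cons l w ih =>
    rw [FreeGroup.invRev_cons, val_append, ih, val_cons, mul_inv_rev]
    congr 1
    simp only [FreeGroup.invRev, val, List.map_cons, List.map_nil, List.reverse_singleton, List.prod_singleton]
    exact letterVal_not _ _

/-- The element of the factor represented by a letter. -/
def lval {i : Fin 2} (l : D.X i × Bool) : D.Factor i :=
  if l.2 then PresentedGroup.of l.1 else (PresentedGroup.of l.1)⁻¹

@[simp] theorem valIn_nil (i : Fin 2) : D.valIn i [] = 1 := by
  simp [valIn, ← FreeGroup.one_eq_mk]

theorem valIn_append (i : Fin 2) (w w' : List (D.X i × Bool)) :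
    D.valIn i (w ++ w') = D.valIn i w * D.valIn i w' := by
  simp [valIn, ← FreeGroup.mul_mk]

theorem valIn_singleton (i : Fin 2) (l : D.X i × Bool) : D.valIn i [l] = lval l := by
  obtain ⟨x, b⟩ := l
  cases b
  · have : (FreeGroup.mk [(x, false)]) = (FreeGroup.of x)⁻¹ := by
      simp [FreeGroup.of, FreeGroup.inv_mk, FreeGroup.invRev]
    simp [valIn, lval, this, PresentedGroup.of]
  · rfl

theorem valIn_cons (i : Fin 2) (l : D.X i × Bool) (w : List (D.X i × Bool)) :
    D.valIn i (l :: w) = lval l * D.valIn i w := by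
  rw [← valIn_singleton, ← valIn_append]; rfl

theorem valIn_surjective (i : Fin 2) (g : D.Factor i) : ∃ w, D.valIn i w = g := by
  classical
  obtain ⟨x, rfl⟩ := PresentedGroup.mk_surjective _ g
  exact ⟨x.toWord, by rw [valIn, FreeGroup.mk_toWord]⟩

theorem letterVal_tag (i : Fin 2) (l : D.X i × Bool) :
    D.letterVal (⟨i, l.1⟩, l.2) = inc i (lval l) := by
  obtain ⟨x, b⟩ := l
  cases b <;> simp [letterVal, lval]

theorem val_tag (i : Fin 2) (w : List (D.X i × Bool)) :
    D.val (D.tag i w) = inc i (D.valIn i w) := by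
  induction w with
  | nil => simp [tag]
  | cons l w ih => rw [valIn_cons, map_mul, ← ih, tag, List.map_cons, val_cons, letterVal_tag]; rfl

theorem factor_induction {i : Fin 2} {P : D.Factor i → Prop} (h1 : P 1)
    (h : ∀ g x, P g ↔ P (g * PresentedGroup.of x)) (g : D.Factor i) : P g := by
  obtain ⟨w, rfl⟩ := valIn_surjective i g
  induction w using List.reverseRecOn with
  | nil => simpa using h1
  | append_singleton w l ih =>
    obtain ⟨x, b⟩ := l
    rw [valIn_append, valIn_singleton]
    cases b
    · rw [h _ x]; simpa [lval] using ih
    · exact (h _ x).1 ih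

/-! ### Orbits -/

/-- `m` maps `Gᵢ` onto an orbit, for a relation that is thought of as the set of edges. -/
def IsOrbit {W : Type} (Ed : W → D.Gen → W → Prop) (i : Fin 2) (m : D.Factor i → W) : Prop :=
  ∀ g x, Ed (m g) ⟨i, x⟩ (m (g * PresentedGroup.of x))

/-- Edges are determined by one end and the label. -/
def DetRel {W : Type} (Ed : W → D.Gen → W → Prop) : Prop :=
  ∀ u x v u' v', Ed u x v → Ed u' x v' → (u = u' ↔ v = v')

theorem IsOrbit.unique {W : Type} {Ed : W → D.Gen → W → Prop} (hd : DetRel Ed) {i : Fin 2}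
    {m m' : D.Factor i → W} (hm : IsOrbit Ed i m) (hm' : IsOrbit Ed i m') (h : m 1 = m' 1)
    (g : D.Factor i) : m g = m' g := by
  induction g using factor_induction with
  | h1 => exact h
  | h g x => exact hd _ _ _ _ _ (hm g x) (hm' g x)

theorem IsOrbit.shift {W : Type} {Ed : W → D.Gen → W → Prop} {i : Fin 2}
    {m : D.Factor i → W} (hm : IsOrbit Ed i m) (g₀ : D.Factor i) :
    IsOrbit Ed i fun g => m (g₀ * g) := by
  intro g x
  have := hm (g₀ * g) x
  rwa [mul_assoc] at this

theorem _root_.PGraph.Folded.detRel {Γ : D.Graph} (h : Γ.Folded) : DetRel Γ.Edge := by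
  intro u x v u' v' h1 h2
  constructor
  · rintro rfl; exact h.tgt_eq h1 h2
  · rintro rfl; exact h.src_eq h1 h2

theorem IsOrbit.reads {Γ : D.Graph} {i : Fin 2} {m : D.Factor i → Γ.V}
    (hm : IsOrbit Γ.Edge i m) (g : D.Factor i) (w : List (D.X i × Bool)) :
    Γ.Reads (m g) (D.tag i w) (m (g * D.valIn i w)) := by
  induction w generalizing g with
  | nil => simp [tag, Reads]
  | cons l w ih =>
    rw [valIn_cons, ← mul_assoc]
    refine reads_cons.2 ⟨_, ?_, ih _⟩
    obtain ⟨x, b⟩ := l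
    cases b
    · have := hm (g * (PresentedGroup.of x)⁻¹) x
      rw [inv_mul_cancel_right] at this
      simpa [Step, lval] using this
    · exact hm g x

/-- An edge of colour `i` begins at `v`. -/
def HasCol (Γ : D.Graph) (i : Fin 2) (v : Γ.V) : Prop := ∃ d : Γ.DEdge, Γ.ini d = v ∧ col Γ d.1 = i

theorem hasCol_iff {Γ : D.Graph} {i : Fin 2} {v : Γ.V} :
    HasCol Γ i v ↔ ∃ x : D.X i, ∃ u, Γ.Edge v ⟨i, x⟩ u ∨ Γ.Edge u ⟨i, x⟩ v := by
  constructor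
  · rintro ⟨⟨e, b⟩, rfl, rfl⟩
    cases b
    · exact ⟨(Γ.lab e).2, Γ.src e, Or.inr (.mk e)⟩
    · exact ⟨(Γ.lab e).2, Γ.tgt e, Or.inl (.mk e)⟩
  · rintro ⟨x, u, ⟨e, h1, h2, h3⟩ | ⟨e, h1, h2, h3⟩⟩
    · exact ⟨(e, true), h1, by rw [col, h2]⟩
    · exact ⟨(e, false), h3, by rw [col, h2]⟩

theorem hasCol_src {Γ : D.Graph} (e : Γ.E) : HasCol Γ (col Γ e) (Γ.src e) := ⟨(e, true), rfl, rfl⟩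

theorem hasCol_tgt {Γ : D.Graph} (e : Γ.E) : HasCol Γ (col Γ e) (Γ.tgt e) := ⟨(e, false), rfl, rfl⟩

/-- The components are folded images of Cayley graphs. -/
def Complete (Γ : D.Graph) : Prop :=
  ∀ i v, HasCol Γ i v → ∃ m : D.Factor i → Γ.V, m 1 = v ∧ IsOrbit Γ.Edge i m

open Classical in
/-- The vertex `v · g`. -/
noncomputable def act (Γ : D.Graph) (i : Fin 2) (v : Γ.V) (g : D.Factor i) : Γ.V :=
  if h : ∃ m : D.Factor i → Γ.V, m 1 = v ∧ IsOrbit Γ.Edge i m then h.choose g else v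

section act

variable {Γ : D.Graph} (hF : Γ.Folded) (hC : Complete Γ) {i : Fin 2} {v : Γ.V}

@[simp] theorem act_one : act Γ i v 1 = v := by
  unfold act; split_ifs with h
  · exact h.choose_spec.1
  · rfl

include hC in
theorem act_isOrbit (hv : HasCol Γ i v) : IsOrbit Γ.Edge i (act Γ i v) := by
  have h := hC i v hv
  have : act Γ i v = h.choose := by ext g; rw [act, dif_pos h]
  rw [this]; exact h.choose_spec.2

include hF hC in
theorem eq_act {m : D.Factor i → Γ.V} (hv : HasCol Γ i v) (h1 : m 1 = v)
    (hm : IsOrbit Γ.Edge i m) (g : D.Factor i) : m g = act Γ i v g :=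
  hm.unique hF.detRel (act_isOrbit hC hv) (by rw [h1, act_one]) g

include hC in
theorem hasCol_act (hv : HasCol Γ i v) (g : D.Factor i) : HasCol Γ i (act Γ i v g) := by
  obtain ⟨x, -⟩ := hasCol_iff.1 hv
  exact hasCol_iff.2 ⟨x, _, Or.inl (act_isOrbit hC hv g x)⟩

include hF hC in
theorem act_act (hv : HasCol Γ i v) (g h : D.Factor i) :
    act Γ i (act Γ i v g) h = act Γ i v (g * h) :=
  (eq_act hF hC (hasCol_act hC hv g) (by simp) ((act_isOrbit hC hv).shift g) h).symm

include hF hC in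
theorem act_eq_iff (hv : HasCol Γ i v) (g h : D.Factor i) :
    act Γ i v g = act Γ i v h ↔ act Γ i v (g * h⁻¹) = v := by
  constructor
  · intro e; rw [← act_act hF hC hv, e, act_act hF hC hv]; simp
  · intro e
    have := act_act hF hC hv (g * h⁻¹) h
    rw [e] at this
    simpa using this.symm

include hF hC in
theorem reads_tag_iff (hv : HasCol Γ i v) {w : List (D.X i × Bool)} {u : Γ.V} :
    Γ.Reads v (D.tag i w) u ↔ u = act Γ i v (D.valIn i w) := by
  have := (act_isOrbit hC hv).reads 1 w
  rw [act_one, one_mul] at this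
  exact ⟨fun h => hF.reads_eq h this, fun h => h ▸ this⟩

include hF hC in
theorem colPath_iff (hv : HasCol Γ i v) {g : D.Factor i} {u : Γ.V} :
    ColPath Γ i v g u ↔ u = act Γ i v g := by
  constructor
  · rintro ⟨w, h1, rfl⟩; exact (reads_tag_iff hF hC hv).1 h1
  · rintro rfl
    obtain ⟨w, rfl⟩ := valIn_surjective i g
    exact ⟨w, (reads_tag_iff hF hC hv).2 rfl, rfl⟩

include hF hC in
theorem act_edge (hv : HasCol Γ i v) {x : D.X i} {u : Γ.V} (h : Γ.Edge v ⟨i, x⟩ u) :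
    u = act Γ i v (PresentedGroup.of x) := by
  have := act_isOrbit hC hv 1 x
  rw [one_mul, act_one] at this
  exact hF.tgt_eq h this

include hF hC in
theorem connIn_iff (hv : HasCol Γ i v) {u : Γ.V} : ConnIn Γ i v u ↔ ∃ g, u = act Γ i v g := by
  constructor
  · intro h
    have key : ∀ u v, ConnIn Γ i u v → (∀ _ : HasCol Γ i u, ∃ g, v = act Γ i u g) ∧
        (∀ _ : HasCol Γ i v, ∃ g, u = act Γ i v g) ∧ (HasCol Γ i u ↔ HasCol Γ i v) := by
      intro u v h
      induction h with
      | rel u v h =>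
        obtain ⟨e, rfl, rfl, rfl⟩ := h
        have e1 : act Γ (col Γ e) (Γ.src e) (PresentedGroup.of (Γ.lab e).2) = Γ.tgt e :=
          (act_edge hF hC (hasCol_src e) (.mk e)).symm
        refine ⟨fun _ => ⟨_, e1.symm⟩, fun _ => ⟨(PresentedGroup.of (Γ.lab e).2)⁻¹, ?_⟩,
          fun _ => hasCol_tgt e, fun _ => hasCol_src e⟩
        rw [← e1, act_act hF hC (hasCol_src e)]; simp
      | refl u => exact ⟨fun _ => ⟨1, by simp⟩, fun _ => ⟨1, by simp⟩, Iff.rfl⟩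
      | symm u v _ ih => exact ⟨ih.2.1, ih.1, ih.2.2.symm⟩
      | trans u v w _ _ ih1 ih2 =>
        obtain ⟨a1, a2, a3⟩ := ih1
        obtain ⟨b1, b2, b3⟩ := ih2
        refine ⟨fun hu => ?_, fun hw => ?_, a3.trans b3⟩
        · obtain ⟨g, rfl⟩ := a1 hu
          obtain ⟨h, rfl⟩ := b1 (a3.1 hu)
          exact ⟨_, act_act hF hC hu g h⟩
        · obtain ⟨g, rfl⟩ := b2 hw
          obtain ⟨h, rfl⟩ := a2 (b3.2 hw)
          exact ⟨_, act_act hF hC hw g h⟩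
    exact (key _ _ h).1 hv
  · rintro ⟨g, rfl⟩
    induction g using factor_induction with
    | h1 => rw [act_one]; exact .refl _
    | h g x =>
      obtain ⟨e, h1, h2, h3⟩ := act_isOrbit hC hv g x
      have : ConnIn Γ i (act Γ i v g) (act Γ i v (g * PresentedGroup.of x)) :=
        .rel _ _ ⟨e, by rw [col, h2], h1, h3⟩
      exact ⟨fun h => .trans _ _ _ h this, fun h => .trans _ _ _ h (.symm _ _ this)⟩

end act

/-! ### Precovers -/

/-- At bichromatic vertices, `A` acts in the same way in both components. -/
def Compat (Γ : D.Graph) : Prop :=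
  ∀ v, Bichromatic Γ v → ∀ i j a, act Γ i v (D.φ i a) = act Γ j v (D.φ j a)

/-- Paths as sequences of syllables. -/
def SPath (Γ : D.Graph) : Γ.V → List (Σ i, D.Factor i) → Γ.V → Prop
  | u, [], v => u = v
  | u, s :: L, v => HasCol Γ s.1 u ∧ SPath Γ (act Γ s.1 u s.2) L v

/-- The element of the amalgam represented by a sequence of syllables. -/
def sval (L : List (Σ i, D.Factor i)) : D.Gp := (L.map fun s => inc s.1 s.2).prod

/-- Alternating sequences of syllables outside of `A`. -/
def Alt (L : List (Σ i, D.Factor i)) : Prop :=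
  L.IsChain (fun s t => s.1 ≠ t.1) ∧ ∀ s ∈ L, s.2 ∉ (D.φ s.1).range

theorem bichromatic_of_ne {Γ : D.Graph} {i j : Fin 2} (hij : i ≠ j) {v : Γ.V}
    (hi : HasCol Γ i v) (hj : HasCol Γ j v) : Bichromatic Γ v := by
  intro k
  have : k = i ∨ k = j := by omega
  rcases this with rfl | rfl
  exacts [hi, hj]

section

variable {Γ : D.Graph} (hF : Γ.Folded) (hC : Complete Γ) (hA : Compat Γ)

include hC hA in
theorem bichromatic_act {v : Γ.V} (hv : Bichromatic Γ v) (i : Fin 2) (a : D.A) :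
    Bichromatic Γ (act Γ i v (D.φ i a)) := by
  intro j
  rw [hA v hv i j]
  exact hasCol_act hC (hv j) _

include hF hC hA in
theorem bichromatic_act_iff {v : Γ.V} {i : Fin 2} (hv : HasCol Γ i v) (a : D.A) :
    Bichromatic Γ (act Γ i v (D.φ i a)) ↔ Bichromatic Γ v := by
  refine ⟨fun h => ?_, fun h => bichromatic_act hC hA h i a⟩
  have := bichromatic_act hC hA h i a⁻¹
  rwa [act_act hF hC hv, ← map_mul, mul_inv_cancel, map_one, act_one] at this

include hF hC hA in
theorem SPath.alt {u v : Γ.V} {L : List (Σ i, D.Factor i)} (h : SPath Γ u L v) :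
    ∃ L', SPath Γ u L' v ∧ sval L' = sval L ∧ (L'.length ≤ 1 ∨ Alt L') := by
  induction L generalizing u with
  | nil => exact ⟨[], h, rfl, Or.inl (by simp)⟩
  | cons s L ih =>
    obtain ⟨i, g⟩ := s
    obtain ⟨hu, h⟩ := h
    obtain ⟨L', h1, h2, h3⟩ := ih h
    have hs : sval (⟨i, g⟩ :: L) = inc i g * sval L' := by rw [h2]; simp [sval]
    rw [hs]
    clear h2 ih h hs
    match L', h1, h3 with
    | [], h1, h3 => exact ⟨[⟨i, g⟩], ⟨hu, h1⟩, by simp [sval], Or.inl (by simp)⟩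
    | ⟨j, k⟩ :: L'', ⟨h4, h5⟩, h3 =>
      by_cases hij : i = j
      · subst hij
        simp only at h4 h5
        rw [act_act hF hC hu] at h5
        by_cases hr : g * k ∈ (D.φ i).range
        swap
        · refine ⟨⟨i, g * k⟩ :: L'', ⟨hu, h5⟩, by simp [sval, mul_assoc], h3.imp id fun h => ?_⟩
          refine ⟨?_, ?_⟩
          · have := h.1
            rw [List.isChain_cons] at this ⊢
            exact this
          · intro s hs
            rcases List.mem_cons.1 hs with rfl | hs
            · exact hr
            · exact h.2 s (List.mem_cons_of_mem _ hs)
        obtain ⟨a, ha⟩ := hr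
        match L'', h5, h3 with
        | [], h5, h3 => exact ⟨[⟨i, g * k⟩], ⟨hu, h5⟩, by simp [sval], Or.inl (by simp)⟩
        | ⟨l, m⟩ :: L3, ⟨h6, h7⟩, h3 =>
          simp only at h6 h7
          have h3 : Alt (⟨i, k⟩ :: ⟨l, m⟩ :: L3) := h3.resolve_left (by simp)
          have hil : i ≠ l := (List.isChain_cons_cons.1 h3.1).1
          have hb : Bichromatic Γ u := by
            rw [← bichromatic_act_iff hF hC hA hu a, ha]
            exact bichromatic_of_ne hil (hasCol_act hC hu _) h6
          rw [← ha, hA u hb i l a, act_act hF hC (hb l)] at h7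
          refine ⟨⟨l, D.φ l a * m⟩ :: L3, ⟨hb l, h7⟩, ?_, Or.inr ⟨?_, ?_⟩⟩
          · simp only [sval, List.map_cons, List.prod_cons, map_mul]
            rw [inc_φ l i, ha, map_mul]; simp only [mul_assoc]
          · have := (List.isChain_cons_cons.1 h3.1).2
            rw [List.isChain_cons] at this ⊢
            exact this
          · intro s hs
            rcases List.mem_cons.1 hs with rfl | hs
            · intro hr
              refine h3.2 ⟨l, m⟩ (by simp) ?_
              have := mul_mem ((D.φ l).range.inv_mem ⟨a, rfl⟩) hr
              rwa [inv_mul_cancel_left] at this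
            · exact h3.2 s (by simp [hs])
      · simp only at h4 h5
        by_cases hr : g ∈ (D.φ i).range
        · obtain ⟨a, rfl⟩ := hr
          have hb : Bichromatic Γ u := by
            rw [← bichromatic_act_iff hF hC hA hu a]
            exact bichromatic_of_ne hij (hasCol_act hC hu _) h4
          rw [hA u hb i j a, act_act hF hC (hb j)] at h5
          refine ⟨⟨j, D.φ j a * k⟩ :: L'', ⟨hb j, h5⟩, ?_, h3.imp id fun h => ⟨?_, ?_⟩⟩
          · simp only [sval, List.map_cons, List.prod_cons, map_mul]
            rw [inc_φ j i]; simp only [mul_assoc]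
          · have := h.1
            rw [List.isChain_cons] at this ⊢
            exact this
          · intro s hs
            rcases List.mem_cons.1 hs with rfl | hs
            · intro hr
              refine h.2 ⟨j, k⟩ (by simp) ?_
              have := mul_mem ((D.φ j).range.inv_mem ⟨a, rfl⟩) hr
              rwa [inv_mul_cancel_left] at this
            · exact h.2 s (by simp [hs])
        by_cases hk : k ∈ (D.φ j).range
        · match L'', h5, h3 with
          | [], h5, h3 =>
            obtain ⟨a, rfl⟩ := hk
            have hb := bichromatic_of_ne hij (hasCol_act hC hu g) h4
            rw [SPath, hA _ hb j i a, act_act hF hC hu] at h5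
            refine ⟨[⟨i, g * D.φ i a⟩], ⟨hu, h5⟩, ?_, Or.inl (by simp)⟩
            simp only [sval, List.map_cons, List.map_nil, List.prod_cons, List.prod_nil, map_mul,
              mul_one]
            rw [inc_φ i j]
          | t :: L3, h5, h3 =>
            exact ((h3.resolve_left (by simp)).2 ⟨j, k⟩ (by simp) hk).elim
        · refine ⟨⟨i, g⟩ :: ⟨j, k⟩ :: L'', ⟨hu, h4, h5⟩, by simp [sval], Or.inr ⟨?_, ?_⟩⟩
          · refine List.isChain_cons_cons.2 ⟨hij, ?_⟩
            rcases h3 with h3 | h3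
            · match L'', h3 with
              | [], _ => simp
            · exact h3.1
          · intro s hs
            rcases List.mem_cons.1 hs with rfl | hs
            · exact hr
            · rcases List.mem_cons.1 hs with rfl | hs
              · exact hk
              · rcases h3 with h3 | h3
                · match L'', h3, hs with
                  | [], _, hs => simp at hs
                · exact h3.2 s (by simp [hs])

theorem Alt.sval_ne {L : List (Σ i, D.Factor i)} (h : Alt L) (hL : sval L = 1) : L = [] := by
  let w : Monoid.CoprodI.Word D.Factor :=
    ⟨L, fun l hl h1 => h.2 l hl (h1 ▸ one_mem _), h.1⟩
  have hw : Monoid.PushoutI.Reduced D.φ w := fun g hg => h.2 g hg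
  have := hw.eq_empty_of_mem_range D.inj ⟨1, by
    rw [map_one, ← hL, Monoid.CoprodI.Word.prod, map_list_prod]
    simp [sval, w, Function.comp_def]⟩
  exact congrArg Monoid.CoprodI.Word.toList this

include hF hC in
theorem exists_sPath {u v : Γ.V} {w : List D.Letter} (h : Γ.Reads u w v) :
    ∃ L, SPath Γ u L v ∧ sval L = D.val w := by
  induction w generalizing u with
  | nil => exact ⟨[], h, rfl⟩
  | cons l w ih =>
    obtain ⟨m, h1, h2⟩ := reads_cons.1 h
    obtain ⟨L, h3, h4⟩ := ih h2
    obtain ⟨⟨i, x⟩, b⟩ := l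
    have hu : HasCol Γ i u := by
      cases b
      · exact hasCol_iff.2 ⟨x, m, Or.inr (by simpa [Step] using h1)⟩
      · exact hasCol_iff.2 ⟨x, m, Or.inl (by simpa [Step] using h1)⟩
    have hm : m = act Γ i u (lval (x, b)) := by
      rw [← valIn_singleton, ← reads_tag_iff hF hC hu]
      exact reads_cons.2 ⟨m, h1, rfl⟩
    refine ⟨⟨i, lval (x, b)⟩ :: L, ⟨hu, hm ▸ h3⟩, ?_⟩
    rw [val_cons, ← h4, letterVal_tag i (x, b)]
    simp [sval]

include hF hC hA in
theorem gBased : GBased Γ := by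
  intro u w v h hw
  obtain ⟨L, h1, h2⟩ := exists_sPath hF hC h
  rw [hw] at h2
  obtain ⟨L', h3, h4, h5⟩ := h1.alt hF hC hA
  rw [h2] at h4
  rcases h5 with h5 | h5
  · match L', h3, h4, h5 with
    | [], h3, _, _ => simpa [SPath] using h3
    | [⟨i, g⟩], ⟨_, h3⟩, h4, _ =>
      have : g = 1 := inc_injective i (by simpa [sval] using h4)
      subst this
      simpa [SPath] using h3
  · rw [h5.sval_ne h4] at h3
    rwa [SPath] at h3

end

end FiniteAmalgam

namespace PGraph

variable {Y : Type}

/-! ### Foldings of quotients -/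

theorem exists_foldClosure_quot {W : Type} (Γ : PGraph Y) [Finite Γ.E] (rV : Γ.V → Γ.V → Prop)
    (rE : Γ.E → Γ.E → Prop)
    (h : ∀ a b, rE a b → Γ.lab a = Γ.lab b ∧ Relation.EqvGen rV (Γ.src a) (Γ.src b) ∧
      Relation.EqvGen rV (Γ.tgt a) (Γ.tgt b)) (f : Γ.V → W) (hf : FoldCongr Γ f)
    (hr : ∀ u v, rV u v → f u = f v)
    (hmin : ∀ (W' : Type) (φ : Γ.V → W'), FoldCongr Γ φ → (∀ u v, rV u v → φ u = φ v) →
      ∀ u v, f u = f v → φ u = φ v) :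
    ∃ Δ, Relation.ReflTransGen Fold (quotGraph Γ rV rE h) Δ ∧ Folded Δ ∧
      ∃ g : Hom (quotGraph Γ rV rE h) Δ, Function.Surjective g.onV ∧ Function.Surjective g.onE ∧
      ∀ u v, g.onV (Quot.mk _ u) = g.onV (Quot.mk _ v) ↔ f u = f v := by
  have : Finite (quotGraph Γ rV rE h).E :=
    Finite.of_surjective (quotHom Γ rV rE h).onE Quot.mk_surjective
  obtain ⟨Δ, h1, h2, g, h3, h4, h5⟩ := exists_foldClosure (quotGraph Γ rV rE h) (Quot.lift f hr)
    (by
      intro e e' hl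
      induction e using Quot.ind
      induction e' using Quot.ind
      exact hf _ _ hl)
    (by
      intro W' φ hφ u v
      induction u using Quot.ind
      induction v using Quot.ind
      exact hmin W' (φ ∘ Quot.mk _) (fun e e' hl => hφ (Quot.mk _ e) (Quot.mk _ e') hl)
        (fun u v huv => congrArg φ (Quot.sound huv)) _ _)
  exact ⟨Δ, h1, h2, g, h3, h4, fun u v => h5 (Quot.mk _ u) (Quot.mk _ v)⟩

/-- The edges of `Γ`, for vertices named by `f`. -/
def namedEdges {N : ℕ} (code : Y ≃ Fin N) (Γ : PGraph Y) (f : Γ.V → ℕ) : EdgeSet :=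
  Set.range fun e => (f (Γ.src e), (code (Γ.lab e) : ℕ), f (Γ.tgt e))

theorem Rep.of_hom {N : ℕ} {code : Y ≃ Fin N} {Γ Δ : PGraph Y} (g : Hom Γ Δ)
    (hV : Function.Surjective g.onV) (hE : Function.Surjective g.onE) (hΔ : Δ.Folded)
    (hr : Δ.Reach) (f : Γ.V → ℕ) (hg : ∀ u v, g.onV u = g.onV v ↔ f u = f v)
    (h0 : f Γ.base = 0) :
    ∃ ι, Rep code Δ ι (namedEdges code Γ f) ∧ ∀ u, ι (g.onV u) = f u := by
  have hs := Function.surjInv_eq hV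
  have hι : ∀ u, f (Function.surjInv hV (g.onV u)) = f u := fun u => (hg _ _).1 (hs _)
  refine ⟨fun v => f (Function.surjInv hV v), ⟨fun u v huv => ?_, ?_, hΔ, fun u x v => ?_, ?_, ?_⟩,
    hι⟩
  · have := (hg _ _).2 huv
    rwa [hs, hs] at this
  · rw [← g.onV_base, hι, h0]
  · constructor
    · intro h
      obtain ⟨u', v', rfl, rfl, e, rfl, rfl, rfl⟩ := g.lift_edge hE h
      exact ⟨e, by simp only [hι]⟩
    · rintro ⟨e, he⟩
      simp only [Prod.mk.injEq] at he
      have h1 := (hg _ _).2 he.1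
      have h2 := (hg _ _).2 he.2.2
      rw [hs] at h1 h2
      rw [← h1, ← h2, ← code.injective (Fin.ext he.2.1)]
      exact g.edge (.mk e)
  · ext n
    constructor
    · rintro ⟨v, rfl⟩
      by_cases hv : v = Δ.base
      · subst hv
        left
        dsimp only
        rw [← g.onV_base, hι, h0]
      · right
        obtain ⟨u, x, h⟩ := hr.exists_edge v hv
        rcases h with h | h
        · obtain ⟨u', v', rfl, rfl, e, rfl, rfl, rfl⟩ := g.lift_edge hE h
          exact ⟨_, ⟨e, rfl⟩, Or.inr (hι _)⟩
        · obtain ⟨u', v', rfl, rfl, e, rfl, rfl, rfl⟩ := g.lift_edge hE h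
          exact ⟨_, ⟨e, rfl⟩, Or.inl (hι _)⟩
    · rintro (rfl | ⟨_, ⟨e, rfl⟩, rfl | rfl⟩)
      · exact ⟨Δ.base, by dsimp only; rw [← g.onV_base, hι, h0]⟩
      · exact ⟨_, hι _⟩
      · exact ⟨_, hι _⟩
  · rintro _ ⟨e, rfl⟩
    exact (code (Γ.lab e)).2

/-- A quotient followed by foldings, computed by a map `f` of the vertices and given up to a
renaming of the vertices. -/
theorem exists_isQuot_iteratesTo {N : ℕ} {code : Y ≃ Fin N} (Γ : PGraph Y) [Finite Γ.E]
    (rV : Γ.V → Γ.V → Prop) (rE : Γ.E → Γ.E → Prop)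
    (h : ∀ a b, rE a b → Γ.lab a = Γ.lab b ∧ Relation.EqvGen rV (Γ.src a) (Γ.src b) ∧
      Relation.EqvGen rV (Γ.tgt a) (Γ.tgt b)) (f : Γ.V → ℕ) (hf : FoldCongr Γ f)
    (hr : ∀ u v, rV u v → f u = f v)
    (hmin : ∀ (W' : Type) (φ : Γ.V → W'), FoldCongr Γ φ → (∀ u v, rV u v → φ u = φ v) →
      ∀ u v, f u = f v → φ u = φ v) (h0 : f Γ.base = 0)
    (hc : (quotGraph Γ rV rE h).Reach)
    {Γ' : PGraph Y} {ι' : Γ'.V → ℕ} {num : ℕ → ℕ}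
    (h' : Rep code Γ' ι' (RAM.map3 num '' namedEdges code Γ f)) (hnum : num 0 = 0)
    (hinj : Set.InjOn num (RAM.verts (namedEdges code Γ f))) :
    ∃ Δ, IsQuot Γ Δ rV rE ∧ IteratesTo Fold Δ Γ' ∧ Γ'.Reach ∧ ∃ g : Hom Γ Γ', Function.Surjective g.onV ∧
      Function.Surjective g.onE ∧ (∀ u, ι' (g.onV u) = num (f u)) ∧
      ∀ u v, g.onV u = g.onV v ↔ f u = f v := by
  obtain ⟨Δ, h1, h2, g, h3, h4, h5⟩ := exists_foldClosure_quot Γ rV rE h f hf hr hmin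
  have hΔ : Δ.Reach := hc.of_hom g h3
  obtain ⟨ι, h6, h7⟩ := Rep.of_hom (code := code) (g.comp (quotHom Γ rV rE h))
    (h3.comp Quot.mk_surjective) (h4.comp Quot.mk_surjective) h2 hΔ f h5 h0
  obtain ⟨k, h8, h9, h10⟩ := h6.iso h' hnum hinj rfl
  refine ⟨_, isQuot_quotGraph Γ rV rE h, ⟨Δ, h1, ⟨k, h8, h9⟩, fun _ => h'.folded.not_fold⟩,
    hΔ.of_hom k h8.2,
    k.comp (g.comp (quotHom Γ rV rE h)), h8.2.comp (h3.comp Quot.mk_surjective),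
    h9.2.comp (h4.comp Quot.mk_surjective), fun u => (h10 _).trans (congrArg num (h7 u)),
    fun u v => h8.1.eq_iff.trans (h5 u v)⟩

end PGraph

namespace FiniteAmalgam

open PGraph

variable {D : FiniteAmalgam}

/-! ### Components -/

theorem ConnIn.symm {Γ : D.Graph} {i : Fin 2} {u v : Γ.V} (h : ConnIn Γ i u v) : ConnIn Γ i v u :=
  Relation.EqvGen.symm _ _ h

theorem ConnIn.trans {Γ : D.Graph} {i : Fin 2} {u v w : Γ.V} (h : ConnIn Γ i u v)
    (h' : ConnIn Γ i v w) : ConnIn Γ i u w := Relation.EqvGen.trans _ _ _ h h'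

theorem relCayley_edge (i : Fin 2) (S : Subgroup (D.Factor i)) (g : D.Factor i) (x : D.X i) :
    (D.relCayley i S).Edge (Quotient.mk'' g) ⟨i, x⟩ (Quotient.mk'' (g * PresentedGroup.of x)) :=
  ⟨(Quotient.mk'' g, x), rfl, rfl, rfl⟩

theorem relCayley_mk_eq {i : Fin 2} {S : Subgroup (D.Factor i)} {g h : D.Factor i} :
    (Quotient.mk'' g : (D.relCayley i S).V) = Quotient.mk'' h ↔ h * g⁻¹ ∈ S := by
  rw [← QuotientGroup.rightRel_apply]
  exact Quotient.eq''

theorem relCayley_folded (i : Fin 2) (S : Subgroup (D.Factor i)) : (D.relCayley i S).Folded := by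
  rintro ⟨u, x⟩ ⟨v, y⟩ hl h
  obtain rfl : x = y := by
    simpa [relCayley] using hl
  rcases h with h | h
  · exact Prod.ext h rfl
  · induction u using Quotient.inductionOn'
    induction v using Quotient.inductionOn'
    refine Prod.ext (relCayley_mk_eq.2 ?_) rfl
    have := relCayley_mk_eq.1 h
    simpa [mul_assoc] using this

theorem cayley_edge (i : Fin 2) (g : D.Factor i) (x : D.X i) :
    (D.cayley i).Edge g ⟨i, x⟩ (g * PresentedGroup.of x) := ⟨(g, x), rfl, rfl, rfl⟩

theorem cayley_folded (i : Fin 2) : (D.cayley i).Folded := by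
  rintro ⟨u, x⟩ ⟨v, y⟩ hl h
  obtain rfl : x = y := by
    simpa [cayley] using hl
  rcases h with h | h
  · exact Prod.ext h rfl
  · exact Prod.ext (mul_right_cancel h) rfl

theorem component_folded {Γ : D.Graph} (hF : Γ.Folded) (e : Γ.E) (v : Γ.V) (hv : InComp Γ e v) :
    (component Γ e v hv).Folded := fun _ _ hl h =>
  Subtype.ext (hF _ _ hl (h.imp (congrArg Subtype.val) (congrArg Subtype.val)))

/-- The stabilizer of a vertex. -/
def stab (Γ : D.Graph) (hF : Γ.Folded) (hC : Complete Γ) (i : Fin 2) (v : Γ.V) :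
    Subgroup (D.Factor i) where
  carrier := {g | HasCol Γ i v → act Γ i v g = v}
  one_mem' _ := act_one
  mul_mem' {g h} hg hh hv := by rw [← act_act hF hC hv, hg hv, hh hv]
  inv_mem' {g} hg hv := by
    have := act_act hF hC hv g g⁻¹
    rwa [hg hv, mul_inv_cancel, act_one] at this

section

variable {Γ : D.Graph} (hF : Γ.Folded) (hC : Complete Γ) {e : Γ.E} {v : Γ.V} (hv : InComp Γ e v)

include hF hC

theorem mem_stab {i : Fin 2} {v : Γ.V} (hv : HasCol Γ i v) {g : D.Factor i} :
    g ∈ stab Γ hF hC i v ↔ act Γ i v g = v := ⟨fun h => h hv, fun h _ => h⟩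

theorem hasCol_of_inComp (hv : InComp Γ e v) : HasCol Γ (col Γ e) v := by
  obtain ⟨g, rfl⟩ := (connIn_iff hF hC (hasCol_src e)).1 hv
  exact hasCol_act hC (hasCol_src e) g

theorem inComp_iff (hv : InComp Γ e v) {u : Γ.V} :
    InComp Γ e u ↔ ∃ g, u = act Γ (col Γ e) v g := by
  rw [← connIn_iff hF hC (hasCol_of_inComp hF hC hv)]
  exact ⟨fun h => hv.symm.trans h, fun h => ConnIn.trans hv h⟩

include hv in
theorem inComp_act (g : D.Factor (col Γ e)) : InComp Γ e (act Γ (col Γ e) v g) :=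
  (inComp_iff hF hC hv).2 ⟨g, rfl⟩

theorem component_orbit : IsOrbit (component Γ e v hv).Edge (col Γ e)
    fun g => ⟨act Γ (col Γ e) v g, inComp_act hF hC hv g⟩ := by
  intro g x
  obtain ⟨d, h1, h2, h3⟩ := act_isOrbit hC (hasCol_of_inComp hF hC hv) g x
  refine ⟨⟨d, by rw [col, h2], ?_⟩, Subtype.ext h1, h2, Subtype.ext h3⟩
  rw [h1]
  exact inComp_act hF hC hv g

theorem iso_component : Iso (component Γ e v hv) (D.relCayley (col Γ e)
    (stab Γ hF hC (col Γ e) v)) := by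
  have hv' := hasCol_of_inComp hF hC hv
  have key : ∀ g h, act Γ (col Γ e) v g = act Γ (col Γ e) v h ↔ h * g⁻¹ ∈ stab Γ hF hC (col Γ e) v := by
    intro g h
    rw [mem_stab hF hC hv', ← act_eq_iff hF hC hv', eq_comm]
  refine (iso_of_bijective (relCayley_folded _ _) (component_folded hF e v hv)
    (Quotient.lift (fun g => ⟨act Γ (col Γ e) v g, inComp_act hF hC hv g⟩) fun g h hgh =>
      Subtype.ext ((key g h).2 (QuotientGroup.rightRel_apply.1 hgh))) ⟨?_, ?_⟩ ?_ ?_).symm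
  · intro a b hab
    induction a using Quotient.inductionOn'
    induction b using Quotient.inductionOn'
    exact relCayley_mk_eq.2 ((key _ _).1 (congrArg Subtype.val hab))
  · rintro ⟨u, hu⟩
    obtain ⟨g, rfl⟩ := (inComp_iff hF hC hv).1 hu
    exact ⟨Quotient.mk'' g, rfl⟩
  · intro a y b
    constructor
    · rintro ⟨⟨a, x⟩, rfl, rfl, rfl⟩
      induction a using Quotient.inductionOn'
      exact component_orbit hF hC hv _ x
    · induction a using Quotient.inductionOn' with | _ g => ?_
      induction b using Quotient.inductionOn' with | _ h => ?_
      intro hab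
      obtain ⟨i, x⟩ := y
      obtain rfl : col Γ e = i := by
        obtain ⟨d, -, h2, -⟩ := hab
        have : col Γ d.1 = i := congrArg Sigma.fst h2
        rw [← d.2.1, this]
      have h1 := (component_folded hF e v hv).tgt_eq hab (component_orbit hF hC hv g x)
      have h2 := relCayley_mk_eq.2 ((key _ _).1 (congrArg Subtype.val h1))
      rw [h2]
      exact relCayley_edge _ _ g x
  · exact Subtype.ext act_one

theorem stab_of_iso {S : Subgroup (D.Factor (col Γ e))}
    (h : Iso (component Γ e v hv) (D.relCayley (col Γ e) S)) : stab Γ hF hC (col Γ e) v = S := by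
  obtain ⟨f, hV, hE⟩ := h
  have h1 : IsOrbit (D.relCayley (col Γ e) S).Edge (col Γ e)
      fun g => f.onV ⟨act Γ (col Γ e) v g, inComp_act hF hC hv g⟩ :=
    fun g x => f.edge (component_orbit hF hC hv g x)
  have h2 := h1.unique (relCayley_folded _ _).detRel (m' := fun g => Quotient.mk'' g)
    (relCayley_edge _ _) (by
      refine Eq.trans (congrArg f.onV (Subtype.ext act_one)) f.onV_base)
  ext g
  rw [mem_stab hF hC (hasCol_of_inComp hF hC hv)]
  have h3 : (Quotient.mk'' g : (D.relCayley (col Γ e) S).V) = Quotient.mk'' 1 ↔ g ∈ S := by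
    rw [relCayley_mk_eq]; simp
  have h4 : f.onV ⟨act Γ (col Γ e) v g, inComp_act hF hC hv g⟩ =
      f.onV ⟨act Γ (col Γ e) v 1, inComp_act hF hC hv 1⟩ ↔ g ∈ S := by
    rw [← h3]
    exact Iff.of_eq (congrArg₂ Eq (h2 g) (h2 1))
  rw [← h4]
  refine ⟨fun h => congrArg f.onV (Subtype.ext (h.trans act_one.symm)), fun h => ?_⟩
  have := congrArg Subtype.val (hV.1 h)
  simpa using this

theorem compLab_eq {i : Fin 2} {v : Γ.V} (hv : HasCol Γ i v) :
    compLab Γ i v = stab Γ hF hC i v := by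
  ext g
  rw [SetLike.mem_coe, mem_stab hF hC hv, eq_comm]
  exact colPath_iff hF hC hv

theorem isPrecover (hA : Compat Γ) (hR : Γ.Reach) : IsPrecover Γ :=
  ⟨hR.connected, gBased hF hC hA, fun _ => ⟨_, iso_component hF hC _⟩⟩

end

/-! ### Subgroups -/

/-- The vertices can be mapped to the cosets of `H`, in a way compatible with the edges. -/
def Over (H : Subgroup D.Gp) (Γ : D.Graph) : Prop :=
  ∃ c : Γ.V → D.Gp ⧸ H, c Γ.base = (1 : D.Gp) ∧
    ∀ e, c (Γ.src e) = D.letterVal (Γ.lab e, true) • c (Γ.tgt e)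

theorem letterVal_smul_iff {H : Subgroup D.Gp} {Γ : D.Graph} {c : Γ.V → D.Gp ⧸ H}
    (hc : ∀ e, c (Γ.src e) = D.letterVal (Γ.lab e, true) • c (Γ.tgt e)) {u v : Γ.V}
    {w : List D.Letter} (h : Γ.Reads u w v) : c u = D.val w • c v := by
  induction w generalizing u with
  | nil => rw [show u = v from h]; simp
  | cons l w ih =>
    obtain ⟨⟨e, b⟩, rfl, rfl, h2⟩ := h
    rw [val_cons, mul_smul, ← ih h2]
    cases b
    · have := letterVal_not (D := D) (Γ.lab e) true
      rw [show D.letterVal (dlab Γ (e, false)) = _ from this, eq_inv_smul_iff]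
      exact (hc e).symm
    · exact hc e

theorem Over.lab_subset {H : Subgroup D.Gp} {Γ : D.Graph} (h : Over H Γ) : Lab Γ ⊆ H := by
  rintro _ ⟨w, hw, rfl⟩
  obtain ⟨c, h1, h2⟩ := h
  have := letterVal_smul_iff h2 hw
  rw [h1, eq_comm, show D.val w • ((1 : D.Gp) : D.Gp ⧸ H) = ((D.val w * 1 : D.Gp) : D.Gp ⧸ H) from rfl,
    QuotientGroup.eq] at this
  simpa using this

theorem foldCongr_of_smul {H : Subgroup D.Gp} {Γ : D.Graph} {c : Γ.V → D.Gp ⧸ H}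
    (hc : ∀ e, c (Γ.src e) = D.letterVal (Γ.lab e, true) • c (Γ.tgt e)) : FoldCongr Γ c := by
  intro e e' hl
  rw [hc, hc, hl, smul_left_cancel_iff]

theorem Over.of_hom {H : Subgroup D.Gp} {Γ Δ : D.Graph} (g : Hom Γ Δ)
    (hV : Function.Surjective g.onV) (hE : Function.Surjective g.onE) {c : Γ.V → D.Gp ⧸ H}
    (h1 : c Γ.base = (1 : D.Gp))
    (h2 : ∀ e, c (Γ.src e) = D.letterVal (Γ.lab e, true) • c (Γ.tgt e))
    (h : ∀ u v, g.onV u = g.onV v → c u = c v) : Over H Δ := by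
  have hs : ∀ u, c (Function.surjInv hV (g.onV u)) = c u := fun u =>
    h _ _ (Function.surjInv_eq hV _)
  refine ⟨fun v => c (Function.surjInv hV v), ?_, fun e => ?_⟩
  · dsimp only
    rw [← g.onV_base, hs, h1]
  · obtain ⟨e, rfl⟩ := hE e
    simp only [g.src_onE, g.tgt_onE, g.lab_onE, hs, h2]

theorem Over.sub {H : Subgroup D.Gp} {Γ Δ : D.Graph} (h : Over H Γ) (g : Hom Δ Γ) : Over H Δ := by
  obtain ⟨c, h1, h2⟩ := h
  refine ⟨c ∘ g.onV, by rw [Function.comp, g.onV_base, h1], fun e => ?_⟩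
  simp only [Function.comp, ← g.src_onE, ← g.tgt_onE, ← g.lab_onE, h2]

theorem Lab.mono {Γ Δ : D.Graph} (g : Hom Γ Δ) : Lab Γ ⊆ Lab Δ := by
  rintro _ ⟨w, hw, rfl⟩
  exact ⟨w, g.onV_base ▸ g.reads hw, rfl⟩


/-! ### Gluing Cayley graphs -/

/-- The edges of the image of `Γ` under a map of the vertices. -/
def ImgEdge {Y : Type} (Γ : PGraph Y) {W : Type} (ψ : Γ.V → W) (u : W) (x : Y) (v : W) : Prop :=
  ∃ e, ψ (Γ.src e) = u ∧ Γ.lab e = x ∧ ψ (Γ.tgt e) = v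

theorem detRel_imgEdge {Γ : D.Graph} {W : Type} {ψ : Γ.V → W} (h : FoldCongr Γ ψ) :
    DetRel (ImgEdge Γ ψ) := by
  rintro _ x _ _ _ ⟨e, rfl, hl, rfl⟩ ⟨e', rfl, hl', rfl⟩
  exact h e e' (hl.trans hl'.symm)

theorem complete_of_src {Γ : D.Graph}
    (h : ∀ e, ∃ m : D.Factor (col Γ e) → Γ.V, m 1 = Γ.src e ∧ IsOrbit Γ.Edge (col Γ e) m)
    (hF : Γ.Folded) : Complete Γ := by
  rintro i _ ⟨⟨e, b⟩, rfl, rfl⟩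
  obtain ⟨m, h1, h2⟩ := h e
  cases b
  · refine ⟨_, ?_, h2.shift (PresentedGroup.of (Γ.lab e).2)⟩
    have := h2 1 (Γ.lab e).2
    rw [h1, one_mul] at this
    simp only [mul_one]
    exact hF.tgt_eq this (.mk e)
  · exact ⟨m, h1, h2⟩

theorem Complete.of_hom {Γ Δ : D.Graph} (h : Complete Γ) (g : Hom Γ Δ)
    (hE : Function.Surjective g.onE) : Complete Δ := by
  rintro i _ ⟨⟨e, b⟩, rfl, rfl⟩
  obtain ⟨e, rfl⟩ := hE e
  obtain ⟨m, h1, h2⟩ := h (col Γ e) (Γ.ini (e, b)) ⟨(e, b), rfl, rfl⟩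
  have : col Δ (g.onE e) = col Γ e := by rw [col, g.lab_onE]; rfl
  rw [this]
  refine ⟨fun x => g.onV (m x), ?_, fun x y => g.edge (h2 x y)⟩
  refine (congrArg g.onV h1).trans ?_
  cases b
  · exact (g.tgt_onE e).symm
  · exact (g.src_onE e).symm

/-- The disjoint union of `Γ` with copies of Cayley graphs. -/
abbrev cayAttach (Γ : D.Graph) (T : Set Γ.DEdge) : D.Graph :=
  Γ.attach fun d : T => D.cayley (Γ.dlab d.1).1.1

theorem SameComp.symm {Γ : D.Graph} {e e' : Γ.E} (h : SameComp Γ e e') : SameComp Γ e' e :=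
  ⟨h.1.symm, by rw [h.1]; exact h.2.symm⟩

theorem SameComp.trans {Γ : D.Graph} {e e' e'' : Γ.E} (h : SameComp Γ e e')
    (h' : SameComp Γ e' e'') : SameComp Γ e e'' :=
  ⟨h'.1.trans h.1, h.2.trans (by rw [← h.1]; exact h'.2)⟩

theorem SameComp.refl {Γ : D.Graph} (e : Γ.E) : SameComp Γ e e := ⟨rfl, Relation.EqvGen.refl _⟩

theorem exists_reps (Γ : D.Graph) : ∃ T : Set Γ.DEdge, (∀ d ∈ T, d.2 = true) ∧
    ∀ e, ∃! d, d ∈ T ∧ SameComp Γ d.1 e := by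
  let s : Setoid Γ.E := ⟨SameComp Γ, SameComp.refl, SameComp.symm, SameComp.trans⟩
  refine ⟨{d | d.2 = true ∧ (Quotient.mk s d.1).out = d.1}, fun d hd => hd.1, fun e => ?_⟩
  have h1 : SameComp Γ (Quotient.mk s e).out e := Quotient.mk_out (s := s) e
  refine ⟨((Quotient.mk s e).out, true), ⟨⟨rfl, by simp⟩, h1⟩, ?_⟩
  rintro ⟨e', b⟩ ⟨⟨h2, h3⟩, h4⟩
  obtain rfl : b = true := h2
  have : Quotient.mk s e' = Quotient.mk s e := Quotient.sound h4
  simp only at h3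
  rw [← h3, this]

theorem inr_orbit {Γ : D.Graph} {T : Set Γ.DEdge} {W : Type} (ψ : (cayAttach Γ T).V → W) (d : T) :
    IsOrbit (ImgEdge (cayAttach Γ T) ψ) (col Γ d.1.1) fun g => ψ (Sum.inr ⟨d, g⟩) :=
  fun g x => ⟨Sum.inr ⟨d, (g, x)⟩, rfl, rfl, rfl⟩

theorem exists_orbit {Γ : D.Graph} {T : Set Γ.DEdge} (hT : ∀ e, ∃ d ∈ T, SameComp Γ d.1 e)
    {W : Type} {ψ : (cayAttach Γ T).V → W} (hψ : FoldCongr _ ψ)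
    (hr : ∀ d : T, ψ (Sum.inl (Γ.src d.1.1)) = ψ (Sum.inr ⟨d, (1 : D.Factor _)⟩)) (e : Γ.E) :
    ∃ m : D.Factor (col Γ e) → W, m 1 = ψ (Sum.inl (Γ.src e)) ∧
      IsOrbit (ImgEdge (cayAttach Γ T) ψ) (col Γ e) m := by
  have hd := detRel_imgEdge hψ
  have key : ∀ i u v, ConnIn Γ i u v →
      ((∃ m : D.Factor i → W, m 1 = ψ (Sum.inl u) ∧ IsOrbit (ImgEdge (cayAttach Γ T) ψ) i m) ↔
        (∃ m : D.Factor i → W, m 1 = ψ (Sum.inl v) ∧ IsOrbit (ImgEdge (cayAttach Γ T) ψ) i m)) := by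
    intro i u v h
    induction h with
    | rel u v h =>
      obtain ⟨e, rfl, rfl, rfl⟩ := h
      have he : ImgEdge (cayAttach Γ T) ψ (ψ (Sum.inl (Γ.src e))) (Γ.lab e)
          (ψ (Sum.inl (Γ.tgt e))) := ⟨Sum.inl e, rfl, rfl, rfl⟩
      constructor
      · rintro ⟨m, h1, h2⟩
        refine ⟨_, ?_, h2.shift (PresentedGroup.of (Γ.lab e).2)⟩
        have := h2 1 (Γ.lab e).2
        rw [one_mul] at this
        simp only [mul_one]
        exact (hd _ _ _ _ _ this he).1 h1
      · rintro ⟨m, h1, h2⟩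
        refine ⟨_, ?_, h2.shift (PresentedGroup.of (Γ.lab e).2)⁻¹⟩
        have := h2 (PresentedGroup.of (Γ.lab e).2)⁻¹ (Γ.lab e).2
        rw [inv_mul_cancel] at this
        simp only [mul_one]
        exact (hd _ _ _ _ _ this he).2 h1
    | refl => exact Iff.rfl
    | symm _ _ _ ih => exact ih.symm
    | trans _ _ _ _ _ ih1 ih2 => exact ih1.trans ih2
  obtain ⟨d, hdT, h⟩ := hT e
  rw [h.1]
  exact (key _ _ _ h.2).1 ⟨_, (hr ⟨d, hdT⟩).symm, inr_orbit ψ ⟨d, hdT⟩⟩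

/-- Deterministic sets of edges. -/
def DetSet (E : EdgeSet) : Prop :=
  ∀ e ∈ E, ∀ e' ∈ E, e.2.1 = e'.2.1 → (e.1 = e'.1 ↔ e.2.2 = e'.2.2)

/-- The copies of Cayley graphs glued to the edges, with vertices numbered from `z e`. -/
def cayEdges {N : ℕ} (code : D.Gen ≃ Fin N) (Γ : D.Graph) (idx : ∀ i, D.Factor i → ℕ)
    (z : Γ.E → ℕ) : EdgeSet :=
  {e' | ∃ e, ∃ (g : D.Factor (col Γ e)) (x : D.X (col Γ e)),
    e' = (z e + idx _ g, (code ⟨_, x⟩ : ℕ), z e + idx _ (g * PresentedGroup.of x))}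

theorem step3_of_quo {N : ℕ} {code : D.Gen ≃ Fin N} {Γ : D.Graph} [Finite Γ.E] {ι : Γ.V → ℕ}
    {E : EdgeSet} (hΓ : Rep code Γ ι E) (hreach : Γ.Reach) {idx : ∀ i, D.Factor i → ℕ}
    {z : Γ.E → ℕ}
    (hκ : Function.Injective (Sum.elim ι fun p : Σ e, D.Factor (col Γ e) => z p.1 + idx _ p.2))
    {R : ℕ → ℕ} {E' : EdgeSet}
    (hQ : RAM.Quo (E ∪ cayEdges code Γ idx z) {x | ∃ e, x = (ι (Γ.src e), z e + idx (col Γ e) 1)}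
      R E' ∅) (hD : DetSet E') {Γ' : D.Graph} {ι' : Γ'.V → ℕ} {num : ℕ → ℕ}
    (h' : Rep code Γ' ι' (RAM.map3 num '' E')) (hnum : num 0 = 0)
    (hinj : Set.InjOn num (RAM.verts E')) :
    Step3 Γ Γ' ∧ Complete Γ' ∧ Γ'.Reach ∧ Nonempty (Hom Γ Γ') ∧ ∀ H, Over H Γ → Over H Γ' := by
  obtain ⟨T, hT, hT'⟩ := exists_reps Γ
  have hT2 : ∀ e, ∃ d ∈ T, SameComp Γ d.1 e := fun e => by
    obtain ⟨d, ⟨h1, h2⟩, -⟩ := hT' e; exact ⟨d, h1, h2⟩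
  let κ : (cayAttach Γ T).V → ℕ := Sum.elim ι fun p => z p.1.1.1 + idx _ p.2
  let f : (cayAttach Γ T).V → ℕ := fun p => R (κ p)
  have hE0 : ∀ e : (cayAttach Γ T).E, (κ ((cayAttach Γ T).src e),
      (code ((cayAttach Γ T).lab e) : ℕ), κ ((cayAttach Γ T).tgt e)) ∈
      E ∪ cayEdges code Γ idx z := by
    rintro (e | ⟨d, g, x⟩)
    · exact Or.inl ((hΓ.edge _ _ _).1 (.mk e))
    · exact Or.inr ⟨d.1.1, g, x, rfl⟩
  have hE' : ∀ e : (cayAttach Γ T).E, (f ((cayAttach Γ T).src e),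
      (code ((cayAttach Γ T).lab e) : ℕ), f ((cayAttach Γ T).tgt e)) ∈ E' := fun e => by
    rw [hQ.edges]; exact ⟨_, hE0 e, rfl⟩
  have hf : FoldCongr (cayAttach Γ T) f := fun e e' hl =>
    hD _ (hE' e) _ (hE' e') (by simp [hl])
  have hp : ∀ e, R (ι (Γ.src e)) = R (z e + idx (col Γ e) 1) := fun e => by
    simpa using hQ.pairs _ ⟨e, rfl⟩
  -- identifications
  let rV : (cayAttach Γ T).V → (cayAttach Γ T).V → Prop := fun p q => ∃ d : T,
    (p = Sum.inl (Γ.ini d.1) ∧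
      q = Sum.inr ⟨d, (D.cayley _).ini (D.cayleyEdge (Γ.dlab d.1))⟩) ∨
    (p = Sum.inl (Γ.ter d.1) ∧ q = Sum.inr ⟨d, (D.cayley _).ter (D.cayleyEdge (Γ.dlab d.1))⟩)
  let rE : (cayAttach Γ T).E → (cayAttach Γ T).E → Prop := fun p q => ∃ d : T,
    p = Sum.inl d.1.1 ∧ q = Sum.inr ⟨d, (D.cayleyEdge (Γ.dlab d.1)).1⟩
  have hrV : ∀ {W : Type} (φ : (cayAttach Γ T).V → W), (∀ d : T,
      φ (Sum.inl (Γ.src d.1.1)) = φ (Sum.inr ⟨d, (1 : D.Factor _)⟩) ∧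
      φ (Sum.inl (Γ.tgt d.1.1)) = φ (Sum.inr ⟨d, ((1 : D.Factor _) * PresentedGroup.of (Γ.lab d.1.1).2 : D.Factor _)⟩)) →
      ∀ u v, rV u v → φ u = φ v := by
    rintro W φ hφ _ _ ⟨⟨⟨e, b⟩, hd⟩, h⟩
    obtain rfl : b = true := hT _ hd
    rcases h with ⟨rfl, rfl⟩ | ⟨rfl, rfl⟩
    · exact (hφ ⟨_, hd⟩).1
    · exact (hφ ⟨_, hd⟩).2
  have hrV1 : ∀ d : T, rV (Sum.inl (Γ.src d.1.1)) (Sum.inr ⟨d, (1 : D.Factor _)⟩) := by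
    rintro ⟨⟨e, b⟩, hd⟩
    obtain rfl : b = true := hT _ hd
    exact ⟨⟨_, hd⟩, Or.inl ⟨rfl, rfl⟩⟩
  have hrV2 : ∀ d : T, rV (Sum.inl (Γ.tgt d.1.1))
      (Sum.inr ⟨d, ((1 : D.Factor _) * PresentedGroup.of (Γ.lab d.1.1).2 : D.Factor _)⟩) := by
    rintro ⟨⟨e, b⟩, hd⟩
    obtain rfl : b = true := hT _ hd
    exact ⟨⟨_, hd⟩, Or.inr ⟨rfl, rfl⟩⟩
  have hfr : ∀ u v, rV u v → f u = f v := by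
    refine hrV f fun d => ⟨hp d.1.1, ?_⟩
    have h1 := hE' (Sum.inl d.1.1)
    have h2 := hE' (Sum.inr ⟨d, ((1 : D.Factor _), (Γ.lab d.1.1).2)⟩)
    exact (hD _ h1 _ h2 rfl).1 (hp d.1.1)
  have hw : ∀ a b, rE a b → (cayAttach Γ T).lab a = (cayAttach Γ T).lab b ∧
      Relation.EqvGen rV ((cayAttach Γ T).src a) ((cayAttach Γ T).src b) ∧
      Relation.EqvGen rV ((cayAttach Γ T).tgt a) ((cayAttach Γ T).tgt b) := by
    rintro _ _ ⟨⟨⟨e, b⟩, hd⟩, rfl, rfl⟩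
    obtain rfl : b = true := hT _ hd
    exact ⟨rfl, .rel _ _ (hrV1 ⟨_, hd⟩), .rel _ _ (hrV2 ⟨_, hd⟩)⟩
  have hmin : ∀ (W' : Type) (φ : (cayAttach Γ T).V → W'), FoldCongr _ φ →
      (∀ u v, rV u v → φ u = φ v) → ∀ u v, f u = f v → φ u = φ v := by
    intro W φ hφ hφr
    have hφ1 := fun d => hφr _ _ (hrV1 d)
    choose m hm1 hm2 using exists_orbit hT2 hφ hφ1
    let φ' : ℕ → W := Function.extend
      (Sum.elim ι fun p : Σ e, D.Factor (col Γ e) => z p.1 + idx _ p.2)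
      (Sum.elim (fun u => φ (Sum.inl u)) fun p => m p.1 p.2) fun _ => φ (cayAttach Γ T).base
    have e1 : ∀ u, φ' (ι u) = φ (Sum.inl u) := fun u => hκ.extend_apply _ _ (Sum.inl u)
    have e2 : ∀ e g, φ' (z e + idx _ g) = m e g := fun e g => hκ.extend_apply _ _ (Sum.inr ⟨e, g⟩)
    have e3 : ∀ p, φ' (κ p) = φ p := by
      rintro (u | ⟨d, g⟩)
      · exact e1 u
      · exact (e2 d.1.1 g).trans ((hm2 d.1.1).unique (detRel_imgEdge hφ) (inr_orbit φ d)
          ((hm1 d.1.1).trans (hφ1 d)) g)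
    have hadm : RAM.Adm (E ∪ cayEdges code Γ idx z)
        {x | ∃ e, x = (ι (Γ.src e), z e + idx (col Γ e) 1)} φ' := by
      refine ⟨?_, ?_⟩
      · have : ∀ e ∈ E ∪ cayEdges code Γ idx z, ∃ x, e.2.1 = (code x : ℕ) ∧
            ImgEdge (cayAttach Γ T) φ (φ' e.1) x (φ' e.2.2) := by
          rintro _ (he | ⟨e, g, x, rfl⟩)
          · obtain ⟨u, x, v, ⟨e, rfl, rfl, rfl⟩, rfl⟩ := hΓ.exists_edge he
            refine ⟨_, rfl, ?_⟩
            simp only [e1]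
            exact ⟨Sum.inl e, rfl, rfl, rfl⟩
          · refine ⟨_, rfl, ?_⟩
            simp only [e2]
            exact hm2 e g x
        intro e he e' he' hl
        obtain ⟨x, h1, h2⟩ := this e he
        obtain ⟨x', h1', h2'⟩ := this e' he'
        rw [h1, h1'] at hl
        rw [code.injective (Fin.ext hl)] at h2
        exact detRel_imgEdge hφ _ _ _ _ _ h2 h2'
      · rintro _ ⟨e, rfl⟩
        simp only
        rw [e1, e2, hm1]
    intro u v huv
    rw [← e3, ← e3, ← hQ.adm W φ' hadm, ← hQ.adm W φ' hadm (κ v)]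
    exact congrArg φ' huv
  have hnamed : namedEdges code (cayAttach Γ T) f = E' := by
    refine Set.Subset.antisymm ?_ ?_
    · rintro _ ⟨e, rfl⟩; exact hE' e
    · intro e he
      rw [hQ.edges] at he
      obtain ⟨_, he | ⟨e, g, x, rfl⟩, rfl⟩ := he
      · obtain ⟨u, x, v, ⟨e, rfl, rfl, rfl⟩, rfl⟩ := hΓ.exists_edge he
        exact ⟨Sum.inl e, rfl⟩
      · obtain ⟨m, h1, h2⟩ := exists_orbit hT2 hf (fun d => hfr _ _ (hrV1 d)) e
        let Ed : ℕ → D.Gen → ℕ → Prop := fun u x v => (u, (code x : ℕ), v) ∈ E'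
        have hEd : DetRel Ed := fun u x v u' v' h1 h2 => hD _ h1 _ h2 rfl
        have h3 : IsOrbit Ed (col Γ e) m := fun g x => by
          obtain ⟨d, a1, a2, a3⟩ := h2 g x
          have := hE' d
          rwa [a1, a2, a3] at this
        have h4 : IsOrbit Ed (col Γ e) fun g => R (z e + idx _ g) := fun g x => by
          change _ ∈ E'
          rw [hQ.edges]
          exact ⟨_, Or.inr ⟨e, g, x, rfl⟩, rfl⟩
        have h5 := h3.unique hEd h4 (h1.trans (hp e))
        obtain ⟨d, a1, a2, a3⟩ := h2 g x
        refine ⟨d, ?_⟩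
        simp only [a1, a2, a3, h5]
        rfl
  have hreach' : (quotGraph (cayAttach Γ T) rV rE hw).Reach := by
    have hl : ∀ u, ∃ w, (quotGraph (cayAttach Γ T) rV rE hw).Reads (Quot.mk _ (Sum.inl Γ.base)) w
        (Quot.mk _ (Sum.inl u)) := by
      intro u
      obtain ⟨w, hw'⟩ := hreach u
      let k : Hom Γ (quotGraph (cayAttach Γ T) rV rE hw) :=
        ⟨fun u => Quot.mk _ (Sum.inl u), fun e => Quot.mk _ (Sum.inl e), fun _ => rfl,
          fun _ => rfl, fun _ => rfl, rfl⟩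
      exact ⟨w, k.reads hw'⟩
    intro v
    induction v using Quot.ind with | _ v => ?_
    rcases v with u | ⟨d, g⟩
    · exact hl u
    · have ho : IsOrbit (quotGraph (cayAttach Γ T) rV rE hw).Edge (col Γ d.1.1)
          fun g => Quot.mk _ (Sum.inr ⟨d, g⟩) :=
        fun g x => ⟨Quot.mk _ (Sum.inr ⟨d, (g, x)⟩), rfl, rfl, rfl⟩
      obtain ⟨w, hw1⟩ := hl (Γ.src d.1.1)
      obtain ⟨w', rfl⟩ := valIn_surjective _ g
      refine ⟨w ++ D.tag _ w', reads_append.2 ⟨_, hw1, ?_⟩⟩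
      have h9 := ho.reads 1 w'
      rw [one_mul] at h9
      exact (congrArg (fun q => PGraph.Reads _ q _ _) (Quot.sound (hrV1 d))).mpr h9
  have : Finite (cayAttach Γ T).E := by
    have := D.finG
    have := D.finX
    have : ∀ i, Finite (D.cayley i).E := fun i => inferInstanceAs (Finite (D.Factor i × D.X i))
    exact inferInstanceAs (Finite (Γ.E ⊕ Σ d : T, (D.cayley (Γ.dlab d.1).1.1).E))
  obtain ⟨Δ, h1, h2, hΓ', g, h3, h4, h5, h6⟩ := exists_isQuot_iteratesTo (code := code)
    (cayAttach Γ T) rV rE hw f hf hfr hmin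
    (by change R (ι Γ.base) = 0; rw [hΓ.base, hQ.zero]) hreach' (by rwa [hnamed]) hnum (by rwa [hnamed])
  have hc : ∀ u v, rV u v → g.onV u = g.onV v := fun u v h => (h6 u v).2 (hfr u v h)
  have hfc : FoldCongr (cayAttach Γ T) g.onV := by
    intro e e' hl
    rw [h6, h6]
    exact hf e e' hl
  have himg : ∀ u x v, ImgEdge (cayAttach Γ T) g.onV u x v → Γ'.Edge u x v := by
    rintro _ _ _ ⟨e, rfl, rfl, rfl⟩
    exact g.edge (.mk e)
  have hψ : ∀ d : T, g.onV (Sum.inl (Γ.src d.1.1)) = g.onV (Sum.inr ⟨d, (1 : D.Factor _)⟩) :=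
    fun d => hc _ _ (hrV1 d)
  refine ⟨⟨T, hT', Δ, h1, h2⟩, complete_of_src (fun e => ?_) h'.folded, hΓ', ⟨g.comp
    ⟨Sum.inl, Sum.inl, fun _ => rfl, fun _ => rfl, fun _ => rfl, rfl⟩⟩, fun H hH => ?_⟩
  · obtain ⟨e, rfl⟩ := h4 e
    rw [col, g.lab_onE, g.src_onE]
    rcases e with e | ⟨d, x, y⟩
    · obtain ⟨m, a1, a2⟩ := exists_orbit hT2 hfc hψ e
      exact ⟨m, a1, fun x y => himg _ _ _ (a2 x y)⟩
    · refine ⟨_, ?_, IsOrbit.shift (fun x y => himg _ _ _ (inr_orbit g.onV d x y)) x⟩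
      exact congrArg (fun x => g.onV (Sum.inr ⟨d, x⟩)) (mul_one x)
  · obtain ⟨c, c1, c2⟩ := hH
    let c' : (cayAttach Γ T).V → D.Gp ⧸ H := Sum.elim c fun p => (inc _ p.2)⁻¹ • c (Γ.src p.1.1.1)
    have c3 : ∀ e, c' ((cayAttach Γ T).src e) =
        D.letterVal ((cayAttach Γ T).lab e, true) • c' ((cayAttach Γ T).tgt e) := by
      rintro (e | ⟨d, x, y⟩)
      · exact c2 e
      · change (inc _ x)⁻¹ • c _ = inc _ (PresentedGroup.of y) •
          (inc _ (x * PresentedGroup.of y))⁻¹ • c _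
        rw [smul_smul, map_mul, mul_inv_rev, mul_inv_cancel_left]
    refine Over.of_hom (c := c') g h3 h4 c1 c3 fun u v huv =>
      hmin _ c' (foldCongr_of_smul c3) (hrV c' fun d => ⟨?_, ?_⟩) u v ((h6 u v).1 huv)
    · change c _ = (inc _ 1)⁻¹ • c _
      rw [map_one, inv_one, one_smul]
    · change c _ = (inc _ (1 * PresentedGroup.of _))⁻¹ • c _
      exact eq_inv_smul_iff.2 ((congrArg (· • c (Γ.tgt d.1.1))
        (congrArg (inc _) (one_mul _))).trans (c2 d.1.1).symm)

/-! ### The identifications at bichromatic vertices -/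

theorem rep_eq_namedEdges {N : ℕ} {code : D.Gen ≃ Fin N} {Γ : D.Graph} {ι : Γ.V → ℕ}
    {E : EdgeSet} (h : Rep code Γ ι E) : E = namedEdges code Γ ι := by
  refine Set.Subset.antisymm (fun e he => ?_) ?_
  · obtain ⟨_, _, _, ⟨e, rfl, rfl, rfl⟩, rfl⟩ := h.exists_edge he
    exact ⟨e, rfl⟩
  · rintro _ ⟨e, rfl⟩
    exact (h.edge _ _ _).1 (.mk e)

theorem fold_of_quo {N : ℕ} {code : D.Gen ≃ Fin N} {Γ : D.Graph} {ι : Γ.V → ℕ}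
    (hι : Function.Injective ι) {Pr : Set (ℕ × ℕ)} {R : ℕ → ℕ} {E' : EdgeSet}
    (hQ : RAM.Quo (namedEdges code Γ ι) Pr R E' ∅) (hD : DetSet E') :
    namedEdges code Γ (fun u => R (ι u)) = E' ∧ FoldCongr Γ (fun u => R (ι u)) ∧
      ∀ (W : Type) (φ : Γ.V → W), FoldCongr Γ φ →
        (∀ x ∈ Pr, ∃ u v, φ u = φ v ∧ x = (ι u, ι v)) →
        ∀ u v, R (ι u) = R (ι v) → φ u = φ v := by
  have hE' : namedEdges code Γ (fun u => R (ι u)) = E' := by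
    rw [hQ.edges, namedEdges, namedEdges, ← Set.range_comp]
    rfl
  refine ⟨hE', fun e e' hl =>
    (hE' ▸ hD) _ ⟨e, rfl⟩ _ ⟨e', rfl⟩ (congrArg (fun x => (code x : ℕ)) hl), ?_⟩
  intro W φ hφ hP u v huv
  let φ' : ℕ → W := Function.extend ι φ fun _ => φ Γ.base
  have e1 : ∀ u, φ' (ι u) = φ u := hι.extend_apply _ _
  have hadm : RAM.Adm (namedEdges code Γ ι) Pr φ' := by
    refine ⟨?_, fun x hx => ?_⟩
    · rintro _ ⟨e, rfl⟩ _ ⟨e', rfl⟩ hl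
      simp only [e1]
      exact hφ e e' (code.injective (Fin.ext hl))
    · obtain ⟨u, v, h, rfl⟩ := hP x hx
      simpa only [e1] using h
  rw [← e1, ← e1, ← hQ.adm W φ' hadm, ← hQ.adm W φ' hadm (ι v)]
  exact congrArg φ' huv

theorem HasCol.map {Γ Δ : D.Graph} (g : Hom Γ Δ) {i : Fin 2} {v : Γ.V} (h : HasCol Γ i v) :
    HasCol Δ i (g.onV v) := by
  obtain ⟨x, w, h | h⟩ := hasCol_iff.1 h
  · exact hasCol_iff.2 ⟨x, _, Or.inl (g.edge h)⟩
  · exact hasCol_iff.2 ⟨x, _, Or.inr (g.edge h)⟩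

theorem map_act {Γ Δ : D.Graph} (hC : Complete Γ) (hF' : Δ.Folded) (hC' : Complete Δ)
    (g : Hom Γ Δ) {i : Fin 2} {v : Γ.V} (h : HasCol Γ i v) (x : D.Factor i) :
    g.onV (act Γ i v x) = act Δ i (g.onV v) x :=
  eq_act (m := fun x => g.onV (act Γ i v x)) hF' hC' (h.map g) (by rw [act_one])
    (fun x y => g.edge (act_isOrbit hC h x y)) x

theorem Over.smul_act {H : Subgroup D.Gp} {Γ : D.Graph} (hF : Γ.Folded) (hC : Complete Γ)
    {c : Γ.V → D.Gp ⧸ H} (hc : ∀ e, c (Γ.src e) = D.letterVal (Γ.lab e, true) • c (Γ.tgt e))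
    {i : Fin 2} {v : Γ.V} (hv : HasCol Γ i v) (g : D.Factor i) :
    c (act Γ i v g) = (inc i g)⁻¹ • c v := by
  have h : ColPath Γ i v g (act Γ i v g) := (colPath_iff hF hC hv).2 rfl
  obtain ⟨w, h7, h8⟩ := h
  rw [letterVal_smul_iff hc h7, val_tag, h8, inv_smul_smul]

theorem step4_of_quo {N : ℕ} {code : D.Gen ≃ Fin N} {Γ : D.Graph} [Finite Γ.E] {ι : Γ.V → ℕ}
    {E : EdgeSet} (hΓ : Rep code Γ ι E) (hreach : Γ.Reach) (hC : Complete Γ)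
    {R : ℕ → ℕ} {E' : EdgeSet}
    (hQ : RAM.Quo E {x | ∃ v, Bichromatic Γ v ∧ ∃ a, x = (ι (act Γ 0 v (D.φ 0 a)),
      ι (act Γ 1 v (D.φ 1 a)))} R E' ∅) (hD : DetSet E') {Γ' : D.Graph} {ι' : Γ'.V → ℕ} {num : ℕ → ℕ}
    (h' : Rep code Γ' ι' (RAM.map3 num '' E')) (hnum : num 0 = 0)
    (hinj : Set.InjOn num (RAM.verts E')) :
    Step4 Γ Γ' ∧ Complete Γ' ∧ Compat Γ' ∧ Γ'.Reach ∧ Nonempty (Hom Γ Γ') ∧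
      ∀ H, Over H Γ → Over H Γ' := by
  have hF := hΓ.folded
  let rV : Γ.V → Γ.V → Prop := fun u w => ∃ v, Bichromatic Γ v ∧
    ∃ a : D.A, ColPath Γ 0 v (D.φ 0 a) u ∧ ColPath Γ 1 v (D.φ 1 a) w
  have hrV : ∀ {W : Type} (φ : Γ.V → W), (∀ v, Bichromatic Γ v → ∀ a,
      φ (act Γ 0 v (D.φ 0 a)) = φ (act Γ 1 v (D.φ 1 a))) → ∀ u w, rV u w → φ u = φ w := by
    rintro W φ hφ u w ⟨v, hv, a, h1, h2⟩
    rw [(colPath_iff hF hC (hv 0)).1 h1, (colPath_iff hF hC (hv 1)).1 h2]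
    exact hφ v hv a
  have hrV' : ∀ v, Bichromatic Γ v → ∀ a, rV (act Γ 0 v (D.φ 0 a)) (act Γ 1 v (D.φ 1 a)) :=
    fun v hv a => ⟨v, hv, a, (colPath_iff hF hC (hv 0)).2 rfl, (colPath_iff hF hC (hv 1)).2 rfl⟩
  let f : Γ.V → ℕ := fun u => R (ι u)
  rw [rep_eq_namedEdges hΓ] at hQ
  obtain ⟨hnamed, hf, hm⟩ := fold_of_quo hΓ.inj hQ hD
  have hfr : ∀ u v, rV u v → f u = f v := hrV f fun v hv a => by
    simpa using hQ.pairs _ ⟨v, hv, a, rfl⟩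
  have hmin : ∀ (W' : Type) (φ : Γ.V → W'), FoldCongr _ φ →
      (∀ u v, rV u v → φ u = φ v) → ∀ u v, f u = f v → φ u = φ v := fun W φ hφ hφr =>
    hm W φ hφ <| by rintro _ ⟨v, hv, a, rfl⟩; exact ⟨_, _, hφr _ _ (hrV' v hv a), rfl⟩
  have hw : ∀ a b : Γ.E, False → Γ.lab a = Γ.lab b ∧
      Relation.EqvGen rV (Γ.src a) (Γ.src b) ∧ Relation.EqvGen rV (Γ.tgt a) (Γ.tgt b) :=
    fun _ _ h => h.elim
  obtain ⟨Δ, h1, h2, hΓ', g, h3, h4, h5, h6⟩ := exists_isQuot_iteratesTo (code := code)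
    Γ rV (fun _ _ => False) hw f hf hfr hmin (by change R (ι Γ.base) = 0; rw [hΓ.base, hQ.zero])
    (hreach.of_hom (quotHom Γ rV _ hw) Quot.mk_surjective) (by rwa [hnamed]) hnum (by rwa [hnamed])
  have hF' := h'.folded
  have hC' : Complete Γ' := hC.of_hom g h4
  have hact : ∀ {i u} x, HasCol Γ i u → g.onV (act Γ i u x) = act Γ' i (g.onV u) x :=
    fun x h => map_act hC hF' hC' g h x
  have hlift : ∀ {i v}, HasCol Γ' i v → ∃ u, g.onV u = v ∧ HasCol Γ i u := by
    rintro i _ ⟨⟨e, b⟩, rfl, rfl⟩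
    obtain ⟨e, rfl⟩ := h4 e
    refine ⟨Γ.ini (e, b), ?_, (e, b), rfl, by rw [col, col, g.lab_onE]⟩
    cases b
    · exact (g.tgt_onE e).symm
    · exact (g.src_onE e).symm
  have h01 : ∀ v, Bichromatic Γ v → ∀ a, g.onV (act Γ 0 v (D.φ 0 a)) = g.onV (act Γ 1 v (D.φ 1 a)) :=
    fun v hv a => (h6 _ _).2 (hfr _ _ (hrV' v hv a))
  refine ⟨⟨Δ, h1, h2⟩, hC', ?_, hΓ', ⟨g⟩, fun H hH => ?_⟩
  · let B : Γ'.V → Prop := fun v' => ∃ b, Bichromatic Γ b ∧ ∃ a, v' = g.onV (act Γ 0 b (D.φ 0 a))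
    have hB : ∀ u, Bichromatic Γ u → B (g.onV u) := fun u hu => ⟨u, hu, 1, by rw [map_one, act_one]⟩
    have key : ∀ v', Bichromatic Γ' v' → B v' := by
      intro v' hv'
      by_contra hBv
      let φ : Γ.V → Γ'.V × Prop := fun u => (g.onV u, ¬ B (g.onV u) → HasCol Γ 0 u)
      have hφ : FoldCongr Γ φ := by
        have hs : ∀ {u i}, HasCol Γ i u → φ u = (g.onV u, ¬ B (g.onV u) → i = 0) := by
          refine fun {u i} hi => Prod.ext rfl (propext (imp_congr_right fun hb =>
            ⟨fun h => ?_, fun h => h ▸ hi⟩))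
          by_contra hne
          exact hb (hB _ (bichromatic_of_ne (Ne.symm hne) h hi))
        intro e e' hl
        have hc : col Γ e = col Γ e' := by rw [col, hl]; rfl
        have := hf e e' hl
        rw [← h6, ← h6] at this
        rw [hs (hasCol_src e), hs (hasCol_src e'), hs (hasCol_tgt e), hs (hasCol_tgt e'), hc]
        exact ⟨fun h => by rw [this.1 (congrArg Prod.fst h)],
          fun h => by rw [this.2 (congrArg Prod.fst h)]⟩
      obtain ⟨u, rfl, hu⟩ := hlift (hv' 0)
      obtain ⟨w, hw1, hw2⟩ := hlift (hv' 1)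
      have h7 := hmin _ φ hφ (hrV φ fun v hv a => by
        refine Prod.ext (h01 v hv a) (propext ?_)
        have : B (g.onV (act Γ 0 v (D.φ 0 a))) := ⟨v, hv, a, rfl⟩
        exact ⟨fun _ h => (h (h01 v hv a ▸ this)).elim, fun _ h => (h this).elim⟩) u w ((h6 _ _).1 hw1.symm)
      have h8 : (¬ B (g.onV u) → HasCol Γ 0 u) = (¬ B (g.onV w) → HasCol Γ 0 w) :=
        congrArg Prod.snd h7
      have h9 := h8.mp (fun _ => hu) (by rwa [hw1])
      refine hBv (hw1 ▸ hB w (bichromatic_of_ne (by decide) h9 hw2))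
    have h2 : ∀ v, Bichromatic Γ' v → ∀ a, act Γ' 0 v (D.φ 0 a) = act Γ' 1 v (D.φ 1 a) := by
      intro v hv a
      obtain ⟨b, hb, a', rfl⟩ := key v hv
      rw [← hact _ (hasCol_act hC (hb 0) _), act_act hF hC (hb 0), h01 b hb,
        ← hact _ (hasCol_act hC (hb 1) _), act_act hF hC (hb 1), ← map_mul, ← map_mul, h01 b hb]
    intro v hv i j a
    fin_cases i <;> fin_cases j
    exacts [rfl, h2 v hv a, (h2 v hv a).symm, rfl]
  · obtain ⟨c, c1, c2⟩ := hH
    refine Over.of_hom (c := c) g h3 h4 c1 c2 fun u v huv =>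
      hmin _ c (foldCongr_of_smul c2) (hrV c fun v hv a => ?_) u v ((h6 u v).1 huv)
    rw [Over.smul_act hF hC c2 (hv 0), Over.smul_act hF hC c2 (hv 1), inc_φ 0 1]

end FiniteAmalgam

namespace PGraph

variable {Y : Type}

theorem subGraph_folded {Γ : PGraph Y} (hF : Γ.Folded) {SV : Set Γ.V} {SE : Set Γ.E} {hb h} :
    (subGraph Γ SV SE hb h).Folded := fun _ _ hl h' =>
  Subtype.ext (hF _ _ hl (h'.imp (congrArg Subtype.val) (congrArg Subtype.val)))

theorem subGraph_edge {Γ : PGraph Y} {SV : Set Γ.V} {SE : Set Γ.E} {hb h} {e : Γ.E} (he : e ∈ SE)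
    {u v : SV} (hu : Γ.src e = u) (hv : Γ.tgt e = v) :
    (subGraph Γ SV SE hb h).Edge u (Γ.lab e) v :=
  ⟨⟨e, he⟩, Subtype.ext hu, rfl, Subtype.ext hv⟩

theorem Rep.subGraph {N : ℕ} {code : Y ≃ Fin N} {Γ : PGraph Y} {ι : Γ.V → ℕ}
    {E E' : EdgeSet} (hΓ : Rep code Γ ι E) {SV : Set Γ.V} {SE : Set Γ.E} {hb h}
    (hr : (Γ.subGraph SV SE hb h).Reach) (hE : E' ⊆ E)
    (hE' : ∀ e, e ∈ SE ↔ (ι (Γ.src e), (code (Γ.lab e) : ℕ), ι (Γ.tgt e)) ∈ E') :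
    Rep code (Γ.subGraph SV SE hb h) (fun v => ι v.1) E' := by
  have key : ∀ (u : (Γ.subGraph SV SE hb h).V) x (v : (Γ.subGraph SV SE hb h).V),
      (Γ.subGraph SV SE hb h).Edge u x v ↔ (ι u.1, (code x : ℕ), ι v.1) ∈ E' := by
    intro u x v
    constructor
    · rintro ⟨e, rfl, rfl, rfl⟩
      exact (hE' _).1 e.2
    · intro he
      obtain ⟨e, h1, rfl, h3⟩ := (hΓ.edge _ _ _).2 (hE he)
      exact subGraph_edge ((hE' e).2 (by rwa [h1, h3])) h1 h3
  refine ⟨fun u v huv => Subtype.ext (hΓ.inj huv), hΓ.base, subGraph_folded hΓ.folded, key, ?_,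
    fun e he => hΓ.lab e (hE he)⟩
  ext n
  constructor
  · rintro ⟨v, rfl⟩
    by_cases hv : v = (Γ.subGraph SV SE hb h).base
    · left; rw [hv]; exact hΓ.base
    · obtain ⟨u, x, h1 | h1⟩ := hr.exists_edge v hv
      · exact Or.inr ⟨_, (key _ _ _).1 h1, Or.inr rfl⟩
      · exact Or.inr ⟨_, (key _ _ _).1 h1, Or.inl rfl⟩
  · rintro (rfl | ⟨e, he, h1⟩)
    · exact ⟨⟨Γ.base, hb⟩, hΓ.base⟩
    · obtain ⟨_, _, _, ⟨e, rfl, rfl, rfl⟩, rfl⟩ := hΓ.exists_edge (hE he)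
      have := h e ((hE' e).2 he)
      rcases h1 with rfl | rfl
      · exact ⟨⟨_, this.1⟩, rfl⟩
      · exact ⟨⟨_, this.2⟩, rfl⟩

end PGraph

namespace FiniteAmalgam

open PGraph

variable {D : FiniteAmalgam}

/-! ### Hairs -/

theorem exists_cutHair {N : ℕ} {code : D.Gen ≃ Fin N} {Γ : D.Graph} {ι : Γ.V → ℕ}
    {E : EdgeSet} (hΓ : Rep code Γ ι E) (hr : Γ.Reach) {d : Γ.DEdge}
    (hb : Γ.ter d ≠ Γ.base) (hd : ∀ d', Γ.ini d' = Γ.ter d → d' = Γ.rev d) :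
    ∃ Γ' : D.Graph, CutHair Γ Γ' ∧ Γ'.Reach ∧
      (∃ ι', Rep code Γ' ι' {e ∈ E | e.1 ≠ ι (Γ.ter d) ∧ e.2.2 ≠ ι (Γ.ter d)}) ∧
      Lab Γ ⊆ Lab Γ' ∧ ∀ H, Over H Γ → Over H Γ' := by
  have hne : ∀ e, e ≠ d.1 → Γ.src e ≠ Γ.ter d ∧ Γ.tgt e ≠ Γ.ter d := fun e he =>
    ⟨fun h => he (congrArg Prod.fst (hd (e, true) h)),
      fun h => he (congrArg Prod.fst (hd (e, false) h))⟩
  have hde : Γ.src d.1 = Γ.ter d ∨ Γ.tgt d.1 = Γ.ter d := by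
    obtain ⟨e, b⟩ := d
    cases b
    · exact Or.inl rfl
    · exact Or.inr rfl
  set Γ' := Γ.subGraph {v | v ≠ Γ.ter d} {e | e ≠ d.1} hb.symm hne with hΓ'
  have key : ∀ n w, w.length = n → ∀ u v (hu : u ≠ Γ.ter d) (hv : v ≠ Γ.ter d), Γ.Reads u w v →
      ∃ w', Γ'.Reads ⟨u, hu⟩ w' ⟨v, hv⟩ ∧ D.val w' = D.val w := by
    intro n
    induction n using Nat.strong_induction_on with
    | _ n ih =>
      rintro (_ | ⟨l, w⟩) hn u v hu hv h
      · exact ⟨[], Subtype.ext h, rfl⟩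
      obtain ⟨d₁, rfl, rfl, h⟩ := h
      by_cases ht : Γ.ter d₁ = Γ.ter d
      · have e1 : Γ.rev d₁ = Γ.rev d := hd (Γ.rev d₁) (by
          rw [← ht]; obtain ⟨e, b⟩ := d₁; cases b <;> rfl)
        have e2 : d₁ = d := by
          obtain ⟨e, b⟩ := d₁
          obtain ⟨e', b'⟩ := d
          simpa [rev] using e1
        subst e2
        match w, h with
        | [], h => exact (hv (h.symm.trans ht)).elim
        | l₂ :: w, h =>
          obtain ⟨d₂, h1, rfl, h⟩ := h
          obtain rfl := hd d₂ h1
          have e3 : Γ.ter (Γ.rev d₁) = Γ.ini d₁ := by obtain ⟨e, b⟩ := d₁; cases b <;> rfl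
          rw [e3] at h
          simp only [List.length_cons] at hn
          obtain ⟨w', h2, h3⟩ := ih w.length (by omega) w rfl _ _ hu hv h
          refine ⟨w', h2, ?_⟩
          rw [h3, val_cons, val_cons, ← mul_assoc,
            show D.letterVal (Γ.dlab (Γ.rev d₁)) = _ from letterVal_not (Γ.lab d₁.1) d₁.2,
            show Γ.dlab d₁ = (Γ.lab d₁.1, d₁.2) from rfl, mul_inv_cancel, one_mul]
      · have e1 : d₁.1 ≠ d.1 := by
          intro h
          obtain ⟨e, b⟩ := d₁
          obtain ⟨e', b'⟩ := d
          obtain rfl : e = e' := h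
          cases b <;> cases b' <;> simp_all [ini, ter]
        simp only [List.length_cons] at hn
        obtain ⟨w', h2, h3⟩ := ih w.length (by omega) w rfl _ _ ht hv h
        refine ⟨Γ.dlab d₁ :: w', ⟨(⟨d₁.1, e1⟩, d₁.2), Subtype.ext ?_, rfl, ?_⟩, ?_⟩
        · obtain ⟨e, b⟩ := d₁; cases b <;> rfl
        · have : Γ'.ter (⟨d₁.1, e1⟩, d₁.2) = ⟨Γ.ter d₁, ht⟩ := by
            refine Subtype.ext ?_
            obtain ⟨e, b⟩ := d₁; cases b <;> rfl
          rwa [this]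
        · rw [val_cons, val_cons, h3]
  have hr' : Γ'.Reach := by
    rintro ⟨v, hv⟩
    obtain ⟨w, hw⟩ := hr v
    obtain ⟨w', h1, -⟩ := key _ w rfl _ _ hb.symm hv hw
    exact ⟨w', h1⟩
  refine ⟨Γ', ⟨d, hb, hd, isSub_subGraph _ _ _ _ _⟩, hr', ⟨_, hΓ.subGraph hr' (fun e he => he.1)
    fun e => ⟨fun he => ⟨(hΓ.edge _ _ _).1 (.mk e), ?_, ?_⟩, ?_⟩⟩, ?_,
    fun H h => h.sub (subHom _ _ _ _ _)⟩
  · exact fun h => (hne e he).1 (hΓ.inj h)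
  · exact fun h => (hne e he).2 (hΓ.inj h)
  · rintro ⟨-, h1, h2⟩ rfl
    rcases hde with h | h
    · exact h1 (congrArg ι h)
    · exact h2 (congrArg ι h)
  · rintro _ ⟨w, hw, rfl⟩
    exact key _ w rfl _ _ hb.symm hb.symm hw

/-! ### Redundant components -/

/-- The component of colour `i` at the bichromatic vertex `v` can be removed. -/
def Removable (Γ : D.Graph) (i : Fin 2) (v : Γ.V) : Prop :=
  Bichromatic Γ v ∧ (∀ g, g ∉ (D.φ i).range → ¬ Bichromatic Γ (act Γ i v g)) ∧
    ((∀ g, act Γ i v g ≠ Γ.base) ∨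
      (Bichromatic Γ Γ.base ∧ ∀ a, a ≠ 1 → act Γ i v (D.φ i a) ≠ v))

section

variable {Γ : D.Graph} (hF : Γ.Folded) (hC : Complete Γ) (hA : Compat Γ)

include hF hC

theorem monochromatic_iff {i : Fin 2} {v : Γ.V} (hv : HasCol Γ i v) :
    Monochromatic Γ i v ↔ ¬ Bichromatic Γ v := by
  constructor
  · intro h hb
    obtain ⟨d, h1, h2⟩ := hb (1 - i)
    have := h d h1
    omega
  · intro h d hd
    by_contra hne
    exact h (bichromatic_of_ne (Ne.symm hne) hv ⟨d, hd, rfl⟩)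

theorem act_eq_iff_stab {i : Fin 2} {v : Γ.V} (hv : HasCol Γ i v) (g h : D.Factor i) :
    act Γ i v g = act Γ i v h ↔ g * h⁻¹ ∈ stab Γ hF hC i v := by
  rw [mem_stab hF hC hv, act_eq_iff hF hC hv]

include hA in
/-- The orbit of `A` at a bichromatic vertex of a component. -/
theorem exists_orbit_map {e : Γ.E} {v : Γ.V} (hv : InComp Γ e v) (hb : Bichromatic Γ v)
    {K : Subgroup D.A} (hK : K.map (D.φ _) = stab Γ hF hC (col Γ e) v) :
    ∃ f : D.A ⧸ K → {u // InComp Γ e u ∧ Bichromatic Γ u}, Function.Injective f ∧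
      ∀ a : D.A, (f a).1 = act Γ (col Γ e) v (D.φ _ a⁻¹) := by
  have hv' := hasCol_of_inComp hF hC hv
  have key : ∀ a b : D.A, act Γ (col Γ e) v (D.φ _ a⁻¹) = act Γ (col Γ e) v (D.φ _ b⁻¹) ↔
      a⁻¹ * b ∈ K := by
    intro a b
    rw [act_eq_iff_stab hF hC hv', ← hK, ← map_inv, ← map_mul, inv_inv,
      Subgroup.mem_map_iff_mem (D.inj _)]
  refine ⟨Quotient.lift (fun a => ⟨act Γ (col Γ e) v (D.φ _ a⁻¹), inComp_act hF hC hv _,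
    bichromatic_act hC hA hb _ _⟩) fun a b hab => Subtype.ext ((key a b).2
      (QuotientGroup.leftRel_apply.1 hab)), ?_, fun a => rfl⟩
  intro a b
  induction a using Quotient.inductionOn'
  induction b using Quotient.inductionOn'
  intro hab
  exact QuotientGroup.eq.2 ((key _ _).1 (congrArg Subtype.val hab))

include hA in
theorem exists_removable {Δ : D.Graph} (h : RemoveComp Γ Δ) : ∃ i v, Removable Γ i v := by
  obtain ⟨e, v, hv, K, hb, hiso, hcard, hbase, -⟩ := h
  have hv' := hasCol_of_inComp hF hC hv
  have hK := (stab_of_iso hF hC hv hiso).symm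
  obtain ⟨f, h1, h2⟩ := exists_orbit_map hF hC hA hv hb hK
  have hfin : Finite D.A := by
    have := D.finG 0
    exact Finite.of_injective _ (D.inj 0)
  have hfin' : Finite {u // InComp Γ e u ∧ Bichromatic Γ u} := by
    refine Nat.finite_of_card_ne_zero ?_
    rw [hcard]
    exact Subgroup.index_ne_zero_of_finite
  have hbij : Function.Bijective f := (Nat.bijective_iff_injective_and_card f).2 ⟨h1, hcard.symm⟩
  refine ⟨col Γ e, v, hb, fun g hg hbg => hg ?_, ?_⟩
  · obtain ⟨a, ha⟩ := hbij.2 ⟨_, inComp_act hF hC hv g, hbg⟩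
    induction a using Quotient.inductionOn' with | _ a => ?_
    have h3 : act Γ (col Γ e) v (D.φ _ a⁻¹) = act Γ (col Γ e) v g :=
      (h2 a).symm.trans (congrArg Subtype.val ha)
    rw [eq_comm, act_eq_iff_stab hF hC hv', ← hK] at h3
    obtain ⟨b, -, h4⟩ := h3
    exact ⟨b * a⁻¹, by rw [map_mul, h4]; simp⟩
  · by_cases hc : InComp Γ e Γ.base
    · right
      rcases hbase with ⟨rfl, h3⟩ | ⟨-, h3⟩
      · refine ⟨?_, fun a ha h4 => ha ?_⟩
        · by_contra h4
          exact h3 ⟨hc, (monochromatic_iff hF hC (hasCol_of_inComp hF hC hc)).2 h4⟩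
        · rw [← mem_stab hF hC hv', ← hK, Subgroup.mem_map_iff_mem (D.inj _)] at h4
          exact h4
      · exact (h3 hc).elim
    · exact Or.inl fun g h3 => hc (h3 ▸ inComp_act hF hC hv g)

include hA in
theorem exists_removeComp {N : ℕ} {code : D.Gen ≃ Fin N} {ι : Γ.V → ℕ}
    {E : EdgeSet} (hΓ : Rep code Γ ι E) (hr : Γ.Reach) {i : Fin 2} {v : Γ.V}
    (h : Removable Γ i v) :
    ∃ Γ' : D.Graph, RemoveComp Γ Γ' ∧ Γ'.Reach ∧ Complete Γ' ∧ Compat Γ' ∧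
      (∃ ι', Rep code Γ' ι' {e ∈ E | ¬ ((∃ x : D.X i, e.2.1 = code ⟨i, x⟩) ∧
        ∃ g, e.1 = ι (act Γ i v g))}) ∧
      Lab Γ ⊆ Lab Γ' ∧ ∀ H, Over H Γ → Over H Γ' := by
  classical
  obtain ⟨hb, hg, hbase⟩ := h
  obtain ⟨d, hd1, hd2⟩ := hb i
  obtain ⟨e, b⟩ := d
  obtain rfl : col Γ e = i := hd2
  have hv : InComp Γ e v := by
    cases b
    · rw [← hd1]; exact .rel _ _ ⟨e, rfl, rfl, rfl⟩
    · rw [← hd1]; exact .refl _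
  clear hd1 b
  have hv' := hasCol_of_inComp hF hC hv
  set i := col Γ e with hi
  set SV : Set Γ.V := {u | ¬ (InComp Γ e u ∧ Monochromatic Γ i u)} with hSV
  set SE : Set Γ.E := {e' | ¬ SameComp Γ e e'} with hSE
  -- an edge of colour `k` that is not removed begins at `u`
  let Al : Fin 2 → Γ.V → Prop := fun k u => HasCol Γ k u ∧ ¬ (k = i ∧ InComp Γ e u)
  have hAl : ∀ {k u}, Al k u → u ∈ SV := by
    rintro k u ⟨⟨d, h1, rfl⟩, h2⟩ ⟨h3, h4⟩
    exact h2 ⟨h4 d h1, h3⟩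
  have hAls : ∀ {e'}, e' ∈ SE → Al (col Γ e') (Γ.src e') := fun {e'} he =>
    ⟨hasCol_src e', fun h => he h⟩
  have hAlt : ∀ {e'}, e' ∈ SE → Al (col Γ e') (Γ.tgt e') := fun {e'} he =>
    ⟨hasCol_tgt e', fun h => he ⟨h.1, ConnIn.trans h.2
      (ConnIn.symm (.rel _ _ ⟨e', h.1, rfl, rfl⟩))⟩⟩
  have hwf : ∀ e' ∈ SE, Γ.src e' ∈ SV ∧ Γ.tgt e' ∈ SV := fun e' he => ⟨hAl (hAls he), hAl (hAlt he)⟩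
  have hbSV : Γ.base ∈ SV := by
    rintro ⟨h1, h2⟩
    rcases hbase with h | h
    · obtain ⟨g, h3⟩ := (inComp_iff hF hC hv).1 h1
      exact h g h3.symm
    · exact (monochromatic_iff hF hC (hasCol_of_inComp hF hC h1)).1 h2 h.1
  have hact : ∀ {k u} (g : D.Factor k), Al k u → Al k (act Γ k u g) := by
    rintro k u g ⟨h1, h2⟩
    refine ⟨hasCol_act hC h1 g, ?_⟩
    rintro ⟨rfl, h3⟩
    refine h2 ⟨rfl, ConnIn.trans h3 (ConnIn.symm ?_)⟩
    exact (connIn_iff hF hC h1).2 ⟨g, rfl⟩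
  set Γ' : D.Graph := Γ.subGraph SV SE hbSV hwf with hΓ'
  have horb : ∀ {k u} (h : Al k u), IsOrbit Γ'.Edge k
      fun g => ⟨act Γ k u g, hAl (hact g h)⟩ := by
    intro k u h g x
    obtain ⟨e', h1, h2, h3⟩ := act_isOrbit hC h.1 g x
    have hc : col Γ e' = k := by rw [col, h2]
    have : e' ∈ SE := fun h4 => (hact g h).2 ⟨hc.symm.trans h4.1, h1 ▸ h4.2⟩
    have h5 := subGraph_edge (hb := hbSV) (h := hwf) this (u := ⟨_, hAl (hact g h)⟩)
      (v := ⟨_, hAl (hact _ h)⟩) h1 h3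
    rw [h2] at h5
    exact h5
  have hcol : ∀ {k} {u : Γ'.V}, HasCol Γ' k u → Al k u.1 := by
    rintro k _ ⟨⟨e', b⟩, rfl, rfl⟩
    cases b
    · exact hAlt e'.2
    · exact hAls e'.2
  have hF' : Γ'.Folded := subGraph_folded hF
  have hC' : Complete Γ' := by
    intro k u hu
    exact ⟨_, Subtype.ext act_one, horb (hcol hu)⟩
  have hact' : ∀ {k} {u : Γ'.V} (hu : HasCol Γ' k u) g, (act Γ' k u g).1 = act Γ k u.1 g := by
    intro k u hu g
    rw [← eq_act hF' hC' hu (Subtype.ext act_one) (horb (hcol hu)) g]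
  have hA' : Compat Γ' := by
    intro u hu k l a
    refine Subtype.ext ?_
    rw [hact' (hu k), hact' (hu l)]
    exact hA _ (fun m => (hcol (hu m)).1) k l a
  have key : ∀ n L, L.length = n → ∀ u v (hu : u ∈ SV) (hv : v ∈ SV), SPath Γ u L v →
      ∃ w, Γ'.Reads ⟨u, hu⟩ w ⟨v, hv⟩ ∧ D.val w = sval L := by
    intro n
    induction n using Nat.strong_induction_on with
    | _ n ih =>
      rintro (_ | ⟨⟨k, g⟩, L⟩) hn u w hu hw h
      · rw [SPath] at h
        exact ⟨[], Subtype.ext h, rfl⟩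
      obtain ⟨hku, h⟩ := h
      simp only [List.length_cons] at hn
      have step : ∀ {k' : Fin 2} (g' : D.Factor k'), Al k' u → act Γ k' u g' = act Γ k u g →
          inc k' g' = inc k g → ∃ w', Γ'.Reads ⟨u, hu⟩ w' ⟨w, hw⟩ ∧
            D.val w' = sval (⟨k, g⟩ :: L) := by
        intro k' g' hal h1 h2
        have h3 := h1 ▸ hAl (hact g' hal)
        obtain ⟨w₂, h4, h5⟩ := ih L.length (by omega) L rfl _ _ h3 hw h
        obtain ⟨w₁, rfl⟩ := valIn_surjective k' g'
        have h6 := (horb hal).reads 1 w₁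
        refine ⟨D.tag k' w₁ ++ w₂, reads_append.2 ⟨⟨_, h3⟩, ?_, h4⟩, ?_⟩
        · have h7 : (⟨act Γ k' u 1, hAl (hact 1 hal)⟩ : Γ'.V) = ⟨u, hu⟩ := Subtype.ext act_one
          have h8 : (⟨act Γ k' u (1 * D.valIn k' w₁), hAl (hact _ hal)⟩ : Γ'.V) = ⟨_, h3⟩ :=
            Subtype.ext (by rw [one_mul]; exact h1)
          rwa [h7, h8] at h6
        · rw [val_append, val_tag, h2, h5]
          simp [sval]
      by_cases hal : Al k u
      · exact step g hal rfl rfl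
      obtain ⟨rfl, hin⟩ : k = i ∧ InComp Γ e u := by
        by_contra h1; exact hal ⟨hku, h1⟩
      have hbu : Bichromatic Γ u := by
        by_contra h1
        exact hu ⟨hin, (monochromatic_iff hF hC hku).2 h1⟩
      by_cases hbg : Bichromatic Γ (act Γ i u g)
      · have : g ∈ (D.φ i).range := by
          obtain ⟨x, rfl⟩ := (inComp_iff hF hC hv).1 hin
          have h1 : x ∈ (D.φ i).range := by
            by_contra h1; exact hg x h1 hbu
          rw [act_act hF hC hv'] at hbg
          have h2 : x * g ∈ (D.φ i).range := by
            by_contra h2; exact hg _ h2 hbg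
          simpa using mul_mem (inv_mem h1) h2
        obtain ⟨a, rfl⟩ := this
        refine step (k' := 1 - i) (D.φ _ a) ⟨hbu _, fun h1 => ?_⟩ (hA u hbu _ _ a) (inc_φ _ _ a)
        omega
      · have hin' : InComp Γ e (act Γ i u g) := inComp_act hF hC hin g
        have hm := (monochromatic_iff hF hC (hasCol_act hC hku g)).2 hbg
        match L, h, hn, ih with
        | [], h, hn, ih =>
          rw [SPath] at h
          exact (hw (h ▸ ⟨hin', hm⟩)).elim
        | ⟨l, x⟩ :: L, ⟨h1, h2⟩, hn, ih =>
          obtain rfl : l = i := by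
            by_contra hne
            exact hbg (bichromatic_of_ne (Ne.symm hne) (hasCol_act hC hku g) h1)
          simp only at h2
          rw [act_act hF hC hku] at h2
          obtain ⟨w', h3, h4⟩ := ih (L.length + 1) (by simp only [List.length_cons] at hn; omega)
            (⟨i, g * x⟩ :: L) rfl u w hu hw ⟨hku, h2⟩
          refine ⟨w', h3, h4.trans ?_⟩
          simp [sval, mul_assoc]
  have hreads : ∀ {u v w} (hu : u ∈ SV) (hv : v ∈ SV), Γ.Reads u w v →
      ∃ w', Γ'.Reads ⟨u, hu⟩ w' ⟨v, hv⟩ ∧ D.val w' = D.val w := by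
    intro u v w hu hv h
    obtain ⟨L, h1, h2⟩ := exists_sPath hF hC h
    rw [← h2]
    exact key _ L rfl _ _ hu hv h1
  have hr' : Γ'.Reach := by
    rintro ⟨v, hv⟩
    obtain ⟨w, hw⟩ := hr v
    obtain ⟨w', h1, -⟩ := hreads hbSV hv hw
    exact ⟨w', h1⟩
  refine ⟨Γ', ?_, hr', hC', hA', ⟨_, hΓ.subGraph hr' (fun e he => he.1) fun e' => ?_⟩, ?_,
    fun H h => h.sub (subHom _ _ _ _ _)⟩
  · have hK : (((stab Γ hF hC i v).comap (D.φ i)).map (D.φ i)) = stab Γ hF hC i v := by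
      refine Subgroup.map_comap_eq_self fun g hgs => ?_
      by_contra h1
      have h2 := hg g h1
      rw [(mem_stab hF hC hv').1 hgs] at h2
      exact h2 hb
    refine ⟨e, v, hv, (stab Γ hF hC i v).comap (D.φ i), hb, ?_, ?_, ?_, isSub_subGraph _ _ _ _ _⟩
    · rw [hK]; exact iso_component hF hC hv
    · obtain ⟨f, h1, h2⟩ := exists_orbit_map hF hC hA hv hb hK
      refine (Nat.card_congr (Equiv.ofBijective f ⟨h1, ?_⟩)).symm
      rintro ⟨u, hu, hbu⟩
      obtain ⟨g, rfl⟩ := (inComp_iff hF hC hv).1 hu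
      have : g ∈ (D.φ i).range := by
        by_contra h3; exact hg g h3 hbu
      obtain ⟨a, rfl⟩ := this
      exact ⟨Quotient.mk'' a⁻¹, Subtype.ext (by
        have := h2 a⁻¹
        rw [inv_inv] at this
        exact this)⟩
    · rcases hbase with h | ⟨h1, h2⟩
      · have : ¬ InComp Γ e Γ.base := by
          intro h1
          obtain ⟨g, h3⟩ := (inComp_iff hF hC hv).1 h1
          exact h g h3.symm
        by_cases hK : (stab Γ hF hC i v).comap (D.φ i) = ⊥
        · exact Or.inl ⟨hK, fun h => this h.1⟩
        · exact Or.inr ⟨hK, this⟩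
      · refine Or.inl ⟨?_, fun h => hbSV h⟩
        rw [Subgroup.eq_bot_iff_forall]
        intro a ha
        by_contra h3
        exact h2 a h3 ((mem_stab hF hC hv').1 ha)
  · have h1 : SameComp Γ e e' ↔ (∃ x : D.X i, (code (Γ.lab e') : ℕ) = code ⟨i, x⟩) ∧
        ∃ g, ι (Γ.src e') = ι (act Γ i v g) := by
      constructor
      · rintro ⟨h1, h2⟩
        refine ⟨?_, ?_⟩
        · obtain ⟨⟨k, x⟩, h3⟩ : ∃ l : D.Gen, l = Γ.lab e' := ⟨_, rfl⟩
          rw [← h3]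
          have h4 : k = i := by rw [hi, ← h1, col, ← h3]
          subst h4
          exact ⟨x, rfl⟩
        · obtain ⟨g, h3⟩ := (inComp_iff hF hC hv).1 h2
          exact ⟨g, congrArg ι h3⟩
      · rintro ⟨⟨x, h1⟩, g, h2⟩
        refine ⟨?_, ?_⟩
        · rw [col, code.injective (Fin.ext h1)]
        · rw [hΓ.inj h2]; exact inComp_act hF hC hv g
    rw [Set.mem_sep_iff, ← h1]
    exact ⟨fun h => ⟨(hΓ.edge _ _ _).1 (.mk e'), h⟩, fun h => h.2⟩
  · rintro _ ⟨w, hw, rfl⟩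
    exact hreads hbSV hbSV hw

end


/-! ### Isomorphisms -/

/-- The graph is a Cayley graph of a factor, or has no edges. -/
def IsFree (Γ : D.Graph) : Prop :=
  (∀ v, ¬ Bichromatic Γ v) ∧ ∀ i, HasCol Γ i Γ.base → ∀ g, g ≠ 1 → act Γ i Γ.base g ≠ Γ.base

section

variable {Γ Δ : D.Graph} (hC : Complete Γ) (hF' : Δ.Folded) {g : Hom Γ Δ}
  (hV : Function.Bijective g.onV) (hE : Function.Bijective g.onE)

include hV hE

theorem hasCol_map_iff {i : Fin 2} {v : Γ.V} : HasCol Δ i (g.onV v) ↔ HasCol Γ i v := by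
  refine ⟨fun h => ?_, fun h => h.map g⟩
  obtain ⟨x, w, h⟩ := hasCol_iff.1 h
  obtain ⟨w, rfl⟩ := hV.2 w
  rw [g.edge_iff hV.1 hE.2, g.edge_iff hV.1 hE.2] at h
  exact hasCol_iff.2 ⟨x, w, h⟩

theorem bichromatic_map_iff {v : Γ.V} : Bichromatic Δ (g.onV v) ↔ Bichromatic Γ v :=
  forall_congr' fun _ => hasCol_map_iff hV hE

include hC hF'

theorem Compat.of_iso (hA : Compat Γ) : Compat Δ := by
  intro v hv i j a
  obtain ⟨v, rfl⟩ := hV.2 v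
  rw [bichromatic_map_iff hV hE] at hv
  have hC' := hC.of_hom g hE.2
  rw [← map_act hC hF' hC' g (hv i), ← map_act hC hF' hC' g (hv j), hA v hv i j]

theorem Removable.of_iso {i : Fin 2} {v : Γ.V} (h : Removable Δ i (g.onV v)) : Removable Γ i v := by
  have hC' := hC.of_hom g hE.2
  obtain ⟨h1, h2, h3⟩ := h
  have hb := (bichromatic_map_iff hV hE).1 h1
  refine ⟨hb, fun x hx h => h2 x hx ?_, ?_⟩
  · rw [← map_act hC hF' hC' g (hb i), bichromatic_map_iff hV hE]
    exact h
  · simp only [← map_act hC hF' hC' g (hb i), ← g.onV_base, bichromatic_map_iff hV hE, ne_eq,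
      hV.1.eq_iff] at h3
    exact h3

theorem IsFree.of_iso (h : IsFree Δ) : IsFree Γ := by
  have hC' := hC.of_hom g hE.2
  refine ⟨fun v hv => h.1 _ ((bichromatic_map_iff hV hE).2 hv), fun i hi x hx he => ?_⟩
  refine h.2 i (g.onV_base ▸ hi.map g) x hx ?_
  rw [← g.onV_base, ← map_act hC hF' hC' g hi, he]

end

/-! ### The end of the removal of redundant components -/

theorem isFree_of_iso {Γ : D.Graph} (hC : Complete Γ)
    (h : (∀ v, ¬ Bichromatic Γ v) ∧ ∃ i, Iso Γ (D.cayley i)) : IsFree Γ := by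
  obtain ⟨h, i, f, hV, hE⟩ := h
  refine ⟨h, fun k hk g hg he => hg ?_⟩
  obtain rfl : k = i := by
    obtain ⟨x, w, h | h⟩ := hasCol_iff.1 hk
    · obtain ⟨e, -, h, -⟩ := f.edge h
      exact (congrArg Sigma.fst h).symm
    · obtain ⟨e, -, h, -⟩ := f.edge h
      exact (congrArg Sigma.fst h).symm
  have h1 : IsOrbit (D.cayley k).Edge k fun g => f.onV (act Γ k Γ.base g) :=
    fun g x => f.edge (act_isOrbit hC hk g x)
  have h2 := h1.unique (cayley_folded k).detRel (m' := fun g => g) (cayley_edge k)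
    ((congrArg f.onV act_one).trans f.onV_base) g
  simp only [he] at h2
  exact h2.symm.trans f.onV_base

theorem IsFree.exists_iso {Γ : D.Graph} (hF : Γ.Folded) (hC : Complete Γ) (hr : Γ.Reach)
    (h : IsFree Γ) (e : Γ.E) : ∃ i, Iso Γ (D.cayley i) := by
  obtain ⟨h1, h2⟩ := h
  obtain ⟨i, hi⟩ : ∃ i, HasCol Γ i Γ.base := by
    obtain ⟨w, hw⟩ := hr (Γ.src e)
    match w, hw with
    | [], hw => exact ⟨col Γ e, (show Γ.base = Γ.src e from hw) ▸ hasCol_src e⟩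
    | l :: w, hw =>
      obtain ⟨d, h3, -, -⟩ := hw
      exact ⟨_, d, h3, rfl⟩
  have hall : ∀ u, ∃ g, u = act Γ i Γ.base g := by
    have : ∀ L u v, SPath Γ u L v → (∃ g, u = act Γ i Γ.base g) → ∃ g, v = act Γ i Γ.base g := by
      intro L
      induction L with
      | nil => intro u v h; rw [SPath] at h; exact h ▸ id
      | cons s L ih =>
        obtain ⟨k, x⟩ := s
        rintro _ v ⟨h3, h4⟩ ⟨g, rfl⟩
        obtain rfl : k = i := by
          by_contra hne
          exact h1 _ (bichromatic_of_ne hne h3 (hasCol_act hC hi g))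
        exact ih _ _ h4 ⟨g * x, act_act hF hC hi g x⟩
    intro u
    obtain ⟨w, hw⟩ := hr u
    obtain ⟨L, h3, -⟩ := exists_sPath hF hC hw
    exact this L _ _ h3 ⟨1, by rw [act_one]⟩
  have hinj : ∀ g k : D.Factor i, act Γ i Γ.base g = act Γ i Γ.base k → g = k := by
    intro g k hgk
    by_contra hne
    exact h2 i hi (g * k⁻¹) (by rwa [Ne, mul_inv_eq_one]) ((act_eq_iff hF hC hi g k).1 hgk)
  refine ⟨i, (iso_of_bijective (cayley_folded i) hF (fun g => act Γ i Γ.base g)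
    ⟨hinj, fun u => ?_⟩ ?_ act_one).symm⟩
  · obtain ⟨g, rfl⟩ := hall u
    exact ⟨g, rfl⟩
  · intro u x v
    constructor
    · rintro ⟨⟨g, y⟩, rfl, rfl, rfl⟩
      exact act_isOrbit hC hi g y
    · intro h3
      obtain ⟨k, x⟩ := x
      obtain rfl : k = i := by
        by_contra hne
        exact h1 _ (bichromatic_of_ne hne (hasCol_iff.2 ⟨x, _, Or.inl h3⟩) (hasCol_act hC hi u))
      have h4 := hF.tgt_eq h3 (act_isOrbit hC hi u x)
      rw [hinj v _ h4]
      exact cayley_edge k u x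

theorem Rep.subsingleton {Y : Type} {N : ℕ} {code : Y ≃ Fin N} {Γ : PGraph Y} {ι : Γ.V → ℕ}
    (h : Rep code Γ ι ∅) : (∀ v, v = Γ.base) ∧ IsEmpty Γ.E := by
  refine ⟨fun v => h.inj ?_, ⟨fun e => ((h.edge _ _ _).1 (.mk e)).elim⟩⟩
  have : ι v ∈ RAM.verts ∅ := h.range ▸ ⟨v, rfl⟩
  rcases this with h1 | ⟨e, he, -⟩
  · rw [h1, h.base]
  · exact he.elim

theorem step5_of_free {N : ℕ} {code : D.Gen ≃ Fin N} {Γ Δ Γ' : D.Graph} {ι : Δ.V → ℕ}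
    {ι' : Γ'.V → ℕ} {E : EdgeSet} (h1 : Relation.ReflTransGen RemoveComp Γ Δ)
    (h2 : ∀ Δ', ¬ RemoveComp Δ Δ') (hΔ : Rep code Δ ι E) (hC : Complete Δ) (hr : Δ.Reach)
    (hf : IsFree Δ) (h' : Rep code Γ' ι' ∅) : Step5 Γ Γ' ∧ Lab Γ' = {1} := by
  obtain ⟨h3, h4⟩ := Rep.subsingleton h'
  refine ⟨⟨Δ, ⟨Δ, h1, Iso.refl Δ, h2⟩, ?_⟩, ?_⟩
  swap
  · ext g
    constructor
    · rintro ⟨w, hw, rfl⟩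
      match w, hw with
      | [], _ => rfl
      | l :: w, ⟨d, _⟩ => exact (h4.false d.1).elim
    · rintro rfl
      exact ⟨[], rfl, rfl⟩
  by_cases hE : Nonempty Δ.E
  · obtain ⟨e⟩ := hE
    refine Or.inl ⟨⟨hf.1, hf.exists_iso hΔ.folded hC hr e⟩, ?_⟩
    refine ⟨⟨fun _ => Δ.base, fun e => (h4.false e).elim, fun e => (h4.false e).elim,
      fun e => (h4.false e).elim, fun e => (h4.false e).elim, rfl⟩, fun u v _ => ?_,
      fun e => (h4.false e).elim, ?_, ?_⟩
    · rw [h3 u, h3 v]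
    · ext v
      exact ⟨by rintro ⟨_, rfl⟩; rfl, fun h => ⟨Γ'.base, h.symm⟩⟩
    · ext e
      exact ⟨by rintro ⟨e, -⟩; exact (h4.false e).elim, fun h => h.elim⟩
  · rw [not_nonempty_iff] at hE
    have h5 : ∀ v, v = Δ.base := fun v => by
      by_contra hv
      obtain ⟨u, x, ⟨e, -⟩ | ⟨e, -⟩⟩ := hr.exists_edge v hv <;> exact hE.false e
    let k : Hom Γ' Δ := ⟨fun _ => Δ.base, fun e => (h4.false e).elim, fun e => (h4.false e).elim,
      fun e => (h4.false e).elim, fun e => (h4.false e).elim, rfl⟩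
    have hk : Function.Injective k.onV := fun u v _ => by rw [h3 u, h3 v]
    by_cases hi : (∀ v, ¬ Bichromatic Δ v) ∧ ∃ i, Iso Δ (D.cayley i)
    · refine Or.inl ⟨hi, k, hk, fun e => (h4.false e).elim, ?_, ?_⟩
      · ext v
        exact ⟨by rintro ⟨_, rfl⟩; rfl, fun h => ⟨Γ'.base, h.symm⟩⟩
      · ext e
        exact ⟨by rintro ⟨e, -⟩; exact (h4.false e).elim, fun h => h.elim⟩
    · refine Or.inr ⟨hi, Iso.symm ⟨k, ⟨hk, fun v => ⟨Γ'.base, (h5 v).symm⟩⟩,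
        fun e => (h4.false e).elim, fun e => (hE.false e).elim⟩⟩

/-! ### Reduced precovers -/

theorem isReducedPrecover {Γ : D.Graph} (hF : Γ.Folded) (hC : Complete Γ) (hA : Compat Γ)
    (hr : Γ.Reach) (h1 : ∀ i v, ¬ Removable Γ i v) (h2 : IsFree Γ → IsEmpty Γ.E)
    (h3 : ∀ i, HasCol Γ i Γ.base → ∀ a, a ≠ 1 → act Γ i Γ.base (D.φ i a) = Γ.base →
      Bichromatic Γ Γ.base) : IsReducedPrecover Γ := by
  refine ⟨isPrecover hF hC hA hr, fun e he => ?_, fun e hb ⟨a, ha, hab⟩ => ?_⟩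
  · rcases he with ⟨h4, h5⟩ | ⟨-, v, hv, hb, h4, h5, h6⟩
    · have hcol : ∀ e', col Γ e' = col Γ e := fun e' => (h4 e').1
      refine (h2 ⟨fun v hv => ?_, fun i hi g hg he => hg ?_⟩).false e
      · obtain ⟨d, -, h7⟩ := hv 0
        obtain ⟨d', -, h8⟩ := hv 1
        rw [hcol] at h7 h8
        omega
      · obtain rfl : i = col Γ e := by
          obtain ⟨d, -, h7⟩ := hi
          rw [← h7, hcol]
        have : g ∈ compLab Γ (col Γ e) Γ.base := by
          rw [compLab_eq hF hC hi, SetLike.mem_coe, mem_stab hF hC hi]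
          exact he
        rw [h5] at this
        exact this
    · have hv' := hasCol_of_inComp hF hC hv
      have hst : ∀ g, act Γ (col Γ e) v g = v → g ∈ compLab Γ (col Γ e) v := fun g hg => by
        rw [compLab_eq hF hC hv', SetLike.mem_coe, mem_stab hF hC hv']
        exact hg
      refine h1 (col Γ e) v ⟨hb, fun g hg hbg => hg ?_, ?_⟩
      · obtain ⟨a, ha⟩ := (h5 _).1 ⟨inComp_act hF hC hv g, hbg⟩
        have h7 := (colPath_iff hF hC hv').1 ha
        rw [act_eq_iff hF hC hv'] at h7
        obtain ⟨b, hb⟩ := h4 (hst _ h7)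
        exact ⟨b * a, by rw [map_mul, hb]; simp⟩
      · rcases h6 with h6 | ⟨-, h6, h7⟩
        · exact Or.inl fun g hg => h6 (hg ▸ inComp_act hF hC hv g)
        · refine Or.inr ⟨h6, fun a ha hav => ha ?_⟩
          have := hst _ hav
          rw [h7] at this
          exact D.inj _ (by rw [map_one]; exact this)
  · have hb' := hasCol_of_inComp hF hC hb
    rw [compLab_eq hF hC hb', SetLike.mem_coe, mem_stab hF hC hb'] at hab
    have hbi := h3 _ hb' a ha hab
    obtain ⟨⟨e', b⟩, h5, h6⟩ := hbi (1 - col Γ e)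
    refine ⟨e', ?_, by simp only at h6; omega, fun c => ?_⟩
    · cases b
      · rw [← h5]; exact .rel _ _ ⟨e', rfl, rfl, rfl⟩
      · rw [← h5]; exact .refl _
    · rw [compLab_eq hF hC hb', compLab_eq hF hC (hbi _), SetLike.mem_coe, SetLike.mem_coe,
        mem_stab hF hC hb', mem_stab hF hC (hbi _), hA _ hbi _ (col Γ e')]


/-! ### Gluing a relative Cayley graph at the basepoint -/

/-- The graph `Γ'` is obtained from `Γ` by gluing a relative Cayley graph of colour `j` at the
basepoint: its vertices are the images of the vertices of `Γ` under `h` and the vertices `m g`. -/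
structure Glued (Γ Γ' : D.Graph) (i j : Fin 2) (h : Hom Γ Γ') (m : D.Factor j → Γ'.V) : Prop where
  ne : j ≠ i
  hasCol : HasCol Γ i Γ.base
  not_hasCol : ¬ HasCol Γ j Γ.base
  inj : Function.Injective h.onV
  orbit : IsOrbit Γ'.Edge j m
  eq : ∀ a, m (D.φ j a) = h.onV (act Γ i Γ.base (D.φ i a))
  exists_of_eq : ∀ u g, h.onV u = m g → ∃ a, u = act Γ i Γ.base (D.φ i a)
  edge : ∀ e, (∃ e₀, h.onE e₀ = e) ∨
    ∃ g, ∃ x : D.X j, Γ'.src e = m g ∧ Γ'.lab e = ⟨j, x⟩ ∧ Γ'.tgt e = m (g * PresentedGroup.of x)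

section

variable {Γ Γ' : D.Graph} {i j : Fin 2} {h : Hom Γ Γ'} {m : D.Factor j → Γ'.V}
  (hG : Glued Γ Γ' i j h m) (hF : Γ.Folded) (hC : Complete Γ) (hA : Compat Γ) (hF' : Γ'.Folded)

include hG hF'

omit hF' in
theorem Glued.exists_of_hasCol {k : Fin 2} {v : Γ'.V} (hv : HasCol Γ' k v) :
    (∃ u, v = h.onV u ∧ HasCol Γ k u) ∨ (k = j ∧ ∃ g, v = m g) := by
  obtain ⟨⟨e, b⟩, rfl, rfl⟩ := hv
  rcases hG.edge e with ⟨e, rfl⟩ | ⟨g, x, h1, h2, h3⟩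
  · left
    refine ⟨Γ.ini (e, b), ?_, (e, b), rfl, by rw [col, col, h.lab_onE]⟩
    cases b
    · exact h.tgt_onE e
    · exact h.src_onE e
  · right
    refine ⟨by rw [col, h2], ?_⟩
    cases b
    · exact ⟨_, h3⟩
    · exact ⟨_, h1⟩

include hC in
theorem Glued.complete : Complete Γ' := by
  refine complete_of_src (fun e => ?_) hF'
  rcases hG.edge e with ⟨e, rfl⟩ | ⟨g, x, h1, h2, h3⟩
  · rw [col, h.lab_onE, h.src_onE]
    obtain ⟨k, h1, h2⟩ := hC _ _ (hasCol_src e)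
    exact ⟨fun g => h.onV (k g), congrArg h.onV h1, fun x y => h.edge (h2 x y)⟩
  · rw [col, h2, h1]
    exact ⟨_, by simp only [mul_one], hG.orbit.shift g⟩

omit hF' in
theorem Glued.hasCol_m (g : D.Factor j) (x : D.X j) : HasCol Γ' j (m g) :=
  hasCol_iff.2 ⟨x, _, Or.inl (hG.orbit g x)⟩

omit hF' in
theorem Glued.exists_of_bichromatic {v : Γ'.V} (hv : Bichromatic Γ' v) :
    ∃ u, v = h.onV u ∧ (Bichromatic Γ u ∨ ∃ a, u = act Γ i Γ.base (D.φ i a)) := by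
  rcases hG.exists_of_hasCol (hv i) with ⟨u, rfl, hu⟩ | ⟨h1, -⟩
  · refine ⟨u, rfl, ?_⟩
    rcases hG.exists_of_hasCol (hv j) with ⟨u', h1, hu'⟩ | ⟨-, g, h1⟩
    · rw [← hG.inj h1] at hu'
      exact Or.inl (bichromatic_of_ne hG.ne hu' hu)
    · exact Or.inr (hG.exists_of_eq _ _ h1)
  · exact (hG.ne h1.symm).elim

variable {a₀ : D.A} (ha : a₀ ≠ 1) (ha' : act Γ i Γ.base (D.φ i a₀) = Γ.base)

include ha in
omit hF' in
theorem Glued.exists_gen : Nonempty (D.X j) := by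
  by_contra hX
  rw [not_nonempty_iff] at hX
  obtain ⟨w, hw⟩ := valIn_surjective j (D.φ j a₀)
  match w with
  | [] => exact ha (D.inj j (by rw [map_one, ← hw, valIn_nil]))
  | l :: _ => exact hX.false l.1

include hF hC hA ha

theorem Glued.compat : Compat Γ' := by
  have hC' := hG.complete hC hF'
  obtain ⟨x₀⟩ := hG.exists_gen ha
  have key : ∀ v, Bichromatic Γ' v → ∀ b, act Γ' i v (D.φ i b) = act Γ' j v (D.φ j b) := by
    intro v hv b
    obtain ⟨u, rfl, hu | ⟨a, rfl⟩⟩ := hG.exists_of_bichromatic hv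
    · rw [← map_act hC hF' hC' h (hu i), ← map_act hC hF' hC' h (hu j), hA u hu i j]
    · have h1 : act Γ' j (h.onV (act Γ i Γ.base (D.φ i a))) (D.φ j b) = m (D.φ j a * D.φ j b) := by
        rw [← hG.eq]
        exact (eq_act (m := fun g => m (D.φ j a * g)) hF' hC' (hG.hasCol_m _ x₀)
          (by simp only [mul_one]) (hG.orbit.shift _) _).symm
      rw [h1, ← map_mul, hG.eq, ← map_act hC hF' hC' h (hasCol_act hC hG.hasCol _),
        act_act hF hC hG.hasCol, map_mul]
  intro v hv k l a
  have h1 : ∀ k, k = i ∨ k = j := fun k => by have := hG.ne; omega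
  rcases h1 k with rfl | rfl <;> rcases h1 l with rfl | rfl
  exacts [rfl, key v hv a, (key v hv a).symm, rfl]

theorem Glued.bichromatic_base : Bichromatic Γ' Γ'.base := by
  obtain ⟨x₀⟩ := hG.exists_gen ha
  have h1 : m 1 = Γ'.base := by
    have := hG.eq 1
    rwa [map_one, map_one, act_one, h.onV_base] at this
  exact bichromatic_of_ne hG.ne (h1 ▸ hG.hasCol_m 1 x₀) (h.onV_base ▸ hG.hasCol.map h)

include ha' in
theorem Glued.not_removable (hR : ∀ k v, ¬ Removable Γ k v) (k : Fin 2) (v : Γ'.V) :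
    ¬ Removable Γ' k v := by
  rintro ⟨hv, h1, h2⟩
  have hC' := hG.complete hC hF'
  have hA' := hG.compat hF hC hA hF' ha
  have hb := hG.bichromatic_base hF hC hA hF' ha
  by_cases hg : ∃ g, act Γ' k v g = Γ'.base
  · obtain ⟨g, hg⟩ := hg
    rcases h2 with h2 | ⟨-, h2⟩
    · exact h2 g hg
    · have h3 : g ∈ (D.φ k).range := by
        by_contra h3
        exact h1 g h3 (hg ▸ hb)
      obtain ⟨b, rfl⟩ := h3
      refine h2 (b * a₀ * b⁻¹) (by simpa using ha) ?_
      have h4 : act Γ' k Γ'.base (D.φ k a₀) = Γ'.base := by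
        rw [hA' _ hb k i, ← h.onV_base, ← map_act hC hF' hC' h hG.hasCol, ha']
      rw [map_mul, map_mul, ← act_act hF' hC' (hv k), ← act_act hF' hC' (hv k), hg, h4, ← hg,
        act_act hF' hC' (hv k), ← map_mul, mul_inv_cancel, map_one, act_one]
  · push Not at hg
    obtain ⟨u, rfl, hu | ⟨a, rfl⟩⟩ := hG.exists_of_bichromatic hv
    · refine hR k u ⟨hu, fun g hgr hbg => h1 g hgr ?_, Or.inl fun g hgb => hg g ?_⟩
      · rw [← map_act hC hF' hC' h (hu k)]
        exact fun l => HasCol.map h (hbg l)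
      · rw [← map_act hC hF' hC' h (hu k), hgb, h.onV_base]
    · refine hg (D.φ k a⁻¹) ?_
      rw [map_act hC hF' hC' h hG.hasCol, h.onV_base, hA' _ hb i k, act_act hF' hC' (hb k),
        ← map_mul, mul_inv_cancel, map_one, act_one]

end

theorem step6_glue {N : ℕ} {code : D.Gen ≃ Fin N} {Γ : D.Graph} {ι : Γ.V → ℕ}
    {E : EdgeSet} (hΓ : Rep code Γ ι E) (hC : Complete Γ) (hA : Compat Γ) (hr : Γ.Reach)
    (hR : ∀ k v, ¬ Removable Γ k v) {i j : Fin 2} (hij : j ≠ i) (hi : HasCol Γ i Γ.base)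
    (hj : ¬ HasCol Γ j Γ.base) {L : Subgroup D.A}
    (hL : ∀ a, a ∈ L ↔ act Γ i Γ.base (D.φ i a) = Γ.base) (hL' : L ≠ ⊥) {nm : D.Factor j → ℕ}
    (h1 : ∀ g g', nm g = nm g' ↔ g' * g⁻¹ ∈ L.map (D.φ j))
    (h2 : ∀ a, nm (D.φ j a) = ι (act Γ i Γ.base (D.φ i a)))
    (h3 : ∀ g, g ∉ (D.φ j).range → ∀ u, nm g ≠ ι u) {E' : EdgeSet}
    (hE' : E' = E ∪ {e | ∃ g, ∃ x : D.X j,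
      e = (nm g, (code ⟨j, x⟩ : ℕ), nm (g * PresentedGroup.of x))})
    {Γ' : D.Graph} {ι' : Γ'.V → ℕ} {num : ℕ → ℕ}
    (h' : Rep code Γ' ι' (RAM.map3 num '' E')) (hnum : num 0 = 0)
    (hinj : Set.InjOn num (RAM.verts E')) :
    Step6 Γ Γ' ∧ IsReducedPrecover Γ' ∧ Nonempty (Hom Γ Γ') ∧ ∀ H, Over H Γ → Over H Γ' := by
  have hF := hΓ.folded
  set S := L.map (D.φ j) with hS
  set B : D.Graph := Γ.attach fun _ : Unit => D.relCayley j S with hB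
  let rV : B.V → B.V → Prop := fun p q => ∃ (a : D.A) (u : Γ.V),
    ColPath Γ i Γ.base (D.φ _ a) u ∧ p = Sum.inl u ∧ q = Sum.inr ⟨(), Quotient.mk'' (D.φ j a)⟩
  let nm' : (D.relCayley j S).V → ℕ := Quotient.lift nm fun g g' hgg =>
    (h1 g g').2 (QuotientGroup.rightRel_apply.1 hgg)
  let f : B.V → ℕ := Sum.elim ι fun p => nm' p.2
  have hrV : ∀ a, rV (Sum.inl (act Γ i Γ.base (D.φ i a))) (Sum.inr ⟨(), Quotient.mk'' (D.φ j a)⟩) :=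
    fun a => ⟨a, _, (colPath_iff hF hC hi).2 rfl, rfl, rfl⟩
  have hrV' : ∀ {p q}, rV p q → ∃ a, p = Sum.inl (act Γ i Γ.base (D.φ i a)) ∧
      q = Sum.inr ⟨(), Quotient.mk'' (D.φ j a)⟩ := by
    rintro _ _ ⟨a, u, hu, rfl, rfl⟩
    exact ⟨a, by rw [(colPath_iff hF hC hi).1 hu], rfl⟩
  have hmix : ∀ u (c : (D.relCayley j S).V), ι u = nm' c → ∃ a, u = act Γ i Γ.base (D.φ i a) ∧
      c = Quotient.mk'' (D.φ j a) := by
    intro u c huc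
    induction c using Quotient.inductionOn' with | _ g => ?_
    have hg : g ∈ (D.φ j).range := by
      by_contra hg
      exact h3 g hg u huc.symm
    obtain ⟨a, rfl⟩ := hg
    exact ⟨a, hΓ.inj (huc.trans (h2 a)), rfl⟩
  have hnm : ∀ c c', nm' c = nm' c' → c = c' := by
    intro c c' hcc
    induction c using Quotient.inductionOn'
    induction c' using Quotient.inductionOn'
    exact relCayley_mk_eq.2 ((h1 _ _).1 hcc)
  have hker : ∀ p q, Relation.EqvGen rV p q ↔ f p = f q := by
    intro p q
    constructor
    · refine eqvGen_imp fun p q hpq => ?_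
      obtain ⟨a, rfl, rfl⟩ := hrV' hpq
      exact (h2 a).symm
    · rcases p with u | ⟨⟨⟩, c⟩ <;> rcases q with v | ⟨⟨⟩, c'⟩ <;> intro hpq
      · rw [hΓ.inj hpq]; exact .refl _
      · obtain ⟨a, rfl, rfl⟩ := hmix _ _ hpq
        exact .rel _ _ (hrV a)
      · obtain ⟨a, rfl, rfl⟩ := hmix _ _ hpq.symm
        exact .symm _ _ (.rel _ _ (hrV a))
      · obtain rfl := hnm c c' hpq
        exact .refl _
  have hcross : ∀ a, ¬ HasCol Γ j (act Γ i Γ.base (D.φ i a)) := by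
    intro a ha
    exact hj ((bichromatic_act_iff hF hC hA hi a).1
      (bichromatic_of_ne hij ha (hasCol_act hC hi _)) j)
  have hmixE : ∀ (e : Γ.E) (d : (D.relCayley j S).E), Γ.lab e = (D.relCayley j S).lab d →
      ¬ (ι (Γ.src e) = nm' ((D.relCayley j S).src d) ∨
        ι (Γ.tgt e) = nm' ((D.relCayley j S).tgt d)) := by
    intro e d hl hst
    have hc : col Γ e = j := by rw [col, hl]; rfl
    rcases hst with hst | hst
    · obtain ⟨a, ha, -⟩ := hmix _ _ hst
      exact hcross a (ha ▸ hc ▸ hasCol_src e)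
    · obtain ⟨a, ha, -⟩ := hmix _ _ hst
      exact hcross a (ha ▸ hc ▸ hasCol_tgt e)
  have hfold : ∀ e e' : B.E, B.lab e = B.lab e' →
      (f (B.src e) = f (B.src e') ∨ f (B.tgt e) = f (B.tgt e')) → e = e' := by
    rintro (e | ⟨⟨⟩, d⟩) (e' | ⟨⟨⟩, d'⟩) hl hst
    · rw [hF e e' hl (hst.imp (fun h => hΓ.inj h) fun h => hΓ.inj h)]
    · exact (hmixE e d' hl hst).elim
    · exact (hmixE e' d hl.symm (hst.imp Eq.symm Eq.symm)).elim
    · rw [relCayley_folded j S d d' hl (hst.imp (hnm _ _) (hnm _ _))]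
  have hw : ∀ a b : B.E, False → B.lab a = B.lab b ∧
      Relation.EqvGen rV (B.src a) (B.src b) ∧ Relation.EqvGen rV (B.tgt a) (B.tgt b) :=
    fun _ _ h => h.elim
  set Q := quotGraph B rV (fun _ _ => False) hw with hQ
  set q : Hom B Q := quotHom B rV (fun _ _ => False) hw with hq
  have hq' : ∀ u v, q.onV u = q.onV v ↔ f u = f v := fun u v => Quot.eq.trans (hker u v)
  have hQF : Q.Folded := by
    intro e e' hl hst
    induction e using Quot.ind with | _ e => ?_
    induction e' using Quot.ind with | _ e' => ?_
    exact congrArg _ (hfold e e' hl (hst.imp (hq' _ _).1 (hq' _ _).1))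
  let ql : Hom Γ Q := q.comp ⟨Sum.inl, Sum.inl, fun _ => rfl, fun _ => rfl, fun _ => rfl, rfl⟩
  have hQm : IsOrbit Q.Edge j fun g => q.onV (Sum.inr ⟨(), Quotient.mk'' g⟩) := fun g x =>
    ⟨q.onE (Sum.inr ⟨(), (Quotient.mk'' g, x)⟩), rfl, rfl, rfl⟩
  have hq1 : ∀ a, q.onV (Sum.inl (act Γ i Γ.base (D.φ i a))) =
      q.onV (Sum.inr ⟨(), Quotient.mk'' (D.φ j a)⟩) := fun a => Quot.sound (hrV a)
  have hqb : q.onV (Sum.inr ⟨(), Quotient.mk'' 1⟩) = Q.base := by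
    have := hq1 1
    rw [map_one, act_one, map_one] at this
    exact this.symm
  have hQr : Q.Reach := by
    intro v
    induction v using Quot.ind with | _ v => ?_
    rcases v with u | ⟨⟨⟩, c⟩
    · obtain ⟨w, hw⟩ := hr u
      exact ⟨w, ql.reads hw⟩
    · induction c using Quotient.inductionOn' with | _ g => ?_
      obtain ⟨w, rfl⟩ := valIn_surjective j g
      have := hQm.reads 1 w
      dsimp only at this
      rw [hqb, one_mul] at this
      exact ⟨_, this⟩
  obtain ⟨κ, hκ1, hκ2⟩ := Rep.of_hom (code := code) q Quot.mk_surjective Quot.mk_surjective hQF hQr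
    f hq' hΓ.base
  have hnamed : namedEdges code B f = E' := by
    rw [hE', rep_eq_namedEdges hΓ]
    refine Set.Subset.antisymm ?_ ?_
    · rintro _ ⟨e | ⟨⟨⟩, c, x⟩, rfl⟩
      · exact Or.inl ⟨e, rfl⟩
      · induction c using Quotient.inductionOn' with | _ g => ?_
        exact Or.inr ⟨g, x, rfl⟩
    · rintro _ (⟨e, rfl⟩ | ⟨g, x, rfl⟩)
      · exact ⟨Sum.inl e, rfl⟩
      · exact ⟨Sum.inr ⟨(), Quotient.mk'' g, x⟩, rfl⟩
  rw [← hnamed] at h' hinj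
  obtain ⟨k, hk1, hk2, hk3⟩ := hκ1.iso h' hnum hinj rfl
  have hF' := h'.folded
  have hG : Glued Γ Γ' i j (k.comp ql) fun g => k.onV (q.onV (Sum.inr ⟨(), Quotient.mk'' g⟩)) := by
    refine ⟨hij, hi, hj, fun u v huv => hΓ.inj ((hq' (Sum.inl u) (Sum.inl v)).1 (hk1.1 huv)),
      fun g x => k.edge (hQm g x), fun a => (congrArg k.onV (hq1 a)).symm, fun u g hug => ?_,
      fun e => ?_⟩
    · obtain ⟨a, ha, -⟩ := hmix u (Quotient.mk'' g) ((hq' (Sum.inl u) (Sum.inr ⟨(), Quotient.mk'' g⟩)).1 (hk1.1 hug))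
      exact ⟨a, ha⟩
    · obtain ⟨e, rfl⟩ := hk2.2 e
      induction e using Quot.ind with | _ e => ?_
      rcases e with e | ⟨⟨⟩, c, x⟩
      · exact Or.inl ⟨e, rfl⟩
      · induction c using Quotient.inductionOn' with | _ g => ?_
        exact Or.inr ⟨g, x, k.src_onE _, k.lab_onE _, k.tgt_onE _⟩
  obtain ⟨a₀, ha, ha'⟩ : ∃ a, a ≠ 1 ∧ act Γ i Γ.base (D.φ i a) = Γ.base := by
    by_contra hne
    push Not at hne
    refine hL' (Subgroup.eq_bot_iff_forall _ |>.2 fun a haL => ?_)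
    by_contra ha
    exact hne a ha ((hL a).1 haL)
  have hb := hG.bichromatic_base hF hC hA hF' ha
  refine ⟨Or.inl ?_, isReducedPrecover hF' (hG.complete hC hF') (hG.compat hF hC hA hF' ha)
    (hQr.of_hom k hk1.2) (hG.not_removable hF hC hA hF' ha ha' hR) (fun hf => (hf.1 _ hb).elim)
    (fun _ _ _ _ _ => hb), ⟨k.comp ql⟩, fun H hH => ?_⟩
  · obtain ⟨⟨e, b⟩, he1, he2⟩ := id hi
    obtain rfl : col Γ e = i := he2
    have hin : InComp Γ e Γ.base := by
      cases b
      · rw [← he1]; exact .rel _ _ ⟨e, rfl, rfl, rfl⟩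
      · rw [← he1]; exact .refl _
    have hst : (stab Γ hF hC (col Γ e) Γ.base).comap (D.φ _) = L := by
      ext a
      rw [hL, ← mem_stab hF hC hi]
      rfl
    refine ⟨e, stab Γ hF hC (col Γ e) Γ.base, j, ⟨?_, ⟨hin, iso_component hF hC hin⟩, ?_⟩, hij, ?_⟩
    · rw [monochromatic_iff hF hC hi]
      exact fun hb => hj (hb j)
    · rw [hst]; exact hL'
    · rw [hst]
      refine ⟨k.comp q, hk1.2.comp Quot.mk_surjective, hk2.2.comp Quot.mk_surjective,
        fun u v => ?_, fun a b => ?_⟩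
      · exact hk1.1.eq_iff.trans Quot.eq
      · exact hk2.1.eq_iff.trans Quot.eq
  · obtain ⟨c, c1, c2⟩ := hH
    have hact := fun a => Over.smul_act hF hC c2 hi (D.φ i a)
    let c' : B.V → D.Gp ⧸ H := Sum.elim c fun p => Quotient.lift
      (fun g => (inc j g)⁻¹ • c Γ.base) (fun g g' hgg => by
        obtain ⟨a, haL, hag⟩ := QuotientGroup.rightRel_apply.1 hgg
        have h4 := hact a
        rw [(hL a).1 haL] at h4
        have h5 : g' = D.φ j a * g := by rw [hag]; simp
        rw [h5, map_mul, mul_inv_rev, mul_smul, inc_φ j i, ← h4]) p.2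
    have c3 : ∀ e, c' (B.src e) = D.letterVal (B.lab e, true) • c' (B.tgt e) := by
      rintro (e | ⟨⟨⟩, x, y⟩)
      · exact c2 e
      · induction x using Quotient.inductionOn' with | _ x => ?_
        change (inc _ x)⁻¹ • c _ = inc _ (PresentedGroup.of y) •
          (inc _ (x * PresentedGroup.of y))⁻¹ • c _
        rw [smul_smul, map_mul, mul_inv_rev, mul_inv_cancel_left]
    refine Over.of_hom (c := c') (k.comp q) (hk1.2.comp Quot.mk_surjective)
      (hk2.2.comp Quot.mk_surjective) c1 c3 fun u v huv => ?_
    refine eqvGen_imp (fun p q hpq => ?_) (Quot.eq.1 (hk1.1 huv))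
    obtain ⟨a, rfl, rfl⟩ := hrV' hpq
    refine (hact a).trans ?_
    rw [inc_φ i j]
    rfl

/-- Nothing is glued. -/
theorem step6_none {N : ℕ} {code : D.Gen ≃ Fin N} {Γ : D.Graph} {ι : Γ.V → ℕ}
    {E : EdgeSet} (hΓ : Rep code Γ ι E) (hC : Complete Γ) (hA : Compat Γ) (hr : Γ.Reach)
    (hR : ∀ k v, ¬ Removable Γ k v) (hf : IsFree Γ → IsEmpty Γ.E)
    (h : ∀ i, HasCol Γ i Γ.base → ¬ Bichromatic Γ Γ.base → ∀ a,
      act Γ i Γ.base (D.φ i a) = Γ.base → a = 1)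
    {Γ' : D.Graph} {ι' : Γ'.V → ℕ} {num : ℕ → ℕ}
    (h' : Rep code Γ' ι' (RAM.map3 num '' E)) (hnum : num 0 = 0)
    (hinj : Set.InjOn num (RAM.verts E)) :
    Step6 Γ Γ' ∧ IsReducedPrecover Γ' ∧ Nonempty (Hom Γ Γ') ∧ ∀ H, Over H Γ → Over H Γ' := by
  obtain ⟨k, hV, hE, -⟩ := hΓ.iso h' hnum hinj rfl
  have hF := hΓ.folded
  have hF' := h'.folded
  have hC' := hC.of_hom k hE.2
  refine ⟨Or.inr ⟨?_, k, hV, hE⟩, isReducedPrecover hF' hC' (hA.of_iso hC hF' hV hE)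
    (hr.of_hom k hV.2) (fun i v hv => ?_) (fun hfr => ?_) (fun i hi a ha hb => ?_), ⟨k⟩,
    fun H hH => ?_⟩
  · rintro e K ⟨h1, ⟨h2, h3⟩, h4⟩
    have hi := hasCol_of_inComp hF hC h2
    refine h4 (Subgroup.eq_bot_iff_forall _ |>.2 fun a ha => ?_)
    refine h _ hi ((monochromatic_iff hF hC hi).1 h1) a ?_
    rw [← mem_stab hF hC hi, stab_of_iso hF hC h2 h3]
    exact ha
  · obtain ⟨v, rfl⟩ := hV.2 v
    exact hR i v (hv.of_iso hC hF' hV hE)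
  · have := hf (hfr.of_iso hC hF' hV hE)
    exact ⟨fun e => (hE.2 e).elim fun e _ => this.false e⟩
  · rw [← k.onV_base] at hi hb ⊢
    rw [hasCol_map_iff hV hE] at hi
    rw [← map_act hC hF' hC' k hi, hV.1.eq_iff] at hb
    rw [bichromatic_map_iff hV hE]
    by_contra hnb
    exact ha (h i hi hnb a hb)
  · obtain ⟨c, c1, c2⟩ := hH
    exact Over.of_hom k hV.2 hE.2 c1 c2 fun u v huv => congrArg c (hV.1 huv)

end FiniteAmalgam

namespace RAM

/-! ### More on commands -/

/-- All assignments to cells of the array `L` are deletions of edges. -/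
def Cmd.ZeroPut : Cmd → Prop
  | .put a _ f => a = .L → f = .lit 0
  | .seq c d => c.ZeroPut ∧ d.ZeroPut
  | .ite _ c d => c.ZeroPut ∧ d.ZeroPut
  | .iter _ _ c => c.ZeroPut
  | _ => True

attribute [simp] Cmd.ZeroPut

@[simp] theorem Cmd.zeroPut_seqs {l : List Cmd} : (seqs l).ZeroPut ↔ ∀ c ∈ l, c.ZeroPut := by
  induction l with
  | nil => simp [seqs]
  | cons c l ih => simp [seqs, ih]

theorem Cmd.ZeroPut.run {c : Cmd} (h : c.ZeroPut) {s : St} {k : ℕ} (hk : s.a .L k = 0) :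
    (c.run s).a .L k = 0 := by
  induction c generalizing s with
  | skip | set | read | print => exact hk
  | put a e f =>
    simp only [Cmd.run, St.put_a]
    split_ifs with h'
    · rw [h h'.1.symm]; rfl
    · exact hk
  | seq c d ih1 ih2 => exact ih2 h.2 (ih1 h.1 hk)
  | ite e c d ih1 ih2 =>
    rw [Cmd.run]
    split_ifs
    exacts [ih1 h.1 hk, ih2 h.2 hk]
  | iter x e c ih =>
    rw [Cmd.run]
    generalize e.eval s = m
    induction m with
    | zero => exact hk
    | succ m ih' => exact ih h (s := St.set _ x m) ih'

/-- The first of the commands whose condition holds. -/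
def Cmd.cases : List (Exp × Cmd) → Cmd
  | [] => .skip
  | p :: l => .ite p.1 p.2 (cases l)

theorem Cmd.run_cases (l : List (Exp × Cmd)) (s : St) :
    (∃ p ∈ l, 0 < p.1.eval s ∧ (cases l).run s = p.2.run s) ∨
      ((∀ p ∈ l, ¬ 0 < p.1.eval s) ∧ (cases l).run s = s) := by
  induction l with
  | nil => exact Or.inr ⟨by simp, rfl⟩
  | cons p l ih =>
    by_cases h : 0 < p.1.eval s
    · exact Or.inl ⟨p, by simp, h, by simp [cases, Cmd.run, h]⟩
    · have : (cases (p :: l)).run s = (cases l).run s := by simp only [cases, Cmd.run, h, if_false]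
      rw [this]
      rcases ih with ⟨q, hq, h'⟩ | ⟨h1, h2⟩
      · exact Or.inl ⟨q, by simp [hq], h'⟩
      · exact Or.inr ⟨fun q hq => (List.mem_cons.1 hq).elim (fun e => e ▸ h) (h1 q), h2⟩

@[simp] theorem Cmd.keepsV_cases {x : Var} {l : List (Exp × Cmd)} :
    (cases l).KeepsV x ↔ ∀ p ∈ l, p.2.KeepsV x := by
  induction l with
  | nil => simp [cases]
  | cons c l ih => simp [cases, ih]

@[simp] theorem Cmd.keepsA_cases {a : Arr} {l : List (Exp × Cmd)} :
    (cases l).KeepsA a ↔ ∀ p ∈ l, p.2.KeepsA a := by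
  induction l with
  | nil => simp [cases]
  | cons c l ih => simp [cases, ih]

@[simp] theorem Cmd.quiet_cases {l : List (Exp × Cmd)} :
    (cases l).Quiet ↔ ∀ p ∈ l, p.2.Quiet := by
  induction l with
  | nil => simp [cases]
  | cons c l ih => simp [cases, ih]

@[simp] theorem Cmd.lim_cases {l : List (Exp × Cmd)} : (cases l).Lim ↔ ∀ p ∈ l, p.2.Lim := by
  induction l with
  | nil => simp [cases]
  | cons c l ih => simp [cases, ih]

theorem Cmd.depth_seqs {l : List Cmd} {n : ℕ} : (seqs l).depth ≤ n ↔ ∀ c ∈ l, c.depth ≤ n := by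
  induction l with
  | nil => simp [seqs, depth]
  | cons c l ih => simp [seqs, depth, ih]

theorem Cmd.depth_cases {l : List (Exp × Cmd)} {n : ℕ} :
    (cases l).depth ≤ n ↔ ∀ p ∈ l, p.2.depth ≤ n := by
  induction l with
  | nil => simp [cases, depth]
  | cons c l ih => simp [cases, depth, ih]

/-! ### Adding and deleting edges -/

theorem mem_edges {s : St} {k : ℕ} (hk : k < s.v .lim) (h : s.a .L k ≠ 0) :
    (s.a .S k, s.a .L k - 1, s.a .T k) ∈ edges s := ⟨k, hk, rfl, by simp only; omega, rfl⟩

theorem Wf.of_edges {N : ℕ} {s : St}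
    (h : ∀ e ∈ edges s, e.1 < s.v .cap ∧ e.2.2 < s.v .cap ∧ e.2.1 < N) (h1 : 0 < s.v .cap)
    (h2 : s.v .cap ≤ s.v .lim) (h3 : 2 * N * s.v .cap ≤ s.v .lim) : Wf N s :=
  ⟨fun k hk h0 => by have := h _ (mem_edges hk h0); simp only at this; omega, h1, h2, h3⟩

theorem Wf.edges {N : ℕ} {s : St} (h : Wf N s) {e : ℕ × ℕ × ℕ} (he : e ∈ edges s) :
    e.1 < s.v .cap ∧ e.2.2 < s.v .cap ∧ e.2.1 < N := by
  obtain ⟨k, hk, h1, h2, h3⟩ := he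
  have := h.lt k hk (by omega)
  omega

theorem Wf.verts {N : ℕ} {s : St} (h : Wf N s) {v : ℕ} (hv : v ∈ verts (RAM.edges s)) :
    v < s.v .cap := by
  rcases hv with rfl | ⟨e, he, rfl | rfl⟩
  exacts [h.cap_pos, (h.edges he).1, (h.edges he).2.1]

/-- Add edges at the end. -/
def addEdges : List (Exp × ℕ × Exp) → Cmd
  | [] => .skip
  | e :: l => .seqs [.put .S (.var .len) e.1, .put .T (.var .len) e.2.2,
      .put .L (.var .len) (.lit (e.2.1 + 1)), .set .len (.add (.var .len) (.lit 1)), addEdges l]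

theorem keepsV_addEdges {x : Var} (hx : x ≠ .len) (l : List (Exp × ℕ × Exp)) :
    (addEdges l).KeepsV x := by
  induction l with
  | nil => trivial
  | cons e l ih => simp [addEdges, ih, hx.symm]

theorem keepsA_addEdges {x : Arr} (hS : x ≠ .S) (hT : x ≠ .T) (hL : x ≠ .L)
    (l : List (Exp × ℕ × Exp)) : (addEdges l).KeepsA x := by
  induction l with
  | nil => trivial
  | cons e l ih => simp [addEdges, ih, hS.symm, hT.symm, hL.symm]

theorem quiet_addEdges (l : List (Exp × ℕ × Exp)) : (addEdges l).Quiet := by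
  induction l with
  | nil => trivial
  | cons e l ih => simp [addEdges, ih]

theorem lim_addEdges (l : List (Exp × ℕ × Exp)) : (addEdges l).Lim := by
  induction l with
  | nil => trivial
  | cons e l ih => simp [addEdges, ih]

theorem depth_addEdges (l : List (Exp × ℕ × Exp)) (n : ℕ) : (addEdges l).depth ≤ n := by
  induction l with
  | nil => exact Nat.zero_le _
  | cons e l ih => simp [addEdges, Cmd.depth_seqs, ih, Cmd.depth]

theorem addEdges_spec (l : List (Exp × ℕ × Exp)) (f : Exp → ℕ) {s : St}
    (hf : ∀ t : St, t.a .tab = s.a .tab → t.v .cap = s.v .cap → ∀ e ∈ l,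
      e.1.eval t = f e.1 ∧ e.2.2.eval t = f e.2.2)
    (hd : ∀ k, s.v .len ≤ k → s.a .L k = 0) (hl : s.v .len + l.length ≤ s.v .lim) :
    ((addEdges l).run s).v .len = s.v .len + l.length ∧
    (∀ k, s.v .len + l.length ≤ k → ((addEdges l).run s).a .L k = 0) ∧
    (∀ k < s.v .len, ((addEdges l).run s).a .S k = s.a .S k ∧
      ((addEdges l).run s).a .T k = s.a .T k ∧ ((addEdges l).run s).a .L k = s.a .L k) ∧
    edges ((addEdges l).run s) = edges s ∪ {x | ∃ e ∈ l, x = (f e.1, e.2.1, f e.2.2)} := by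
  induction l generalizing s with
  | nil => simp [addEdges, Cmd.run]; exact hd
  | cons e l ih =>
    simp only [addEdges, Cmd.run_seqs_cons, Cmd.run_seqs_nil]
    set t := (Cmd.set .len (.add (.var .len) (.lit 1))).run
      ((Cmd.put .L (.var .len) (.lit (e.2.1 + 1))).run ((Cmd.put .T (.var .len) e.2.2).run
        ((Cmd.put .S (.var .len) e.1).run s))) with ht
    have h1 : e.1.eval s = f e.1 := (hf s rfl rfl e (by simp)).1
    have h2 : e.2.2.eval (s.put .S (s.v .len) (e.1.eval s)) = f e.2.2 :=
      (hf _ (St.put_a_ne _ _ _ (by simp)) rfl e (by simp)).2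
    have v1 : t.v .len = s.v .len + 1 := by simp [ht, Cmd.run, Exp.eval]
    have v2 : t.v .lim = s.v .lim := by simp [ht, Cmd.run]
    have v3 : t.v .cap = s.v .cap := by simp [ht, Cmd.run]
    have vS : ∀ k, t.a .S k = if k = s.v .len then f e.1 else s.a .S k := by
      intro k; simp [ht, Cmd.run, Exp.eval, h1]
    have vT : ∀ k, t.a .T k = if k = s.v .len then f e.2.2 else s.a .T k := by
      intro k; simp [ht, Cmd.run, Exp.eval, h2]
    have vL : ∀ k, t.a .L k = if k = s.v .len then e.2.1 + 1 else s.a .L k := by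
      intro k; simp [ht, Cmd.run, Exp.eval]
    have vt : t.a .tab = s.a .tab := by ext k; simp [ht, Cmd.run]
    rw [List.length_cons] at hl ⊢
    obtain ⟨i1, i2, i3, i4⟩ := ih (s := t)
      (fun t' h h' e he => hf t' (h.trans vt) (h'.trans v3) e (by simp [he]))
      (fun k hk => by rw [vL, if_neg (by omega)]; exact hd k (by omega)) (by omega)
    have hE : edges t = edges s ∪ {(f e.1, e.2.1, f e.2.2)} := by
      ext ⟨a, b, c⟩
      simp only [edges, v2, vS, vT, vL, Set.mem_ofPred_eq, Set.mem_union, Set.mem_singleton_iff,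
        Prod.mk.injEq]
      constructor
      · rintro ⟨k, hk, h⟩
        split_ifs at h with hk'
        · exact Or.inr ⟨h.1.symm, by omega, h.2.2.symm⟩
        · exact Or.inl ⟨k, hk, h⟩
      · rintro (⟨k, hk, h⟩ | ⟨rfl, rfl, rfl⟩)
        · have : k ≠ s.v .len := by rintro rfl; rw [hd _ le_rfl] at h; omega
          exact ⟨k, hk, by simpa [this] using h⟩
        · exact ⟨s.v .len, by omega, by simp⟩
    refine ⟨by omega, fun k hk => i2 k (by omega), fun k hk => ?_, ?_⟩
    · rw [(i3 k (by omega)).1, (i3 k (by omega)).2.1, (i3 k (by omega)).2.2, vS, vT, vL,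
        if_neg (by omega), if_neg (by omega), if_neg (by omega)]
      exact ⟨rfl, rfl, rfl⟩
    · rw [i4, hE, Set.union_assoc]
      congr 1
      ext x
      simp

/-- Delete the edges with the given property. -/
def kill (test : Exp) : Cmd := loopL .k (.ite test (.put .L (.var .k) (.lit 0)) .skip)

theorem kill_spec {N : ℕ} {s : St} (hs : Wf N s) (hd : Det s) (test : Exp)
    (Q : ℕ × ℕ × ℕ → Prop) (hQ : ∀ t : St, (∀ x, x ≠ .k → t.v x = s.v x) → (∀ a, a ≠ .L → t.a a = s.a a) →
      t.v .k < s.v .lim → s.a .L (t.v .k) ≠ 0 → t.a .L (t.v .k) = s.a .L (t.v .k) →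
      (0 < test.eval t ↔ Q (s.a .S (t.v .k), s.a .L (t.v .k) - 1, s.a .T (t.v .k)))) :
    Wf N ((kill test).run s) ∧ Det ((kill test).run s) ∧
    edges ((kill test).run s) = {e ∈ edges s | ¬ Q e} ∧
    ((∃ e ∈ edges s, Q e) → alive ((kill test).run s) < alive s) := by
  have fr := (kill test).frame s
  classical
  have key := loopL_inv (x := .k) (c := .ite test (.put .L (.var .k) (.lit 0)) .skip) (s := s) rfl
    (fun n t => ∀ k, t.a .L k =
      if k < n ∧ Q (s.a .S k, s.a .L k - 1, s.a .T k) then 0 else s.a .L k) (by simp) (by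
    intro n hn t ft ih k
    have h := hQ (t.set .k n) (fun x hx => by
      rw [St.set_v, if_neg hx]; exact ft.v (by simp [hx.symm]))
      (fun a ha => ft.a (by simp [ha.symm])) (by simpa using hn)
    simp only [St.set_v, if_true, St.set_a] at h
    have hn' : t.a .L n = s.a .L n := by simp [ih]
    rw [Cmd.run]
    by_cases hk : k = n
    · subst hk
      by_cases h0 : s.a .L k = 0
      · split_ifs <;> simp [h0, hn']
      · by_cases h' : Q (s.a .S k, s.a .L k - 1, s.a .T k) <;> simp [h h0 hn', h', hn']
    · have hk' : k < n + 1 ↔ k < n := by omega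
      split_ifs <;> simp_all)
  have hlim : ((kill test).run s).v .lim = s.v .lim := fr.v (by simp [kill])
  have hcap : ((kill test).run s).v .cap = s.v .cap := fr.v (by simp [kill])
  have hS : ((kill test).run s).a .S = s.a .S := fr.a (by simp [kill])
  have hT : ((kill test).run s).a .T = s.a .T := fr.a (by simp [kill])
  change ∀ k, ((kill test).run s).a .L k = _ at key
  generalize (kill test).run s = t at *
  have hL : ∀ k < s.v .lim, t.a .L k ≠ 0 → t.a .L k = s.a .L k ∧
      ¬ Q (s.a .S k, s.a .L k - 1, s.a .T k) := by
    intro k hk h0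
    rw [key] at h0 ⊢
    split_ifs at h0 ⊢ with hq
    · exact (h0 rfl).elim
    · exact ⟨rfl, fun h => hq ⟨hk, h⟩⟩
  refine ⟨⟨fun k hk h0 => ?_, hcap ▸ hs.cap_pos, hcap ▸ hlim ▸ hs.cap_le,
    hcap ▸ hlim ▸ hs.cap_le'⟩, ?_, ?_, ?_⟩
  · rw [hlim] at hk
    have := (hL k hk h0).1
    rw [hS, hT, hcap, this]
    exact hs.lt k hk (this ▸ h0)
  · intro k hk k' hk' h0 h1 h
    rw [hlim] at hk hk'
    rw [hS, hT] at h
    have a1 := (hL k hk h0).1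
    have a2 := (hL k' hk' (h1 ▸ h0)).1
    exact hd k hk k' hk' (a1 ▸ h0) (by rw [← a1, ← a2, h1]) h
  · ext ⟨a, b, c⟩
    simp only [edges, hlim, hS, hT, Set.mem_ofPred_eq]
    constructor
    · rintro ⟨k, hk, rfl, h2, rfl⟩
      obtain ⟨g1, g2⟩ := hL k hk (by omega)
      refine ⟨⟨k, hk, rfl, by omega, rfl⟩, ?_⟩
      have : s.a .L k - 1 = b := by omega
      rwa [this] at g2
    · rintro ⟨⟨k, hk, rfl, h2, rfl⟩, h⟩
      refine ⟨k, hk, rfl, ?_, rfl⟩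
      rw [key, if_neg fun h' => h ?_, h2]
      rw [← show s.a .L k - 1 = b by omega]
      exact h'.2
  · rintro ⟨⟨a, b, c⟩, ⟨k, hk, rfl, h2, rfl⟩, h⟩
    simp only at h2 h
    refine alive_lt hlim hk (by omega) ((key k).trans (if_pos ⟨hk, ?_⟩)) fun k' h0 => ?_
    swap
    · rwa [show s.a .L k - 1 = b by omega]
    · by_cases hk' : k' < s.v .lim
      · rwa [← (hL k' hk' h0).1]
      · rwa [key, if_neg (by tauto)] at h0

/-- Set `p` to a vertex that satisfies one of the given conditions on the vertex `j`, and `flag` to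
the number of the condition plus one; set `flag` to zero if there is no such vertex. -/
def find (tests : List (Exp × ℕ)) : Cmd := .seq (.set .flag (.lit 0))
  (loopL .j (.cases (tests.map fun e => (e.1, .seqs [.set .flag (.lit (e.2 + 1)),
    .set .p (.var .j)]))))

theorem find_spec {s : St} (tests : List (Exp × ℕ)) (W : ℕ → ℕ → Prop)
    (hW : ∀ t : St, t.a = s.a → t.v .cap = s.v .cap → t.v .lim = s.v .lim → t.v .j < s.v .lim → ∀ e ∈ tests,
      (0 < e.1.eval t ↔ W e.2 (t.v .j))) :
    (((find tests).run s).v .flag = 0 → ∀ e ∈ tests, ∀ v < s.v .lim, ¬ W e.2 v) ∧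
    (((find tests).run s).v .flag ≠ 0 → ∃ e ∈ tests, ((find tests).run s).v .flag = e.2 + 1 ∧
      W e.2 (((find tests).run s).v .p)) := by
  have := loopL_inv (x := .j) (c := (.cases (tests.map fun e => (e.1, .seqs [.set .flag
      (.lit (e.2 + 1)), .set .p (.var .j)])))) (s := s.set .flag 0) (M := s.v .lim) (by simp)
    (fun n t => (t.v .flag = 0 → ∀ e ∈ tests, ∀ v < n, ¬ W e.2 v) ∧
      (t.v .flag ≠ 0 → ∃ e ∈ tests, t.v .flag = e.2 + 1 ∧ W e.2 (t.v .p))) (by simp) (by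
    rintro n hn t ft ⟨ih1, ih2⟩
    have ha : t.a = s.a := by
      ext a : 1
      rw [ft.a (by simp [-Prod.forall, -List.mem_map, List.forall_mem_map]), St.set_a]
    have h := hW (t.set .j n) (by simpa using ha)
      (by simpa using ft.v (x := .cap) (by simp [-Prod.forall, -List.mem_map, List.forall_mem_map]))
      (by simpa using ft.v (x := .lim) (by simp [-Prod.forall, -List.mem_map, List.forall_mem_map])) (by simpa using hn)
    simp only [St.set_v, if_true] at h
    rcases Cmd.run_cases _ (t.set .j n) with ⟨p, hp, h1, h2⟩ | ⟨h1, h2⟩ <;> rw [h2]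
    · obtain ⟨e, he, rfl⟩ := List.mem_map.1 hp
      simp only [Cmd.run_seqs_cons, Cmd.run_seqs_nil, Cmd.run, Exp.eval, St.set_v, reduceCtorEq,
        if_false, if_true]
      exact ⟨by simp, fun _ => ⟨e, he, rfl, (h e he).1 h1⟩⟩
    · simp only [St.set_v, reduceCtorEq, if_false]
      refine ⟨fun hf e he v hv => ?_, ih2⟩
      rcases Nat.lt_succ_iff_lt_or_eq.1 hv with hv | rfl
      · exact ih1 hf e he v hv
      · exact fun hw => h1 _ (List.mem_map.2 ⟨e, he, rfl⟩) ((h e he).2 hw))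
  exact this

theorem find_a (s : St) (tests : List (Exp × ℕ)) : ((find tests).run s).a = s.a := by
  ext a : 1
  exact (find tests).run_a (by simp [find, -Prod.forall, -List.mem_map, List.forall_mem_map]) s

theorem find_keepsV {x : Var} (tests : List (Exp × ℕ)) (h1 : x ≠ .flag) (h2 : x ≠ .j)
    (h3 : x ≠ .p) : (find tests).KeepsV x := by
  simp [find, -Prod.forall, -List.mem_map, List.forall_mem_map, h1.symm, h2.symm, h3.symm]

theorem Tab.congr {N : ℕ} {s t : St} (h : Tab N s) (hl : t.v .lim = s.v .lim)
    (hc : t.v .cap = s.v .cap) (ha : t.a = s.a) : Tab N t := by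
  have : edges t = edges s := edges_congr hl (by rw [ha]) (by rw [ha]) (by rw [ha])
  simpa [Tab, this, hc, ha] using h

/-- As long as there is a vertex that satisfies one of the given conditions, delete the edges that
satisfy a condition that may depend on this vertex. -/
def prune (N : ℕ) (tests : List (Exp × ℕ)) (test : Exp) : Cmd :=
  loopL .i (.seqs [build N, find tests, .ite (.var .flag) (kill test) .skip])

theorem prune_spec {N : ℕ} {s : St} (hs : Wf N s) (hd : Det s) (tests : List (Exp × ℕ)) (test : Exp)
    {M : Type*} (I : EdgeSet → M → Prop) (W : M → ℕ → ℕ → Prop)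
    (Q : M → ℕ → ℕ → ℕ × ℕ × ℕ → Prop) (hI : ∃ m, I (edges s) m)
    (hW : ∀ t m, Wf N t → Tab N t → I (edges t) m → ∀ e ∈ tests,
      (0 < e.1.eval t ↔ W m e.2 (t.v .j)))
    (hQ : ∀ t m, Wf N t → Tab N t → I (edges t) m → ∀ e ∈ tests, t.v .flag = e.2 + 1 →
      W m e.2 (t.v .p) → ∀ t' : St, (∀ x, x ≠ .k → t'.v x = t.v x) → (∀ a, a ≠ .L → t'.a a = t.a a) →
      t'.v .k < t.v .lim → t.a .L (t'.v .k) ≠ 0 → t'.a .L (t'.v .k) = t.a .L (t'.v .k) →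
      (0 < test.eval t' ↔
        Q m e.2 (t.v .p) (t.a .S (t'.v .k), t.a .L (t'.v .k) - 1, t.a .T (t'.v .k))))
    (hstep : ∀ E m c v, I E m → W m c v → (∃ m', I {e ∈ E | ¬ Q m c v e} m') ∧ ∃ e ∈ E, Q m c v e)
    (hlt : ∀ t m c v, Wf N t → I (edges t) m → W m c v → v < t.v .lim) :
    Wf N ((prune N tests test).run s) ∧ Det ((prune N tests test).run s) ∧
    ∃ m, I (edges ((prune N tests test).run s)) m ∧ ∀ e ∈ tests, ∀ v, ¬ W m e.2 v := by
  have := loopL_inv (x := .i) (c := .seqs [build N, find tests, .ite (.var .flag) (kill test) .skip])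
    (s := s) rfl (fun n t => Wf N t ∧ Det t ∧ t.v .lim = s.v .lim ∧ ∃ m, I (edges t) m ∧
      ((∀ e ∈ tests, ∀ v, ¬ W m e.2 v) ∨ alive t + n ≤ s.v .lim))
    ⟨hs, hd, rfl, hI.imp fun m h => ⟨h, Or.inr (by simpa using alive_le s)⟩⟩ (by
    rintro n hn t₀ - ⟨hw₀, hd₀, hl₀, m, hm₀, h₀⟩
    set t := t₀.set .i n with ht
    have hw : Wf N t := hw₀.congr (by simp [t]) (by simp [t]) rfl rfl rfl
    have hd' : Det t := hd₀.congr (by simp [t]) rfl rfl rfl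
    have hE : edges t = edges t₀ := edges_congr (by simp [t]) rfl rfl rfl
    have ha : alive t = alive t₀ := by simp [alive, t]
    have hlim : t.v .lim = s.v .lim := by simpa [t] using hl₀
    rw [← hE] at hm₀
    rw [← ha] at h₀
    simp only [Cmd.run_seqs_cons, Cmd.run_seqs_nil]
    obtain ⟨b1, b2⟩ := build_spec hw
    have b := (b1 (by_contra fun h => not_det_of_conflict (b2 h) hd')).2
    have fb := (build N).frame t
    set u := (build N).run t
    have u1 : u.v .lim = t.v .lim := fb.v (by simp [build, buildStep])
    have u2 : u.v .cap = t.v .cap := fb.v (by simp [build, buildStep])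
    have u3 : u.a .S = t.a .S := fb.a (by simp [build, buildStep])
    have u4 : u.a .T = t.a .T := fb.a (by simp [build, buildStep])
    have u5 : u.a .L = t.a .L := fb.a (by simp [build, buildStep])
    have uw := hw.congr u1 u2 u3 u4 u5
    have ue := edges_congr u1 u3 u4 u5
    rw [← ue] at hm₀
    have ub : Tab N u := b
    have ud := hd'.congr u1 u3 u4 u5
    have ual : alive u = alive t := by simp [alive, u1, u5]
    clear_value u
    obtain ⟨f1, f2⟩ := find_spec (s := u) tests (W m) (fun t' h1 h2 h3 h4 e he => by
      refine hW t' m (uw.congr h3 h2 (by rw [h1]) (by rw [h1]) (by rw [h1])) (ub.congr h3 h2 h1) ?_ e he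
      rwa [edges_congr h3 (by rw [h1]) (by rw [h1]) (by rw [h1])])
    have fa := find_a u tests
    have fv : ∀ {x}, x ≠ .flag → x ≠ .j → x ≠ .p → ((find tests).run u).v x = u.v x :=
      fun h1 h2 h3 => (find tests).run_v (find_keepsV tests h1 h2 h3) u
    set w := (find tests).run u
    clear_value w
    have w1 : w.v .lim = u.v .lim := fv (by simp) (by simp) (by simp)
    have w2 : w.v .cap = u.v .cap := fv (by simp) (by simp) (by simp)
    have ww := uw.congr w1 w2 (by rw [fa]) (by rw [fa]) (by rw [fa])
    have wd := ud.congr w1 (by rw [fa]) (by rw [fa]) (by rw [fa])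
    have we : edges w = edges u := edges_congr w1 (by rw [fa]) (by rw [fa]) (by rw [fa])
    have wal : alive w = alive u := by simp [alive, w1, fa]
    rw [← we] at hm₀
    rw [Cmd.run]
    split_ifs with hf
    swap
    · simp only [Exp.eval] at hf
      refine ⟨ww, wd, by simp only [Cmd.run]; omega, m, hm₀, Or.inl fun e he v hv => ?_⟩
      exact f1 (by omega) e he v (by have := hlt w m e.2 v ww hm₀ hv; omega) hv
    simp only [Exp.eval] at hf
    obtain ⟨e, he, e1, e2⟩ := f2 (by omega)
    obtain ⟨k1, k2, k3, k4⟩ := kill_spec ww wd test (Q m e.2 (w.v .p))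
      (hQ w m ww (ub.congr w1 w2 fa) hm₀ e he e1 e2)
    obtain ⟨⟨m', hm'⟩, hq⟩ := hstep _ m e.2 (w.v .p) hm₀ e2
    have kl : ((kill test).run w).v .lim = w.v .lim := (kill test).run_v (by simp [kill]) w
    refine ⟨k1, k2, by omega, m', k3 ▸ hm', Or.inr ?_⟩
    have := k4 hq
    rcases h₀ with h | h
    · exact (h e he _ e2).elim
    · omega)
  obtain ⟨h1, h2, h3, m, h4, h5⟩ := this
  refine ⟨h1, h2, m, h4, fun e he v hv => ?_⟩
  rcases h5 with h | h
  · exact h e he v hv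
  · obtain ⟨-, x, ⟨k, hk, e1, e2, e3⟩, -⟩ := hstep _ m e.2 v h4 hv
    have : alive (prune N tests test |>.run s) = 0 := by
      change alive (Cmd.run (loopL _ _) s) = 0; omega
    rw [alive, Finset.card_eq_zero, Finset.filter_eq_empty_iff] at this
    exact this (Finset.mem_range.2 hk) (by change ((prune N tests test).run s).a .L k = _ at e2; omega)


/-! ### The graph in memory between two steps -/

/-- The state between two steps: the vertices are numbered consecutively, no two edges are
foldable, and the cells from `len` on are free. -/
structure Held (N : ℕ) (s : St) : Prop where
  wf : Wf N s
  det : Det s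
  dead : ∀ k, s.v .len ≤ k → s.a .L k = 0
  verts : ∀ v, v < s.v .cap ↔ v ∈ verts (edges s)

open PGraph in
theorem Held.rep {Y : Type} {N : ℕ} (code : Y ≃ Fin N) {s : St} (h : Held N s) :
    Rep code (NumGraph.ofState code s h.wf).toPGraph (fun v : Fin (s.v .cap) => (v : ℕ))
      (edges s) := NumGraph.rep_ofState code h.wf h.det h.verts

theorem numbering_zero (s : St) : numbering s 0 = 0 := by classical exact Nat.count_zero _

theorem zeroPut_emit : emit.ZeroPut := by
  simp [emit, compact, printGraph, markStep, numberStep, relabelStep]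

theorem emit_verts {N : ℕ} {t : St} (hw : Wf N t) (v : ℕ) :
    v < (emit.run t).v .cap ↔ v ∈ verts (edges (emit.run t)) := by
  obtain ⟨-, h2, h3, -⟩ := emit_spec hw
  rw [h3, h2]
  constructor
  · rintro ⟨u, rfl | ⟨e, he, hu⟩, rfl⟩
    · exact Or.inl (numbering_zero t)
    · exact Or.inr ⟨_, ⟨e, he, rfl⟩, hu.imp (congrArg _) (congrArg _)⟩
  · rintro (rfl | ⟨_, ⟨e, he, rfl⟩, hu⟩)
    · exact ⟨0, Or.inl rfl, numbering_zero t⟩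
    · rcases hu with rfl | rfl
      · exact ⟨_, Or.inr ⟨e, he, Or.inl rfl⟩, rfl⟩
      · exact ⟨_, Or.inr ⟨e, he, Or.inr rfl⟩, rfl⟩

theorem emit_len (t : St) : (emit.run t).v .len = t.v .len ∧ (emit.run t).v .lim = t.v .lim := by
  constructor <;>
  exact emit.run_v (by simp [emit, compact, printGraph, markStep, numberStep, relabelStep]) t

theorem emit_held {N : ℕ} {t : St} (hw : Wf N t) (hd : Det t)
    (hdead : ∀ k, t.v .len ≤ k → t.a .L k = 0) : Held N (emit.run t) := by
  obtain ⟨-, h2, h3, -, h5, h6, -⟩ := emit_spec hw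
  refine ⟨h5, h6 hd, fun k hk => ?_, emit_verts hw⟩
  rw [(emit_len t).1] at hk
  exact zeroPut_emit.run (hdead k hk)

theorem emit_out {Y : Type} {N : ℕ} (code : Y ≃ Fin N) {t : St} (hw : Wf N t)
    (hw' : Wf N (emit.run t)) : (emit.run t).out =
      t.out ++ (NumGraph.ofState code (emit.run t) hw').encode code := by
  rw [NumGraph.ofState, NumGraph.encode_ofList]
  exact (emit_spec hw).1

/-! ### Walking in the graph in memory -/

open PGraph

/-- The number of a letter. -/
def lno {Y : Type} {N : ℕ} (code : Y ≃ Fin N) (l : Y × Bool) : ℕ :=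
  2 * (code l.1 : ℕ) + if l.2 then 1 else 0

theorem lno_lt {Y : Type} {N : ℕ} (code : Y ≃ Fin N) (l : Y × Bool) : lno code l < 2 * N := by
  have := (code l.1).2
  unfold lno; split_ifs <;> omega

theorem lno_inj {Y : Type} {N : ℕ} (code : Y ≃ Fin N) {l l' : Y × Bool}
    (h : lno code l = lno code l') : l = l' := by
  obtain ⟨x, b⟩ := l
  obtain ⟨x', b'⟩ := l'
  unfold lno at h
  have h1 : (code x : ℕ) = code x' ∧ b = b' := by
    cases b <;> cases b' <;> simp at h ⊢ <;> omega
  rw [code.injective (Fin.ext h1.1), h1.2]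

/-- All letters. -/
def letters {Y : Type} {N : ℕ} (code : Y ≃ Fin N) : List (Y × Bool) :=
  (List.finRange N).flatMap fun c => [(code.symm c, true), (code.symm c, false)]

theorem mem_letters {Y : Type} {N : ℕ} (code : Y ≃ Fin N) (l : Y × Bool) :
    l ∈ letters code := by
  rw [letters, List.mem_flatMap]
  refine ⟨code l.1, List.mem_finRange _, ?_⟩
  obtain ⟨x, b⟩ := l
  cases b <;> simp

/-- The table entry for a vertex and a letter. -/
def look {Y : Type} {N : ℕ} (code : Y ≃ Fin N) (e : Exp) (l : Y × Bool) : Exp :=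
  .get .tab (ix N e (.lit (lno code l)))

/-- The end of the path from a vertex with the given label. -/
def walk {Y : Type} {N : ℕ} (code : Y ≃ Fin N) : Exp → List (Y × Bool) → Exp
  | e, [] => e
  | e, l :: w => walk code (.sub (look code e l) (.lit 1)) w

/-- The memory holds a graph and the table of its transitions. -/
structure Loaded {Y : Type} {N : ℕ} (code : Y ≃ Fin N) (s : St) (Γ : PGraph Y) (ι : Γ.V → ℕ) :
    Prop where
  wf : Wf N s
  tab : Tab N s
  rep : Rep code Γ ι (edges s)

section

variable {Y : Type} {N : ℕ} {code : Y ≃ Fin N} {s : St} {Γ : PGraph Y} {ι : Γ.V → ℕ}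

theorem Loaded.lt (h : Loaded code s Γ ι) (u : Γ.V) : ι u < s.v .cap :=
  h.wf.verts (h.rep.range ▸ ⟨u, rfl⟩)

theorem Loaded.congr (h : Loaded code s Γ ι) {t : St} (hl : t.v .lim = s.v .lim)
    (hc : t.v .cap = s.v .cap) (ha : ∀ a, a ≠ .P → a ≠ .Q → t.a a = s.a a) :
    Loaded code t Γ ι := by
  have hS := ha .S (by simp) (by simp)
  have hT := ha .T (by simp) (by simp)
  have hL := ha .L (by simp) (by simp)
  have e := edges_congr hl hS hT hL
  refine ⟨h.wf.congr hl hc hS hT hL, ?_, e ▸ h.rep⟩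
  simpa [Tab, e, hc, ha .tab (by simp) (by simp)] using h.tab

theorem step_iff_tr {E : EdgeSet} (h : Rep code Γ ι E) {u v : Γ.V} {l : Y × Bool} :
    Γ.Step u l v ↔ Tr E (ι u) (lno code l) (ι v) := by
  obtain ⟨x, b⟩ := l
  cases b
  · simp only [Step, Tr, lno, Bool.false_eq_true, if_false, h.edge]
    constructor
    · exact fun h => ⟨_, Or.inr ⟨by omega, h⟩⟩
    · rintro ⟨c, ⟨h1, -⟩ | ⟨h1, h2⟩⟩
      · omega
      · rwa [show (code x : ℕ) = c by omega]
  · simp only [Step, Tr, lno, if_true, h.edge]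
    constructor
    · exact fun h => ⟨_, Or.inl ⟨by omega, h⟩⟩
    · rintro ⟨c, ⟨h1, h2⟩ | ⟨h1, -⟩⟩
      · rwa [show (code x : ℕ) = c by omega]
      · omega

theorem Tr.mem_verts {E : EdgeSet} {u l v : ℕ} (h : Tr E u l v) :
    u ∈ verts E ∧ v ∈ verts E := by
  obtain ⟨c, ⟨-, h⟩ | ⟨-, h⟩⟩ := h
  · exact ⟨Or.inr ⟨_, h, Or.inl rfl⟩, Or.inr ⟨_, h, Or.inr rfl⟩⟩
  · exact ⟨Or.inr ⟨_, h, Or.inr rfl⟩, Or.inr ⟨_, h, Or.inl rfl⟩⟩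

theorem Loaded.look (h : Loaded code s Γ ι) {u v : Γ.V} {l : Y × Bool} (hs : Γ.Step u l v)
    {e : Exp} (he : e.eval s = ι u) : (look code e l).eval s = ι v + 1 := by
  simp only [RAM.look, Exp.eval, he]
  exact (h.tab _ (h.lt u) _ (lno_lt code l) _).2 ((step_iff_tr h.rep).1 hs)

theorem Loaded.look_pos (h : Loaded code s Γ ι) {l : Y × Bool} {e : Exp}
    (he : e.eval s < s.v .cap) :
    0 < (RAM.look code e l).eval s ↔ ∃ u v, ι u = e.eval s ∧ Γ.Step u l v := by
  constructor
  · intro hp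
    simp only [RAM.look, Exp.eval] at hp
    have h1 := (h.tab _ he _ (lno_lt code l)
      (s.a .tab (2 * N * e.eval s + lno code l) - 1)).1 (by omega)
    obtain ⟨h2, h3⟩ := h1.mem_verts
    rw [← h.rep.range] at h2 h3
    obtain ⟨u, hu⟩ := h2
    obtain ⟨v, hv⟩ := h3
    rw [← hv, ← hu] at h1
    exact ⟨u, v, hu, (step_iff_tr h.rep).2 h1⟩
  · rintro ⟨u, v, hu, hs⟩
    rw [h.look hs hu.symm]; omega

theorem Loaded.walk (h : Loaded code s Γ ι) {u v : Γ.V} {w : List (Y × Bool)}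
    (hr : Γ.Reads u w v) {e : Exp} (he : e.eval s = ι u) : (walk code e w).eval s = ι v := by
  induction w generalizing u e with
  | nil => rw [← show u = v from hr]; exact he
  | cons l w ih =>
    obtain ⟨m, h1, h2⟩ := reads_cons.1 hr
    exact ih h2 (by rw [Exp.eval, h.look h1 he]; rfl)

/-- The states that agree as far as the transitions are concerned. -/
theorem look_congr {t : St} (ht : t.a .tab = s.a .tab) {e : Exp} (he : e.eval t = e.eval s)
    (l : Y × Bool) : (RAM.look code e l).eval t = (RAM.look code e l).eval s := by
  simp only [RAM.look, Exp.eval, ht, he]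

theorem walk_congr {t : St} (ht : t.a .tab = s.a .tab) {e : Exp} (he : e.eval t = e.eval s)
    (w : List (Y × Bool)) : (RAM.walk code e w).eval t = (RAM.walk code e w).eval s := by
  induction w generalizing e with
  | nil => exact he
  | cons l w ih => exact ih (by simp only [Exp.eval, look_congr ht he])

end

end RAM

namespace FiniteAmalgam

open PGraph RAM

variable {D : FiniteAmalgam}

instance (i : Fin 2) : Finite (D.Factor i) := D.finG i

instance : Finite D.A := Finite.of_injective _ (D.inj 0)

/-- A number for each element of a factor. -/
noncomputable def fno (i : Fin 2) (g : D.Factor i) : ℕ := Finite.equivFin (D.Factor i) g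

theorem fno_inj {i : Fin 2} {g h : D.Factor i} (e : fno i g = fno i h) : g = h :=
  (Finite.equivFin _).injective (Fin.ext e)

theorem fno_lt {i : Fin 2} (g : D.Factor i) : fno i g < Nat.card (D.Factor i) :=
  (Finite.equivFin (D.Factor i) g).2

/-- A list of all elements of a finite type. -/
noncomputable def elems (α : Type) [Finite α] : List α := (@Finset.univ α (Fintype.ofFinite α)).toList

theorem mem_elems {α : Type} [Finite α] (x : α) : x ∈ elems α := by
  rw [elems, Finset.mem_toList]; exact @Finset.mem_univ α (Fintype.ofFinite α) x

theorem length_elems (α : Type) [Finite α] : (elems α).length = Nat.card α := by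
  rw [elems, Finset.length_toList]
  exact (@Nat.card_eq_fintype_card α (Fintype.ofFinite α)).symm

/-- A word that represents the given element of a factor. -/
noncomputable def word (i : Fin 2) (g : D.Factor i) : List (D.X i × Bool) :=
  (valIn_surjective i g).choose

theorem valIn_word (i : Fin 2) (g : D.Factor i) : D.valIn i (word i g) = g :=
  (valIn_surjective i g).choose_spec

variable {N : ℕ} (code : D.Gen ≃ Fin N)

/-- The vertex `e · g`. -/
noncomputable def actE (i : Fin 2) (e : Exp) (g : D.Factor i) : Exp :=
  walk code e (D.tag i (word i g))

/-- An edge of colour `i` begins at the vertex `e`. -/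
def hasColE (i : Fin 2) (e : Exp) : Exp :=
  .any (((letters code).filter (·.1.1 = i)).map fun l => look code e l)

/-- The vertex `e` is bichromatic. -/
def bichE (e : Exp) : Exp := .and (hasColE code 0 e) (hasColE code 1 e)

variable {code} {s : St} {Γ : D.Graph} {ι : Γ.V → ℕ}

theorem hasColE_iff (h : Loaded code s Γ ι) (i : Fin 2) {e : Exp} (he : e.eval s < s.v .cap) :
    0 < (hasColE code i e).eval s ↔ ∃ u, ι u = e.eval s ∧ HasCol Γ i u := by
  rw [hasColE, Exp.eval_any]
  simp only [List.mem_map, exists_exists_and_eq_and]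
  constructor
  · rintro ⟨⟨⟨j, x⟩, b⟩, hl, hp⟩
    rw [List.mem_filter] at hl
    obtain rfl : j = i := by simpa using hl.2
    obtain ⟨u, v, hu, hs⟩ := (h.look_pos he).1 hp
    refine ⟨u, hu, hasCol_iff.2 ⟨x, v, ?_⟩⟩
    cases b
    · exact Or.inr hs
    · exact Or.inl hs
  · rintro ⟨u, hu, hc⟩
    obtain ⟨x, v, hx | hx⟩ := hasCol_iff.1 hc
    · exact ⟨(⟨i, x⟩, true), List.mem_filter.2 ⟨mem_letters _ _, by simp⟩,
        (h.look_pos he).2 ⟨u, v, hu, hx⟩⟩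
    · exact ⟨(⟨i, x⟩, false), List.mem_filter.2 ⟨mem_letters _ _, by simp⟩,
        (h.look_pos he).2 ⟨u, v, hu, hx⟩⟩

theorem hasColE_iff' (h : Loaded code s Γ ι) (i : Fin 2) {e : Exp} {u : Γ.V}
    (he : e.eval s = ι u) : 0 < (hasColE code i e).eval s ↔ HasCol Γ i u := by
  rw [hasColE_iff h i (he ▸ h.lt u), he]
  exact ⟨fun ⟨v, hv, hc⟩ => h.rep.inj hv ▸ hc, fun hc => ⟨u, rfl, hc⟩⟩

theorem bichE_iff (h : Loaded code s Γ ι) {e : Exp} (he : e.eval s < s.v .cap) :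
    0 < (bichE code e).eval s ↔ ∃ u, ι u = e.eval s ∧ Bichromatic Γ u := by
  rw [bichE, Exp.eval_and, hasColE_iff h 0 he, hasColE_iff h 1 he]
  constructor
  · rintro ⟨⟨u, hu, hc⟩, v, hv, hc'⟩
    rw [← hu] at hv
    exact ⟨u, hu, bichromatic_of_ne Fin.zero_ne_one hc (h.rep.inj hv ▸ hc')⟩
  · rintro ⟨u, hu, hb⟩
    exact ⟨⟨u, hu, hb 0⟩, u, hu, hb 1⟩

theorem bichE_iff' (h : Loaded code s Γ ι) {e : Exp} {u : Γ.V} (he : e.eval s = ι u) :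
    0 < (bichE code e).eval s ↔ Bichromatic Γ u := by
  rw [bichE_iff h (he ▸ h.lt u), he]
  exact ⟨fun ⟨v, hv, hc⟩ => h.rep.inj hv ▸ hc, fun hc => ⟨u, rfl, hc⟩⟩

theorem eval_actE (h : Loaded code s Γ ι) (hC : Complete Γ) {i : Fin 2} {e : Exp} {u : Γ.V}
    (he : e.eval s = ι u) (hu : HasCol Γ i u) (g : D.Factor i) :
    (actE code i e g).eval s = ι (act Γ i u g) := by
  refine h.walk ?_ he
  rw [reads_tag_iff h.rep.folded hC hu, valIn_word]

end FiniteAmalgam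

namespace FiniteAmalgam

open PGraph RAM

variable {D : FiniteAmalgam} {N : ℕ} (code : D.Gen ≃ Fin N)

/-! ### Gluing on Cayley graphs -/

instance (i : Fin 2) : Finite (D.X i) := D.finX i

/-- The colour of a label, given by its number. -/
def colN (c : ℕ) : Fin 2 := if h : c < N then (code.symm ⟨c, h⟩).1 else 0

theorem colN_code (x : D.Gen) : colN code (code x) = x.1 := by simp [colN]

/-- The edge `k` has colour `i`. -/
noncomputable def isColE (i : Fin 2) : Exp :=
  .any ((elems (D.X i)).map fun x => .eq eL (.lit (code ⟨i, x⟩ + 1)))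

theorem isColE_iff (i : Fin 2) (s : St) :
    0 < (isColE code i).eval s ↔ ∃ x : D.X i, s.a .L (s.v .k) = code ⟨i, x⟩ + 1 := by
  simp only [isColE, Exp.eval_any, List.mem_map, exists_exists_and_eq_and, Exp.eval_eq, Exp.eval]
  exact ⟨fun ⟨x, _, h⟩ => ⟨x, h⟩, fun ⟨x, h⟩ => ⟨x, mem_elems x, h⟩⟩

/-- The edges of a Cayley graph with vertices numbered from `cap`. -/
noncomputable def cayList (i : Fin 2) : List (Exp × ℕ × Exp) :=
  (elems (D.Factor i)).flatMap fun g => (elems (D.X i)).map fun x =>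
    (.add (.var .cap) (.lit (fno i g)), (code ⟨i, x⟩ : ℕ),
      .add (.var .cap) (.lit (fno i (g * PresentedGroup.of x))))

/-- A bound for the orders of the factors. -/
noncomputable def ord (D : FiniteAmalgam) : ℕ := Nat.card (D.Factor 0) + Nat.card (D.Factor 1)

theorem card_le_ord (i : Fin 2) : Nat.card (D.Factor i) ≤ ord D := by
  unfold ord
  fin_cases i <;> simp

theorem card_gen_le {N : ℕ} (code : D.Gen ≃ Fin N) (i : Fin 2) : Nat.card (D.X i) ≤ N := by
  have := Nat.card_le_card_of_injective (fun x : D.X i => code ⟨i, x⟩) fun x y h => by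
    simpa using h
  simpa using this

theorem length_cayList (i : Fin 2) : (cayList code i).length ≤ ord D * N := by
  have : (cayList code i).length = Nat.card (D.Factor i) * Nat.card (D.X i) := by
    simp [cayList, List.length_flatMap, length_elems]
  rw [this]
  exact Nat.mul_le_mul (card_le_ord i) (card_gen_le code i)

/-- Glue a copy of the Cayley graph of colour `i` on the source of the edge `k`. -/
noncomputable def attachBody (i : Fin 2) : Cmd := .seqs [
  .put .P (.var .np) eS,
  .put .Q (.var .np) (.add (.var .cap) (.lit (fno i (1 : D.Factor i)))),
  .set .np (.add (.var .np) (.lit 1)),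
  addEdges (cayList code i),
  .set .cap (.add (.var .cap) (.lit (Nat.card (D.Factor i))))]

theorem attachBody_spec (i : Fin 2) {t : St} (hd : ∀ k, t.v .len ≤ k → t.a .L k = 0)
    (hl : t.v .len + (cayList code i).length ≤ t.v .lim) {u : St}
    (hu : u = (attachBody code i).run t) :
    u.v .len = t.v .len + (cayList code i).length ∧ (∀ k, u.v .len ≤ k → u.a .L k = 0) ∧
    (∀ k < t.v .len, u.a .S k = t.a .S k ∧ u.a .T k = t.a .T k ∧ u.a .L k = t.a .L k) ∧
    edges u = edges t ∪ {e | ∃ (g : D.Factor i) (x : D.X i), e = (t.v .cap + fno i g,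
      (code ⟨i, x⟩ : ℕ), t.v .cap + fno i (g * PresentedGroup.of x))} ∧
    u.v .cap = t.v .cap + Nat.card (D.Factor i) ∧ u.v .np = t.v .np + 1 ∧
    pairs u = pairs t ∪ {(t.a .S (t.v .k), t.v .cap + fno i (1 : D.Factor i))} := by
  simp only [attachBody, Cmd.run_seqs_cons, Cmd.run_seqs_nil] at hu
  set t₁ := (Cmd.set .np (.add (.var .np) (.lit 1))).run ((Cmd.put .Q (.var .np)
    (.add (.var .cap) (.lit (fno i (1 : D.Factor i))))).run ((Cmd.put .P (.var .np) eS).run t))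
    with ht₁
  have v1 : ∀ x, x ≠ .np → t₁.v x = t.v x := by intro x hx; simp [ht₁, Cmd.run, hx]
  have v2 : t₁.v .np = t.v .np + 1 := by simp [ht₁, Cmd.run, Exp.eval]
  have a1 : ∀ a, a ≠ .P → a ≠ .Q → t₁.a a = t.a a := by
    intro a h1 h2; ext k; simp [ht₁, Cmd.run, h1, h2]
  have aP : ∀ k, t₁.a .P k = if k = t.v .np then t.a .S (t.v .k) else t.a .P k := by
    intro k; simp [ht₁, Cmd.run, Exp.eval]
  have aQ : ∀ k, t₁.a .Q k = if k = t.v .np then t.v .cap + fno i (1 : D.Factor i)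
      else t.a .Q k := by
    intro k; simp [ht₁, Cmd.run, Exp.eval]
  have e1 : edges t₁ = edges t := edges_congr (v1 _ (by simp)) (a1 _ (by simp) (by simp))
    (a1 _ (by simp) (by simp)) (a1 _ (by simp) (by simp))
  obtain ⟨b1, b2, b3, b4⟩ := addEdges_spec (s := t₁) (cayList code i)
    (fun e => e.eval t₁) (by
      intro t' _ hc e he
      simp only [cayList, List.mem_flatMap, List.mem_map] at he
      obtain ⟨g, -, x, -, rfl⟩ := he
      simp [Exp.eval, hc]) (by rw [v1 _ (by simp), a1 _ (by simp) (by simp)]; exact hd)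
    (by rw [v1 _ (by simp), v1 _ (by simp)]; exact hl)
  have hv := fun {x : Var} (hx : x ≠ .len) => (addEdges (cayList code i)).run_v (keepsV_addEdges hx _) t₁
  have ha := fun {a : Arr} (h1 : a ≠ .S) (h2 : a ≠ .T) (h3 : a ≠ .L) =>
    (addEdges (cayList code i)).run_a (keepsA_addEdges h1 h2 h3 _) t₁
  set t₂ := (addEdges (cayList code i)).run t₁
  have hu' : u = t₂.set .cap (t₂.v .cap + Nat.card (D.Factor i)) := hu
  rw [v1 .len (by simp)] at b1 b2 b3
  have e2 : edges u = edges t₂ := edges_congr (by simp [hu']) (by simp [hu']) (by simp [hu'])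
    (by simp [hu'])
  refine ⟨by simp [hu', b1], ?_, ?_, ?_, ?_, ?_, ?_⟩
  · intro k hk; rw [hu'] at hk ⊢; exact b2 k (by simpa [b1] using hk)
  · intro k hk
    rw [hu', St.set_a, (b3 k hk).1, (b3 k hk).2.1, (b3 k hk).2.2,
      a1 _ (by simp) (by simp), a1 _ (by simp) (by simp), a1 _ (by simp) (by simp)]
    exact ⟨rfl, rfl, rfl⟩
  · rw [e2, b4, e1]
    congr 1
    ext e
    simp only [cayList, List.mem_flatMap, List.mem_map, Set.mem_ofPred_eq]
    constructor
    · rintro ⟨e, ⟨g, -, x, -, rfl⟩, rfl⟩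
      exact ⟨g, x, by simp [Exp.eval, v1]⟩
    · rintro ⟨g, x, rfl⟩
      exact ⟨_, ⟨g, mem_elems _, x, mem_elems _, rfl⟩, by simp [Exp.eval, v1]⟩
  · simp [hu', hv, v1]
  · simp [hu', hv, v2]
  · ext ⟨a, b⟩
    simp only [pairs, hu', St.set_v, St.set_a, reduceCtorEq, if_false, hv, v2, aP, aQ,
      ha (a := .P) (by simp) (by simp) (by simp), ha (a := .Q) (by simp) (by simp) (by simp),
      Set.mem_ofPred_eq, Set.mem_union, Set.mem_singleton_iff, Prod.mk.injEq, ne_eq,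
      not_false_eq_true]
    constructor
    · rintro ⟨k, hk, h⟩
      split_ifs at h with hk'
      · exact Or.inr ⟨h.1.symm, h.2.symm⟩
      · exact Or.inl ⟨k, by omega, h⟩
    · rintro (⟨k, hk, h⟩ | ⟨rfl, rfl⟩)
      · exact ⟨k, by omega, by simpa [show k ≠ t.v .np by omega] using h⟩
      · exact ⟨t.v .np, by omega, by simp⟩

theorem keepsV_attachBody (i : Fin 2) {x : Var} (h1 : x ≠ .np) (h2 : x ≠ .len) (h3 : x ≠ .cap) :
    (attachBody code i).KeepsV x := by
  simp [attachBody, keepsV_addEdges h2, h1.symm, h3.symm]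

/-- Glue a copy of a Cayley graph on the source of each edge. -/
noncomputable def attachAll : Cmd := .seqs [.set .num (.var .len), .set .np (.lit 0),
  loopL .k (.ite (.and (.sub (.var .num) (.var .k)) eL)
    (.cases ([0, 1].map fun i => (isColE code i, attachBody code i))) .skip)]

theorem attachAll_spec {s : St} (hs : Held N s) (h1 : s.v .len + s.v .len * (ord D * N) ≤ s.v .lim)
    (h2 : s.v .cap + s.v .len * ord D ≤ s.v .lim)
    (h3 : 2 * N * (s.v .cap + s.v .len * ord D) ≤ s.v .lim) {t : St}
    (ht : t = (attachAll code).run s) :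
    ∃ z : ℕ → ℕ, (∀ k, s.v .cap ≤ z k) ∧
    (∀ k < s.v .lim, ∀ k', k < k' → s.a .L k ≠ 0 →
      z k + Nat.card (D.Factor (colN code (s.a .L k - 1))) ≤ z k') ∧
    Wf N t ∧ t.v .np ≤ t.v .lim ∧ (∀ k, t.v .len ≤ k → t.a .L k = 0) ∧ t.v .lim = s.v .lim ∧
    t.v .len ≤ s.v .len + s.v .len * (ord D * N) ∧ t.v .cap ≤ s.v .cap + s.v .len * ord D ∧
    edges t = edges s ∪ {e | ∃ k < s.v .lim, s.a .L k ≠ 0 ∧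
      ∃ (g : D.Factor (colN code (s.a .L k - 1))) (x : D.X (colN code (s.a .L k - 1))),
        e = (z k + fno _ g, (code ⟨_, x⟩ : ℕ), z k + fno _ (g * PresentedGroup.of x))} ∧
    pairs t = {x | ∃ k < s.v .lim, s.a .L k ≠ 0 ∧
      x = (s.a .S k, z k + fno (colN code (s.a .L k - 1)) (1 : D.Factor _))} := by
  set sz : ℕ → ℕ := fun k => if s.a .L k = 0 then 0 else
    Nat.card (D.Factor (colN code (s.a .L k - 1))) with hsz
  set z : ℕ → ℕ := fun k => s.v .cap + ∑ k' ∈ Finset.range k, sz k' with hz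
  have z1 : ∀ k, z (k + 1) = z k + sz k := fun k => by
    simp only [hz, Finset.sum_range_succ]; omega
  have zm : ∀ k k', k ≤ k' → z k ≤ z k' := fun k k' h => by
    induction k', h using Nat.le_induction with
    | base => exact le_rfl
    | succ n _ ih => rw [z1]; omega
  have live : ∀ k < s.v .lim, s.a .L k ≠ 0 →
      k < s.v .len ∧ ∃ y : D.Gen, s.a .L k = code y + 1 := by
    intro k hk h0
    refine ⟨by by_contra h; exact h0 (hs.dead k (by omega)), ?_⟩
    have := (hs.wf.lt k hk h0).2.2
    exact ⟨code.symm ⟨s.a .L k - 1, by omega⟩, by simp; omega⟩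
  simp only [attachAll, Cmd.run_seqs_cons, Cmd.run_seqs_nil] at ht
  set s₀ := (Cmd.set .np (.lit 0)).run ((Cmd.set .num (.var .len)).run s) with hs₀
  have w1 : ∀ x, x ≠ .np → x ≠ .num → s₀.v x = s.v x := by
    intro x h h'; simp [hs₀, Cmd.run, h, h']
  have w2 : s₀.v .np = 0 := by simp [hs₀, Cmd.run, Exp.eval]
  have w3 : s₀.v .num = s.v .len := by simp [hs₀, Cmd.run, Exp.eval]
  have w4 : s₀.a = s.a := rfl
  have key := loopL_inv (x := .k) (c := .ite (.and (.sub (.var .num) (.var .k)) eL)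
    (.cases ([0, 1].map fun i => (isColE code i, attachBody code i))) .skip) (s := s₀)
    (M := s.v .lim) (w1 _ (by simp) (by simp)) (fun n t => t.v .cap = z n ∧ t.v .np ≤ n ∧
      t.v .np ≤ s.v .len ∧ t.v .len ≤ s.v .len + t.v .np * (ord D * N) ∧ s.v .len ≤ t.v .len ∧
      t.v .cap ≤ s.v .cap + t.v .np * ord D ∧ (∀ k, t.v .len ≤ k → t.a .L k = 0) ∧
      (∀ k < s.v .len, t.a .S k = s.a .S k ∧ t.a .T k = s.a .T k ∧ t.a .L k = s.a .L k) ∧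
      edges t = edges s ∪ {e | ∃ k < n, s.a .L k ≠ 0 ∧
        ∃ (g : D.Factor (colN code (s.a .L k - 1))) (x : D.X (colN code (s.a .L k - 1))),
        e = (z k + fno _ g, (code ⟨_, x⟩ : ℕ), z k + fno _ (g * PresentedGroup.of x))} ∧
      pairs t = {x | ∃ k < n, s.a .L k ≠ 0 ∧
        x = (s.a .S k, z k + fno (colN code (s.a .L k - 1)) (1 : D.Factor _))}) (by
    refine ⟨by simp [w1, hz], by omega, by omega, by simp [w1], by simp [w1], by simp [w1], ?_, by
      simp [w4], ?_, ?_⟩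
    · rw [w1 _ (by simp) (by simp)]; exact hs.dead
    · rw [edges_congr (w1 _ (by simp) (by simp)) (by rw [w4]) (by rw [w4]) (by rw [w4])]; simp
    · simp [pairs, w2]) (by
    rintro n hn t₀ ft ⟨i1, i2, i3, i4, i4', i5, i6, i7, i8, i9⟩
    have hlim : t₀.v .lim = s.v .lim := (ft.v (by
      simp [-Prod.forall, -List.mem_map, keepsV_attachBody])).trans
      (w1 _ (by simp) (by simp))
    have hnum : t₀.v .num = s.v .len := (ft.v (by
      simp [-Prod.forall, -List.mem_map, keepsV_attachBody])).trans w3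
    set t := t₀.set .k n with ht'
    have u1 : ∀ x, x ≠ .k → t.v x = t₀.v x := by intro x hx; simp [t, hx]
    have u2 : t.a = t₀.a := rfl
    have u3 : t.v .k = n := by simp [t]
    have u4 : edges t = edges t₀ := edges_congr (u1 _ (by simp)) (by rw [u2]) (by rw [u2]) (by rw [u2])
    have u5 : pairs t = pairs t₀ := by simp [pairs, t]
    have alt : ∀ {p : ℕ → Prop}, (∃ k < n + 1, p k) ↔ (∃ k < n, p k) ∨ p n := by
      intro p
      constructor
      · rintro ⟨k, hk, h⟩
        rcases Nat.lt_succ_iff_lt_or_eq.1 hk with hk | rfl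
        · exact Or.inl ⟨k, hk, h⟩
        · exact Or.inr h
      · rintro (⟨k, hk, h⟩ | h)
        · exact ⟨k, by omega, h⟩
        · exact ⟨n, by omega, h⟩
    have guard : 0 < (Exp.and (.sub (.var .num) (.var .k)) eL).eval t ↔ s.a .L n ≠ 0 := by
      rw [Exp.eval_and]
      simp only [Exp.eval, u1, u3, hnum, u2, ne_eq, reduceCtorEq, not_false_eq_true]
      constructor
      · rintro ⟨h, h'⟩; rw [(i7 n (by omega)).2.2] at h'; omega
      · intro h
        have := (live n hn h).1
        rw [(i7 n this).2.2]; omega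
    clear_value t
    rw [Cmd.run]
    by_cases h0 : s.a .L n ≠ 0
    swap
    · rw [if_neg (mt guard.1 h0)]
      have hn0 : s.a .L n = 0 := by omega
      simp only [Cmd.run, u1, u2, u4, u5, ne_eq, reduceCtorEq, not_false_eq_true]
      refine ⟨by rw [i1, z1, hsz]; simp [hn0], by omega, i3, i4, i4', i5, i6, i7, ?_, ?_⟩
      · rw [i8]; congr 1; ext e; simp only [Set.mem_ofPred_eq, alt]; simp [hn0]
      · rw [i9]; ext e; simp only [Set.mem_ofPred_eq, alt]; simp [hn0]
    obtain ⟨hnl, ⟨j, y⟩, hy⟩ := live n hn h0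
    have hcol : ∀ i : Fin 2, 0 < (isColE code i).eval t ↔ i = j := by
      intro i
      rw [isColE_iff, u2, u3, (i7 n hnl).2.2, hy]
      constructor
      · rintro ⟨x, hx⟩
        have : code ⟨i, x⟩ = code ⟨j, y⟩ := Fin.ext (by omega)
        exact congrArg Sigma.fst (code.injective this)
      · rintro rfl; exact ⟨y, rfl⟩
    have hrun : (Cmd.cases ([0, 1].map fun i => (isColE code i, attachBody code i))).run t =
        (attachBody code j).run t := by
      rcases Cmd.run_cases ([0, 1].map fun i => (isColE code i, attachBody code i)) t with
        ⟨p, hp, g1, g2⟩ | ⟨g1, -⟩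
      · obtain ⟨i, -, rfl⟩ := List.mem_map.1 hp
        rw [g2, (hcol i).1 g1]
      · refine (g1 (isColE code j, attachBody code j) (List.mem_map.2 ⟨j, ?_, rfl⟩)
          ((hcol j).2 rfl)).elim
        exact (by decide : ∀ i : Fin 2, i ∈ [0, 1]) j
    obtain rfl : colN code (s.a .L n - 1) = j := by
      rw [hy, Nat.add_sub_cancel, colN_code]
    rw [if_pos (guard.2 h0)]
    have hlen := length_cayList code (colN code (s.a .L n - 1))
    have hcard := card_le_ord (D := D) (colN code (s.a .L n - 1))
    have hb : (t₀.v .np + 1) * (ord D * N) ≤ s.v .len * (ord D * N) :=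
      Nat.mul_le_mul_right _ (by omega)
    rw [add_mul, one_mul] at hb
    rw [hrun]
    obtain ⟨a1, a2, a3, a4, a5, a6, a7⟩ := attachBody_spec code (colN code (s.a .L n - 1)) (t := t)
      (by rw [u1 _ (by simp), u2]; exact i6)
      (by rw [u1 _ (by simp), u1 _ (by simp), hlim]; omega) rfl
    set u := (attachBody code (colN code (s.a .L n - 1))).run t
    rw [u1 .len (by simp)] at a1 a3
    rw [u1 .cap (by simp)] at a4 a5 a7
    rw [u1 .np (by simp)] at a6
    rw [u2] at a3
    refine ⟨?_, by omega, by omega, ?_, by omega, ?_, a2, ?_, ?_, ?_⟩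
    · rw [a5, i1, z1, hsz]; simp [h0]
    · rw [a6, add_mul, one_mul]; omega
    · rw [a6, add_mul, one_mul]; omega
    · intro k hk
      obtain ⟨b1, b2, b3⟩ := a3 k (by omega)
      rw [b1, b2, b3]; exact i7 k hk
    · rw [a4, u4, i8, Set.union_assoc, i1]
      congr 1
      ext e
      simp only [Set.mem_union, Set.mem_ofPred_eq, alt]
      simp [h0]
    · rw [a7, u5, i9, u3, u2, (i7 n hnl).1, i1]
      ext e
      simp only [Set.mem_union, Set.mem_ofPred_eq, alt, Set.mem_singleton_iff]
      simp [h0])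
  rw [← ht] at key
  have hlim : t.v .lim = s.v .lim := by
    rw [ht, Cmd.run_v _ (by
      simp [-Prod.forall, -List.mem_map, keepsV_attachBody]), w1 _ (by simp)
      (by simp)]
  obtain ⟨k1, -, k3, k4, k5, k6, k7, k8, k9, k10⟩ := key
  have b1 : t.v .np * (ord D * N) ≤ s.v .len * (ord D * N) := Nat.mul_le_mul_right _ k3
  have b2 : t.v .np * ord D ≤ s.v .len * ord D := Nat.mul_le_mul_right _ k3
  have b3 : t.v .cap ≤ s.v .cap + s.v .len * ord D := by omega
  have zs : ∀ k, s.a .L k ≠ 0 → z k + Nat.card (D.Factor (colN code (s.a .L k - 1))) = z (k + 1) :=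
    fun k h => by rw [z1, hsz]; simp [h]
  have z0 : ∀ k, s.v .cap ≤ z k := fun k => by simp [hz]
  refine ⟨z, z0, fun k hk k' h h0 => zs k h0 ▸ zm _ _ h, Wf.of_edges ?_ ?_ (by omega) ?_,
    by omega, k7, hlim, by omega, b3, k9, k10⟩
  · intro e he
    have := z0 (s.v .lim)
    rw [k9] at he
    rcases he with he | ⟨k, hk, h0, g, x, rfl⟩
    · have := hs.wf.edges he; omega
    · have c1 := zm _ _ hk
      rw [Nat.succ_eq_add_one, ← zs k h0] at c1
      have c2 := fno_lt g
      have c3 := fno_lt (g * PresentedGroup.of x)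
      exact ⟨by simp only; omega, by simp only; omega, (code _).2⟩
  · have := z0 (s.v .lim)
    have := hs.wf.cap_pos
    omega
  · rw [hlim]
    exact (Nat.mul_le_mul_left _ b3).trans h3

end FiniteAmalgam

namespace RAM

theorem detSet_edges {s : St} (h : Det s) : FiniteAmalgam.DetSet (edges s) := by
  rintro ⟨a, b, c⟩ ⟨k, hk, rfl, h2, rfl⟩ ⟨a', b', c'⟩ ⟨k', hk', rfl, h2', rfl⟩ h3
  simp only at h2 h2' h3 ⊢
  constructor <;> intro e
  · rw [h k hk k' hk' (by omega) (by omega) (Or.inl e)]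
  · rw [h k hk k' hk' (by omega) (by omega) (Or.inr e)]

end RAM

namespace FiniteAmalgam

open PGraph RAM

variable {D : FiniteAmalgam} {N : ℕ} (code : D.Gen ≃ Fin N)

/-- The graph in memory. -/
abbrev memGraph {s : St} (h : Held N s) : NumGraph D.Gen := NumGraph.ofState code s h.wf

instance {Y : Type} (Γ : NumGraph Y) : Finite Γ.toPGraph.E := inferInstanceAs (Finite (Fin Γ.nE))

theorem held_emit {c : Cmd} {s : St} (hs : ∀ k, s.v .len ≤ k → s.a .L k = 0)
    (hc : c.KeepsV .len ∧ c.KeepsV .lim ∧ c.KeepsV .cap ∧ c.Quiet ∧ c.ZeroPut)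
    (hw : Wf N (c.run s)) (hd : Det (c.run s)) {t : St} (ht : t = (Cmd.seq c RAM.emit).run s) :
    ∃ h : Held N t, t.out = s.out ++ (memGraph code h).encode code ∧ t.v .lim = s.v .lim ∧
      t.v .len = s.v .len ∧ t.v .cap ≤ s.v .cap ∧
      ∃ num, num 0 = 0 ∧ Set.InjOn num (verts (edges (c.run s))) ∧
        edges t = map3 num '' edges (c.run s) := by
  subst ht
  obtain ⟨h1, h2, h3, h4, h5⟩ := hc
  have e := emit_held hw hd fun k hk => h5.run (hs k (Cmd.run_v c h1 s ▸ hk))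
  obtain ⟨l1, l2⟩ := emit_len (c.run s)
  obtain ⟨-, s2, -, s4, -⟩ := emit_spec hw
  exact ⟨e, (emit_out code hw e.wf).trans (by rw [Cmd.run_out c h4]; rfl), l2.trans (Cmd.run_v c h2 s),
    l1.trans (Cmd.run_v c h1 s), s4.trans_eq (Cmd.run_v c h3 s), numbering (c.run s),
    numbering_zero _, numbering_inj _, s2⟩

/-- Perform the pending identifications, fold as long as possible and write the graph. -/
def finish (N : ℕ) : Cmd := .seq (engine N) emit

theorem finish_spec {t : St} (hw : Wf N t) (hnp : t.v .np ≤ t.v .lim)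
    (hd : ∀ k, t.v .len ≤ k → t.a .L k = 0) {u : St} (hu : u = (finish N).run t) :
    ∃ h : Held N u, u.out = t.out ++ (memGraph code h).encode code ∧ u.v .lim = t.v .lim ∧
      u.v .len = t.v .len ∧ u.v .cap ≤ t.v .cap ∧
      ∃ R E' num, Quo (edges t) (pairs t) R E' ∅ ∧ DetSet E' ∧ num 0 = 0 ∧
        Set.InjOn num (verts E') ∧ edges u = map3 num '' E' := by
  obtain ⟨h1, ⟨R, hR⟩, h2⟩ := engine_spec hw hnp
  obtain ⟨h, b1, b2, b3, b4, num, b5, b6, b7⟩ := held_emit code hd (c := engine N) (by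
    simp [engine, mergePairs, pairStep, merge, renameStep, renameCell, foldAll, foldStep, build,
      buildStep]) h1 h2 hu
  exact ⟨h, b1, b2, b3, b4, R, _, num, hR, detSet_edges h2, b5, b6, b7⟩

/-- The properties of the result of a step that are needed to determine `Lab`. -/
structure Link (Γ Γ' : D.Graph) : Prop where
  lab : Lab Γ ⊆ Lab Γ'
  ovr : ∀ H, Over H Γ → Over H Γ'

/-- Step 3. -/
noncomputable def cmd3 : Cmd := .seqs [attachAll code, finish N]

theorem cmd3_spec {s : St} (hs : Held N s) {Γ : D.Graph} [Finite Γ.E] {ι : Γ.V → ℕ}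
    (hrep : Rep code Γ ι (edges s)) (hr : Γ.Reach)
    (h1 : s.v .len + s.v .len * (ord D * N) ≤ s.v .lim)
    (h2 : s.v .cap + s.v .len * ord D ≤ s.v .lim)
    (h3 : 2 * N * (s.v .cap + s.v .len * ord D) ≤ s.v .lim) {t : St}
    (ht : t = (cmd3 code).run s) :
    ∃ h : Held N t, t.out = s.out ++ (memGraph code h).encode code ∧ t.v .lim = s.v .lim ∧
      t.v .len ≤ s.v .len + s.v .len * (ord D * N) ∧ t.v .cap ≤ s.v .cap + s.v .len * ord D ∧
      Step3 Γ (memGraph code h).toPGraph ∧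
      (memGraph code h).toPGraph.Reach ∧ Complete (memGraph code h).toPGraph ∧
      Link Γ (memGraph code h).toPGraph := by
  simp only [cmd3, Cmd.run_seqs_cons, Cmd.run_seqs_nil] at ht
  obtain ⟨z, a1, a2, a3, a4, a5, a6, a7, a8, a9, a10⟩ := attachAll_spec code hs h1 h2 h3 rfl
  have ao : ((attachAll code).run s).out = s.out := Cmd.run_out _ (by
    simp [attachAll, attachBody, quiet_addEdges, -Prod.forall, -List.mem_map]) s
  obtain ⟨h, b1, b2, b3, b4, R, E', num, hQ, hD, hnum, hinj, hE⟩ :=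
    finish_spec code a3 a4 a5 ht
  have hrep' := h.rep code
  rw [hE] at hrep'
  have hcell : ∀ e : Γ.E, ∃ k < s.v .lim, s.a .S k = ι (Γ.src e) ∧
      s.a .L k = code (Γ.lab e) + 1 ∧ s.a .T k = ι (Γ.tgt e) :=
    fun e => (hrep.edge _ _ _).1 (Edge.mk e)
  choose κ κ1 κ2 κ3 κ4 using hcell
  have hlt : ∀ v, ι v < s.v .cap := fun v => hs.wf.verts (hrep.range ▸ ⟨v, rfl⟩)
  have κinj : Function.Injective κ := by
    intro e e' h
    refine hrep.folded e e' (code.injective (Fin.ext ?_)) (Or.inl (hrep.inj ?_))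
    · have := κ3 e; rw [h, κ3 e'] at this; omega
    · rw [← κ2, ← κ2, h]
  have κsurj : ∀ k < s.v .lim, s.a .L k ≠ 0 → ∃ e, κ e = k := by
    intro k hk h0
    obtain ⟨u, x, v, ⟨e, rfl, rfl, rfl⟩, h⟩ := hrep.exists_edge (mem_edges hk h0)
    simp only [Prod.mk.injEq] at h
    refine ⟨e, hs.det _ (κ1 e) k hk (by rw [κ3]; omega) (by rw [κ3]; omega) (Or.inl ?_)⟩
    rw [κ2, h.1]
  have κcol : ∀ e, colN code (s.a .L (κ e) - 1) = col Γ e := by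
    intro e; rw [κ3, Nat.add_sub_cancel, colN_code]; rfl
  have hκ : Function.Injective
      (Sum.elim ι fun p : Σ e, D.Factor (col Γ e) => z (κ p.1) + fno _ p.2) := by
    rintro (u | ⟨e, g⟩) (u' | ⟨e', g'⟩) hx
    · rw [hrep.inj (show ι u = ι u' from hx)]
    · have := a1 (κ e')
      have h4 : ι u = z (κ e') + fno _ g' := hx
      have := hlt u
      omega
    · have := a1 (κ e)
      have h4 : z (κ e) + fno _ g = ι u' := hx
      have := hlt u'
      omega
    · have h4 : z (κ e) + fno _ g = z (κ e') + fno _ g' := hx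
      have lt : ∀ e e' : Γ.E, ∀ g : D.Factor (col Γ e), κ e < κ e' → z (κ e) + fno _ g < z (κ e') := by
        intro e e' g hlt
        have h5 := a2 _ (κ1 e) _ hlt (by rw [κ3]; omega)
        rw [κcol] at h5
        have := fno_lt g
        omega
      rcases lt_trichotomy (κ e) (κ e') with hlt | heq | hlt
      · have := lt e e' g hlt; omega
      · obtain rfl := κinj heq
        rw [fno_inj (show fno _ g = fno _ g' by omega)]
      · have := lt e' e g' hlt; omega
  have hQ' : Quo (edges s ∪ cayEdges code Γ (fun i => fno i) fun e => z (κ e))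
      {x | ∃ e, x = (ι (Γ.src e), z (κ e) + fno (col Γ e) (1 : D.Factor _))} R E' ∅ := by
    convert hQ using 1
    · rw [a9]
      congr 1
      ext x
      simp only [cayEdges, Set.mem_ofPred_eq]
      constructor
      · rintro ⟨e, g, y, rfl⟩
        refine ⟨κ e, κ1 e, by rw [κ3]; omega, ?_⟩
        rw [κcol]
        exact ⟨g, y, rfl⟩
      · rintro ⟨k, hk, h0, hx⟩
        obtain ⟨e, rfl⟩ := κsurj k hk h0
        rw [κcol] at hx
        exact ⟨e, hx⟩
    · rw [a10]
      ext x
      simp only [Set.mem_ofPred_eq]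
      constructor
      · rintro ⟨e, rfl⟩
        refine ⟨κ e, κ1 e, by rw [κ3]; omega, ?_⟩
        rw [κcol, κ2]
      · rintro ⟨k, hk, h0, hx⟩
        obtain ⟨e, rfl⟩ := κsurj k hk h0
        rw [κcol, κ2] at hx
        exact ⟨e, hx⟩
  obtain ⟨c1, c2, c3, ⟨c4⟩, c5⟩ := step3_of_quo hrep hr hκ hQ' hD hrep' hnum hinj
  exact ⟨h, by rw [b1, ao], b2.trans a6, b3.trans_le a7, b4.trans a8, c1, c3, c2,
    ⟨Lab.mono c4, c5⟩⟩

/-! ### Identifying vertices at bichromatic vertices -/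

/-- The identifications at the vertex `j`. -/
noncomputable def pairAt : List D.A → Cmd
  | [] => .skip
  | a :: l => .seqs [.put .P (.var .np) (actE code 0 (.var .j) (D.φ 0 a)),
      .put .Q (.var .np) (actE code 1 (.var .j) (D.φ 1 a)),
      .set .np (.add (.var .np) (.lit 1)), pairAt l]

theorem pairAt_frame (l : List D.A) : (∀ x, x ≠ .np → (pairAt code l).KeepsV x) ∧
    (∀ a, a ≠ .P → a ≠ .Q → (pairAt code l).KeepsA a) ∧ (pairAt code l).Quiet ∧
    (pairAt code l).Lim ∧ (pairAt code l).depth = 0 := by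
  induction l with
  | nil => simp [pairAt, Cmd.depth]
  | cons a l ih =>
    obtain ⟨h1, h2, h3, h4, h5⟩ := ih
    refine ⟨fun x hx => ?_, fun x hx hx' => ?_, ?_, ?_, ?_⟩
    · simp [pairAt, h1 x hx, hx.symm]
    · simp [pairAt, h2 x hx hx', hx.symm, hx'.symm]
    · simp [pairAt, h3]
    · simp [pairAt, h4]
    · simp [pairAt, h5, Cmd.depth, Cmd.seqs]

theorem pairAt_spec {s : St} {Γ : D.Graph} {ι : Γ.V → ℕ} (h : Loaded code s Γ ι)
    (hC : Complete Γ) {v : Γ.V} (hv : s.v .j = ι v) (hb : Bichromatic Γ v) (l : List D.A)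
    {t : St} (ht : t.a .tab = s.a .tab) (htj : t.v .j = s.v .j) :
    ((pairAt code l).run t).v .np = t.v .np + l.length ∧
    pairs ((pairAt code l).run t) = pairs t ∪ {x | ∃ a ∈ l,
      x = (ι (act Γ 0 v (D.φ 0 a)), ι (act Γ 1 v (D.φ 1 a)))} := by
  induction l generalizing t with
  | nil => simp [pairAt, Cmd.run]
  | cons a l ih =>
    have hw : ∀ (i : Fin 2) (t : St), t.a .tab = s.a .tab → t.v .j = s.v .j →
        (actE code i (.var .j) (D.φ i a)).eval t = ι (act Γ i v (D.φ i a)) := by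
      intro i t h1 h2
      rw [← eval_actE h hC (e := .var .j) hv (hb i)]
      exact walk_congr h1 (e := .var .j) h2 _
    simp only [pairAt, Cmd.run_seqs_cons, Cmd.run_seqs_nil]
    set u := (Cmd.set .np (.add (.var .np) (.lit 1))).run ((Cmd.put .Q (.var .np)
      (actE code 1 (.var .j) (D.φ 1 a))).run ((Cmd.put .P (.var .np)
      (actE code 0 (.var .j) (D.φ 0 a))).run t)) with hu
    have e1 := hw 0 t ht htj
    have e2 := hw 1 ((Cmd.put .P (.var .np) (actE code 0 (.var .j) (D.φ 0 a))).run t)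
      ((St.put_a_ne _ _ _ (by simp)).trans ht) htj
    have u1 : u.v .np = t.v .np + 1 := by simp [hu, Cmd.run, Exp.eval]
    have u2 : ∀ k, u.a .P k = if k = t.v .np then ι (act Γ 0 v (D.φ 0 a)) else t.a .P k := by
      intro k; rw [← e1]; simp [hu, Cmd.run, Exp.eval]
    have u3 : ∀ k, u.a .Q k = if k = t.v .np then ι (act Γ 1 v (D.φ 1 a)) else t.a .Q k := by
      intro k; rw [← e2]; simp [hu, Cmd.run, Exp.eval]
    obtain ⟨i1, i2⟩ := ih (t := u) (by ext k; simp [hu, Cmd.run, ht]) (by simp [hu, Cmd.run, htj])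
    refine ⟨by rw [i1, u1, List.length_cons]; omega, ?_⟩
    have : pairs u = pairs t ∪ {(ι (act Γ 0 v (D.φ 0 a)), ι (act Γ 1 v (D.φ 1 a)))} := by
      ext ⟨x, y⟩
      simp only [pairs, u1, u2, u3, Set.mem_ofPred_eq, Set.mem_union, Set.mem_singleton_iff,
        Prod.mk.injEq]
      constructor
      · rintro ⟨k, hk, h⟩
        split_ifs at h with hk'
        · exact Or.inr ⟨h.1.symm, h.2.symm⟩
        · exact Or.inl ⟨k, by omega, h⟩
      · rintro (⟨k, hk, h⟩ | ⟨rfl, rfl⟩)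
        · exact ⟨k, by omega, by simpa [show k ≠ t.v .np by omega] using h⟩
        · exact ⟨t.v .np, by omega, by simp⟩
    rw [i2, this, Set.union_assoc]
    congr 1
    ext x
    simp

/-- The identifications at all bichromatic vertices. -/
noncomputable def pairLoop : Cmd :=
  loopL .j (.ite (.and (.sub (.var .cap) (.var .j)) (bichE code (.var .j)))
    (pairAt code (elems D.A)) .skip)

theorem pairLoop_keepsV {x : Var} (h1 : x ≠ .np) (h2 : x ≠ .j) : (pairLoop code).KeepsV x := by
  simp [pairLoop, (pairAt_frame code (elems D.A)).1 x h1, h2.symm]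

theorem pairLoop_keepsA {a : Arr} (h1 : a ≠ .P) (h2 : a ≠ .Q) : (pairLoop code).KeepsA a := by
  simp [pairLoop, (pairAt_frame code (elems D.A)).2.1 a h1 h2]

theorem pairLoop_spec {s : St} {Γ : D.Graph} {ι : Γ.V → ℕ} (hload : Loaded code s Γ ι)
    (hC : Complete Γ) (hnp : s.v .np = 0) :
    ((pairLoop code).run s).v .np ≤ s.v .cap * (elems D.A).length ∧
    pairs ((pairLoop code).run s) = {x | ∃ v, Bichromatic Γ v ∧ ∃ a,
      x = (ι (act Γ 0 v (D.φ 0 a)), ι (act Γ 1 v (D.φ 1 a)))} := by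
  have hrep := hload.rep
  have hlt := hload.lt
  have key := loopL_inv (x := .j) (c := .ite (.and (.sub (.var .cap) (.var .j))
    (bichE code (.var .j))) (pairAt code (elems D.A)) .skip) (s := s) rfl (fun n t => t.v .np ≤ min n (s.v .cap) * (elems D.A).length ∧
      pairs t = {x | ∃ v : Γ.V, ι v < n ∧ Bichromatic Γ v ∧ ∃ a,
        x = (ι (act Γ 0 v (D.φ 0 a)), ι (act Γ 1 v (D.φ 1 a)))})
    (by simp [hnp, pairs]) (by
    rintro n hn t₀ ft ⟨i1, i2⟩
    set t := t₀.set .j n with ht'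
    have tc : t.v .cap = s.v .cap := ft.v (pairLoop_keepsV code (by simp) (by simp))
    have tj : t.v .j = n := by simp [t]
    have tn : t.v .np = t₀.v .np := by simp [t]
    have tp : pairs t = pairs t₀ := by simp [pairs, t]
    have tl : t.v .lim = s.v .lim := ft.v (pairLoop_keepsV code (by simp) (by simp))
    have tS : ∀ a : Arr, a ≠ .P → a ≠ .Q → t.a a = s.a a := fun a h h' =>
      ft.a (pairLoop_keepsA code h h')
    have load : Loaded code t Γ ι := hload.congr tl tc tS
    clear_value t
    have guard : 0 < (Exp.and (.sub (.var .cap) (.var .j)) (bichE code (.var .j))).eval t ↔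
        ∃ v : Γ.V, ι v = n ∧ Bichromatic Γ v := by
      rw [Exp.eval_and]
      simp only [Exp.eval, tc, tj]
      constructor
      · rintro ⟨g1, g2⟩
        obtain ⟨v, hv, hb⟩ := (bichE_iff load (e := .var .j) (by
          simp only [Exp.eval, tc, tj]; omega)).1 g2
        exact ⟨v, by simpa [Exp.eval, tj] using hv, hb⟩
      · rintro ⟨v, hv, hb⟩
        have := hlt v
        exact ⟨by omega, (bichE_iff' load (by simp [Exp.eval, tj, hv])).2 hb⟩
    have hmin : min n (s.v .cap) ≤ min (n + 1) (s.v .cap) := by omega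
    rw [Cmd.run]
    by_cases hg : ∃ v : Γ.V, ι v = n ∧ Bichromatic Γ v
    · rw [if_pos (guard.2 hg)]
      obtain ⟨v, hv, hb⟩ := hg
      have hvc := hlt v
      obtain ⟨q1, q2⟩ := pairAt_spec code load hC (v := v) (by rw [tj, hv]) hb (elems D.A)
        (t := t) rfl rfl
      rw [q1, q2, tn, tp, i2]
      refine ⟨?_, ?_⟩
      · have : min (n + 1) (s.v .cap) = min n (s.v .cap) + 1 := by omega
        rw [this, add_mul, one_mul]; omega
      · ext x
        simp only [Set.mem_union, Set.mem_ofPred_eq]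
        constructor
        · rintro (⟨w, hw, h⟩ | ⟨a, -, rfl⟩)
          · exact ⟨w, by omega, h⟩
          · exact ⟨v, by omega, hb, a, rfl⟩
        · rintro ⟨w, hw, hb', a, rfl⟩
          by_cases hw' : ι w = n
          · obtain rfl : w = v := hrep.inj (hw'.trans hv.symm)
            exact Or.inr ⟨a, mem_elems a, rfl⟩
          · exact Or.inl ⟨w, by omega, hb', a, rfl⟩
    · rw [if_neg (mt guard.1 hg)]
      simp only [Cmd.run, tn, tp, i2]
      refine ⟨i1.trans (Nat.mul_le_mul_right _ hmin), ?_⟩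
      ext x
      simp only [Set.mem_ofPred_eq]
      constructor
      · rintro ⟨w, hw, h⟩
        exact ⟨w, by omega, h⟩
      · rintro ⟨w, hw, hb', h⟩
        exact ⟨w, by have : ι w ≠ n := fun e => hg ⟨w, e, hb'⟩
                     omega, hb', h⟩)
  obtain ⟨key1, key2⟩ := key
  refine ⟨key1.trans (Nat.mul_le_mul_right _ (min_le_right _ _)), key2.trans ?_⟩
  ext x
  simp only [Set.mem_ofPred_eq]
  exact ⟨fun ⟨v, h⟩ => ⟨v, h.2⟩, fun ⟨v, h⟩ => ⟨v, (hlt v).trans_le hload.wf.cap_le, h⟩⟩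

/-- Step 4. -/
noncomputable def cmd4 : Cmd := .seqs [build N, .set .np (.lit 0), pairLoop code, finish N]

theorem build_v {s : St} {x : Var} (hx : x ∉ [Var.k, .flag, .idx, .p, .q]) :
    ((build N).run s).v x = s.v x := by
  refine Cmd.run_v _ ?_ s
  cases x <;> simp [build, buildStep] at hx ⊢

theorem build_a {s : St} {a : Arr} (ha : a ≠ .tab) : ((build N).run s).a a = s.a a :=
  Cmd.run_a _ (by simp [build, buildStep, ha.symm]) s

theorem loaded_build {s : St} (hs : Wf N s) (hd : Det s) {Γ : D.Graph} {ι : Γ.V → ℕ}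
    (h : Rep code Γ ι (edges s)) : Loaded code ((build N).run s) Γ ι := by
  obtain ⟨b1, b2⟩ := build_spec hs
  have b := (b1 (by_contra fun h => not_det_of_conflict (b2 h) hd)).2
  have u1 : ((build N).run s).v .lim = s.v .lim := build_v (by simp)
  have u2 : ((build N).run s).v .cap = s.v .cap := build_v (by simp)
  have u3 := @build_a N s
  exact ⟨hs.congr u1 u2 (u3 (by simp)) (u3 (by simp)) (u3 (by simp)), b, (edges_congr u1 (u3 (by simp)) (u3 (by simp)) (u3 (by simp))).symm ▸ h⟩

theorem cmd4_spec {s : St} (hs : Held N s) {Γ : D.Graph} [Finite Γ.E] {ι : Γ.V → ℕ}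
    (hrep : Rep code Γ ι (edges s)) (hr : Γ.Reach) (hC : Complete Γ)
    (h1 : s.v .cap * ord D ≤ s.v .lim) {t : St} (ht : t = (cmd4 code).run s) :
    ∃ h : Held N t, t.out = s.out ++ (memGraph code h).encode code ∧ t.v .lim = s.v .lim ∧
      t.v .len = s.v .len ∧ t.v .cap ≤ s.v .cap ∧
      Step4 Γ (memGraph code h).toPGraph ∧
      (memGraph code h).toPGraph.Reach ∧ Complete (memGraph code h).toPGraph ∧
      Compat (memGraph code h).toPGraph ∧
      Link Γ (memGraph code h).toPGraph := by
  have hload := loaded_build code hs.wf hs.det hrep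
  have hlt : ∀ v, ι v < s.v .cap := fun v => hs.wf.verts (hrep.range ▸ ⟨v, rfl⟩)
  simp only [cmd4, Cmd.run_seqs_cons, Cmd.run_seqs_nil] at ht
  have hload' : Loaded code ((Cmd.set .np (.lit 0)).run ((build N).run s)) Γ ι :=
    hload.congr (by simp) (by simp) fun _ _ _ => rfl
  obtain ⟨key1, key2⟩ := pairLoop_spec code hload' hC (by simp [Cmd.run, Exp.eval])
  set s₂ := (Cmd.set .np (.lit 0)).run ((build N).run s) with hs₂
  have v2 : ∀ {x}, x ∉ [Var.k, .flag, .idx, .p, .q, .np, .j] →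
      ((pairLoop code).run s₂).v x = s.v x := fun {x} hx => by
    simp only [List.mem_cons, List.not_mem_nil, or_false, not_or] at hx
    rw [Cmd.run_v _ (pairLoop_keepsV code (by tauto) (by tauto)), hs₂, Cmd.run, St.set_v,
      if_neg (by tauto), build_v (by simp; tauto)]
  have v3 : ∀ {a}, a ∉ [Arr.P, .Q, .tab] → ((pairLoop code).run s₂).a a = s.a a := fun {a} ha => by
    simp only [List.mem_cons, List.not_mem_nil, or_false, not_or] at ha
    rw [Cmd.run_a _ (pairLoop_keepsA code (by tauto) (by tauto)), hs₂, Cmd.run, St.set_a,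
      build_a (by tauto)]
  have hcap2 : s₂.v .cap = s.v .cap := by
    rw [hs₂, Cmd.run, St.set_v, if_neg (by simp), build_v (by simp)]
  have o3 : ((pairLoop code).run s₂).out = s.out := by
    rw [Cmd.run_out _ (by simp [pairLoop, (pairAt_frame code (elems D.A)).2.2.1]), hs₂]
    exact Cmd.run_out _ (by simp [build, buildStep]) s
  have hA : (elems D.A).length ≤ ord D := by
    rw [length_elems]
    exact (Nat.card_le_card_of_injective _ (D.inj 0)).trans (card_le_ord 0)
  set s₃ := (pairLoop code).run s₂
  clear_value s₂ s₃
  have lim3 : s₃.v .lim = s.v .lim := v2 (by simp)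
  have len3 : s₃.v .len = s.v .len := v2 (by simp)
  have cap3 : s₃.v .cap = s.v .cap := v2 (by simp)
  have S3 : s₃.a .S = s.a .S := v3 (by simp)
  have T3 : s₃.a .T = s.a .T := v3 (by simp)
  have L3 : s₃.a .L = s.a .L := v3 (by simp)
  have e3 : edges s₃ = edges s := edges_congr lim3 S3 T3 L3
  obtain ⟨h, b1, b2, b3, b4, R, E', num, hQ, hD, hnum, hinj, hE⟩ := finish_spec code
    (hs.wf.congr lim3 cap3 S3 T3 L3) (by
      rw [lim3]
      exact key1.trans (le_trans (Nat.mul_le_mul hcap2.le hA) h1))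
    (by rw [len3, L3]; exact hs.dead) ht
  have hrep' := h.rep code
  rw [hE] at hrep'
  rw [e3, key2] at hQ
  obtain ⟨c1, c2, c3, c4, ⟨c5⟩, c6⟩ := step4_of_quo (Γ := Γ) (code := code) hrep hr hC hQ hD hrep' hnum hinj
  exact ⟨h, by rw [b1, o3], b2.trans lim3, b3.trans len3, b4.trans_eq cap3, c1, c4, c2, c3,
    ⟨Lab.mono c5, c6⟩⟩


theorem _root_.RAM.Exp.eval_all_cons {s : St} {e : Exp} {l : List Exp} :
    0 < (Exp.all (e :: l)).eval s ↔ 0 < e.eval s ∧ 0 < (Exp.all l).eval s := by simp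

theorem _root_.RAM.Exp.eval_all_nil {s : St} : 0 < (Exp.all []).eval s ↔ True := by simp

theorem _root_.RAM.Exp.eval_all_map {s : St} {α : Type} {f : α → Exp} {l : List α} :
    0 < (Exp.all (l.map f)).eval s ↔ ∀ x ∈ l, 0 < (f x).eval s := by simp

theorem _root_.RAM.Exp.eval_any_cons {s : St} {e : Exp} {l : List Exp} :
    0 < (Exp.any (e :: l)).eval s ↔ 0 < e.eval s ∨ 0 < (Exp.any l).eval s := by simp

theorem _root_.RAM.Exp.eval_any_nil {s : St} : 0 < (Exp.any []).eval s ↔ False := by simp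

theorem _root_.RAM.Exp.eval_any_map {s : St} {α : Type} {f : α → Exp} {l : List α} :
    0 < (Exp.any (l.map f)).eval s ↔ ∃ x ∈ l, 0 < (f x).eval s := by simp

/-! ### Removing redundant components -/

open Classical in
/-- The component of colour `i` at the vertex `j` can be removed. -/
noncomputable def removableE (i : Fin 2) : Exp :=
  .all [.sub (.var .cap) (.var .j), bichE code (.var .j),
    .all (((elems (D.Factor i)).filter (· ∉ (D.φ i).range)).map fun g =>
      .not (bichE code (actE code i (.var .j) g))),
    .any [.all ((elems (D.Factor i)).map fun g => .not (.eq (actE code i (.var .j) g) (.lit 0))),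
      .and (bichE code (.lit 0)) (.all (((elems D.A).filter (· ≠ 1)).map fun a =>
        .not (.eq (actE code i (.var .j) (D.φ i a)) (.var .j))))]]

open Classical in
/-- The condition that the whole graph is a Cayley graph or a single vertex, if there are no
bichromatic vertices. -/
noncomputable def freeE : Exp := .all ([0, 1].map fun i => .any [.not (hasColE code i (.lit 0)),
  .all (((elems (D.Factor i)).filter (· ≠ 1)).map fun g =>
    .not (.eq (actE code i (.lit 0) g) (.lit 0)))])

section

variable {code} {s : St} {Γ : D.Graph} {ι : Γ.V → ℕ}

theorem eval_actE_eq (h : Loaded code s Γ ι) (hC : Complete Γ) {i : Fin 2} {e e' : Exp} {u v : Γ.V}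
    (he : e.eval s = ι u) (he' : e'.eval s = ι v) (hu : HasCol Γ i u) (g : D.Factor i) :
    0 < (Exp.eq (actE code i e g) e').eval s ↔ act Γ i u g = v := by
  rw [Exp.eval_eq, eval_actE h hC he hu, he']
  exact h.rep.inj.eq_iff

theorem removableE_iff (h : Loaded code s Γ ι) (hC : Complete Γ) (i : Fin 2) :
    0 < (removableE code i).eval s ↔ ∃ u, ι u = s.v .j ∧ Removable Γ i u := by
  have key : ∀ u, s.v .j = ι u → HasCol Γ i u → (0 < (removableE code i).eval s ↔
      Removable Γ i u) := by
    intro u hu hi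
    have hu' : (Exp.var .j).eval s = ι u := hu
    have hlt := h.lt u
    have h0 : (Exp.lit 0).eval s = ι Γ.base := h.rep.base.symm
    have hs : 0 < (Exp.sub (.var .cap) (.var .j)).eval s := by simp only [Exp.eval]; omega
    simp only [removableE, Exp.eval_all_cons, Exp.eval_all_nil, Exp.eval_all_map, Exp.eval_any_cons, Exp.eval_any_nil,
      Exp.eval_and, and_true, List.mem_filter, or_false, Exp.eval_not, hs,
      bichE_iff' h hu', bichE_iff' h h0, true_and, eval_actE_eq h hC hu' h0 hi,
      eval_actE_eq h hC hu' hu' hi, bichE_iff' h (eval_actE h hC hu' hi _), mem_elems,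
      forall_const, decide_eq_true_eq, Removable, ne_eq]
  constructor
  · intro hp
    have hp' := hp
    simp only [removableE, Exp.eval_all_cons] at hp'
    obtain ⟨u, hu, hb⟩ := (bichE_iff h (e := .var .j) (by
      have := hp'.1; simp only [Exp.eval] at this ⊢; omega)).1 hp'.2.1
    exact ⟨u, hu, (key u hu.symm (hb i)).1 hp⟩
  · rintro ⟨u, hu, hr⟩
    exact (key u hu.symm (hr.1 i)).2 hr

open Classical in
theorem freeE_iff (h : Loaded code s Γ ι) (hC : Complete Γ) (hb : ∀ v, ¬ Bichromatic Γ v) :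
    0 < (freeE code).eval s ↔ IsFree Γ := by
  have h0 : (Exp.lit 0).eval s = ι Γ.base := h.rep.base.symm
  have hi : ∀ i, 0 < (Exp.any [.not (hasColE code i (.lit 0)),
      .all (((elems (D.Factor i)).filter (· ≠ 1)).map fun g =>
        .not (.eq (actE code i (.lit 0) g) (.lit 0)))]).eval s ↔
      (HasCol Γ i Γ.base → ∀ g, g ≠ 1 → act Γ i Γ.base g ≠ Γ.base) := by
    intro i
    by_cases hc : HasCol Γ i Γ.base
    · simp only [Exp.eval_any_cons, Exp.eval_any_nil, Exp.eval_all_map, or_false,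
        Exp.eval_not, hasColE_iff' h i h0, hc, not_true, false_or, List.mem_filter, mem_elems, true_and, decide_eq_true_eq,
        eval_actE_eq h hC h0 h0 hc, forall_const, ne_eq]
    · simp only [Exp.eval_any_cons, Exp.eval_not, hasColE_iff' h i h0, hc, not_false_eq_true, true_or,
        false_imp_iff]
  simp only [freeE, Exp.eval_all_map, hi, IsFree, hb, not_false_eq_true,
    implies_true, true_and]
  exact ⟨fun g i => g i ((by decide : ∀ i : Fin 2, i ∈ [0, 1]) i), fun g i _ => g i⟩

end

/-- The graph `Δ`, held in memory, has been obtained from `Γ` by removals. -/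
structure Reduced (Γ : D.Graph) (E : EdgeSet) (m : Σ Δ : D.Graph, Δ.V → ℕ) : Prop where
  steps : Relation.ReflTransGen RemoveComp Γ m.1
  rep : Rep code m.1 m.2 E
  reach : m.1.Reach
  complete : Complete m.1
  compat : Compat m.1
  link : Link Γ m.1

/-- Remove redundant components as long as possible. -/
noncomputable def prune5 : Cmd :=
  prune N ([0, 1].map fun i : Fin 2 => (removableE code i, (i : ℕ)))
    (.any ([0, 1].map fun i : Fin 2 => .all [.eq (.var .flag) (.lit (i + 1)), isColE code i,
      .any ((elems (D.Factor i)).map fun g => .eq eS (actE code i (.var .p) g))]))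

/-- Step 5 up to the output. -/
noncomputable def body5 : Cmd := .seqs [
  prune5 code,
  build N, find [(.and (.sub (.var .cap) (.var .j)) (bichE code (.var .j)), 0)],
  .ite (.and (.not (.var .flag)) (freeE code)) (kill (.lit 1)) .skip]

/-- Step 5. -/
noncomputable def cmd5 : Cmd := .seq (body5 code) emit

theorem prune5_spec {s : St} (hw : Wf N s) (hd : Det s) {Γ : D.Graph} (h : ∃ m, Reduced code Γ (edges s) m)
    {t : St} (ht : t = (prune5 code).run s) :
    Wf N t ∧ Det t ∧ ∃ m, Reduced code Γ (edges t) m ∧ ∀ i v, ¬ Removable m.1 i v := by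
  have m01 : ∀ i : Fin 2, i ∈ [0, 1] := by decide
  have := prune_spec hw hd ([0, 1].map fun i : Fin 2 => (removableE code i, (i : ℕ)))
    (.any ([0, 1].map fun i : Fin 2 => .all [.eq (.var .flag) (.lit (i + 1)), isColE code i,
      .any ((elems (D.Factor i)).map fun g => .eq eS (actE code i (.var .p) g))]))
    (Reduced code Γ) (fun m c v => ∃ i : Fin 2, (i : ℕ) = c ∧ ∃ u, m.2 u = v ∧ Removable m.1 i u)
    (fun m c v e => ∃ i : Fin 2, (i : ℕ) = c ∧ ∃ u, m.2 u = v ∧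
      ((∃ x : D.X i, e.2.1 = code ⟨i, x⟩) ∧ ∃ g, e.1 = m.2 (act m.1 i u g))) h ?_ ?_ ?_ ?_
  · rw [prune5] at ht
    rw [← ht] at this
    obtain ⟨h1, h2, m, h3, h4⟩ := this
    exact ⟨h1, h2, m, h3, fun i v hr => h4 _ (List.mem_map.2 ⟨i, m01 i, rfl⟩) _ ⟨i, rfl, v, rfl, hr⟩⟩
  · intro t m h1 h2 h3 e he
    obtain ⟨i, -, rfl⟩ := List.mem_map.1 he
    rw [removableE_iff ⟨h1, h2, h3.rep⟩ h3.complete]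
    exact ⟨fun h => ⟨i, rfl, h⟩, fun ⟨i', h, h'⟩ => Fin.ext h ▸ h'⟩
  · rintro t m h1 h2 h3 e he hf ⟨i, hi, u, hu, hr⟩ t' hv ha hk h0 hL
    obtain ⟨i', -, rfl⟩ := List.mem_map.1 he
    obtain rfl := Fin.ext hi
    have hload : Loaded code t m.1 m.2 := ⟨h1, h2, h3.rep⟩
    have heval : ∀ g, (actE code i (.var .p) g).eval t' = m.2 (act m.1 i u g) := fun g => by
      rw [← eval_actE hload h3.complete (e := .var .p) hu.symm (hr.1 i)]
      exact walk_congr (ha _ (by simp)) (e := .var .p) (hv _ (by simp)) _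
    have hflag : t'.v .flag = i + 1 := (hv _ (by simp)).trans hf
    simp only [Exp.eval_all_cons, Exp.eval_all_nil,
      Exp.eval_any_map, and_true, Exp.eval_eq, isColE_iff, hL]
    simp only [Exp.eval, hflag, ha .S (by simp)]
    constructor
    · rintro ⟨i', -, h4, ⟨x, hx⟩, g, -, hg⟩
      obtain rfl : i = i' := Fin.ext (by omega)
      exact ⟨i, rfl, u, hu, ⟨x, by omega⟩, g, hg.trans (heval g)⟩
    · rintro ⟨i', h4, u', hu', ⟨x, hx⟩, g, hg⟩
      obtain rfl := Fin.ext h4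
      obtain rfl := h3.rep.inj (hu'.trans hu.symm)
      exact ⟨i', m01 _, rfl, ⟨x, by omega⟩, g, mem_elems g, hg.trans (heval g).symm⟩
  · rintro E m c v h3 ⟨i, rfl, u, rfl, hr⟩
    obtain ⟨Γ', h4, h5, h6, h7, ⟨ι', h8⟩, h9, h10⟩ := exists_removeComp h3.rep.folded h3.complete
      h3.compat h3.rep h3.reach hr
    refine ⟨⟨⟨Γ', ι'⟩, h3.steps.tail h4, ?_, h5, h6, h7, h3.link.lab.trans h9,
      fun H hH => h10 H (h3.link.ovr H hH)⟩, ?_⟩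
    · refine (?_ : {e ∈ E | _} = {e ∈ E | _}) ▸ h8
      ext e
      refine and_congr_right fun _ => not_congr ⟨fun h => ⟨i, rfl, u, rfl, h⟩, ?_⟩
      rintro ⟨i', hi', u', hu', h⟩
      obtain rfl := Fin.ext hi'
      obtain rfl := h3.rep.inj hu'
      exact h
    · obtain ⟨x, -⟩ := hasCol_iff.1 (hr.1 i)
      have hE := act_isOrbit h3.complete (hr.1 i) 1 x
      exact ⟨_, (h3.rep.edge _ _ _).1 hE, i, rfl, u, rfl, ⟨x, rfl⟩, 1, rfl⟩
  · rintro t m c v h1 h3 ⟨i, -, u, rfl, -⟩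
    exact (h1.verts (h3.rep.range ▸ ⟨u, rfl⟩)).trans_le h1.cap_le

theorem over_bot_cayley (i : Fin 2) : Over ⊥ (D.cayley i) := by
  refine ⟨fun g => (((inc i g)⁻¹ : D.Gp) : D.Gp ⧸ (⊥ : Subgroup D.Gp)), ?_, fun e => ?_⟩
  · change (((inc i (1 : D.Factor i))⁻¹ : D.Gp) : D.Gp ⧸ (⊥ : Subgroup D.Gp)) = _
    simp
  · change (((inc i e.1)⁻¹ : D.Gp) : D.Gp ⧸ (⊥ : Subgroup D.Gp)) =
      (((inc i (PresentedGroup.of e.2)) * (inc i (e.1 * PresentedGroup.of e.2))⁻¹ : D.Gp) : D.Gp ⧸ _)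
    rw [map_mul, mul_inv_rev, mul_inv_cancel_left]

theorem over_of_isEmpty (H : Subgroup D.Gp) {Γ : D.Graph} (h : IsEmpty Γ.E) : Over H Γ :=
  ⟨fun _ => (1 : D.Gp), rfl, fun e => h.elim e⟩

theorem IsFree.lab_subset {Γ : D.Graph} (hF : Γ.Folded) (hC : Complete Γ) (hr : Γ.Reach)
    (h : IsFree Γ) : Lab Γ ⊆ {1} := by
  have : Over ⊥ Γ := by
    rcases isEmpty_or_nonempty Γ.E with hE | ⟨⟨e⟩⟩
    · exact over_of_isEmpty _ hE
    · obtain ⟨i, f, -⟩ := h.exists_iso hF hC hr e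
      exact (over_bot_cayley i).sub f
  exact this.lab_subset

theorem cmd5_spec {s : St} (hs : Held N s) {Γ : D.Graph} {ι : Γ.V → ℕ}
    (hrep : Rep code Γ ι (edges s)) (hr : Γ.Reach) (hC : Complete Γ) (hA : Compat Γ)
    {t : St} (ht : t = (cmd5 code).run s) :
    ∃ h : Held N t, t.out = s.out ++ (memGraph code h).encode code ∧ t.v .lim = s.v .lim ∧
      t.v .len = s.v .len ∧ t.v .cap ≤ s.v .cap ∧
      Step5 Γ (memGraph code h).toPGraph ∧
      (memGraph code h).toPGraph.Reach ∧ Complete (memGraph code h).toPGraph ∧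
      Compat (memGraph code h).toPGraph ∧ (∀ i v, ¬ Removable (memGraph code h).toPGraph i v) ∧
      (IsFree (memGraph code h).toPGraph → IsEmpty (memGraph code h).toPGraph.E) ∧
      Link Γ (memGraph code h).toPGraph := by
  obtain ⟨w1, d1, m, hred, hno⟩ := prune5_spec code hs.wf hs.det
    ⟨⟨Γ, ι⟩, .refl, hrep, hr, hC, hA, subset_rfl, fun _ h => h⟩ rfl
  obtain ⟨Δ, ι₁⟩ := m
  obtain ⟨q1, q2, q3, q4, q5, q6⟩ := hred
  simp only at q1 q2 q3 q4 q5 q6 hno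
  have hΔ' : ∀ Δ', ¬ RemoveComp Δ Δ' := fun Δ' h =>
    let ⟨i, v, h⟩ := exists_removable q2.folded q4 q5 h
    hno i v h
  have key : Wf N ((body5 code).run s) ∧ Det ((body5 code).run s) ∧
      ((IsFree Δ ∧ edges ((body5 code).run s) = ∅) ∨
        (¬ IsFree Δ ∧ Rep code Δ ι₁ (edges ((body5 code).run s)))) := by
    simp only [body5, Cmd.run_seqs_cons, Cmd.run_seqs_nil, Cmd.run]
    set s₁ := Cmd.run _ s
    set s₂ := (build N).run s₁ with hs₂
    have hl2 := loaded_build code w1 d1 q2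
    rw [← hs₂] at hl2
    have d2 : Det s₂ := d1.congr (build_v (by simp)) (build_a (by simp)) (build_a (by simp))
      (build_a (by simp))
    have hf := find_spec (s := s₂) [(.and (.sub (.var .cap) (.var .j)) (bichE code (.var .j)), 0)]
      (fun _ v => v < s₂.v .cap ∧ ∃ u, ι₁ u = v ∧ Bichromatic Δ u) (by
        simp only [List.mem_singleton, forall_eq]
        intro t ha hc hl hj
        have hl' : Loaded code t Δ ι₁ := hl2.congr hl hc fun _ _ _ => by rw [ha]
        have : 0 < (Exp.sub (.var .cap) (.var .j)).eval t ↔ t.v .j < s₂.v .cap := by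
          simp only [Exp.eval]; omega
        rw [Exp.eval_and, this]
        exact and_congr_right fun h => bichE_iff hl' (e := .var .j) (hc ▸ h))
    set s₃ := Cmd.run (find _) s₂
    have ha3 : s₃.a = s₂.a := find_a _ _
    have hc3 : s₃.v .cap = s₂.v .cap :=
      Cmd.run_v _ (find_keepsV _ (by simp) (by simp) (by simp)) s₂
    have hv3 : s₃.v .lim = s₂.v .lim :=
      Cmd.run_v _ (find_keepsV _ (by simp) (by simp) (by simp)) s₂
    have hl3 : Loaded code s₃ Δ ι₁ := hl2.congr hv3 hc3 fun _ _ _ => by rw [ha3]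
    have d3 : Det s₃ := d2.congr hv3 (by rw [ha3]) (by rw [ha3]) (by rw [ha3])
    have hfree : 0 < (Exp.and (.not (.var .flag)) (freeE code)).eval s₃ ↔ IsFree Δ := by
      rw [Exp.eval_and, Exp.eval_not]
      by_cases h0 : s₃.v .flag = 0
      · have hnb : ∀ v, ¬ Bichromatic Δ v := fun v hv =>
          hf.1 h0 _ (List.mem_singleton_self _) _ ((hl2.lt v).trans_le hl2.wf.cap_le) ⟨hl2.lt v, v, rfl, hv⟩
        rw [freeE_iff hl3 q4 hnb]
        simp [Exp.eval, h0]
      · obtain ⟨e, he, -, -, u, -, hu⟩ := hf.2 h0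
        have : ¬ IsFree Δ := fun h => h.1 u hu
        simp [Exp.eval, this]; omega
    split_ifs with h
    · obtain ⟨k1, k2, k3, -⟩ := kill_spec hl3.wf d3 (.lit 1) (fun _ => True) (fun _ _ _ _ _ _ => by
        simp [Exp.eval])
      exact ⟨k1, k2, Or.inl ⟨hfree.1 h, k3.trans (by simp)⟩⟩
    · exact ⟨hl3.wf, d3, Or.inr ⟨fun h' => h (hfree.2 h'), hl3.rep⟩⟩
  obtain ⟨w, d, hE⟩ := key
  obtain ⟨h, b1, b2, b3, b4, num, hnum, hinj, hE'⟩ := held_emit code hs.dead (c := body5 code) (by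
    simp [body5, prune5, prune, kill, find, build, buildStep, Cmd.cases]) w d ht
  refine ⟨h, b1, b2, b3, b4, ?_⟩
  have hrep' := h.rep code
  rcases hE with ⟨hf, hE⟩ | ⟨hf, hE⟩
  · rw [hE', hE, Set.image_empty] at hrep'
    obtain ⟨c1, c2⟩ := step5_of_free q1 hΔ' q2 q4 q3 hf hrep'
    obtain ⟨c3, c4⟩ := Rep.subsingleton hrep'
    have hnc : ∀ i v, ¬ HasCol (memGraph code h).toPGraph i v := fun i v ⟨d, _⟩ => c4.false d.1
    exact ⟨c1, fun v => ⟨[], (c3 v).symm⟩, fun i v hv => (hnc i v hv).elim,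
      fun v hv => (hnc 0 v (hv 0)).elim, fun i v hv => hnc i v (hv.1 i), fun _ => c4,
      q6.lab.trans (c2 ▸ hf.lab_subset q2.folded q4 q3), fun H _ => over_of_isEmpty H c4⟩
  · obtain ⟨f, f1, f2, -⟩ := hE.iso hrep' hnum hinj hE'
    have hC' := q4.of_hom f f2.2
    refine ⟨⟨Δ, ⟨Δ, q1, Iso.refl Δ, hΔ'⟩, Or.inr ⟨fun h' => hf (isFree_of_iso q4 h'), f, f1, f2⟩⟩,
      q3.of_hom f f1.2, hC', q5.of_iso q4 hrep'.folded f1 f2, ?_, ?_, q6.lab.trans (Lab.mono f), ?_⟩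
    · intro i v hv
      obtain ⟨u, rfl⟩ := f1.2 v
      exact hno i u (hv.of_iso q4 hrep'.folded f1 f2)
    · exact fun h' => (hf (h'.of_iso q4 hrep'.folded f1 f2)).elim
    · intro H hH
      obtain ⟨c, h1, h2⟩ := q6.ovr H hH
      exact Over.of_hom f f1.2 f2.2 h1 h2 fun u v huv => by rw [f1.1 huv]

end FiniteAmalgam

theorem RAM.Quo.eq_of_detSet {E E' : EdgeSet} {R : ℕ → ℕ} {P : Set (ℕ × ℕ)}
    (h : Quo E ∅ R E' P) (hD : FiniteAmalgam.DetSet E) : E' = E := by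
  have hR : R = id := funext fun v => h.adm ℕ id ⟨hD, fun x hx => hx.elim⟩ v
  rw [h.edges, hR]
  ext ⟨a, b, c⟩
  simp [map3]

namespace FiniteAmalgam

open PGraph RAM

variable {D : FiniteAmalgam} {N : ℕ} (code : D.Gen ≃ Fin N)

/-! ### Gluing a relative Cayley graph at the basepoint -/

theorem _root_.PGraph.Rep.detSet {Y : Type} {code : Y ≃ Fin N} {Γ : PGraph Y} {ι : Γ.V → ℕ}
    {E : EdgeSet} (h : Rep code Γ ι E) : DetSet E := by
  intro e he e' he' hl
  obtain ⟨u, x, v, h1, rfl⟩ := h.exists_edge he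
  obtain ⟨u', x', v', h1', rfl⟩ := h.exists_edge he'
  obtain rfl := code.injective (Fin.ext hl)
  simp only [h.inj.eq_iff]
  exact ⟨fun e => h.folded.tgt_eq h1 (e ▸ h1'), fun e => h.folded.src_eq h1 (e ▸ h1')⟩

theorem one_sub_ne : ∀ i : Fin 2, 1 - i ≠ i := by decide

variable (D) in
/-- The subgroups at which a Cayley graph may be glued, with the colour at the basepoint. -/
noncomputable def glueCases : List (Fin 2 × Subgroup D.A) :=
  [0, 1].flatMap fun i => (elems (Subgroup D.A)).map fun L => (i, L)

theorem mem_glueCases (i : Fin 2) (L : Subgroup D.A) : (i, L) ∈ glueCases D := by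
  simp only [glueCases, List.mem_flatMap, List.mem_map]
  exact ⟨i, by revert i; decide, L, mem_elems L, rfl⟩

open Classical in
/-- The condition of Step 6 for the subgroup `L` and the colour `i` at the basepoint. -/
noncomputable def glueE (i : Fin 2) (L : Subgroup D.A) : Exp :=
  .all [.lit (if L = ⊥ then 0 else 1), hasColE code i (.lit 0), .not (hasColE code (1 - i) (.lit 0)),
    .all ((elems D.A).map fun a => if a ∈ L then .eq (actE code i (.lit 0) (D.φ i a)) (.lit 0) else
      .not (.eq (actE code i (.lit 0) (D.φ i a)) (.lit 0)))]

open Classical in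
/-- The name of the vertex `L g` of the glued graph. -/
noncomputable def glueName (i : Fin 2) (L : Subgroup D.A) (g : D.Factor (1 - i)) : Exp :=
  if h : g ∈ (D.φ (1 - i)).range then actE code i (.lit 0) (D.φ i h.choose) else
    .add (.var .cap) (.lit (fno (1 - i) (Quotient.mk'' g :
      Quotient (QuotientGroup.rightRel (L.map (D.φ (1 - i))))).out))

/-- The edges of the glued graph. -/
noncomputable def glueList (i : Fin 2) (L : Subgroup D.A) : List (Exp × ℕ × Exp) :=
  (elems (D.Factor (1 - i))).flatMap fun g => (elems (D.X (1 - i))).map fun x =>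
    (glueName code i L g, (code ⟨1 - i, x⟩ : ℕ), glueName code i L (g * PresentedGroup.of x))

/-- The ways of gluing a relative Cayley graph at the basepoint. -/
noncomputable def glueCmds : List (Exp × Cmd) :=
  (glueCases D).map fun p => (glueE code p.1 p.2, .seqs [addEdges (glueList code p.1 p.2),
    .set .cap (.add (.var .cap) (.lit (ord D)))])

/-- Step 6. -/
noncomputable def cmd6 : Cmd :=
  .seqs [build N, .set .np (.lit 0), .cases (glueCmds code), finish N]

theorem length_glueList (i : Fin 2) (L : Subgroup D.A) :
    (glueList code i L).length ≤ ord D * N := by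
  simp only [glueList, List.length_flatMap, List.length_map, List.map_const', List.sum_replicate,
    length_elems, smul_eq_mul]
  exact Nat.mul_le_mul (card_le_ord _) (card_gen_le code _)

section

variable {code} {s : St} {Γ : D.Graph} {ι : Γ.V → ℕ}

open Classical in
theorem glueE_iff (h : Loaded code s Γ ι) (hC : Complete Γ) (i : Fin 2) (L : Subgroup D.A) :
    0 < (glueE code i L).eval s ↔ L ≠ ⊥ ∧ HasCol Γ i Γ.base ∧ ¬ HasCol Γ (1 - i) Γ.base ∧
      ∀ a, a ∈ L ↔ act Γ i Γ.base (D.φ i a) = Γ.base := by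
  have h0 : (Exp.lit 0).eval s = ι Γ.base := h.rep.base.symm
  have hL : 0 < (Exp.lit (if L = ⊥ then 0 else 1)).eval s ↔ L ≠ ⊥ := by
    simp only [Exp.eval]
    split_ifs with hL <;> simp [hL]
  simp only [glueE, Exp.eval_all_cons, Exp.eval_all_nil, Exp.eval_all_map, and_true, hL,
    Exp.eval_not, hasColE_iff' h _ h0]
  refine and_congr_right fun _ => and_congr_right fun hi => and_congr_right fun _ =>
    forall_congr' fun a => ?_
  split_ifs with ha
  · rw [eval_actE_eq h hC h0 h0 hi]
    simp [ha, mem_elems]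
  · rw [Exp.eval_not, eval_actE_eq h hC h0 h0 hi]
    simp [ha, mem_elems]

variable {i : Fin 2} {L : Subgroup D.A}

theorem glueName_φ (h : Loaded code s Γ ι) (hC : Complete Γ) (hi : HasCol Γ i Γ.base) (a : D.A) :
    (glueName code i L (D.φ (1 - i) a)).eval s = ι (act Γ i Γ.base (D.φ i a)) := by
  have hr : D.φ (1 - i) a ∈ (D.φ (1 - i)).range := ⟨a, rfl⟩
  rw [glueName, dif_pos hr, D.inj _ hr.choose_spec,
    eval_actE h hC (e := .lit 0) h.rep.base.symm hi]

theorem glueName_of_notMem {g : D.Factor (1 - i)} (hg : g ∉ (D.φ (1 - i)).range) :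
    (glueName code i L g).eval s = s.v .cap + fno (1 - i) (Quotient.mk'' g :
      Quotient (QuotientGroup.rightRel (L.map (D.φ (1 - i))))).out := by
  rw [glueName, dif_neg hg]
  rfl

theorem glueName_eq_iff (h : Loaded code s Γ ι) (hC : Complete Γ) (hi : HasCol Γ i Γ.base)
    (hL : ∀ a, a ∈ L ↔ act Γ i Γ.base (D.φ i a) = Γ.base) (g g' : D.Factor (1 - i)) :
    (glueName code i L g).eval s = (glueName code i L g').eval s ↔
      g' * g⁻¹ ∈ L.map (D.φ (1 - i)) := by
  have hLr : L.map (D.φ (1 - i)) ≤ (D.φ (1 - i)).range := fun _ ⟨a, _, h⟩ => ⟨a, h⟩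
  by_cases hg : g ∈ (D.φ (1 - i)).range <;> by_cases hg' : g' ∈ (D.φ (1 - i)).range
  · obtain ⟨a, rfl⟩ := hg
    obtain ⟨a', rfl⟩ := hg'
    rw [glueName_φ h hC hi, glueName_φ h hC hi, h.rep.inj.eq_iff, eq_comm,
      act_eq_iff h.rep.folded hC hi, ← map_inv, ← map_mul, ← hL, ← map_inv, ← map_mul,
      Subgroup.mem_map_iff_mem (D.inj _)]
  · refine iff_of_false ?_ fun h' => hg' ?_
    · obtain ⟨a, rfl⟩ := hg
      rw [glueName_φ h hC hi, glueName_of_notMem hg']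
      have := h.lt (act Γ i Γ.base (D.φ i a))
      omega
    · simpa using mul_mem (hLr h') hg
  · refine iff_of_false ?_ fun h' => hg ?_
    · obtain ⟨a, rfl⟩ := hg'
      rw [glueName_φ h hC hi, glueName_of_notMem hg]
      have := h.lt (act Γ i Γ.base (D.φ i a))
      omega
    · simpa using mul_mem (inv_mem (hLr h')) hg'
  · rw [glueName_of_notMem hg, glueName_of_notMem hg', Nat.add_left_cancel_iff]
    refine ⟨fun h' => ?_, fun h' => ?_⟩
    · exact relCayley_mk_eq.1 (Quotient.out_injective (fno_inj h'))
    · exact congrArg (fun q => fno _ (Quotient.out q)) (relCayley_mk_eq.2 h')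

theorem glueName_lt (h : Loaded code s Γ ι) (hC : Complete Γ) (hi : HasCol Γ i Γ.base)
    (g : D.Factor (1 - i)) : (glueName code i L g).eval s < s.v .cap + ord D := by
  by_cases hg : g ∈ (D.φ (1 - i)).range
  · obtain ⟨a, rfl⟩ := hg
    rw [glueName_φ h hC hi]
    have := h.lt (act Γ i Γ.base (D.φ i a))
    omega
  · rw [glueName_of_notMem hg]
    have := fno_lt (Quotient.mk'' g : Quotient (QuotientGroup.rightRel (L.map (D.φ (1 - i))))).out
    have := card_le_ord (D := D) (1 - i)
    omega

theorem glueName_congr {t : St} (ht : t.a .tab = s.a .tab) (hc : t.v .cap = s.v .cap)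
    (g : D.Factor (1 - i)) : (glueName code i L g).eval t = (glueName code i L g).eval s := by
  unfold glueName
  split_ifs
  · exact walk_congr ht (e := .lit 0) rfl _
  · simp [Exp.eval, hc]

/-- The old edges and the glued ones are deterministic. -/
theorem detSet_glue (h : Loaded code s Γ ι) (hC : Complete Γ) (hA : Compat Γ)
    (hi : HasCol Γ i Γ.base) (hj : ¬ HasCol Γ (1 - i) Γ.base)
    (hL : ∀ a, a ∈ L ↔ act Γ i Γ.base (D.φ i a) = Γ.base) :
    DetSet (edges s ∪ {e | ∃ g, ∃ x : D.X (1 - i), e = ((glueName code i L g).eval s,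
      (code ⟨1 - i, x⟩ : ℕ), (glueName code i L (g * PresentedGroup.of x)).eval s)}) := by
  have hne : ∀ u g, HasCol Γ (1 - i) u → ι u ≠ (glueName code i L g).eval s := by
    intro u g hu hug
    by_cases hg : g ∈ (D.φ (1 - i)).range
    · obtain ⟨a, rfl⟩ := hg
      rw [glueName_φ h hC hi] at hug
      obtain rfl := h.rep.inj hug
      have hji : 1 - i ≠ i := one_sub_ne i
      exact hj ((bichromatic_act_iff h.rep.folded hC hA hi a).1 (bichromatic_of_ne hji hu
        (hasCol_act hC hi _)) _)
    · rw [glueName_of_notMem hg] at hug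
      have := h.lt u
      omega
  have hmix : ∀ e ∈ edges s, ∀ g, ∀ x : D.X (1 - i), e.2.1 = (code ⟨1 - i, x⟩ : ℕ) →
      e.1 ≠ (glueName code i L g).eval s ∧ e.2.2 ≠ (glueName code i L g).eval s := by
    intro e he g x hx
    obtain ⟨u, y, v, h1, rfl⟩ := h.rep.exists_edge he
    obtain rfl := code.injective (Fin.ext hx)
    exact ⟨hne _ _ (hasCol_iff.2 ⟨x, v, Or.inl h1⟩), hne _ _ (hasCol_iff.2 ⟨x, u, Or.inr h1⟩)⟩
  rintro e (he | ⟨g, x, rfl⟩) e' (he' | ⟨g', x', rfl⟩) hl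
  · exact h.rep.detSet e he e' he' hl
  · exact iff_of_false (hmix e he g' x' hl).1 (hmix e he (g' * PresentedGroup.of x') x' hl).2
  · exact iff_of_false (hmix e' he' g x hl.symm).1.symm
      (hmix e' he' (g * PresentedGroup.of x) x hl.symm).2.symm
  · obtain rfl : x = x' := by simpa using code.injective (Fin.ext hl)
    simp only
    rw [glueName_eq_iff h hC hi hL, glueName_eq_iff h hC hi hL]
    simp [mul_assoc]

end

theorem cmd6_spec {s : St} (hs : Held N s) {Γ : D.Graph} {ι : Γ.V → ℕ}
    (hrep : Rep code Γ ι (edges s)) (hr : Γ.Reach) (hC : Complete Γ) (hA : Compat Γ)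
    (hR : ∀ i v, ¬ Removable Γ i v) (hf : IsFree Γ → IsEmpty Γ.E)
    (h1 : s.v .len + ord D * N ≤ s.v .lim) (h2 : s.v .cap + ord D ≤ s.v .lim)
    (h3 : 2 * N * (s.v .cap + ord D) ≤ s.v .lim)
    {t : St} (ht : t = (cmd6 code).run s) :
    ∃ h : Held N t, t.out = s.out ++ (memGraph code h).encode code ∧
      Step6 Γ (memGraph code h).toPGraph ∧ IsReducedPrecover (memGraph code h).toPGraph ∧
      Link Γ (memGraph code h).toPGraph := by
  have hload := loaded_build code hs.wf hs.det hrep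
  simp only [cmd6, Cmd.run_seqs_cons, Cmd.run_seqs_nil] at ht
  set s₂ := (Cmd.set .np (.lit 0)).run ((build N).run s) with hs₂
  have v2 : ∀ {x}, x ∉ [Var.k, .flag, .idx, .p, .q, .np] → s₂.v x = s.v x := fun {x} hx => by
    simp only [List.mem_cons, List.not_mem_nil, or_false, not_or] at hx
    rw [hs₂, Cmd.run, St.set_v, if_neg (by tauto), build_v (by simp; tauto)]
  have a2 : ∀ {a}, a ≠ .tab → s₂.a a = s.a a := fun {a} ha => by
    rw [hs₂, Cmd.run, St.set_a, build_a ha]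
  have np2 : s₂.v .np = 0 := by simp [hs₂, Cmd.run, Exp.eval]
  have o2 : s₂.out = s.out := Cmd.run_out (build N) (by simp [build, buildStep]) s
  have e2 : edges s₂ = edges s :=
    edges_congr (v2 (by simp)) (a2 (by simp)) (a2 (by simp)) (a2 (by simp))
  have hl2 : Loaded code s₂ Γ ι := 
    hload.congr (by simp [hs₂]) (by simp [hs₂]) fun _ _ _ => rfl
  have d2 : ∀ k, s₂.v .len ≤ k → s₂.a .L k = 0 := by
    rw [v2 (by simp), a2 (by simp)]; exact hs.dead
  rw [← v2 (x := .len) (by simp), ← v2 (x := .lim) (by simp)] at h1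
  rw [← v2 (x := .cap) (by simp), ← v2 (x := .lim) (by simp)] at h2 h3
  rw [← o2]
  clear_value s₂
  rcases Cmd.run_cases (glueCmds code) s₂ with ⟨p, hp, hg, hrun⟩ | ⟨hno, hrun⟩ <;> rw [hrun] at ht
  · obtain ⟨⟨i, L⟩, -, rfl⟩ := List.mem_map.1 hp
    obtain ⟨hL', hi, hj, hL⟩ := (glueE_iff hl2 hC i L).1 hg
    simp only [Cmd.run_seqs_cons, Cmd.run_seqs_nil] at ht
    have hlen := length_glueList code i L
    obtain ⟨b1, b2, b3, b4⟩ := addEdges_spec (s := s₂) (glueList code i L) (fun e => e.eval s₂) (by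
      intro t' ht' hc e he
      simp only [glueList, List.mem_flatMap, List.mem_map] at he
      obtain ⟨g, -, x, -, rfl⟩ := he
      exact ⟨glueName_congr ht' hc _, glueName_congr ht' hc _⟩) d2 (by omega)
    have hv := fun {x : Var} (hx : x ≠ .len) =>
      (addEdges (glueList code i L)).run_v (keepsV_addEdges hx _) s₂
    have ho : ((addEdges (glueList code i L)).run s₂).out = s₂.out :=
      Cmd.run_out _ (quiet_addEdges _) _
    have b4' : edges ((addEdges (glueList code i L)).run s₂) = edges s₂ ∪
        {e | ∃ g, ∃ x : D.X (1 - i), e = ((glueName code i L g).eval s₂,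
        (code ⟨1 - i, x⟩ : ℕ), (glueName code i L (g * PresentedGroup.of x)).eval s₂)} := by
      rw [b4]
      congr 1
      ext e
      simp only [glueList, List.mem_flatMap, List.mem_map, Set.mem_ofPred_eq]
      constructor
      · rintro ⟨e, ⟨g, -, x, -, rfl⟩, rfl⟩
        exact ⟨g, x, rfl⟩
      · rintro ⟨g, x, rfl⟩
        exact ⟨_, ⟨g, mem_elems _, x, mem_elems _, rfl⟩, rfl⟩
    set s₃ := (addEdges (glueList code i L)).run s₂
    clear_value s₃
    set s₄ := (Cmd.set .cap (.add (.var .cap) (.lit (ord D)))).run s₃ with hs₄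
    have e4 : edges s₄ = edges s₃ := edges_congr (by simp [hs₄, Cmd.run]) rfl rfl rfl
    have l4 : s₄.v .lim = s₂.v .lim := by simp [hs₄, Cmd.run, hv]
    have n4 : s₄.v .np = 0 := by simp [hs₄, Cmd.run, hv, np2]
    have c4 : s₄.v .cap = s₂.v .cap + ord D := by simp [hs₄, Cmd.run, Exp.eval, hv]
    obtain ⟨h, c1, -, -, -, R, E', num, hQ, -, hnum, hinj, hE⟩ := finish_spec code (t := s₄)
      (Wf.of_edges (by
        rw [e4, b4', c4]
        rintro e (he | ⟨g, x, rfl⟩)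
        · have := hl2.wf.edges he
          omega
        · exact ⟨glueName_lt hl2 hC hi _, glueName_lt hl2 hC hi _, Fin.is_lt _⟩)
        (by have := hl2.wf.cap_pos; omega) (by omega) (by rw [c4, l4]; exact h3))
      (by omega) (by simpa [hs₄, Cmd.run, b1] using b2) ht
    rw [pairs_eq_empty n4, e4, b4'] at hQ
    obtain rfl := hQ.eq_of_detSet (detSet_glue hl2 hC hA hi hj hL)
    have hrep' := h.rep code
    rw [hE] at hrep'
    obtain ⟨k1, k2, ⟨k3⟩, k4⟩ := step6_glue hl2.rep hC hA hr hR (one_sub_ne i) hi hj hL hL'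
      (glueName_eq_iff hl2 hC hi hL) (glueName_φ hl2 hC hi) (fun g hg u hu => by
        rw [glueName_of_notMem hg] at hu
        have := hl2.lt u
        omega) rfl hrep' hnum hinj
    exact ⟨h, by rw [c1]; exact congrArg (· ++ _) ho, k1, k2, ⟨Lab.mono k3, k4⟩⟩
  · obtain ⟨h, c1, -, -, -, R, E', num, hQ, -, hnum, hinj, hE⟩ := finish_spec code hl2.wf (by omega) d2 ht
    rw [pairs_eq_empty np2] at hQ
    obtain rfl := hQ.eq_of_detSet hl2.rep.detSet
    have hrep' := h.rep code
    rw [hE] at hrep'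
    obtain ⟨k1, k2, ⟨k3⟩, k4⟩ := step6_none hl2.rep hC hA hr hR hf (fun i hi hb a ha => by
      by_contra hne
      refine hno _ (List.mem_map_of_mem (mem_glueCases i ((stab Γ hl2.rep.folded hC i Γ.base).comap
        (D.φ i)))) ((glueE_iff hl2 hC _ _).2 ⟨fun h => hne ?_, hi, fun hj => hb ?_, fun a => ?_⟩)
      · have hm : a ∈ (stab Γ hl2.rep.folded hC i Γ.base).comap (D.φ i) :=
          (mem_stab hl2.rep.folded hC hi).2 ha
        exact Subgroup.mem_bot.1 (h ▸ hm)
      · exact bichromatic_of_ne (one_sub_ne i).symm hi hj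
      · exact mem_stab hl2.rep.folded hC hi) hrep' hnum hinj
    exact ⟨h, c1, k1, k2, ⟨Lab.mono k3, k4⟩⟩


/-! ### Folding and cutting hairs -/

variable {code} in
theorem exists_folded_of_quo {Γ : D.Graph} [Finite Γ.E] {ι : Γ.V → ℕ} (hinj : Function.Injective ι)
    (h0 : ι Γ.base = 0) (hr : Γ.Reach) {R : ℕ → ℕ} {E' : EdgeSet}
    (hQ : RAM.Quo (namedEdges code Γ ι) ∅ R E' ∅) (hD : DetSet E') :
    ∃ (Δ : D.Graph) (ι' : Δ.V → ℕ), Relation.ReflTransGen Fold Γ Δ ∧ Rep code Δ ι' E' ∧ Δ.Reach ∧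
      Link Γ Δ := by
  let f : Γ.V → ℕ := fun u => R (ι u)
  obtain ⟨hE', hf, hm⟩ := fold_of_quo hinj hQ hD
  have hmin := fun (W : Type) (φ : Γ.V → W) hφ => hm W φ hφ fun _ h => h.elim
  obtain ⟨Δ, h1, h2, h, h3, h4, h5⟩ := exists_foldClosure Γ f hf hmin
  have hΔ := hr.of_hom h h3
  obtain ⟨ι', h6, -⟩ := Rep.of_hom (code := code) h h3 h4 h2 hΔ f h5
    (by simp only [f, h0, hQ.zero])
  refine ⟨Δ, ι', h1, hE' ▸ h6, hΔ, Lab.mono h, ?_⟩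
  rintro H ⟨c, c1, c2⟩
  exact Over.of_hom h h3 h4 c1 c2 fun u v huv =>
    hmin _ c (foldCongr_of_smul c2) u v ((h5 u v).1 huv)

/-- The directed edge `d` is a hair. -/
def IsHair (Γ : D.Graph) (d : Γ.DEdge) : Prop :=
  Γ.ter d ≠ Γ.base ∧ ∀ d', Γ.ini d' = Γ.ter d → d' = Γ.rev d

/-- The vertex `j` is the end of a hair. -/
def hairE : Exp := .all [.var .j, .sub (.var .cap) (.var .j),
  .any ((letters code).map fun l => .all [look code (.var .j) l,
    .all (((letters code).filter fun l' => lno code l' ≠ lno code l).map fun l' =>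
      .not (look code (.var .j) l'))])]

variable {code} in
theorem hairE_iff {s : St} {Γ : D.Graph} {ι : Γ.V → ℕ} (h : Loaded code s Γ ι) :
    0 < (hairE code).eval s ↔ ∃ d, IsHair Γ d ∧ ι (Γ.ter d) = s.v .j := by
  have hlook : ∀ {u}, ι u = s.v .j → ∀ l, 0 < (look code (.var .j) l).eval s ↔
      ∃ v, Γ.Step u l v := by
    intro u hu l
    rw [h.look_pos (e := .var .j) (hu ▸ h.lt u :)]
    constructor
    · rintro ⟨u', v, hu', hs⟩
      obtain rfl := h.rep.inj (hu'.trans hu.symm)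
      exact ⟨v, hs⟩
    · rintro ⟨v, hs⟩
      exact ⟨u, v, hu, hs⟩
  simp only [hairE, Exp.eval_all_cons, Exp.eval_all_nil, Exp.eval_any_map, and_true,
    Exp.eval_all_map, Exp.eval_not, List.mem_filter, mem_letters, true_and, decide_eq_true_eq]
  constructor
  · rintro ⟨hj, hc, l, hl, hu⟩
    have hc' : s.v .j < s.v .cap := by simp only [Exp.eval] at hc; omega
    obtain ⟨u, v, hu', hs⟩ := (h.look_pos (e := .var .j) hc').1 hl
    replace hu' : ι u = s.v .j := hu'
    obtain ⟨d, rfl, rfl, rfl⟩ := step_iff.1 hs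
    refine ⟨Γ.rev d, ⟨fun hb => ?_, fun d' hd' => ?_⟩, ?_⟩
    · have : Γ.ter (Γ.rev d) = Γ.ini d := by cases d with | mk e b => cases b <;> rfl
      rw [← this, hb, h.rep.base] at hu'
      simp only [Exp.eval] at hj
      omega
    · have h1 : Γ.ter (Γ.rev d) = Γ.ini d := by cases d with | mk e b => cases b <;> rfl
      rw [h1] at hd'
      have h2 : Γ.dlab d' = Γ.dlab d := by
        by_contra hne
        exact hu _ (fun h => hne (lno_inj code h)) ((hlook hu' _).2 ⟨_, step_iff.2 ⟨d', hd', rfl, rfl⟩⟩)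
      obtain ⟨e, b⟩ := d
      obtain ⟨e', b'⟩ := d'
      simp only [dlab, Prod.mk.injEq] at h2
      obtain ⟨h2, rfl⟩ := h2
      have h3 : e' = e := h.rep.folded _ _ h2 (by
        cases b'
        · exact Or.inr hd'
        · exact Or.inl hd')
      simp [rev, h3]
    · cases d with | mk e b => cases b <;> exact hu'
  · rintro ⟨d, ⟨hb, hd⟩, hj⟩
    have h1 : Γ.ini (Γ.rev d) = Γ.ter d := by cases d with | mk e b => cases b <;> rfl
    refine ⟨?_, ?_, Γ.dlab (Γ.rev d), (hlook hj _).2 ⟨_, step_iff.2 ⟨_, h1, rfl, rfl⟩⟩, ?_⟩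
    · simp only [Exp.eval]
      rw [← hj]
      exact Nat.pos_of_ne_zero fun h' => hb (h.rep.inj (h'.trans h.rep.base.symm))
    · have := h.lt (Γ.ter d)
      simp only [Exp.eval]
      omega
    · intro l hl hs
      obtain ⟨v, hs⟩ := (hlook hj l).1 hs
      obtain ⟨d', h2, rfl, -⟩ := step_iff.1 hs
      exact hl (by rw [hd d' h2])

/-- The graph `Δ`, held in memory, has been obtained from `Γ` by foldings and cutting hairs. -/
structure Trimmed (Γ : D.Graph) (E : EdgeSet) (m : Σ Δ : D.Graph, Δ.V → ℕ) : Prop where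
  steps : Relation.ReflTransGen (fun Δ Δ' => Fold Δ Δ' ∨ CutHair Δ Δ') Γ m.1
  rep : Rep code m.1 m.2 E
  reach : m.1.Reach
  link : Link Γ m.1

/-- Cut all hairs. -/
def trim : Cmd := prune N [(hairE code, 0)] (.any [.eq eS (.var .p), .eq eT (.var .p)])

theorem trim_spec {s : St} (hw : Wf N s) (hd : Det s) {Γ : D.Graph} (h : ∃ m, Trimmed code Γ (edges s) m)
    {t : St} (ht : t = (trim code).run s) :
    Wf N t ∧ Det t ∧ ∃ m, Trimmed code Γ (edges t) m ∧ ∀ d, ¬ IsHair m.1 d := by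
  obtain ⟨h1, h2, m, h3, h4⟩ := prune_spec hw hd [(hairE code, 0)]
    (.any [.eq eS (.var .p), .eq eT (.var .p)]) (Trimmed code Γ)
    (fun m _ v => ∃ d, IsHair m.1 d ∧ m.2 (m.1.ter d) = v)
    (fun _ _ v e => e.1 = v ∨ e.2.2 = v) h (by
      simp only [List.mem_singleton, forall_eq]
      exact fun t m h1 h2 h3 => hairE_iff ⟨h1, h2, h3.rep⟩) (by
      intro t m h1 h2 h3 e he hf hW t' hv ha hk h0 hL
      simp only [Exp.eval_any_cons, Exp.eval_any_nil, or_false, Exp.eval_eq]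
      simp only [Exp.eval, ha .S (by simp), ha .T (by simp), hv .p (by simp)]) (by
      rintro E m c v h3 ⟨d, ⟨hb, hd⟩, rfl⟩
      obtain ⟨Γ', k1, k2, ⟨ι', k3⟩, k4, k5⟩ := exists_cutHair h3.rep h3.reach hb hd
      refine ⟨⟨⟨Γ', ι'⟩, h3.steps.tail (Or.inr k1), ?_, k2, h3.link.lab.trans k4,
        fun H hH => k5 H (h3.link.ovr H hH)⟩, _, (h3.rep.edge _ _ _).1 (.mk d.1), ?_⟩
      · simpa only [not_or] using k3
      · obtain ⟨e, b⟩ := d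
        cases b
        · exact Or.inl rfl
        · exact Or.inr rfl) (by
      rintro t m c v h1 h3 ⟨d, -, rfl⟩
      exact (h1.verts (h3.rep.range ▸ ⟨_, rfl⟩)).trans_le h1.cap_le)
  rw [← trim, ← ht] at h1 h2 h3
  exact ⟨h1, h2, m, h3, fun d hd => h4 _ (List.mem_singleton_self _) _ ⟨d, hd, rfl⟩⟩

/-- Step 2. -/
def cmd2 : Cmd := .seq (.seqs [.set .np (.lit 0), engine N, trim code]) emit

theorem cmd2_spec {s : St} (hs : Wf N s) (hdead : ∀ k, s.v .len ≤ k → s.a .L k = 0) {Γ : D.Graph}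
    [Finite Γ.E] {ι : Γ.V → ℕ} (hinj : Function.Injective ι) (h0 : ι Γ.base = 0)
    (hE : edges s = namedEdges code Γ ι) (hr : Γ.Reach) {t : St} (ht : t = (cmd2 code).run s) :
    ∃ h : Held N t, t.out = s.out ++ (memGraph code h).encode code ∧ t.v .lim = s.v .lim ∧
      t.v .len = s.v .len ∧ t.v .cap ≤ s.v .cap ∧
      Step2 Γ (memGraph code h).toPGraph ∧ (memGraph code h).toPGraph.Reach ∧
      Link Γ (memGraph code h).toPGraph := by
  set s₁ := (Cmd.set .np (.lit 0)).run s with hs₁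
  have e1 : edges s₁ = edges s := edges_congr (by simp [hs₁, Cmd.run]) rfl rfl rfl
  have n1 : s₁.v .np = 0 := by simp [hs₁, Cmd.run, Exp.eval]
  obtain ⟨w2, ⟨R, hQ⟩, d2⟩ := engine_spec (N := N) (s := s₁)
    (hs.congr (by simp [hs₁, Cmd.run]) (by simp [hs₁, Cmd.run]) rfl rfl rfl) (by omega)
  rw [pairs_eq_empty n1, e1, hE] at hQ
  obtain ⟨Δ, ι', f1, f2, f3, f4⟩ := exists_folded_of_quo hinj h0 hr hQ (detSet_edges d2)
  obtain ⟨w3, d3, ⟨Δ', ι₁⟩, m1, m2⟩ := trim_spec code w2 d2 ⟨⟨Δ, ι'⟩,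
    Relation.ReflTransGen.mono (fun _ _ => Or.inl) _ _ f1, f2, f3, f4⟩ rfl
  obtain ⟨q1, q2, q3, q4⟩ := m1
  simp only at q1 q2 q3 q4 m2
  obtain ⟨h, b1, b2, b3, b4, num, hnum, hinj', hE'⟩ := held_emit code hdead
    (c := .seqs [.set .np (.lit 0), engine N, trim code]) (by
      simp [trim, prune, kill, find, engine, mergePairs, pairStep, merge, renameStep, renameCell,
        foldAll, foldStep, build, buildStep, Cmd.cases]) w3 d3 ht
  have hrep' := h.rep code
  obtain ⟨f, g1, g2, -⟩ := Rep.iso q2 hrep' hnum hinj' hE'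
  refine ⟨h, b1, b2, b3, b4, ⟨Δ', q1, ⟨f, g1, g2⟩, ?_⟩, q3.of_hom f g1.2,
    q4.lab.trans (Lab.mono f), ?_⟩
  · rintro Γ' (hf | ⟨⟨e, b⟩, hb, hd, -⟩)
    · exact hrep'.folded.not_fold hf
    · obtain ⟨e, rfl⟩ := g2.2 e
      have hter : (memGraph code h).toPGraph.ter (f.onE e, b) = f.onV (Δ'.ter (e, b)) := by
        cases b
        · exact f.src_onE e
        · exact f.tgt_onE e
      refine m2 (e, b) ⟨fun h' => hb ?_, ?_⟩
      · rw [hter, h', f.onV_base]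
      · rintro ⟨e', b'⟩ h'
        have := hd (f.onE e', b') (by
          rw [hter, ← h']
          cases b'
          · exact f.tgt_onE e'
          · exact f.src_onE e')
        simp only [rev, Prod.mk.injEq, g2.1.eq_iff] at this ⊢
        exact this
  · intro H hH
    obtain ⟨c, h1, h2⟩ := q4.ovr H hH
    exact Over.of_hom f g1.2 g2.2 h1 h2 fun u v huv => by rw [g1.1 huv]

end FiniteAmalgam

namespace RAM

theorem elist_eq_map {s : St} {m : ℕ} (hm : m ≤ s.v .lim) (hL : ∀ k, s.a .L k ≠ 0 ↔ k < m) :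
    elist s = (List.range m).map fun k => (s.a .S k, s.a .L k - 1, s.a .T k) := by
  obtain ⟨n, hn⟩ := Nat.exists_eq_add_of_le hm
  rw [elist, hn, List.range_add, List.filterMap_append]
  have h1 : ((List.range n).map (m + ·)).filterMap (fun k => if s.a .L k = 0 then none else
      some (s.a .S k, s.a .L k - 1, s.a .T k)) = [] := by
    rw [List.filterMap_eq_nil_iff]
    intro k hk
    obtain ⟨k, -, rfl⟩ := List.mem_map.1 hk
    rw [if_pos]
    by_contra h
    have := (hL _).1 h
    omega
  rw [h1, List.append_nil, ← List.filterMap_eq_map]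
  refine List.filterMap_congr fun k hk => ?_
  rw [if_neg ((hL k).2 (List.mem_range.1 hk))]
  rfl

end RAM

namespace FiniteAmalgam

open PGraph RAM

variable {D : FiniteAmalgam} {N : ℕ} (code : D.Gen ≃ Fin N)

theorem iso_ofState {s : St} {Γ : D.Graph} {ι : Γ.V → ℕ} {κ : Γ.E → ℕ} {m : ℕ} (hw : Wf N s)
    (hw' : Wf N (emit.run s)) (hm : m ≤ s.v .lim) (hL : ∀ k, s.a .L k ≠ 0 ↔ k < m)
    (hκ : Function.Injective κ) (hκ' : ∀ k, k < m ↔ ∃ e, κ e = k)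
    (hS : ∀ e, s.a .S (κ e) = ι (Γ.src e)) (hT : ∀ e, s.a .T (κ e) = ι (Γ.tgt e))
    (hlab : ∀ e, s.a .L (κ e) = code (Γ.lab e) + 1) (hι : Function.Injective ι)
    (h0 : ι Γ.base = 0) (hV : ∀ v, v = Γ.base ∨ ∃ e, v = Γ.src e ∨ v = Γ.tgt e) :
    Iso Γ (NumGraph.ofState code (emit.run s) hw').toPGraph := by
  obtain ⟨-, -, h3, -, -, -, h7⟩ := emit_spec hw
  have eL : (emit.run s).a .L = s.a .L :=
    Cmd.run_a _ (by simp [emit, compact, relabelStep, markStep, numberStep, printGraph]) s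
  have hel := elist_eq_map (s := emit.run s) (m := m) (by rw [(emit_len s).2]; exact hm) (by rw [eL]; exact hL)
  rw [eL] at hel
  have hlen : (elist (emit.run s)).length = m := by rw [hel]; simp
  have hκm : ∀ e, κ e < m := fun e => (hκ' _).2 ⟨e, rfl⟩
  have hel' : ∀ e (h : κ e < (elist (emit.run s)).length), (elist (emit.run s))[κ e] =
      (numbering s (ι (Γ.src e)), (code (Γ.lab e) : ℕ), numbering s (ι (Γ.tgt e))) := by
    intro e h
    obtain ⟨q1, q2⟩ := h7 (κ e) ((hκm e).trans_le hm) ((hL _).2 (hκm e))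
    simp only [hel, List.getElem_map, List.getElem_range, q1, q2, hS, hT, hlab, Nat.add_sub_cancel]
  have hE : ∀ e, (ι (Γ.src e), (code (Γ.lab e) : ℕ), ι (Γ.tgt e)) ∈ edges s := fun e => by
    have := mem_edges ((hκm e).trans_le hm) ((hL _).2 (hκm e))
    rwa [hS, hT, hlab, Nat.add_sub_cancel] at this
  have hE' : ∀ e ∈ edges s, ∃ e', e = (ι (Γ.src e'), (code (Γ.lab e') : ℕ), ι (Γ.tgt e')) := by
    rintro ⟨u, c, v⟩ ⟨k, hk, h1, h2, h3⟩
    obtain ⟨e, rfl⟩ := (hκ' k).1 ((hL k).1 (by omega))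
    rw [hS] at h1
    rw [hT] at h3
    rw [hlab] at h2
    simp only at h1 h2 h3
    exact ⟨e, by rw [h1, h3, Nat.add_right_cancel h2]⟩
  have hv : ∀ v, ι v ∈ verts (edges s) := by
    intro v
    rcases hV v with rfl | ⟨e, rfl | rfl⟩
    · exact Or.inl h0
    · exact Or.inr ⟨_, hE e, Or.inl rfl⟩
    · exact Or.inr ⟨_, hE e, Or.inr rfl⟩
  have hinj := numbering_inj s
  have hz := numbering_zero s
  have hκn : ∀ e, κ e < (elist (emit.run s)).length := fun e => hlen.symm ▸ hκm e
  clear h7 eL hel hw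
  generalize numbering s = num at *
  generalize emit.run s = s' at *
  refine ⟨⟨fun v => ⟨num (ι v), (h3 _).2 ⟨_, hv v, rfl⟩⟩,
    fun e => ⟨κ e, hκn e⟩, fun e => ?_, fun e => ?_, fun e => ?_, ?_⟩, ⟨?_, ?_⟩, ⟨?_, ?_⟩⟩
  · exact Fin.ext (congrArg Prod.fst (hel' e (hκn e)))
  · exact Fin.ext (congrArg (fun x => x.2.2) (hel' e (hκn e)))
  · refine code.injective (Fin.ext ?_)
    refine Eq.trans ?_ (congrArg (fun x => x.2.1) (hel' e (hκn e)))
    exact congrArg Fin.val (code.apply_symm_apply _)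
  · exact Fin.ext ((congrArg num h0).trans hz)
  · intro u v huv
    exact hι (hinj (hv u) (hv v) (congrArg Fin.val huv))
  · rintro ⟨v, hv'⟩
    obtain ⟨u, hu, rfl⟩ := (h3 v).1 hv'
    have : ∃ w, ι w = u := by
      rcases hu with h | ⟨e, he, h | h⟩
      · exact ⟨Γ.base, h0.trans h.symm⟩
      · obtain ⟨e, rfl⟩ := hE' e he
        exact ⟨_, h.symm⟩
      · obtain ⟨e, rfl⟩ := hE' e he
        exact ⟨_, h.symm⟩
    obtain ⟨w, rfl⟩ := this
    exact ⟨w, rfl⟩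
  · exact fun e e' h => hκ (congrArg Fin.val h)
  · rintro ⟨k, hk⟩
    obtain ⟨e, rfl⟩ := (hκ' k).1 (hlen ▸ hk)
    exact ⟨e, rfl⟩

/-! ### The bouquet -/

section

variable {ws : List (List D.Letter)}

theorem bouquet_step (j : Fin ws.length) {k : ℕ} (hk : k < (ws.get j).length) :
    (bouquet ws).Reads (bouquetPoint ws j k) [(ws.get j)[k]] (bouquetPoint ws j (k + 1)) := by
  refine ⟨(⟨j, k, hk⟩, (ws.get j)[k].2), ?_, rfl, ?_⟩
  · cases h : (ws.get j)[k].2 <;> simp only [ini, bouquet, List.get_eq_getElem, List.get_eq_getElem] at h ⊢ <;> simp [h]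
  · cases h : (ws.get j)[k].2 <;> simp only [ter, bouquet, List.get_eq_getElem] at h ⊢ <;> simp [h, Reads]

theorem bouquet_reads (j : Fin ws.length) {k : ℕ} (hk : k ≤ (ws.get j).length) :
    (bouquet ws).Reads none ((ws.get j).take k) (bouquetPoint ws j k) := by
  induction k with
  | zero => simp only [List.take_zero, Reads, bouquetPoint, lt_irrefl, false_and, dif_neg, not_false_eq_true]; rfl
  | succ k ih =>
    rw [← List.take_append_getElem hk]
    exact reads_append.2 ⟨_, ih (by omega), bouquet_step j hk⟩

theorem bouquet_reach : (bouquet ws).Reach := by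
  rintro (_ | ⟨j, k, h⟩)
  · exact ⟨[], rfl⟩
  · have := bouquet_reads j (k := k) h.2.le
    rw [bouquetPoint, dif_pos h] at this
    exact ⟨_, this⟩

theorem val_mem_lab_bouquet {w : List D.Letter} (hw : w ∈ ws) : D.val w ∈ Lab (bouquet ws) := by
  obtain ⟨j, rfl⟩ := List.get_of_mem hw
  have := bouquet_reads j le_rfl
  rw [bouquetPoint, dif_neg (by omega), List.take_length] at this
  exact ⟨_, this, rfl⟩

theorem over_bouquet : Over (Subgroup.closure {g | ∃ w ∈ ws, D.val w = g}) (bouquet ws) := by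
  set H := Subgroup.closure {g | ∃ w ∈ ws, D.val w = g}
  let c : (bouquet ws).V → D.Gp ⧸ H := fun v => match v with
    | none => ((1 : D.Gp) : D.Gp ⧸ H)
    | some ⟨j, k, _⟩ => (((D.val ((ws.get j).take k))⁻¹ : D.Gp) : D.Gp ⧸ H)
  have hc : ∀ j k, k ≤ (ws.get j).length → c (bouquetPoint ws j k) =
      (((D.val ((ws.get j).take k))⁻¹ : D.Gp) : D.Gp ⧸ H) := by
    intro j k hk
    rw [bouquetPoint]
    split_ifs with h
    · rfl
    · rw [not_and_or, Nat.pos_iff_ne_zero, not_not, not_lt] at h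
      rcases h with rfl | h
      · simp [c, FiniteAmalgam.val]
      · have : D.val (ws.get j) ∈ H := Subgroup.subset_closure ⟨_, List.get_mem _ _, rfl⟩
        rw [List.take_of_length_le h]
        exact QuotientGroup.eq.2 (by simpa using this)
  refine ⟨c, rfl, fun e => ?_⟩
  obtain ⟨j, k, hk⟩ := e
  have hv : D.val ((ws.get j).take (k + 1)) = D.val ((ws.get j).take k) * D.letterVal (ws.get j)[k] := by
    rw [← List.take_append_getElem hk, val_append]
    simp [FiniteAmalgam.val]
  have h1 := hc j k hk.le
  have h2 := hc j (k + 1) hk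
  rcases hl : (ws.get j)[k] with ⟨x, b⟩
  have hl' : (ws.get j).get ⟨k, hk⟩ = (x, b) := hl
  rw [hl] at hv
  cases b
  · have e1 : (bouquet ws).src ⟨j, k, hk⟩ = bouquetPoint ws j (k + 1) := by simp only [bouquet, hl']; rfl
    have e2 : (bouquet ws).tgt ⟨j, k, hk⟩ = bouquetPoint ws j k := by simp only [bouquet, hl']; rfl
    have e3 : (bouquet ws).lab ⟨j, k, hk⟩ = x := by simp only [bouquet, hl']
    rw [e1, e2, e3, h1, h2, hv, mul_inv_rev, ← letterVal_not]
    rfl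
  · have e1 : (bouquet ws).src ⟨j, k, hk⟩ = bouquetPoint ws j k := by simp only [bouquet, hl']; rfl
    have e2 : (bouquet ws).tgt ⟨j, k, hk⟩ = bouquetPoint ws j (k + 1) := by simp only [bouquet, hl']; rfl
    have e3 : (bouquet ws).lab ⟨j, k, hk⟩ = x := by simp only [bouquet, hl']
    rw [e1, e2, e3, h1, h2, hv, mul_inv_rev]
    change _ = ((D.letterVal (x, true) * _ : D.Gp) : D.Gp ⧸ H)
    rw [mul_inv_cancel_left]

/-- The number of letters before the `j`-th word. -/
def off (ws : List (List D.Letter)) (j : ℕ) : ℕ := totalLength (ws.take j)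

theorem off_succ (j : Fin ws.length) : off ws (j + 1) = off ws j + (ws.get j).length := by
  simp [off, totalLength, List.map_take, List.sum_take_succ]

theorem off_mono {j j' : ℕ} (h : j ≤ j') : off ws j ≤ off ws j' := by
  refine monotone_nat_of_le_succ (f := off ws) (fun j => ?_) h
  by_cases hj : j < ws.length
  · have := off_succ (ws := ws) ⟨j, hj⟩
    simp only at this
    omega
  · rw [off, off, List.take_of_length_le (by omega), List.take_of_length_le (by omega)]

/-- The numbering of the edges of the bouquet. -/
def edgeNo (e : (bouquet ws).E) : ℕ := off ws e.1 + e.2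

/-- The number of the `k`-th vertex on a loop with `l` edges, numbered from `n`. -/
def pointNo (n l k : ℕ) : ℕ := if 0 < k ∧ k < l then n + k else 0

/-- The numbering of the vertices of the bouquet. -/
def vertNo : (bouquet ws).V → ℕ
  | none => 0
  | some p => off ws p.1 + p.2.1

theorem vertNo_bouquetPoint (j : Fin ws.length) (k : ℕ) :
    vertNo (bouquetPoint ws j k) = pointNo (off ws j) (ws.get j).length k := by
  unfold bouquetPoint pointNo
  split_ifs <;> rfl

theorem off_add_inj {j j' : Fin ws.length} {k k' : ℕ} (hk : k < (ws.get j).length)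
    (hk' : k' < (ws.get j').length) (h : off ws j + k = off ws j' + k') : j = j' ∧ k = k' := by
  have h1 := off_succ j
  have h2 := off_succ j'
  rcases lt_trichotomy (j : ℕ) j' with h3 | h3 | h3
  · have := off_mono (ws := ws) (Nat.succ_le_of_lt h3)
    rw [Nat.succ_eq_add_one] at this
    omega
  · obtain rfl := Fin.ext h3
    exact ⟨rfl, by omega⟩
  · have := off_mono (ws := ws) (Nat.succ_le_of_lt h3)
    rw [Nat.succ_eq_add_one] at this
    omega

theorem edgeNo_injective : Function.Injective (edgeNo (ws := ws)) := by
  rintro ⟨j, k⟩ ⟨j', k'⟩ h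
  obtain ⟨rfl, h'⟩ := off_add_inj k.2 k'.2 h
  rw [Fin.ext h']

theorem vertNo_injective : Function.Injective (vertNo (ws := ws)) := by
  rintro (_ | ⟨j, k, h⟩) (_ | ⟨j', k', h'⟩) e
  · rfl
  · have : 0 = off ws j' + k' := e
    omega
  · have : off ws j + k = 0 := e
    omega
  · obtain ⟨rfl, e'⟩ := off_add_inj h.2 h'.2 e
    subst e'
    rfl

theorem lt_totalLength_iff (k : ℕ) : k < totalLength ws ↔ ∃ e, edgeNo (ws := ws) e = k := by
  have hlt : ∀ e, edgeNo (ws := ws) e < totalLength ws := by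
    rintro ⟨j, k⟩
    have h1 := off_succ j
    have h2 := off_mono (ws := ws) (Nat.succ_le_of_lt j.2)
    have h3 : off ws ws.length = totalLength ws := by simp [off]
    have := k.2
    rw [Nat.succ_eq_add_one] at h2
    change off ws j + k < _
    omega
  have hcard : Fintype.card (Σ j : Fin ws.length, Fin (ws.get j).length) = totalLength ws := by
    rw [Fintype.card_sigma]
    simp [totalLength]
  have : Function.Bijective fun e : (Σ j : Fin ws.length, Fin (ws.get j).length) =>
      (⟨edgeNo (ws := ws) e, hlt e⟩ : Fin (totalLength ws)) := by
    rw [Fintype.bijective_iff_injective_and_card]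
    exact ⟨fun e e' h => edgeNo_injective (congrArg Fin.val h), by simpa using hcard⟩
  constructor
  · intro hk
    obtain ⟨e, he⟩ := this.2 ⟨k, hk⟩
    exact ⟨e, congrArg Fin.val he⟩
  · rintro ⟨e, rfl⟩
    exact hlt e

theorem bouquet_vertex (v : (bouquet ws).V) :
    v = (bouquet ws).base ∨ ∃ e, v = (bouquet ws).src e ∨ v = (bouquet ws).tgt e := by
  by_cases hv : v = (bouquet ws).base
  · exact Or.inl hv
  · obtain ⟨u, x, ⟨e, -, -, h⟩ | ⟨e, h, -⟩⟩ := bouquet_reach.exists_edge v hv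
    · exact Or.inr ⟨e, Or.inr h.symm⟩
    · exact Or.inr ⟨e, Or.inl h.symm⟩

end


/-! ### Reading the words -/

/-- Write the edge for the letter `l`, between the vertices `cur` and `nxt`. -/
def putLetter (l : D.Letter) : Cmd := .seqs [
  .put .S (.var .len) (.var (if l.2 then .cur else .nxt)),
  .put .T (.var .len) (.var (if l.2 then .nxt else .cur)),
  .put .L (.var .len) (.lit (code l.1 + 1))]

/-- Read the letter number `k` of a word of length `num`. -/
def readLetter : Cmd := .seqs [.read .ltr,
  .ite (.var .k) (.set .cur (.var .len)) (.set .cur (.lit 0)),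
  .ite (.sub (.var .num) (.add (.var .k) (.lit 1))) (.set .nxt (.add (.var .len) (.lit 1)))
    (.set .nxt (.lit 0)),
  .cases ((letters code).map fun l => (.eq (.var .ltr) (.lit (lno code l)), putLetter code l)),
  .set .len (.add (.var .len) (.lit 1))]

/-- Read a word. -/
def readWord : Cmd := .seqs [.read .num, .iter .k (.var .num) (readLetter code)]

/-- Read the input. -/
def readWords : Cmd := .seqs [.read .cnt, .iter .i (.var .cnt) (readWord code)]

/-- The edge for the letter `l`, at the place `k` of a word of length `n`, is held in the cell
`m + k`. -/
structure Cell (a : Arr → ℕ → ℕ) (m n k : ℕ) (l : D.Letter) : Prop where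
  src : a .S (m + k) = pointNo m n (if l.2 then k else k + 1)
  tgt : a .T (m + k) = pointNo m n (if l.2 then k + 1 else k)
  lab : a .L (m + k) = code l.1 + 1

theorem Cell.congr {a a' : Arr → ℕ → ℕ} {m n k : ℕ} {l : D.Letter} (h : Cell code a m n k l)
    (ha : ∀ b, a' b (m + k) = a b (m + k)) : Cell code a' m n k l :=
  ⟨(ha _).trans h.src, (ha _).trans h.tgt, (ha _).trans h.lab⟩

theorem keepsV_readLetter {x : Var} (hx : x ∉ [Var.ltr, .cur, .nxt, .len]) :
    (readLetter code).KeepsV x := by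
  simp only [List.mem_cons, List.not_mem_nil, or_false, not_or] at hx
  have : (Cmd.cases ((letters code).map fun l =>
      (Exp.eq (.var .ltr) (.lit (lno code l)), putLetter code l))).KeepsV x := by
    refine Cmd.keepsV_cases.2 ?_
    simp [-Prod.forall, -List.mem_map, List.forall_mem_map, putLetter]
  simp [readLetter, this]
  tauto

theorem readLetter_spec {s : St} {l : D.Letter} {rest : List ℕ} (hs : s.inp = lno code l :: rest)
    {m : ℕ} (hm : s.v .len = m + s.v .k) (hk : s.v .k < s.v .num) :
    ((readLetter code).run s).inp = rest ∧ ((readLetter code).run s).v .len = s.v .len + 1 ∧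
      Cell code ((readLetter code).run s).a m (s.v .num) (s.v .k) l ∧
      (∀ b k, k ≠ s.v .len → ((readLetter code).run s).a b k = s.a b k) ∧
      ((readLetter code).run s).out = s.out := by
  simp only [readLetter, Cmd.run_seqs_cons, Cmd.run_seqs_nil]
  set s₁ := (Cmd.read .ltr).run s with hs₁
  set s₂ := (Cmd.ite _ _ _).run s₁ with hs₂
  set s₃ := (Cmd.ite _ _ _).run s₂ with hs₃
  have a3 : s₃.a = s.a := by
    simp only [hs₃, hs₂, hs₁, Cmd.run]; split_ifs <;> rfl
  have i3 : s₃.inp = rest := by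
    have : s.inp.tail = rest := by rw [hs]; rfl
    rw [← this]
    simp only [hs₃, hs₂, hs₁, Cmd.run]; split_ifs <;> rfl
  have o3 : s₃.out = s.out := by
    simp only [hs₃, hs₂, hs₁, Cmd.run]; split_ifs <;> rfl
  have n3 : s₃.v .len = s.v .len := by
    simp only [hs₃, hs₂, hs₁, Cmd.run]; split_ifs <;> simp
  have l3 : s₃.v .ltr = lno code l := by
    simp only [hs₃, hs₂, hs₁, Cmd.run, hs]; split_ifs <;> simp
  have c3 : s₃.v .cur = if 0 < s.v .k then s.v .len else 0 := by
    simp only [hs₃, hs₂, hs₁, Cmd.run, Exp.eval]; split_ifs <;> simp_all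
  have x3 : s₃.v .nxt = if 0 < s.v .num - (s.v .k + 1) then s.v .len + 1 else 0 := by
    have e1 : s₂.v .num = s.v .num := by simp only [hs₂, hs₁, Cmd.run]; split_ifs <;> simp
    have e2 : s₂.v .k = s.v .k := by simp only [hs₂, hs₁, Cmd.run]; split_ifs <;> simp
    have e3 : s₂.v .len = s.v .len := by simp only [hs₂, hs₁, Cmd.run]; split_ifs <;> simp
    simp only [hs₃, Cmd.run, Exp.eval, e1, e2, e3]; split_ifs <;> simp
  clear_value s₃
  rcases Cmd.run_cases ((letters code).map fun l =>
      (Exp.eq (.var .ltr) (.lit (lno code l)), putLetter code l)) s₃ with ⟨p, hp, h1, h2⟩ | ⟨h1, -⟩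
  swap
  · refine absurd ?_ (h1 _ (List.mem_map_of_mem (mem_letters code l)))
    rw [Exp.eval_eq]
    exact l3
  obtain ⟨l', -, rfl⟩ := List.mem_map.1 hp
  rw [Exp.eval_eq] at h1
  obtain rfl : l = l' := lno_inj code (l3.symm.trans h1)
  rw [h2]
  have hcur : s₃.v .cur = pointNo m (s.v .num) (s.v .k) := by
    rw [c3, hm, pointNo]
    simp only [hk, and_true]
  have hnxt : s₃.v .nxt = pointNo m (s.v .num) (s.v .k + 1) := by
    rw [x3, hm, pointNo]
    split_ifs <;> omega
  obtain ⟨x, b⟩ := l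
  refine ⟨?_, ?_, ⟨?_, ?_, ?_⟩, ?_, ?_⟩
  · simp [putLetter, Cmd.run, i3]
  · simp [putLetter, Cmd.run, Exp.eval, n3]
  · rw [← hm]
    cases b <;> simp [putLetter, Cmd.run, Exp.eval, n3, hcur, hnxt]
  · rw [← hm]
    cases b <;> simp [putLetter, Cmd.run, Exp.eval, n3, hcur, hnxt]
  · rw [← hm]
    simp [putLetter, Cmd.run, Exp.eval, n3]
  · intro b k hb
    simp [putLetter, Cmd.run, Exp.eval, n3, hb, a3]
  · simp [putLetter, Cmd.run, o3]

/-- The words `ws` are held in memory. -/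
def Words (a : Arr → ℕ → ℕ) (ws : List (List D.Letter)) (n : ℕ) : Prop :=
  ∀ j : Fin ws.length, (j : ℕ) < n → ∀ k : Fin (ws.get j).length,
    Cell code a (off ws j) (ws.get j).length k ((ws.get j).get k)

theorem readWord_spec {s : St} {w : List D.Letter} {rest : List ℕ}
    (hs : s.inp = w.length :: w.map (lno code) ++ rest) {t : St} (ht : t = (readWord code).run s) :
    t.inp = rest ∧ t.v .len = s.v .len + w.length ∧ t.out = s.out ∧
      (∀ k : Fin w.length, Cell code t.a (s.v .len) w.length k (w.get k)) ∧
      ∀ b k, (k < s.v .len ∨ s.v .len + w.length ≤ k) → t.a b k = s.a b k := by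
  set s₁ := (Cmd.read .num).run s with hs₁
  have num1 : s₁.v .num = w.length := by simp [hs₁, Cmd.run, hs]
  have a1 : s₁.a = s.a := rfl
  have o1 : s₁.out = s.out := rfl
  have len1 : s₁.v .len = s.v .len := by simp [hs₁, Cmd.run]
  have inp1 : s₁.inp = w.map (lno code) ++ rest := by simp [hs₁, Cmd.run, hs]
  have ht' : t = (Cmd.iter .k (.var .num) (readLetter code)).run s₁ := ht
  clear_value s₁
  have := Cmd.iter_inv (x := .k) (e := .var .num) (c := readLetter code) (s := s₁) (fun n t =>
    t.inp = (w.drop n).map (lno code) ++ rest ∧ t.v .len = s.v .len + n ∧ t.out = s.out ∧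
      (∀ k : Fin w.length, (k : ℕ) < n → Cell code t.a (s.v .len) w.length k (w.get k)) ∧
      ∀ b k, (k < s.v .len ∨ s.v .len + n ≤ k) → t.a b k = s.a b k)
    ⟨by simpa using inp1, len1, o1, fun k hk => absurd hk (Nat.not_lt_zero _), fun b k _ => by rw [a1]⟩ (by
    rintro n hn t ft ⟨h1, h2, h3, h4, h5⟩
    simp only [Exp.eval, num1] at hn
    have hnum : t.v .num = w.length := (ft.v (x := .num)
      ⟨by simp, keepsV_readLetter code (by simp)⟩).trans num1
    rw [← List.cons_getElem_drop_succ (h := hn), List.map_cons, List.cons_append] at h1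
    obtain ⟨g1, g2, g3, g4, g5⟩ := readLetter_spec code (s := t.set .k n) (m := s.v .len)
      h1 (by simpa using h2) (by simpa [hnum] using hn)
    simp only [St.set_v, reduceCtorEq, if_false, if_true, hnum, St.set_a, St.set_out, h2] at g2 g3 g4 g5
    refine ⟨g1, g2, g5.trans h3, fun k hk => ?_, fun b k hk => ?_⟩
    · rcases Nat.lt_succ_iff_lt_or_eq.1 hk with hk | hk
      · exact (h4 k hk).congr code fun b => g4 b _ (by omega)
      · obtain rfl : k = ⟨n, hn⟩ := Fin.ext hk
        exact g3
    · rw [g4 b k (by omega), h5 b k (by omega)])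
  rw [← ht'] at this
  simp only [Exp.eval, num1, List.drop_length, List.map_nil, List.nil_append] at this
  obtain ⟨h1, h2, h3, h4, h5⟩ := this
  exact ⟨h1, h2, h3, fun k => h4 k k.2, h5⟩

/-- The state after reading `n` words. -/
theorem readWords_prefix (ws : List (List D.Letter)) {n : ℕ} (hn : n ≤ ws.length) {t : St}
    (ht : t = (Cmd.iter .i (.lit n) (readWord code)).run
      ((Cmd.read .cnt).run (.init (encodeWords code ws)))) :
    t.inp = (ws.drop n).flatMap (fun w => w.length :: w.map (lno code)) ∧ t.v .len = off ws n ∧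
      t.out = [] ∧ Words code t.a ws n ∧ ∀ k, off ws n ≤ k → t.a .L k = 0 := by
  set s₁ := (Cmd.read .cnt).run (.init (encodeWords code ws)) with hs₁
  have := Cmd.iter_inv (x := .i) (e := .lit n) (c := readWord code) (s := s₁) (fun n t =>
    t.inp = (ws.drop n).flatMap (fun w => w.length :: w.map (lno code)) ∧ t.v .len = off ws n ∧
      t.out = [] ∧ Words code t.a ws n ∧ ∀ k, off ws n ≤ k → t.a .L k = 0)
    ⟨rfl, rfl, rfl, fun j hj => absurd hj (Nat.not_lt_zero _), fun k _ => rfl⟩ (by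
    rintro i hi t - ⟨h1, h2, h3, h4, h5⟩
    have hi' : i < ws.length := lt_of_lt_of_le hi hn
    have ho := off_succ (ws := ws) ⟨i, hi'⟩
    simp only [List.get_eq_getElem] at ho
    rw [← List.cons_getElem_drop_succ (h := hi'), List.flatMap_cons] at h1
    obtain ⟨g1, g2, g3, g4, g5⟩ := readWord_spec code (s := t.set .i i) (w := ws[i]) (by simpa using h1) rfl
    simp only [St.set_v, reduceCtorEq, if_false, St.set_a, St.set_out, h2] at g2 g3 g4 g5
    refine ⟨g1, by rw [g2, ho], g3.trans h3, fun j hj => ?_, fun k hk => ?_⟩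
    · rcases Nat.lt_succ_iff_lt_or_eq.1 hj with hj | hj
      · intro k
        refine (h4 j hj k).congr code fun b => g5 b _ (Or.inl ?_)
        have h6 := off_succ j
        have h7 := off_mono (ws := ws) (Nat.succ_le_of_lt hj)
        have h8 := k.2
        rw [Nat.succ_eq_add_one] at h7
        omega
      · obtain rfl : j = ⟨i, hi'⟩ := Fin.ext hj
        exact g4
    · rw [g5 _ _ (Or.inr (by omega)), h5 k (by omega)])
  rw [← ht] at this
  exact this

theorem readWords_spec (ws : List (List D.Letter)) {t : St}
    (ht : t = (readWords code).run (.init (encodeWords code ws))) :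
    t.v .len = totalLength ws ∧ t.out = [] ∧ Words code t.a ws ws.length ∧
      ∀ k, totalLength ws ≤ k → t.a .L k = 0 := by
  have h := readWords_prefix code ws le_rfl (t := t) ht
  have h3 : off ws ws.length = totalLength ws := by simp [off]
  rw [h3] at h
  exact ⟨h.2.1, h.2.2.1, h.2.2.2⟩

theorem lim_readLetter : (readLetter code).Lim := by
  have : (Cmd.cases ((letters code).map fun l =>
      (Exp.eq (.var .ltr) (.lit (lno code l)), putLetter code l))).Lim := by
    refine Cmd.lim_cases.2 ?_
    simp [-Prod.forall, -List.mem_map, List.forall_mem_map, putLetter, Cmd.Lim, Cmd.seqs]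
  simp [readLetter, this, Cmd.Lim, Cmd.seqs]

theorem depth_readLetter : (readLetter code).depth = 0 := by
  rw [← Nat.le_zero, readLetter, Cmd.depth_seqs]
  simp only [List.mem_cons, List.not_mem_nil, or_false, forall_eq_or_imp, forall_eq]
  refine ⟨le_rfl, le_rfl, le_rfl, Cmd.depth_cases.2 ?_, le_rfl⟩
  simp [-Prod.forall, -List.mem_map, List.forall_mem_map, putLetter, Cmd.seqs, Cmd.depth]

theorem cost_readWord_le : ∃ B, ∀ (s : St) (w : List D.Letter) (rest : List ℕ),
    s.inp = w.length :: w.map (lno code) ++ rest → (readWord code).cost s ≤ B * (w.length + 1) := by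
  refine ⟨(readLetter code).coef + (Exp.var .num).size + 15, fun s w rest hs => ?_⟩
  set s₁ := (Cmd.read .num).run s with hs₁
  have num1 : (Exp.var .num).eval s₁ = w.length := by simp [hs₁, Exp.eval, Cmd.run, hs]
  have h1 : (readWord code).cost s = 1 + ((Cmd.iter .k (.var .num) (readLetter code)).cost s₁ + 0) := rfl
  rw [h1, Cmd.cost, num1]
  have : ∀ f : ℕ → St, ∑ n ∈ Finset.range w.length, ((readLetter code).cost (f n) + 7) ≤
      w.length * ((readLetter code).coef + 7) := by
    intro f
    refine (Finset.sum_le_card_nsmul _ _ ((readLetter code).coef + 7) fun n _ => ?_).trans (by simp)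
    have := Cmd.cost_le (lim_readLetter code) (f n)
    rw [depth_readLetter, pow_zero, mul_one] at this
    omega
  have := this fun n => (loop (fun n s => (readLetter code).run (s.set .k n)) n s₁).set .k n
  nlinarith

theorem cost_readWords_le : ∃ B, ∀ ws : List (List D.Letter),
    (readWords code).cost (.init (encodeWords code ws)) ≤ B * (totalLength ws + ws.length + 1) := by
  obtain ⟨B, hB⟩ := cost_readWord_le code
  refine ⟨B + (Exp.var .cnt).size + 15, fun ws => ?_⟩
  set s₁ := (Cmd.read .cnt).run (.init (encodeWords code ws)) with hs₁
  have num1 : (Exp.var .cnt).eval s₁ = ws.length := rfl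
  have h1 : (readWords code).cost (.init (encodeWords code ws)) =
    1 + ((Cmd.iter .i (.var .cnt) (readWord code)).cost s₁ + 0) := rfl
  rw [h1, Cmd.cost, num1]
  have h2 : ∑ n ∈ Finset.range ws.length,
      ((readWord code).cost ((loop (fun n s => (readWord code).run (s.set .i n)) n s₁).set .i n) + 7) ≤
      ∑ n : Fin ws.length, (B * ((ws.get n).length + 1) + 7) := by
    rw [Finset.sum_range]
    refine Finset.sum_le_sum fun n _ => Nat.add_le_add_right ?_ 7
    have h3 := (readWords_prefix code ws n.2.le rfl).1
    rw [← List.cons_getElem_drop_succ (h := n.2), List.flatMap_cons] at h3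
    exact hB _ _ _ h3
  have h4 : ∑ n : Fin ws.length, (B * ((ws.get n).length + 1) + 7) =
      B * totalLength ws + (B + 7) * ws.length := by
    have : ∑ n : Fin ws.length, (ws.get n).length = totalLength ws := by simp [totalLength]
    rw [Finset.sum_add_distrib, ← Finset.mul_sum, Finset.sum_add_distrib, this]
    simp
    ring
  rw [h4] at h2
  nlinarith


theorem cell_le {a : Arr → ℕ → ℕ} {ws : List (List D.Letter)} (h : Words code a ws ws.length)
    (e : (bouquet ws).E) : a .S (edgeNo e) = vertNo ((bouquet ws).src e) ∧
      a .T (edgeNo e) = vertNo ((bouquet ws).tgt e) ∧ a .L (edgeNo e) = code ((bouquet ws).lab e) + 1 := by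
  obtain ⟨h1, h2, h3⟩ := h e.1 e.1.2 e.2
  refine ⟨h1.trans ?_, h2.trans ?_, h3⟩
  · exact (vertNo_bouquetPoint _ _).symm
  · exact (vertNo_bouquetPoint _ _).symm

/-- The steps after reading the input. -/
noncomputable def steps : Cmd := .seqs [emit, cmd2 code, cmd3 code, cmd4 code, cmd5 code, cmd6 code]

theorem lim_depth_steps : (steps code).Lim ∧ (steps code).depth ≤ 2 := by
  have h1 : (Cmd.cases (glueCmds code)).Lim := by
    simp [glueCmds, -Prod.forall, -List.mem_map, List.forall_mem_map, lim_addEdges]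
  have h2 : ∀ l, (addEdges l).depth = 0 := fun l => Nat.le_zero.1 (depth_addEdges l 0)
  have h3 : (Cmd.cases (glueCmds code)).depth = 0 := by
    rw [← Nat.le_zero, glueCmds, Cmd.depth_cases, List.forall_mem_map]
    exact fun p _ => Cmd.depth_seqs.2 (by simp [h2, Cmd.depth])
  simp [steps, emit, compact, relabelStep, markStep, numberStep, printGraph, cmd2, trim, prune, kill,
    find, engine, mergePairs, pairStep, merge, renameStep, renameCell, foldAll, foldStep, build,
    buildStep, cmd3, attachAll, attachBody, finish, cmd4, pairLoop, cmd5, body5, prune5, cmd6,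
    Cmd.seqs, Cmd.depth, loopL, pairAt_frame code (elems D.A), h1, h2, h3, Cmd.cases,
    lim_addEdges]

theorem edges_eq_namedEdges {s : St} (hw : Wf N s) :
    edges s = namedEdges code (NumGraph.ofState code s hw).toPGraph
      fun v : Fin (s.v .cap) => (v : ℕ) := by
  ext e
  rw [← mem_elist, List.mem_iff_get]
  refine exists_congr fun k => Eq.congr_left ?_
  refine Prod.ext rfl (Prod.ext ?_ rfl)
  exact (congrArg Fin.val (code.apply_symm_apply ⟨((elist s).get k).2.1,
    (hw.edges (mem_elist.1 (List.get_mem _ k))).2.2⟩)).symm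

/-- A factor for the size of the memory. -/
noncomputable def memFactor (D : FiniteAmalgam) (N : ℕ) : ℕ :=
  (1 + ord D * N) + (1 + 2 * ord D) + 2 * N * (1 + 2 * ord D) + (1 + ord D) * ord D

theorem memFactor_mul (M : ℕ) : memFactor D N * M = M + ord D * N * M + (M + 2 * (ord D * M)) +
    2 * N * (M + 2 * (ord D * M)) + (ord D * M + ord D * (ord D * M)) := by
  rw [memFactor]
  ring

/-- Read the input and determine the size of the memory. -/
noncomputable def input : Cmd := .seqs [readWords code, .set .cap (.add (.var .len) (.lit 1)),
  .set .lim (.mulc (memFactor D N) (.add (.var .len) (.lit 1)))]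

/-- The algorithm. -/
noncomputable def algorithm : Cmd := .seq (input code) (steps code)

theorem lab_mul {Γ : D.Graph} {g h : D.Gp} (hg : g ∈ Lab Γ) (hh : h ∈ Lab Γ) : g * h ∈ Lab Γ := by
  obtain ⟨w, h1, rfl⟩ := hg
  obtain ⟨w', h2, rfl⟩ := hh
  exact ⟨w ++ w', reads_append.2 ⟨_, h1, h2⟩, val_append w w'⟩

theorem lab_inv {Γ : D.Graph} {g : D.Gp} (hg : g ∈ Lab Γ) : g⁻¹ ∈ Lab Γ := by
  obtain ⟨w, h1, rfl⟩ := hg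
  exact ⟨_, h1.inv, val_invRev w⟩

theorem closure_subset_lab {Γ : D.Graph} {S : Set D.Gp} (h : S ⊆ Lab Γ) :
    (Subgroup.closure S : Set D.Gp) ⊆ Lab Γ := by
  intro g hg
  induction hg using Subgroup.closure_induction with
  | mem g hg => exact h hg
  | one => exact ⟨[], rfl, rfl⟩
  | mul _ _ _ _ h1 h2 => exact lab_mul h1 h2
  | inv _ _ h1 => exact lab_inv h1

/-- The memory after reading the words. -/
theorem read_spec (ws : List (List D.Letter)) {s : St} (hs : s = (input code).run (.init (encodeWords code ws))) :
    Wf N s ∧ s.out = [] ∧ s.v .len = totalLength ws ∧ s.v .cap = totalLength ws + 1 ∧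
      s.v .lim = memFactor D N * (totalLength ws + 1) ∧ Words code s.a ws ws.length ∧
      ∀ k, s.a .L k ≠ 0 ↔ k < totalLength ws := by
  simp only [input, Cmd.run_seqs_cons, Cmd.run_seqs_nil] at hs
  obtain ⟨h1, h2, h3, h4⟩ := readWords_spec code ws rfl
  set s₀ := (readWords code).run (.init (encodeWords code ws))
  have v1 : s.v .len = totalLength ws := by simp [hs, Cmd.run, h1]
  have v2 : s.v .cap = totalLength ws + 1 := by simp [hs, Cmd.run, Exp.eval, h1]
  have v3 : s.v .lim = memFactor D N * (totalLength ws + 1) := by simp [hs, Cmd.run, Exp.eval, h1]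
  have a1 : s.a = s₀.a := by simp [hs, Cmd.run]
  have o1 : s.out = [] := by simp [hs, Cmd.run, h2]
  rw [← a1] at h3 h4
  have hL : ∀ k, s.a .L k ≠ 0 ↔ k < totalLength ws := by
    intro k
    refine ⟨fun h => by_contra fun h' => h (h4 k (not_lt.1 h')), fun h => ?_⟩
    obtain ⟨e, rfl⟩ := (lt_totalLength_iff k).1 h
    rw [(cell_le code h3 e).2.2]
    omega
  have hv : ∀ v, vertNo (ws := ws) v < totalLength ws + 1 := by
    rintro (_ | ⟨j, k, h⟩)
    · exact Nat.succ_pos _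
    · exact Nat.lt_succ_of_lt ((lt_totalLength_iff _).2 ⟨⟨j, k, h.2⟩, rfl⟩)
  refine ⟨⟨fun k _ hk => ?_, ?_, ?_, ?_⟩, o1, v1, v2, v3, h3, hL⟩
  · obtain ⟨e, rfl⟩ := (lt_totalLength_iff k).1 ((hL k).1 hk)
    obtain ⟨c1, c2, c3⟩ := cell_le code h3 e
    rw [c1, c2, c3, v2]
    exact ⟨hv _, hv _, Fin.is_lt _⟩
  · omega
  · rw [v2, v3, memFactor_mul]; omega
  · rw [v2, v3, memFactor_mul]
    have := Nat.mul_le_mul_left (2 * N) (Nat.le_add_right (totalLength ws + 1)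
      (2 * (ord D * (totalLength ws + 1))))
    omega

theorem algorithm_spec (ws : List (List D.Letter)) :
    ∃ Γ : Fin 6 → NumGraph D.Gen, ((algorithm code).run (.init (encodeWords code ws))).out =
        (List.ofFn fun k => (Γ k).encode code).flatten ∧ IsRun ws Γ ∧
      IsReducedPrecover (Γ 5).toPGraph ∧
      Lab (Γ 5).toPGraph = (Subgroup.closure {g | ∃ w ∈ ws, D.val w = g} : Set D.Gp) := by
  obtain ⟨s, hs⟩ : ∃ s, s = (input code).run (.init (encodeWords code ws)) := ⟨_, rfl⟩
  rw [algorithm, Cmd.run, ← hs]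
  obtain ⟨w0, o0, len0, cap0, lim0, hw0, hL0⟩ := read_spec code ws hs
  set m := totalLength ws
  clear hs
  rw [memFactor_mul] at lim0
  have hm0 : m ≤ s.v .lim := by omega
  have w1 : Wf N (emit.run s) := (emit_spec w0).2.2.2.2.1
  have c1 : (emit.run s).v .cap ≤ s.v .cap := (emit_spec w0).2.2.2.1
  have o1 := emit_out code w0 w1
  obtain ⟨len1, lim1⟩ := emit_len s
  have d1 : ∀ k, (emit.run s).v .len ≤ k → (emit.run s).a .L k = 0 := by
    intro k hk
    refine zeroPut_emit.run (by_contra fun h => ?_)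
    have := (hL0 k).1 h
    omega
  have i1 := iso_ofState (Γ := bouquet ws) code w0 w1 hm0 hL0 edgeNo_injective
    lt_totalLength_iff (fun e => (cell_le code hw0 e).1) (fun e => (cell_le code hw0 e).2.1)
    (fun e => (cell_le code hw0 e).2.2) vertNo_injective rfl bouquet_vertex
  simp only [steps, Cmd.run_seqs_cons, Cmd.run_seqs_nil]
  generalize emit.run s = s₁ at *
  set Γ₁ := NumGraph.ofState code s₁ w1
  obtain ⟨f, f1, f2⟩ := i1
  have r1 : Γ₁.toPGraph.Reach := bouquet_reach.of_hom f f1.2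
  obtain ⟨h2, o2, lim2, len2, cap2, st2, r2, k2⟩ := cmd2_spec code w1 d1 (Γ := Γ₁.toPGraph)
    (ι := fun v : Fin (s₁.v .cap) => (v : ℕ)) Fin.val_injective rfl (edges_eq_namedEdges code w1) r1 rfl
  generalize (cmd2 code).run s₁ = s₂ at *
  have b1 : s₂.v .len * ord D ≤ ord D * (m + 1) := by
    rw [len2, len1, len0, mul_comm]
    exact Nat.mul_le_mul_left _ (Nat.le_succ m)
  have b2 : s₂.v .len * (ord D * N) ≤ ord D * N * m := by rw [len2, len1, len0, mul_comm]
  have b3 : ord D * N * (m + 1) = ord D * N * m + ord D * N := by ring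
  have b4 : ord D ≤ ord D * (m + 1) := Nat.le_mul_of_pos_right _ (Nat.succ_pos m)
  have b5 : ∀ x, x ≤ (m + 1) + 2 * (ord D * (m + 1)) → 2 * N * x ≤ s.v .lim := fun x hx => by
    have := Nat.mul_le_mul_left (2 * N) hx
    omega
  obtain ⟨h3, o3, lim3, len3, cap3, st3, r3, p3, k3⟩ := cmd3_spec code h2 (h2.rep code) r2
    (by omega) (by omega) ((b5 _ (by omega)).trans_eq (by omega)) rfl
  generalize (cmd3 code).run s₂ = s₃ at *
  obtain ⟨h4, o4, lim4, len4, cap4, st4, r4, p4, q4, k4⟩ := cmd4_spec code h3 (h3.rep code) r3 p3 (by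
    have h5 : s₃.v .cap ≤ (m + 1) + ord D * (m + 1) := by omega
    have h6 := Nat.mul_le_mul_right (ord D) h5
    rw [Nat.add_mul, mul_comm (m + 1), mul_comm (ord D * (m + 1))] at h6
    omega) rfl
  generalize (cmd4 code).run s₃ = s₄ at *
  obtain ⟨h5, o5, lim5, len5, cap5, st5, r5, p5, q5, n5, e5, k5⟩ := cmd5_spec code h4 (h4.rep code)
    r4 p4 q4 rfl
  generalize (cmd5 code).run s₄ = s₅ at *
  obtain ⟨h6, o6, st6, p6, k6⟩ := cmd6_spec code h5 (h5.rep code) r5 p5 q5 n5 e5 (by omega)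
    (by omega) ((b5 _ (by omega)).trans_eq (by omega)) rfl
  generalize (cmd6 code).run s₅ = s₆ at *
  refine ⟨![Γ₁, memGraph code h2, memGraph code h3, memGraph code h4, memGraph code h5,
    memGraph code h6], ?_, ⟨⟨f, f1, f2⟩, st2, st3, st4, st5, st6⟩, p6, ?_⟩
  · rw [o6, o5, o4, o3, o2, o1, o0]
    simp [List.ofFn_succ]
  · refine Set.Subset.antisymm ?_ (closure_subset_lab ?_)
    · refine Over.lab_subset (k6.ovr _ (k5.ovr _ (k4.ovr _ (k3.ovr _ (k2.ovr _ ?_)))))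
      obtain ⟨c, c1, c2⟩ := over_bouquet (ws := ws)
      exact Over.of_hom f f1.2 f2.2 c1 c2 fun u v huv => by rw [f1.1 huv]
    · rintro _ ⟨w, hw, rfl⟩
      exact k6.lab (k5.lab (k4.lab (k3.lab (k2.lab (Lab.mono f (val_mem_lab_bouquet hw))))))

theorem exists_cost_algorithm_le : ∃ C, ∀ ws : List (List D.Letter), ws ≠ [] → (∀ w ∈ ws, w ≠ []) →
    (algorithm code).cost (.init (encodeWords code ws)) ≤ C * totalLength ws ^ 2 := by
  obtain ⟨B, hB⟩ := cost_readWords_le code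
  set K := (Cmd.set .cap (.add (.var .len) (.lit 1))).coef +
    (Cmd.set .lim (.mulc (memFactor D N) (.add (.var .len) (.lit 1)))).coef
  refine ⟨3 * B + K + (steps code).coef * (2 * memFactor D N + 1) ^ 2, fun ws hne hws => ?_⟩
  have h1 : ws.length ≤ totalLength ws := by
    have := List.length_le_sum_of_one_le (ws.map List.length) (by
      simpa [Nat.one_le_iff_ne_zero] using hws)
    simpa [totalLength] using this
  have h2 : 1 ≤ totalLength ws := (List.length_pos_iff.2 hne).trans_le h1
  obtain ⟨s, hs⟩ : ∃ s, s = (input code).run (.init (encodeWords code ws)) := ⟨_, rfl⟩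
  have hcost : (algorithm code).cost (.init (encodeWords code ws)) =
      (readWords code).cost (.init (encodeWords code ws)) + K + (steps code).cost s := by
    rw [hs]
    simp only [algorithm, input, Cmd.seqs, Cmd.cost, Cmd.run, K, Cmd.coef]
  have hl := (read_spec code ws hs).2.2.2.2.1
  have h3 := Cmd.cost_le (lim_depth_steps code).1 s
  set m := totalLength ws
  have h4 : s.v .lim + 1 ≤ (2 * memFactor D N + 1) * m := by rw [hl]; nlinarith
  have h5 : (s.v .lim + 1) ^ (steps code).depth ≤ ((2 * memFactor D N + 1) * m) ^ 2 :=
    (Nat.pow_le_pow_right (Nat.succ_pos _) (lim_depth_steps code).2).trans (Nat.pow_le_pow_left h4 2)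
  have h6 := h3.trans (Nat.mul_le_mul_left _ h5)
  have h7 : m ≤ m ^ 2 := Nat.le_self_pow (by omega) m
  have h8 := (hB ws).trans (Nat.mul_le_mul_left B (show m + ws.length + 1 ≤ 3 * m ^ 2 by omega))
  have h9 : K ≤ K * m ^ 2 := Nat.le_mul_of_pos_right _ (by omega)
  rw [hcost]
  calc _ ≤ B * (3 * m ^ 2) + K * m ^ 2 + (steps code).coef * ((2 * memFactor D N + 1) * m) ^ 2 := by omega
    _ = _ := by ring

end FiniteAmalgam

theorem mainTheorem10 (D : FiniteAmalgam) (N : ℕ) (code : D.Gen ≃ Fin N) :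
    ∃ (P : RAM.Program) (C : ℕ), ∀ ws : List (List D.Letter),
      ∃ (Γ : Fin 6 → NumGraph D.Gen) (t : ℕ),
        RAM.RunsIn P (encodeWords code ws)
          (List.ofFn fun k => (Γ k).encode code).flatten t ∧
        FiniteAmalgam.IsRun ws Γ ∧
        FiniteAmalgam.IsReducedPrecover (Γ 5).toPGraph ∧
        FiniteAmalgam.Lab (Γ 5).toPGraph = (Subgroup.closure {g | ∃ w ∈ ws, D.val w = g} : Set D.Gp) ∧
        (ws ≠ [] → (∀ w ∈ ws, w ≠ []) → t ≤ C * totalLength ws ^ 2) := by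
  obtain ⟨C, hC⟩ := FiniteAmalgam.exists_cost_algorithm_le code
  refine ⟨(FiniteAmalgam.algorithm code).code 0 0, C, fun ws => ?_⟩
  obtain ⟨Γ, h1, h2, h3, h4⟩ := FiniteAmalgam.algorithm_spec code ws
  exact ⟨Γ, _, h1 ▸ RAM.Cmd.runsIn _ _, h2, h3, h4, hC ws⟩
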